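/- **Theorem.** A *dominating triangle* of a finite simple graph $G=(V,E)$ is a set of three pairwise adjacent vertices such that every vertex of $G$ belongs to the set or is adjacent to one of its members. *Dominating Triangle* is the problem of deciding whether a given graph with $n$ vertices and $m$ edges has a dominating triangle. Algorithms are programs of a word RAM with words of $O(\log N)$ bits, where $N$ measures the input size (a program is correct for all inputs, with words bounded in absolute value by $(N+2)^c$ for a constant $c$ of the program; arithmetic, memory access and coin flips take unit time; memory is initially $0$ outside the input). The graph is given by $n$, $m$ and a list of its edges, and $N=n+m$; for the multiplication of $n\times n$ matrices, $N=n$. Let $\omega$ be the infimum of all real $\tau$ such that for every constant $a$, two $n\times n$ integer matrices with entries of absolute value at most $n^{a}$ can be multiplied deterministically in time $n^{\tau+o(1)}$. 1. For every $\varepsilon>0$, Dominating Triangle can be solved deterministically in time $$O\Big(1+\Big(\tfrac{m^{1+\frac{2\omega}{\omega+1}}}{n}\Big)^{1+\varepsilon}\Big).$$ If $\omega=2$, then for every $\varepsilon>0$ it can be solved deterministically in time $O\big(1+(m^{7/3}/n)^{1+\varepsilon}\big)$. 2. For every $\varepsilon>0$ and every $d\in\mathbb N$, Dominating Triangle can be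 solved by a randomized algorithm in time $O\big(1+m^{\frac{\omega+1}{2}+\varepsilon}\big)$; the time bound holds for all outcomes of the coin flips, and on every input the answer is correct with probability at least $1-(n+2)^{-d}$. 3. If the infimum $\omega$ is attained, i.e. if for every constant $a$ a single algorithm multiplies $n\times n$ integer matrices with entries of absolute value at most $n^a$ in time $n^{\omega+o(1)}$, then each of the bounds in 1 and 2 (in 2, for each $d$) is achieved by a single algorithm with $\varepsilon$ replaced by a function of $m$ that tends to $0$ as $m\to\infty$. All bounds hold for all graphs (for $n=0$, the quotient is read as $0$). In the usual notation: the deterministic time is $\big(m^{1+2\omega/(\omega+1)}/n\big)^{1+o(1)}$, which is $(m^{7/3}/n)^{1+o(1)}$ if $\omega=2$, and the randomized time is $m^{(\omega+1)/2+o(1)}$. -/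

import Mathlib

open Filter Topology

/-! ### Dominating patterns in graphs -/

/-- `S` dominates `G`: every vertex is in `S` or has a neighbour in `S`. -/
def Dominates {V : Type*} (G : SimpleGraph V) (S : Set V) : Prop :=
  ∀ v, v ∈ S ∨ ∃ s ∈ S, G.Adj s v

/-- `G` has a dominating `P`-pattern: a set of vertices that induces a copy of `P` in `G` and
dominates `G`. -/
def HasDominatingPattern {V U : Type*} (G : SimpleGraph V) (P : SimpleGraph U) : Prop :=
  ∃ S : Set V, Nonempty (G.induce S ≃g P) ∧ Dominates G S

/-- `G` has a dominating triangle, i.e. a dominating `K₃`-pattern. -/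
def HasDominatingTriangle {V : Type*} (G : SimpleGraph V) : Prop :=
  HasDominatingPattern G (⊤ : SimpleGraph (Fin 3))

/-! ### The word RAM

A program acts on finitely many registers (those that it names) and on a memory, an array of cells.
Every elementary command takes one step.  The parameter `W` of the execution relation is the
largest number that fits into a word: an operation whose result does not fit, or an access
to an address that does not fit, has no execution.  All problems below demand executions with
`W` polynomial in the input size, that is, with words of logarithmically many bits. -/

/-- The arithmetic operations (integer division rounds down for positive divisors). -/
inductive ArithOp
  | add
  | sub
  | mul
  | div

/-- The value of an arithmetic operation. -/
def ArithOp.eval : ArithOp → ℤ → ℤ → ℤ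
  | .add, a, b => a + b
  | .sub, a, b => a - b
  | .mul, a, b => a * b
  | .div, a, b => a / b

/-- Programs of the word RAM; `x y z` are names of registers. -/
inductive Program
  /-- do nothing -/
  | skip
  /-- `x := k` -/
  | const (x : ℕ) (k : ℤ)
  /-- `x := y ∘ z` -/
  | arith (o : ArithOp) (x y z : ℕ)
  /-- `x := memory[y]` -/
  | load (x y : ℕ)
  /-- `memory[x] := y` -/
  | store (x y : ℕ)
  /-- `x :=` a fair random bit -/
  | flip (x : ℕ)
  /-- first `p`, then `q` -/
  | seq (p q : Program)
  /-- if `x > 0` then `p` else `q` -/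
  | branch (x : ℕ) (p q : Program)
  /-- while `x > 0` do `p` -/
  | loop (x : ℕ) (p : Program)

/-- A program is deterministic if it has no coin-flip command. -/
def Program.Deterministic : Program → Prop
  | .skip => True
  | .const _ _ => True
  | .arith _ _ _ _ => True
  | .load _ _ => True
  | .store _ _ => True
  | .flip _ => False
  | .seq p q => p.Deterministic ∧ q.Deterministic
  | .branch _ p q => p.Deterministic ∧ q.Deterministic
  | .loop _ p => p.Deterministic

/-- Contents of the registers and of the memory. -/
@[ext]
structure RamState where
  reg : ℕ → ℤ
  mem : ℕ → ℤ

/-- The state after writing `v` to register `x`. -/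
def RamState.setReg (s : RamState) (x : ℕ) (v : ℤ) : RamState :=
  ⟨Function.update s.reg x v, s.mem⟩

/-- The state after writing `v` to memory cell `a`. -/
def RamState.setMem (s : RamState) (a : ℕ) (v : ℤ) : RamState :=
  ⟨s.reg, Function.update s.mem a v⟩

/-- `Exec W p s bs t s'`: started in state `s`, program `p` halts after exactly `t` steps in
state `s'`, its coin flips having had the outcomes `bs` in this order, and all words that it
computed or used as addresses were at most `W` in absolute value. -/
inductive Exec (W : ℕ) : Program → RamState → List Bool → ℕ → RamState → Prop
  | skip (s : RamState) : Exec W .skip s [] 1 s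
  | const (s : RamState) (x : ℕ) (k : ℤ) (hk : |k| ≤ W) :
      Exec W (.const x k) s [] 1 (s.setReg x k)
  | arith (s : RamState) (o : ArithOp) (x y z : ℕ)
      (h : |o.eval (s.reg y) (s.reg z)| ≤ W) :
      Exec W (.arith o x y z) s [] 1 (s.setReg x (o.eval (s.reg y) (s.reg z)))
  | load (s : RamState) (x y a : ℕ) (ha : s.reg y = a) (hW : a ≤ W) :
      Exec W (.load x y) s [] 1 (s.setReg x (s.mem a))
  | store (s : RamState) (x y a : ℕ) (ha : s.reg x = a) (hW : a ≤ W) :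
      Exec W (.store x y) s [] 1 (s.setMem a (s.reg y))
  | flip (s : RamState) (x : ℕ) (b : Bool) :
      Exec W (.flip x) s [b] 1 (s.setReg x (if b then 1 else 0))
  | seq {p q : Program} {s s' s'' : RamState} {bs bs' : List Bool} {t t' : ℕ}
      (hp : Exec W p s bs t s') (hq : Exec W q s' bs' t' s'') :
      Exec W (.seq p q) s (bs ++ bs') (t + t') s''
  | branchPos {x : ℕ} {p q : Program} {s s' : RamState} {bs : List Bool} {t : ℕ}
      (hx : 0 < s.reg x) (hp : Exec W p s bs t s') :
      Exec W (.branch x p q) s bs (t + 1) s'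
  | branchNonpos {x : ℕ} {p q : Program} {s s' : RamState} {bs : List Bool} {t : ℕ}
      (hx : s.reg x ≤ 0) (hq : Exec W q s bs t s') :
      Exec W (.branch x p q) s bs (t + 1) s'
  | loopDone {x : ℕ} {p : Program} {s : RamState} (hx : s.reg x ≤ 0) :
      Exec W (.loop x p) s [] 1 s
  | loopStep {x : ℕ} {p : Program} {s s' s'' : RamState} {bs bs' : List Bool} {t t' : ℕ}
      (hx : 0 < s.reg x) (hp : Exec W p s bs t s') (hl : Exec W (.loop x p) s' bs' t' s'') :
      Exec W (.loop x p) s (bs ++ bs') (t + t' + 1) s''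

/-- With the random bits `r 0, r 1, …, r (T - 1)`, program `p` halts within `T` steps in
state `s'`. -/
def HaltsWithin (W : ℕ) (p : Program) (s : RamState) (T : ℕ) (r : Fin T → Bool)
    (s' : RamState) : Prop :=
  ∃ t ≤ T, ∃ bs, bs <+: List.ofFn r ∧ Exec W p s bs t s'

/-! ### The exponent of matrix multiplication -/

/-- The input of matrix multiplication: `n` in register `0`, the entries of `A` row by row in the
memory cells `0, …, n² - 1`, those of `B` in the cells `n², …, 2n² - 1`, and `0` everywhere else. -/
def MatMulInput {n : ℕ} (A B : Matrix (Fin n) (Fin n) ℤ) (s : RamState) : Prop :=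
  s.reg 0 = n ∧ (∀ x, x ≠ 0 → s.reg x = 0) ∧
    (∀ i j : Fin n, s.mem (i * n + j) = A i j) ∧
    (∀ i j : Fin n, s.mem (n ^ 2 + (i * n + j)) = B i j) ∧
    ∀ a, 2 * n ^ 2 ≤ a → s.mem a = 0

/-- The output `C` of matrix multiplication is in the memory cells `2n², …, 3n² - 1`. -/
def MatMulOutput {n : ℕ} (C : Matrix (Fin n) (Fin n) ℤ) (s : RamState) : Prop :=
  ∀ i j : Fin n, s.mem (2 * n ^ 2 + (i * n + j)) = C i j

/-- `n × n` integer matrices, with entries of logarithmically many bits (absolute value at most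
`n ^ a`, for an arbitrary constant `a`), can be multiplied in time `n ^ (τ + o(1))`. -/
def MatMulInTime (τ : ℝ) : Prop :=
  ∀ a : ℕ, ∃ p : Program, p.Deterministic ∧ ∃ (c : ℕ) (C : ℝ) (e : ℕ → ℝ),
    Tendsto e atTop (𝓝 0) ∧
    ∀ n : ℕ, 0 < n → ∀ A B : Matrix (Fin n) (Fin n) ℤ,
      (∀ i j, |A i j| ≤ (n : ℤ) ^ a) → (∀ i j, |B i j| ≤ (n : ℤ) ^ a) →
      ∀ s, MatMulInput A B s → ∃ t s',
        Exec ((n + 2) ^ c) p s [] t s' ∧ MatMulOutput (A * B) s' ∧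
        (t : ℝ) ≤ C * (n : ℝ) ^ (τ + e n)

/-- The matrix multiplication exponent `ω`. -/
noncomputable def matMulExponent : ℝ := sInf {τ : ℝ | MatMulInTime τ}

/-! ### Algorithms for Dominating Triangle -/

/-- `l` lists every edge of `G` exactly once, in any order and orientation. -/
def IsEdgeList {n : ℕ} (G : SimpleGraph (Fin n)) (l : List (Fin n × Fin n)) : Prop :=
  (l.map fun e => s(e.1, e.2)).Nodup ∧ ∀ e, e ∈ G.edgeSet ↔ e ∈ l.map fun e => s(e.1, e.2)

/-- The input graph is given by its number of vertices in register `0`, its number of edges in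
register `1` and the endpoints of the `i`-th edge in the memory cells `2i` and `2i + 1`;
everything else is `0`. -/
def GraphInput {n : ℕ} (l : List (Fin n × Fin n)) (s : RamState) : Prop :=
  s.reg 0 = n ∧ s.reg 1 = l.length ∧ (∀ x, 2 ≤ x → s.reg x = 0) ∧
    (∀ i : Fin l.length, s.mem (2 * i) = ((l.get i).1 : ℕ) ∧
      s.mem (2 * i + 1) = ((l.get i).2 : ℕ)) ∧
    ∀ a, 2 * l.length ≤ a → s.mem a = 0

/-- The final state `s` gives the correct answer, `1` for yes and `0` for no, in register `0`. -/
def CorrectAnswer {n : ℕ} (G : SimpleGraph (Fin n)) (s : RamState) : Prop :=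
  (HasDominatingTriangle G → s.reg 0 = 1) ∧ (¬ HasDominatingTriangle G → s.reg 0 = 0)

/-- Some deterministic program solves Dominating Triangle on all graphs, with at most `f n m` steps
on graphs with `n` vertices and `m` edges. -/
def DominatingTriangleInDetTime (f : ℕ → ℕ → ℝ) : Prop :=
  ∃ p : Program, p.Deterministic ∧ ∃ c : ℕ,
    ∀ (n : ℕ) (G : SimpleGraph (Fin n)) (l : List (Fin n × Fin n)), IsEdgeList G l →
      ∀ s, GraphInput l s → ∃ t s',
        Exec ((n + G.edgeSet.ncard + 2) ^ c) p s [] t s' ∧ CorrectAnswer G s' ∧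
        (t : ℝ) ≤ f n G.edgeSet.ncard

/-- Some randomized program solves Dominating Triangle: on every graph with `n` vertices and `m`
edges, it halts within `f n m` steps whatever the random bits are, and its answer is correct
with probability at least `1 - (n + 2) ^ (-d)`. -/
def DominatingTriangleInRandTime (d : ℕ) (f : ℕ → ℕ → ℝ) : Prop :=
  ∃ (p : Program) (c : ℕ),
    ∀ (n : ℕ) (G : SimpleGraph (Fin n)) (l : List (Fin n × Fin n)), IsEdgeList G l →
      ∀ s, GraphInput l s → ∃ T : ℕ, (T : ℝ) ≤ f n G.edgeSet.ncard ∧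
        (∀ r : Fin T → Bool, ∃ s',
          HaltsWithin ((n + G.edgeSet.ncard + 2) ^ c) p s T r s') ∧
        (1 - 1 / ((n : ℝ) + 2) ^ d) * 2 ^ T ≤
          ({r : Fin T → Bool | ∃ s', HaltsWithin ((n + G.edgeSet.ncard + 2) ^ c) p s T r s' ∧
            CorrectAnswer G s'}.ncard : ℝ)

/-! Every vertex of a triangle is adjacent to the other two, so a triangle x, y, z dominates exactly
when the open neighbourhoods N(x), N(y), N(z) cover all n vertices. By inclusion and exclusion this
is an equation between the degrees, the numbers |N(x) ∩ N(y)| for adjacent pairs and the number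
|N(x) ∩ N(y) ∩ N(z)| (`domTriple_iff`). The pair counts are computed once; the two algorithms differ
in how they find the triple counts.

The common tool (`edgeCounts_run`) counts, for all adjacent y, z, the common neighbours in a marked
set R. Fix a degree limit Δ. Triangles with a vertex of degree at most Δ are enumerated in time
O(mΔ). The others live on k ≤ 2m/Δ vertices of degree more than Δ and are counted by one product of
k × k matrices. With Δ about m^((ω-1)/(ω+1)) both parts take time about m^(2ω/(ω+1)). The running
time of the given multiplication program is not known to the algorithm, so Δ is found by search: the
product is run with a budget of about mΔ, and Δ is doubled when the budget is used up
(`findLimit_run`). A limit that is good in the analysis (`GoodLimit`) stops the search, and the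
costs form a geometric series.

First algorithm (`checkHeavy_run`): the three neighbourhoods cover n vertices, so one vertex x of a
dominating triangle has degree at least n/3, and at most 6m/n vertices are of this kind. For each of
them the tool with R = N(x) gives all triple counts through x. The total is about (m/n) ·
m^(2ω/(ω+1)).

Second algorithm (`checkAll_run`): let Δ be the square root of m, rounded down. The partners of x
are its neighbours if its degree is at most Δ, and all vertices of degree more than Δ otherwise;
every triangle consists of some x and two partners of x. For the set S of partners of x, all triple
counts are entries of a product of an S × N(x) and an N(x) × S matrix, which is cut into blocks of
size |S| × |S|. As |S| = O(√m) and the sum of deg(x) + |S| over all x is O(m), the cost is about m ·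
(√m)^(ω-1) = m^((ω+1)/2). No coin is flipped: the randomized bound is met by a deterministic program
(`DominatingTriangleInDetTime.inRandTime`).

The algorithms are written in a small language with three-dimensional arrays and compiled to the
word RAM with constant slowdown (`Cmd.compile_exec`, `detTime_of_run`). The multiplication program,
which is only known to exist, is translated into this language by `Program.limited`: loop rounds are
charged to a budget, and the memory becomes one row of an array. Each call takes a fresh row, so
nothing has to be erased.

For the exponents, ω ≥ 2 because n² output cells must be written (`MatMulInTime.two_le`), and cubic
multiplication makes ω an infimum over a nonempty set. Given ε, a τ close to ω is used. If ω is
attained, τ = ω works for all δ > 0 with one program, and `GrowsLike.exists_exponent` merges the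
bounds for all δ into one exponent that tends to 0. -/

/-! ### A small imperative language with named variables and three-dimensional arrays -/

/-- Variable names `ν` are placed in registers, array names `α` are interleaved in the memory. -/
structure Layout (ν α : Type) where
  vreg : ν → ℕ
  vreg_inj : Function.Injective vreg
  aidx : α → ℕ
  aidx_inj : Function.Injective aidx
  J : ℕ
  aidx_lt : ∀ t, aidx t < J

/-- The arrays are total functions; only cells whose three indices are at most the word bound have a
counterpart in the RAM memory. -/
structure Store (ν α : Type) where
  v : ν → ℤ
  a : α → ℕ → ℕ → ℕ → ℤ

/-- Integer expressions; `band a b` is the short-circuit conjunction (positive means true). -/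
inductive Expr (ν α : Type)
  | lit (k : ℤ)
  | var (x : ν)
  | op (o : ArithOp) (a b : Expr ν α)
  | get (t : α) (a b c : Expr ν α)
  | inp (a : Expr ν α)
  | band (a b : Expr ν α)

inductive Cmd (ν α : Type)
  | skip
  | set (x : ν) (e : Expr ν α)
  | put (t : α) (a b c e : Expr ν α)
  | seq (p q : Cmd ν α)
  | ite (e : Expr ν α) (p q : Cmd ν α)
  | loop (e : Expr ν α) (p : Cmd ν α)

variable {ν α : Type}

namespace Expr

/-- `toNat` gives negative indices a junk value; this never matters because the semantics demands
`Safe`. -/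
def eval (I : ℕ → ℤ) (σ : Store ν α) : Expr ν α → ℤ
  | lit k => k
  | var x => σ.v x
  | op o a b => o.eval (a.eval I σ) (b.eval I σ)
  | get t a b c => σ.a t (a.eval I σ).toNat (b.eval I σ).toNat (c.eval I σ).toNat
  | inp a => I (a.eval I σ).toNat
  | band a b => if 0 < a.eval I σ then b.eval I σ else a.eval I σ

/-- All array accesses are in bounds. -/
def Safe (V len : ℕ) (I : ℕ → ℤ) (σ : Store ν α) : Expr ν α → Prop
  | lit _ => True
  | var _ => True
  | op _ a b => a.Safe V len I σ ∧ b.Safe V len I σ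
  | get _ a b c => a.Safe V len I σ ∧ b.Safe V len I σ ∧ c.Safe V len I σ ∧
      (0 ≤ a.eval I σ ∧ a.eval I σ ≤ V) ∧ (0 ≤ b.eval I σ ∧ b.eval I σ ≤ V) ∧
      (0 ≤ c.eval I σ ∧ c.eval I σ ≤ V)
  | inp a => a.Safe V len I σ ∧ 0 ≤ a.eval I σ ∧ a.eval I σ < len
  | band a b => a.Safe V len I σ ∧ (0 < a.eval I σ → b.Safe V len I σ)

end Expr

namespace Store

variable [DecidableEq ν] [DecidableEq α]

def setV (σ : Store ν α) (x : ν) (k : ℤ) : Store ν α := ⟨Function.update σ.v x k, σ.a⟩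

def setA (σ : Store ν α) (t : α) (i j l : ℕ) (k : ℤ) : Store ν α :=
  ⟨σ.v, fun t' i' j' l' => if t' = t ∧ i' = i ∧ j' = j ∧ l' = l then k else σ.a t' i' j' l'⟩

end Store

section

variable [DecidableEq ν] [DecidableEq α]

/-- Big-step semantics; all stored values have absolute value at most `V`. -/
inductive HExec (V len : ℕ) (I : ℕ → ℤ) : Cmd ν α → Store ν α → ℕ → Store ν α → Prop
  | skip (σ) : HExec V len I .skip σ 1 σ
  | set (σ) (x : ν) (e : Expr ν α) (hs : e.Safe V len I σ) (hb : |e.eval I σ| ≤ V) :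
      HExec V len I (.set x e) σ 1 (σ.setV x (e.eval I σ))
  | put (σ) (t : α) (a b c e : Expr ν α) (i j l : ℕ) (hs : e.Safe V len I σ)
      (hb : |e.eval I σ| ≤ V)
      (ha : a.Safe V len I σ) (hb' : b.Safe V len I σ) (hc : c.Safe V len I σ)
      (hi : a.eval I σ = i) (hj : b.eval I σ = j) (hl : c.eval I σ = l)
      (hi' : i ≤ V) (hj' : j ≤ V) (hl' : l ≤ V) :
      HExec V len I (.put t a b c e) σ 1 (σ.setA t i j l (e.eval I σ))
  | seq {p q σ σ' σ'' t t'} (hp : HExec V len I p σ t σ') (hq : HExec V len I q σ' t' σ'') :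
      HExec V len I (.seq p q) σ (t + t') σ''
  | iteT {e p q σ σ' t} (hs : e.Safe V len I σ) (he : 0 < e.eval I σ)
      (hp : HExec V len I p σ t σ') : HExec V len I (.ite e p q) σ (t + 1) σ'
  | iteF {e p q σ σ' t} (hs : e.Safe V len I σ) (he : e.eval I σ ≤ 0)
      (hp : HExec V len I q σ t σ') : HExec V len I (.ite e p q) σ (t + 1) σ'
  | loopF {e p σ} (hs : e.Safe V len I σ) (he : e.eval I σ ≤ 0) :
      HExec V len I (.loop e p) σ 1 σ
  | loopT {e p σ σ' σ'' t t'} (hs : e.Safe V len I σ) (he : 0 < e.eval I σ)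
      (hp : HExec V len I p σ t σ') (hl : HExec V len I (.loop e p) σ' t' σ'') :
      HExec V len I (.loop e p) σ (t + t' + 1) σ''

end

/-! ### Compilation -/

theorem Exec.seqNil {W : ℕ} {p q : Program} {s s' s'' : RamState} {t t' : ℕ}
    (hp : Exec W p s [] t s') (hq : Exec W q s' [] t' s'') :
    Exec W (.seq p q) s [] (t + t') s'' := by
  simpa using Exec.seq hp hq

/-- The temporary registers of the compiled code. -/
def tmpReg (d : ℕ) : ℕ := 2 * d + 7

/-- Turns the indices in temporaries `d, d + 1, d + 2` into an address in temporary `d`. -/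
def addrCode (Λ : Layout ν α) (t : α) (d : ℕ) : Program :=
  .seq (.arith .mul (tmpReg d) (tmpReg d) 1) <|
  .seq (.arith .add (tmpReg d) (tmpReg d) (tmpReg (d + 1))) <|
  .seq (.arith .mul (tmpReg d) (tmpReg d) 1) <|
  .seq (.arith .add (tmpReg d) (tmpReg d) (tmpReg (d + 2))) <|
  .seq (.const (tmpReg (d + 1)) Λ.J) <|
  .seq (.arith .mul (tmpReg d) (tmpReg d) (tmpReg (d + 1))) <|
  .seq (.const (tmpReg (d + 1)) (Λ.aidx t)) <|
  .seq (.arith .add (tmpReg d) (tmpReg d) (tmpReg (d + 1)))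
  (.arith .add (tmpReg d) (tmpReg d) 3)

/-- The address of an array cell. -/
def Layout.addr (Λ : Layout ν α) (V len : ℕ) (t : α) (i j l : ℕ) : ℕ :=
  ((i * (V + 1) + j) * (V + 1) + l) * Λ.J + Λ.aidx t + len

namespace Expr

def compile (Λ : Layout ν α) : Expr ν α → ℕ → Program
  | lit k, d => .const (tmpReg d) k
  | var x, d => .arith .add (tmpReg d) (2 * Λ.vreg x) 5
  | op o a b, d => .seq (a.compile Λ d) (.seq (b.compile Λ (d + 1))
      (.arith o (tmpReg d) (tmpReg d) (tmpReg (d + 1))))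
  | get t a b c, d => .seq (a.compile Λ d) (.seq (b.compile Λ (d + 1))
      (.seq (c.compile Λ (d + 2)) (.seq (addrCode Λ t d) (.load (tmpReg d) (tmpReg d)))))
  | inp a, d => .seq (a.compile Λ d) (.load (tmpReg d) (tmpReg d))
  | band a b, d => .seq (a.compile Λ d) (.branch (tmpReg d) (b.compile Λ d) .skip)

/-- A bound on the running time of the compiled code. -/
def time : Expr ν α → ℕ
  | lit _ => 1
  | var _ => 1
  | op _ a b => a.time + b.time + 1
  | get _ a b c => a.time + b.time + c.time + 10
  | inp a => a.time + 1
  | band a b => a.time + b.time + 2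

/-- The number of words of size `V` that the evaluation needs. -/
def width : Expr ν α → ℕ
  | lit k => k.natAbs
  | var _ => 1
  | op _ a b => a.width + b.width + 1
  | get _ a b c => a.width + b.width + c.width + 8
  | inp a => a.width + 1
  | band a b => a.width + b.width

end Expr

namespace Cmd

def compile (Λ : Layout ν α) : Cmd ν α → Program
  | skip => .skip
  | set x e => .seq (e.compile Λ 0) (.arith .add (2 * Λ.vreg x) (tmpReg 0) 5)
  | put t a b c e => .seq (e.compile Λ 0) (.seq (a.compile Λ 1) (.seq (b.compile Λ 2)
      (.seq (c.compile Λ 3) (.seq (addrCode Λ t 1) (.store (tmpReg 1) (tmpReg 0))))))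
  | seq p q => .seq (p.compile Λ) (q.compile Λ)
  | ite e p q => .seq (e.compile Λ 0) (.branch (tmpReg 0) (p.compile Λ) (q.compile Λ))
  | loop e p => .seq (e.compile Λ 0) (.loop (tmpReg 0) (.seq (p.compile Λ) (e.compile Λ 0)))

/-- The compiled code runs at most this many times longer. -/
def slow : Cmd ν α → ℕ
  | skip => 1
  | set _ e => e.time + 1
  | put _ a b c e => a.time + b.time + c.time + e.time + 10
  | seq p q => p.slow + q.slow
  | ite e p q => e.time + 1 + p.slow + q.slow
  | loop e p => e.time + 1 + p.slow

def width : Cmd ν α → ℕ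
  | skip => 0
  | set _ e => e.width
  | put _ a b c e => a.width + b.width + c.width + e.width + 8
  | seq p q => p.width + q.width
  | ite e p q => e.width + p.width + q.width
  | loop e p => e.width + p.width

end Cmd

/-! ### Correctness of the compiled code -/

/-- A RAM state represents a store. -/
structure Represents (Λ : Layout ν α) (V len : ℕ) (I : ℕ → ℤ) (σ : Store ν α) (s : RamState) :
    Prop where
  var : ∀ x, s.reg (2 * Λ.vreg x) = σ.v x
  base : s.reg 1 = (V + 1 : ℕ)
  off : s.reg 3 = len
  zero : s.reg 5 = 0
  inp : ∀ a < len, s.mem a = I a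
  arr : ∀ t i j l, i ≤ V → j ≤ V → l ≤ V → s.mem (Λ.addr V len t i j l) = σ.a t i j l

/-- All entries are at most `V` in absolute value. -/
structure Store.Bdd (V : ℕ) (σ : Store ν α) : Prop where
  var : ∀ x, |σ.v x| ≤ V
  arr : ∀ t i j l, |σ.a t i j l| ≤ V

theorem Represents.congr {Λ : Layout ν α} {V len : ℕ} {I : ℕ → ℤ} {σ : Store ν α}
    {s s' : RamState} (h : Represents Λ V len I σ s)
    (hr : ∀ r, r % 2 = 0 ∨ r < 7 → s'.reg r = s.reg r) (hm : s'.mem = s.mem) :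
    Represents Λ V len I σ s' where
  var x := by rw [hr _ (by omega), h.var]
  base := by rw [hr _ (by omega), h.base]
  off := by rw [hr _ (by omega), h.off]
  zero := by rw [hr _ (by omega), h.zero]
  inp := by rw [hm]; exact h.inp
  arr := by rw [hm]; exact h.arr

/-- Past the input, an address is a number in mixed radix: the last digit, to base `J`, is the
array, the next two, to base `V + 1`, are `l` and `j`, and `i` is the leading digit, which needs no
bound. -/
theorem Layout.addr_inj (Λ : Layout ν α) {V len : ℕ} {t t' : α} {i j l i' j' l' : ℕ}
    (hj : j ≤ V) (hl : l ≤ V) (hj' : j' ≤ V) (hl' : l' ≤ V)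
    (h : Λ.addr V len t i j l = Λ.addr V len t' i' j' l') :
    t = t' ∧ i = i' ∧ j = j' ∧ l = l' := by
  have key : ∀ (a b c d m : ℕ), b < m → d < m → a * m + b = c * m + d → a = c ∧ b = d := by
    intro a b c d m hb hd h
    have h1 : (a * m + b) / m = a := by
      rw [mul_comm, Nat.mul_add_div (by omega), Nat.div_eq_of_lt hb, add_zero]
    have h2 : (c * m + d) / m = c := by
      rw [mul_comm, Nat.mul_add_div (by omega), Nat.div_eq_of_lt hd, add_zero]
    have h3 : a = c := by rw [← h1, ← h2, h]
    exact ⟨h3, by subst h3; omega⟩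
  unfold Layout.addr at h
  obtain ⟨h1, h2⟩ := key _ _ _ _ _ (Λ.aidx_lt t) (Λ.aidx_lt t') (Nat.add_right_cancel h)
  obtain ⟨h3, h4⟩ := key _ _ _ _ _ (by omega) (by omega) h1
  obtain ⟨h5, h6⟩ := key _ _ _ _ _ (by omega) (by omega) h3
  exact ⟨Λ.aidx_inj h2, h5, h6, h4⟩

/-- Three digits to base `V + 1`, a factor `J` and an offset, all at most `V`, fit into a constant
power of `V`. The exponent 8 leaves slack, and `2 ≤ V` absorbs the constants. -/
theorem Layout.addr_le (Λ : Layout ν α) {V len : ℕ} (hV : 2 ≤ V) (hJ : Λ.J ≤ V) (hlen : len ≤ V)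
    (t : α) {i j l : ℕ} (hi : i ≤ V) (hj : j ≤ V) (hl : l ≤ V) :
    Λ.addr V len t i j l ≤ V ^ 8 := by
  unfold Layout.addr
  have ht := Λ.aidx_lt t
  have h1 : i * (V + 1) + j ≤ V ^ 3 := by
    have a1 : i * (V + 1) ≤ V * (V + 1) := Nat.mul_le_mul_right _ hi
    have a2 : V * V * 2 ≤ V ^ 3 := by rw [pow_succ, sq]; exact Nat.mul_le_mul_left _ hV
    have a3 : V * 2 ≤ V * V := Nat.mul_le_mul_left _ hV
    have a4 : V * (V + 1) = V * V + V := by ring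
    omega
  have h2 : V ^ 3 * 2 ≤ V ^ 4 := by rw [pow_succ V 3]; exact Nat.mul_le_mul_left _ hV
  have h3 : V ≤ V ^ 3 := Nat.le_self_pow (by omega) V
  have h4 : (i * (V + 1) + j) * (V + 1) + l ≤ V ^ 5 := by
    have : (i * (V + 1) + j) * (V + 1) ≤ V ^ 3 * (V + 1) := Nat.mul_le_mul_right _ h1
    have e : V ^ 5 = V ^ 4 * V := by ring
    have : V ^ 4 * 2 ≤ V ^ 5 := by rw [e]; exact Nat.mul_le_mul_left _ hV
    nlinarith
  have h5 : ((i * (V + 1) + j) * (V + 1) + l) * Λ.J ≤ V ^ 5 * V := Nat.mul_le_mul h4 hJ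
  have e6 : V ^ 6 * 2 ≤ V ^ 7 := by rw [pow_succ V 6]; exact Nat.mul_le_mul_left _ hV
  have e7 : V ^ 7 * 2 ≤ V ^ 8 := by rw [pow_succ V 7]; exact Nat.mul_le_mul_left _ hV
  have e8 : V ≤ V ^ 6 := Nat.le_self_pow (by omega) V
  have : V ^ 5 * V = V ^ 6 := by ring
  omega

theorem addrCode_exec (Λ : Layout ν α) {V len W : ℕ} (hV : 2 ≤ V) (hJ : Λ.J ≤ V)
    (hlen : len ≤ V) (hW : V ^ 8 ≤ W) (t : α) (d : ℕ) {i j l : ℕ} (hi : i ≤ V) (hj : j ≤ V)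
    (hl : l ≤ V) (s : RamState) (hb : s.reg 1 = (V + 1 : ℕ)) (ho : s.reg 3 = len)
    (h0 : s.reg (tmpReg d) = i) (h1 : s.reg (tmpReg (d + 1)) = j)
    (h2 : s.reg (tmpReg (d + 2)) = l) :
    ∃ s', Exec W (addrCode Λ t d) s [] 9 s' ∧ s'.mem = s.mem ∧
      s'.reg (tmpReg d) = (Λ.addr V len t i j l : ℕ) ∧
      ∀ r, (r % 2 = 0 ∨ r < tmpReg d) → s'.reg r = s.reg r := by
  have hle := Λ.addr_le hV hJ hlen t hi hj hl
  have ht := Λ.aidx_lt t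
  unfold Layout.addr at hle ⊢
  set P := V + 1 with hP
  have hJ1 : 1 ≤ Λ.J := by omega
  have b4 : (i * P + j) * P + l ≤ ((i * P + j) * P + l) * Λ.J := Nat.le_mul_of_pos_right _ hJ1
  have b2 : i * P + j ≤ (i * P + j) * P := Nat.le_mul_of_pos_right _ (by omega)
  have hJW : Λ.J ≤ V ^ 8 := hJ.trans (Nat.le_self_pow (by omega) V)
  have ab : ∀ x : ℕ, x ≤ V ^ 8 → |(x : ℤ)| ≤ (W : ℕ) := by
    intro x hx; rw [abs_of_nonneg (by positivity)]; exact_mod_cast hx.trans hW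
  have n1 : tmpReg d ≠ tmpReg (d + 1) := by simp [tmpReg]
  have n2 : tmpReg d ≠ tmpReg (d + 2) := by simp [tmpReg]
  have n3 : tmpReg (d + 1) ≠ tmpReg (d + 2) := by simp [tmpReg]
  have n4 : tmpReg d ≠ 1 := by simp [tmpReg]
  have n5 : tmpReg d ≠ 3 := by simp [tmpReg]
  have n6 : tmpReg (d + 1) ≠ 3 := by simp [tmpReg]; 
  -- The states after the nine commands. All new contents are casts of natural numbers, so every
  -- word bound becomes an inequality of naturals below `V ^ 8`.
  let s1 := s.setReg (tmpReg d) ((i * P : ℕ) : ℤ)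
  let s2 := s1.setReg (tmpReg d) ((i * P + j : ℕ) : ℤ)
  let s3 := s2.setReg (tmpReg d) (((i * P + j) * P : ℕ) : ℤ)
  let s4 := s3.setReg (tmpReg d) (((i * P + j) * P + l : ℕ) : ℤ)
  let s5 := s4.setReg (tmpReg (d + 1)) (Λ.J : ℤ)
  let s6 := s5.setReg (tmpReg d) ((((i * P + j) * P + l) * Λ.J : ℕ) : ℤ)
  let s7 := s6.setReg (tmpReg (d + 1)) (Λ.aidx t : ℤ)
  let s8 := s7.setReg (tmpReg d) ((((i * P + j) * P + l) * Λ.J + Λ.aidx t : ℕ) : ℤ)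
  let s9 := s8.setReg (tmpReg d) ((((i * P + j) * P + l) * Λ.J + Λ.aidx t + len : ℕ) : ℤ)
  have arith : ∀ (o : ArithOp) (u : RamState) (x y z : ℕ) (k : ℕ), k ≤ V ^ 8 →
      o.eval (u.reg y) (u.reg z) = k → Exec W (.arith o x y z) u [] 1 (u.setReg x (k : ℤ)) := by
    intro o u x y z k hk he
    rw [← he]; exact Exec.arith u o x y z (by rw [he]; exact ab k hk)
  refine ⟨s9, ?_, rfl, by simp [s9, RamState.setReg], ?_⟩
  · change Exec W (addrCode Λ t d) s [] (1 + (1 + (1 + (1 + (1 + (1 + (1 + (1 + 1)))))))) s9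
    unfold addrCode
    refine Exec.seqNil (t := 1) (s' := s1) (arith _ _ _ _ _ _ (by omega) ?_) ?_
    · simp [ArithOp.eval, h0, hb]
    refine Exec.seqNil (t := 1) (s' := s2) (arith _ _ _ _ _ _ (by omega) ?_) ?_
    · simp [ArithOp.eval, s1, RamState.setReg, n1.symm, h1]
    refine Exec.seqNil (t := 1) (s' := s3) (arith _ _ _ _ _ _ (by omega) ?_) ?_
    · simp [ArithOp.eval, s2, s1, RamState.setReg, n4.symm, hb]
    refine Exec.seqNil (t := 1) (s' := s4) (arith _ _ _ _ _ _ (by omega) ?_) ?_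
    · simp [ArithOp.eval, s3, s2, s1, RamState.setReg, n2.symm, h2]
    refine Exec.seqNil (t := 1) (s' := s5) (Exec.const _ _ _ (ab _ hJW)) ?_
    refine Exec.seqNil (t := 1) (s' := s6) (arith _ _ _ _ _ _ (by omega) ?_) ?_
    · simp [ArithOp.eval, s5, s4, RamState.setReg, n1]
    refine Exec.seqNil (t := 1) (s' := s7) (Exec.const _ _ _ (ab _ (by omega))) ?_
    refine Exec.seqNil (t := 1) (s' := s8) (arith _ _ _ _ _ _ (by omega) ?_) ?_
    · simp [ArithOp.eval, s7, s6, RamState.setReg, n1]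
    refine arith _ _ _ _ _ _ (by omega) ?_
    simp [ArithOp.eval, s8, s7, s6, s5, s4, s3, s2, s1, RamState.setReg, n6.symm, n5.symm, ho]
  · intro r hr
    have r1 : r ≠ tmpReg d := by unfold tmpReg at *; omega
    have r2 : r ≠ tmpReg (d + 1) := by unfold tmpReg at *; omega
    simp [s9, s8, s7, s6, s5, s4, s3, s2, s1, RamState.setReg, r1, r2]

theorem natAbs_le_pow_two {V : ℕ} (hV : 2 ≤ V) (k : ℤ) : |k| ≤ ((V ^ k.natAbs : ℕ) : ℤ) := by
  rw [Int.abs_eq_natAbs]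
  exact_mod_cast (Nat.lt_pow_self (by omega)).le

/-- Products add the exponents, sums cost a factor 2 that the additional `V` pays for, and integer
division does not increase the absolute value. -/
theorem ArithOp.abs_eval_le (o : ArithOp) {V : ℕ} (hV : 2 ≤ V) {x y : ℤ} {a b : ℕ}
    (hx : |x| ≤ ((V ^ a : ℕ) : ℤ)) (hy : |y| ≤ ((V ^ b : ℕ) : ℤ)) :
    |o.eval x y| ≤ ((V ^ (a + b + 1) : ℕ) : ℤ) := by
  have pa : 1 ≤ V ^ a := Nat.one_le_pow _ _ (by omega)
  have pb : 1 ≤ V ^ b := Nat.one_le_pow _ _ (by omega)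
  have e : V ^ (a + b + 1) = V ^ a * V ^ b * V := by ring
  have h1 : V ^ a ≤ V ^ a * V ^ b := Nat.le_mul_of_pos_right _ pb
  have h2 : V ^ b ≤ V ^ a * V ^ b := Nat.le_mul_of_pos_left _ pa
  have h3 : V ^ a * V ^ b * 2 ≤ V ^ (a + b + 1) := by rw [e]; exact Nat.mul_le_mul_left _ hV
  have h4 : ((V ^ a : ℕ) : ℤ) + ((V ^ b : ℕ) : ℤ) ≤ ((V ^ (a + b + 1) : ℕ) : ℤ) := by
    have : V ^ a + V ^ b ≤ V ^ (a + b + 1) := by omega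
    exact_mod_cast this
  cases o with
  | add => exact (abs_add_le x y).trans (by linarith)
  | sub => exact (abs_sub x y).trans (by linarith)
  | mul =>
    simp only [ArithOp.eval, abs_mul]
    calc |x| * |y| ≤ ((V ^ a : ℕ) : ℤ) * ((V ^ b : ℕ) : ℤ) := by gcongr
      _ ≤ _ := by
        have : V ^ a * V ^ b ≤ V ^ (a + b + 1) := by omega
        exact_mod_cast this
  | div =>
    simp only [ArithOp.eval]
    have : |x / y| ≤ |x| := by
      rw [Int.abs_eq_natAbs, Int.abs_eq_natAbs]
      exact_mod_cast Int.natAbs_ediv_le_natAbs x y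
    have h5 : ((V ^ a : ℕ) : ℤ) ≤ ((V ^ (a + b + 1) : ℕ) : ℤ) := by
      have : V ^ a ≤ V ^ (a + b + 1) := by omega
      exact_mod_cast this
    linarith

section

variable {Λ : Layout ν α} {V len W : ℕ} {I : ℕ → ℤ}

/-- Only stored values are bounded by `V`. Intermediate values may be larger, but only by a power of
`V` that depends on the expression alone, so words of logarithmically many bits suffice for the
compiled code. -/
theorem Expr.abs_eval_le (hV : 2 ≤ V) (hI : ∀ a < len, |I a| ≤ V) {σ : Store ν α} (hσ : σ.Bdd V)
    (e : Expr ν α) (hs : e.Safe V len I σ) : |e.eval I σ| ≤ ((V ^ e.width : ℕ) : ℤ) := by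
  have mono : ∀ {x : ℤ} {a b : ℕ}, a ≤ b → |x| ≤ ((V ^ a : ℕ) : ℤ) → |x| ≤ ((V ^ b : ℕ) : ℤ) := by
    intro x a b hab h
    exact h.trans (by exact_mod_cast Nat.pow_le_pow_right (by omega) hab)
  induction e with
  | lit k => exact natAbs_le_pow_two hV k
  | var x => simpa [Expr.width, Expr.eval] using hσ.var x
  | op o a b iha ihb => exact o.abs_eval_le hV (iha hs.1) (ihb hs.2)
  | get t a b c _ _ _ =>
    refine mono (a := 1) (by simp [Expr.width]) ?_
    simpa [Expr.eval] using hσ.arr t _ _ _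
  | inp a _ =>
    refine mono (a := 1) (by simp [Expr.width]) ?_
    have := hI (a.eval I σ).toNat (by have := hs.2; omega)
    simpa [Expr.eval] using this
  | band a b iha ihb =>
    simp only [Expr.eval]
    split_ifs with h
    · exact mono (by simp [Expr.width]) (ihb (hs.2 h))
    · exact mono (by simp [Expr.width]) (iha hs.1)

/-- The temporaries form a stack: code for depth `d` changes no even register and no register below
`tmpReg d`. Hence the variables, the three fixed registers and the results of the subexpressions
evaluated earlier survive. -/
theorem Expr.compile_exec (hV : 2 ≤ V) (hJ : Λ.J ≤ V) (hlen : len ≤ V)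
    (hI : ∀ a < len, |I a| ≤ V) {σ : Store ν α} (hσ : σ.Bdd V)
    (e : Expr ν α) (hs : e.Safe V len I σ) (hW : V ^ e.width ≤ W) (d : ℕ) (s : RamState)
    (hr : Represents Λ V len I σ s) :
    ∃ t ≤ e.time, ∃ s', Exec W (e.compile Λ d) s [] t s' ∧ s'.mem = s.mem ∧
      s'.reg (tmpReg d) = e.eval I σ ∧ ∀ r, (r % 2 = 0 ∨ r < tmpReg d) → s'.reg r = s.reg r := by
  have hlow : ∀ d, 7 ≤ tmpReg d := fun d => by unfold tmpReg; omega
  have hlt : ∀ d, tmpReg d < tmpReg (d + 1) := fun d => by unfold tmpReg; omega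
  have hset : ∀ (u : RamState) (k : ℤ) (r : ℕ), (r % 2 = 0 ∨ r < tmpReg d) →
      (u.setReg (tmpReg d) k).reg r = u.reg r := by
    intro u k r hr
    have : r ≠ tmpReg d := by unfold tmpReg at *; omega
    simp [RamState.setReg, this]
  have mono : ∀ {a b : ℕ}, a ≤ b → V ^ b ≤ W → V ^ a ≤ W := by
    intro a b hab h
    exact (Nat.pow_le_pow_right (by omega) hab).trans h
  have hW' : ∀ {x : ℤ} {k : ℕ}, V ^ k ≤ W → |x| ≤ ((V ^ k : ℕ) : ℤ) → |x| ≤ (W : ℤ) :=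
    fun h1 h2 => h2.trans (by exact_mod_cast h1)
  have hbd := Expr.abs_eval_le hV hI hσ e hs
  induction e generalizing d s with
  | lit k =>
    exact ⟨1, le_rfl, _, Exec.const _ _ _ (hW' hW hbd), rfl, by simp [RamState.setReg, Expr.eval],
      hset _ _⟩
  | var x =>
    have h := Exec.arith (W := W) s .add (tmpReg d) (2 * Λ.vreg x) 5
      (by simpa [ArithOp.eval, hr.zero, hr.var, Expr.eval] using hW' hW hbd)
    exact ⟨1, le_rfl, _, h, rfl, by simp [RamState.setReg, Expr.eval, ArithOp.eval, hr.zero, hr.var],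
      hset _ _⟩
  | op o a b iha ihb =>
    obtain ⟨t1, ht1, s1, e1, m1, v1, f1⟩ := iha hs.1 (mono (by simp [Expr.width]; omega) hW) d s hr hset
      (Expr.abs_eval_le hV hI hσ _ hs.1)
    obtain ⟨t2, ht2, s2, e2, m2, v2, f2⟩ := ihb hs.2 (mono (by simp [Expr.width]; omega) hW) (d + 1) s1
      (hr.congr (fun r h => f1 r (by have := hlow d; omega)) m1)
      (by intro u k r hr
          have : r ≠ tmpReg (d + 1) := by unfold tmpReg at *; omega
          simp [RamState.setReg, this])
      (Expr.abs_eval_le hV hI hσ _ hs.2)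
    have v1' : s2.reg (tmpReg d) = a.eval I σ := by rw [f2 _ (Or.inr (hlt d)), v1]
    have h := Exec.arith (W := W) s2 o (tmpReg d) (tmpReg d) (tmpReg (d + 1))
      (by rw [v1', v2]; exact hW' hW hbd)
    refine ⟨_, ?_, _, e1.seqNil (e2.seqNil h), ?_, ?_, ?_⟩
    · simp [Expr.time]; omega
    · simp [RamState.setReg, m1, m2]
    · simp [RamState.setReg, v1', v2, Expr.eval]
    · intro r h'
      rw [hset _ _ _ h', f2 _ (by have := hlt d; omega), f1 _ h']
  | get t a b c iha ihb ihc =>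
    obtain ⟨hsa, hsb, hsc, ha, hb, hc⟩ := hs
    obtain ⟨t1, ht1, s1, e1, m1, v1, f1⟩ := iha hsa (mono (by simp [Expr.width]; omega) hW) d s hr hset
      (Expr.abs_eval_le hV hI hσ _ hsa)
    have r1 := hr.congr (fun r h => f1 r (by have := hlow d; omega)) m1
    obtain ⟨t2, ht2, s2, e2, m2, v2, f2⟩ := ihb hsb (mono (by simp [Expr.width]; omega) hW) (d + 1) s1 r1
      (by intro u k r hr
          have : r ≠ tmpReg (d + 1) := by unfold tmpReg at *; omega
          simp [RamState.setReg, this])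
      (Expr.abs_eval_le hV hI hσ _ hsb)
    have r2 := r1.congr (fun r h => f2 r (by have := hlow (d + 1); omega)) m2
    obtain ⟨t3, ht3, s3, e3, m3, v3, f3⟩ := ihc hsc (mono (by simp [Expr.width]; omega) hW) (d + 2) s2 r2
      (by intro u k r hr
          have : r ≠ tmpReg (d + 2) := by unfold tmpReg at *; omega
          simp [RamState.setReg, this])
      (Expr.abs_eval_le hV hI hσ _ hsc)
    have r3 := r2.congr (fun r h => f3 r (by have := hlow (d + 2); omega)) m3
    have l1 := hlt d
    have l2 : tmpReg (d + 1) < tmpReg (d + 2) := hlt (d + 1)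
    have l3 : tmpReg (d + 1 + 1) = tmpReg (d + 2) := rfl
    obtain ⟨s4, e4, m4, v4, f4⟩ := addrCode_exec Λ hV hJ hlen
      (mono (a := 8) (by simp [Expr.width]) hW) t d
      (i := (a.eval I σ).toNat) (j := (b.eval I σ).toNat) (l := (c.eval I σ).toNat)
      (by omega) (by omega) (by omega) s3 r3.base r3.off
      (by rw [f3 _ (by omega), f2 _ (by omega), v1]; omega)
      (by rw [f3 _ (by omega), v2]; omega) (by rw [v3]; omega)
    have hle := (Λ.addr_le hV hJ hlen t (i := (a.eval I σ).toNat) (j := (b.eval I σ).toNat)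
      (l := (c.eval I σ).toNat) (by omega) (by omega) (by omega)).trans
      (mono (a := 8) (by simp [Expr.width]) hW)
    refine ⟨_, ?_, _, e1.seqNil (e2.seqNil (e3.seqNil (e4.seqNil (Exec.load s4 (tmpReg d) (tmpReg d) _ v4 hle)))), ?_, ?_, ?_⟩
    · simp [Expr.time]; omega
    · simp [RamState.setReg, m1, m2, m3, m4]
    · simp only [RamState.setReg, Function.update_self, Expr.eval, m4]
      exact r3.arr t _ _ _ (by omega) (by omega) (by omega)
    · intro r h'
      rw [hset _ _ _ h', f4 _ h', f3 _ (by omega), f2 _ (by omega), f1 _ h']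
  | inp a iha =>
    obtain ⟨t1, ht1, s1, e1, m1, v1, f1⟩ := iha hs.1 (mono (by simp [Expr.width]) hW) d s hr hset
      (Expr.abs_eval_le hV hI hσ _ hs.1)
    have h2 := hs.2
    have hv : V ≤ W := by simpa using mono (a := 1) (by simp [Expr.width]) hW
    refine ⟨_, ?_, _, e1.seqNil (Exec.load s1 (tmpReg d) (tmpReg d) (a.eval I σ).toNat
      (by rw [v1]; omega) (by omega)), ?_, ?_, ?_⟩
    · simp [Expr.time]; omega
    · simp [RamState.setReg, m1]
    · simp only [RamState.setReg, Function.update_self, Expr.eval, m1]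
      exact hr.inp _ (by omega)
    · intro r h'
      rw [hset _ _ _ h', f1 _ h']
  | band a b iha ihb =>
    obtain ⟨t1, ht1, s1, e1, m1, v1, f1⟩ := iha hs.1 (mono (by simp [Expr.width]) hW) d s hr hset
      (Expr.abs_eval_le hV hI hσ _ hs.1)
    by_cases hpos : 0 < a.eval I σ
    · obtain ⟨t2, ht2, s2, e2, m2, v2, f2⟩ := ihb (hs.2 hpos) (mono (by simp [Expr.width]) hW) d s1
        (hr.congr (fun r h => f1 r (by have := hlow d; omega)) m1) hset
        (Expr.abs_eval_le hV hI hσ _ (hs.2 hpos))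
      refine ⟨_, ?_, _, e1.seqNil (Exec.branchPos (by rw [v1]; exact hpos) e2), ?_, ?_, ?_⟩
      · simp [Expr.time]; omega
      · rw [m2, m1]
      · rw [v2]; simp [Expr.eval, hpos]
      · intro r h'
        rw [f2 _ h', f1 _ h']
    · refine ⟨_, ?_, _, e1.seqNil (Exec.branchNonpos (by rw [v1]; omega) (Exec.skip _)), m1, ?_, f1⟩
      · simp [Expr.time]; omega
      · rw [v1]; simp [Expr.eval, hpos]

theorem Represents.setV [DecidableEq ν] [DecidableEq α] {σ : Store ν α} {s s' : RamState}
    (hr : Represents Λ V len I σ s) (x : ν) (k : ℤ)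
    (hreg : s'.reg (2 * Λ.vreg x) = k)
    (hoth : ∀ r, (r % 2 = 0 ∨ r < 7) → r ≠ 2 * Λ.vreg x → s'.reg r = s.reg r)
    (hm : s'.mem = s.mem) : Represents Λ V len I (σ.setV x k) s' where
  var y := by
    by_cases h : y = x
    · subst h; simp [Store.setV, hreg]
    · have : 2 * Λ.vreg y ≠ 2 * Λ.vreg x := by
        intro h'; exact h (Λ.vreg_inj (by omega))
      rw [hoth _ (by omega) this, hr.var]; simp [Store.setV, h]
  base := by rw [hoth _ (by omega) (by omega), hr.base]
  off := by rw [hoth _ (by omega) (by omega), hr.off]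
  zero := by rw [hoth _ (by omega) (by omega), hr.zero]
  inp := by rw [hm]; exact hr.inp
  arr := by rw [hm]; exact hr.arr

theorem Represents.setA [DecidableEq ν] [DecidableEq α] {σ : Store ν α} {s : RamState}
    (hr : Represents Λ V len I σ s) (t : α) {i j l : ℕ} (hj : j ≤ V) (hl : l ≤ V) (k : ℤ) :
    Represents Λ V len I (σ.setA t i j l k) (s.setMem (Λ.addr V len t i j l) k) where
  var := hr.var
  base := hr.base
  off := hr.off
  zero := hr.zero
  inp a ha := by
    have : a ≠ Λ.addr V len t i j l := by unfold Layout.addr; omega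
    simp [RamState.setMem, this, hr.inp a ha]
  arr t' i' j' l' hi' hj' hl' := by
    by_cases h : t' = t ∧ i' = i ∧ j' = j ∧ l' = l
    · obtain ⟨rfl, rfl, rfl, rfl⟩ := h
      simp [RamState.setMem, Store.setA]
    · have : Λ.addr V len t' i' j' l' ≠ Λ.addr V len t i j l :=
        fun h' => h (Λ.addr_inj hj' hl' hj hl h')
      simp [RamState.setMem, Store.setA, this, h, hr.arr t' i' j' l' hi' hj' hl']

theorem Store.Bdd.setV [DecidableEq ν] [DecidableEq α] {σ : Store ν α} (h : σ.Bdd V) (x : ν)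
    {k : ℤ} (hk : |k| ≤ V) : (σ.setV x k).Bdd V where
  var y := by
    by_cases hy : y = x
    · subst hy; simpa [Store.setV] using hk
    · simpa [Store.setV, hy] using h.var y
  arr := h.arr

theorem Store.Bdd.setA [DecidableEq ν] [DecidableEq α] {σ : Store ν α} (h : σ.Bdd V) (t : α)
    (i j l : ℕ) {k : ℤ} (hk : |k| ≤ V) : (σ.setA t i j l k).Bdd V where
  var := h.var
  arr t' i' j' l' := by
    simp only [Store.setA]
    split_ifs
    · exact hk
    · exact h.arr t' i' j' l'

/-- Induction on the execution. The exponent exceeds the width by 8 so that the addresses of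
`Layout.addr_le` fit even if the width is 0. -/
theorem Cmd.compile_exec [DecidableEq ν] [DecidableEq α] (hV : 2 ≤ V) (hJ : Λ.J ≤ V)
    (hlen : len ≤ V) (hI : ∀ a < len, |I a| ≤ V) {c : Cmd ν α} {σ σ' : Store ν α} {t : ℕ}
    (h : HExec V len I c σ t σ') (hσ : σ.Bdd V) (hW : V ^ (c.width + 8) ≤ W) (s : RamState)
    (hr : Represents Λ V len I σ s) :
    σ'.Bdd V ∧ ∃ t' ≤ c.slow * t, ∃ s', Exec W (c.compile Λ) s [] t' s' ∧
      Represents Λ V len I σ' s' := by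
  have mono : ∀ {a b : ℕ}, a ≤ b → V ^ b ≤ W → V ^ a ≤ W := by
    intro a b hab h
    exact (Nat.pow_le_pow_right (by omega) hab).trans h
  have hlow : ∀ d, 7 ≤ tmpReg d := fun d => by unfold tmpReg; omega
  have hlt : ∀ d, tmpReg d < tmpReg (d + 1) := fun d => by unfold tmpReg; omega
  have E := @Expr.compile_exec ν α Λ V len W I hV hJ hlen hI
  induction h generalizing s with
  | skip σ => exact ⟨hσ, 1, by simp [Cmd.slow], s, Exec.skip s, hr⟩
  | set σ x e hs hb =>
    obtain ⟨t1, ht1, s1, e1, m1, v1, f1⟩ := E hσ e hs (mono (by simp [Cmd.width]) hW) 0 s hr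
    have r1 := hr.congr (fun r h => f1 r (by have := hlow 0; omega)) m1
    have hv : V ≤ W := by simpa using mono (a := 1) (by simp) hW
    have h2 := Exec.arith (W := W) s1 .add (2 * Λ.vreg x) (tmpReg 0) 5
      (by simp only [ArithOp.eval, v1, r1.zero, add_zero]; exact hb.trans (by exact_mod_cast hv))
    refine ⟨hσ.setV x hb, _, ?_, _, e1.seqNil h2, r1.setV x _ ?_ ?_ rfl⟩
    · simp only [Cmd.slow]; omega
    · simp [RamState.setReg, ArithOp.eval, v1, r1.zero]
    · intro r _ h; simp [RamState.setReg, h]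
  | put σ t a b c e i j l hs hb ha hb' hc hi hj hl hi' hj' hl' =>
    obtain ⟨t0, ht0, s0, e0, m0, v0, f0⟩ := E hσ e hs (mono (by simp [Cmd.width]; omega) hW) 0 s hr
    have r0 := hr.congr (fun r h => f0 r (by have := hlow 0; omega)) m0
    obtain ⟨t1, ht1, s1, e1, m1, v1, f1⟩ := E hσ a ha (mono (by simp [Cmd.width]; omega) hW) 1 s0 r0
    have r1 := r0.congr (fun r h => f1 r (by have := hlow 1; omega)) m1
    obtain ⟨t2, ht2, s2, e2, m2, v2, f2⟩ := E hσ b hb' (mono (by simp [Cmd.width]; omega) hW) 2 s1 r1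
    have r2 := r1.congr (fun r h => f2 r (by have := hlow 2; omega)) m2
    obtain ⟨t3, ht3, s3, e3, m3, v3, f3⟩ := E hσ c hc (mono (by simp [Cmd.width]; omega) hW) 3 s2 r2
    have r3 := r2.congr (fun r h => f3 r (by have := hlow 3; omega)) m3
    have l0 : tmpReg 0 < tmpReg 1 := hlt 0
    have l1 : tmpReg 1 < tmpReg 2 := hlt 1
    have l2 : tmpReg 2 < tmpReg 3 := hlt 2
    have l3 : tmpReg (1 + 1) = tmpReg 2 := rfl
    have l4 : tmpReg (1 + 2) = tmpReg 3 := rfl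
    obtain ⟨s4, e4, m4, v4, f4⟩ := addrCode_exec Λ hV hJ hlen (W := W)
      (mono (a := 8) (by omega) hW) t 1
      (i := i) (j := j) (l := l) hi' hj' hl' s3 r3.base r3.off
      (by rw [f3 _ (by omega), f2 _ (by omega), v1, hi])
      (by rw [f3 _ (by omega), v2, hj]) (by rw [v3, hl])
    have r4 := r3.congr (fun r h => f4 r (by have := hlow 1; omega)) m4
    have v5 : s4.reg (tmpReg 0) = e.eval I σ := by
      rw [f4 _ (by omega), f3 _ (by omega), f2 _ (by omega), f1 _ (by omega), v0]
    have hle := (Λ.addr_le hV hJ hlen t hi' hj' hl').trans (mono (a := 8) (by omega) hW)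
    refine ⟨hσ.setA t i j l hb, _, ?_, _, e0.seqNil (e1.seqNil (e2.seqNil (e3.seqNil
      (e4.seqNil (Exec.store s4 (tmpReg 1) (tmpReg 0) _ v4 hle))))), ?_⟩
    · simp only [Cmd.slow]; omega
    · rw [v5]; exact r4.setA t hj' hl' _
  | @seq p q σ σ' σ'' t t' hp hq ihp ihq =>
    obtain ⟨b1, t1, ht1, s1, e1, r1⟩ := ihp hσ (mono (by simp [Cmd.width]) hW) s hr
    obtain ⟨b2, t2, ht2, s2, e2, r2⟩ := ihq b1 (mono (by simp [Cmd.width]) hW) s1 r1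
    refine ⟨b2, _, ?_, s2, e1.seqNil e2, r2⟩
    simp only [Cmd.slow]; nlinarith
  | @iteT e p q σ σ' t hs he hp ih =>
    obtain ⟨t0, ht0, s0, e0, m0, v0, f0⟩ := E hσ e hs (mono (by simp [Cmd.width]; omega) hW) 0 s hr
    have r0 := hr.congr (fun r h => f0 r (by have := hlow 0; omega)) m0
    obtain ⟨b1, t1, ht1, s1, e1, r1⟩ := ih hσ (mono (by simp [Cmd.width]; omega) hW) s0 r0
    refine ⟨b1, _, ?_, s1, e0.seqNil (Exec.branchPos (by rw [v0]; exact he) e1), r1⟩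
    simp only [Cmd.slow]; nlinarith
  | @iteF e p q σ σ' t hs he hp ih =>
    obtain ⟨t0, ht0, s0, e0, m0, v0, f0⟩ := E hσ e hs (mono (by simp [Cmd.width]; omega) hW) 0 s hr
    have r0 := hr.congr (fun r h => f0 r (by have := hlow 0; omega)) m0
    obtain ⟨b1, t1, ht1, s1, e1, r1⟩ := ih hσ (mono (by simp [Cmd.width]) hW) s0 r0
    refine ⟨b1, _, ?_, s1, e0.seqNil (Exec.branchNonpos (by rw [v0]; exact he) e1), r1⟩
    simp only [Cmd.slow]; nlinarith
  | @loopF e p σ hs he =>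
    obtain ⟨t0, ht0, s0, e0, m0, v0, f0⟩ := E hσ e hs (mono (by simp [Cmd.width]; omega) hW) 0 s hr
    have r0 := hr.congr (fun r h => f0 r (by have := hlow 0; omega)) m0
    refine ⟨hσ, _, ?_, s0, e0.seqNil (Exec.loopDone (by rw [v0]; exact he)), r0⟩
    simp only [Cmd.slow]; omega
  | @loopT e p σ σ' σ'' t t' hs he hp hl ihp ihl =>
    obtain ⟨t0, ht0, s0, e0, m0, v0, f0⟩ := E hσ e hs (mono (by simp [Cmd.width]; omega) hW) 0 s hr
    have r0 := hr.congr (fun r h => f0 r (by have := hlow 0; omega)) m0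
    obtain ⟨b1, t1, ht1, s1, e1, r1⟩ := ihp hσ (mono (by simp [Cmd.width]) hW) s0 r0
    obtain ⟨b2, t2, ht2, s2, e2, r2⟩ := ihl b1 hW s1 r1
    -- The compiled loop evaluates its condition once in front and again at the end of each round.
    -- So the code for the remaining rounds begins with an evaluation that belongs to the present
    -- round of the RAM loop, and its execution is cut there. The list `[]` is generalized since the
    -- constructor for sequences has a concatenation in its place.
    have : ∃ t3 t4 s3, Exec W (e.compile Λ 0) s1 [] t3 s3 ∧
        Exec W (.loop (tmpReg 0) (.seq (p.compile Λ) (e.compile Λ 0))) s3 [] t4 s2 ∧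
        t2 = t3 + t4 := by
      generalize hbs : ([] : List Bool) = bs at e2
      cases e2 with
      | @seq _ _ _ s3 _ bs1 bs2 t3 t4 h1 h2 =>
        obtain ⟨rfl, rfl⟩ := List.append_eq_nil_iff.1 hbs.symm
        exact ⟨t3, t4, s3, h1, h2, rfl⟩
    obtain ⟨t3, t4, s3, e3, e4, rfl⟩ := this
    have estep := Exec.loopStep (x := tmpReg 0) (by rw [v0]; exact he) (e1.seqNil e3) e4
    refine ⟨b2, _, ?_, s2, e0.seqNil (by simpa using estep), r2⟩
    simp only [Cmd.slow] at *
    nlinarith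

end

theorem Expr.compile_deterministic (Λ : Layout ν α) (e : Expr ν α) (d : ℕ) :
    (e.compile Λ d).Deterministic := by
  induction e generalizing d <;> simp [Expr.compile, Program.Deterministic, addrCode, *]

theorem Cmd.compile_deterministic (Λ : Layout ν α) (c : Cmd ν α) :
    (c.compile Λ).Deterministic := by
  induction c <;> simp [Cmd.compile, Program.Deterministic, addrCode,
    Expr.compile_deterministic, *]

set_option linter.unusedSectionVars false

/-! ### Program logic -/

/-- Word bound, input length and input of an execution. -/
structure Env where
  V : ℕ
  len : ℕ
  inp : ℕ → ℤ

variable {ν α : Type}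

instance : Add (Expr ν α) := ⟨.op .add⟩
instance : Sub (Expr ν α) := ⟨.op .sub⟩
instance : Mul (Expr ν α) := ⟨.op .mul⟩

/-- `e` evaluates to `k` without leaving the bounds. -/
def Evals (E : Env) (σ : Store ν α) (e : Expr ν α) (k : ℤ) : Prop :=
  e.Safe E.V E.len E.inp σ ∧ e.eval E.inp σ = k

namespace Evals

variable {E : Env} {σ : Store ν α} {a b c : Expr ν α} {i j l : ℤ}

@[simp] theorem lit_iff {k : ℤ} : Evals E σ (.lit k : Expr ν α) l ↔ k = l := by
  simp [Evals, Expr.Safe, Expr.eval]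

@[simp] theorem var_iff {x : ν} : Evals E σ (.var x : Expr ν α) l ↔ σ.v x = l := by
  simp [Evals, Expr.Safe, Expr.eval]

theorem lit (k : ℤ) : Evals E σ (.lit k : Expr ν α) k := by simp

theorem var {x : ν} {k : ℤ} (h : σ.v x = k) : Evals E σ (.var x : Expr ν α) k := by simp [h]

theorem add (ha : Evals E σ a i) (hb : Evals E σ b j) : Evals E σ (a + b) (i + j) :=
  ⟨⟨ha.1, hb.1⟩, by rw [← ha.2, ← hb.2]; rfl⟩

theorem sub (ha : Evals E σ a i) (hb : Evals E σ b j) : Evals E σ (a - b) (i - j) :=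
  ⟨⟨ha.1, hb.1⟩, by rw [← ha.2, ← hb.2]; rfl⟩

theorem mul (ha : Evals E σ a i) (hb : Evals E σ b j) : Evals E σ (a * b) (i * j) :=
  ⟨⟨ha.1, hb.1⟩, by rw [← ha.2, ← hb.2]; rfl⟩

theorem op {o : ArithOp} (ha : Evals E σ a i) (hb : Evals E σ b j) :
    Evals E σ (.op o a b) (o.eval i j) :=
  ⟨⟨ha.1, hb.1⟩, by rw [← ha.2, ← hb.2]; rfl⟩

theorem get {t : α} {i j l : ℕ} (ha : Evals E σ a i) (hb : Evals E σ b j) (hc : Evals E σ c l)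
    (hi : i ≤ E.V) (hj : j ≤ E.V) (hl : l ≤ E.V) : Evals E σ (.get t a b c) (σ.a t i j l) := by
  refine ⟨⟨ha.1, hb.1, hc.1, ?_, ?_, ?_⟩, ?_⟩
  · rw [ha.2]; omega
  · rw [hb.2]; omega
  · rw [hc.2]; omega
  · simp [Expr.eval, ha.2, hb.2, hc.2]

theorem inp {i : ℕ} (ha : Evals E σ a i) (hi : i < E.len) : Evals E σ (.inp a) (E.inp i) := by
  refine ⟨⟨ha.1, ?_, ?_⟩, ?_⟩
  · rw [ha.2]; omega
  · rw [ha.2]; omega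
  · simp [Expr.eval, ha.2]

theorem band (ha : Evals E σ a i) (hb : 0 < i → Evals E σ b j) :
    Evals E σ (.band a b) (if 0 < i then j else i) := by
  refine ⟨⟨ha.1, fun h => (hb (by rwa [ha.2] at h)).1⟩, ?_⟩
  simp only [Expr.eval, ha.2]
  split_ifs with h
  · exact (hb h).2
  · rfl

theorem congr {k k' : ℤ} (h : Evals E σ a k) (hk : k = k') : Evals E σ a k' := hk ▸ h

end Evals

namespace Cmd

/-- The command may write the variable `x`. -/
def wv : Cmd ν α → ν → Prop
  | skip, _ => False
  | set y _, x => x = y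
  | put _ _ _ _ _, _ => False
  | seq p q, x => p.wv x ∨ q.wv x
  | ite _ p q, x => p.wv x ∨ q.wv x
  | loop _ p, x => p.wv x

/-- The command may write the array `t`. -/
def wa : Cmd ν α → α → Prop
  | skip, _ => False
  | set _ _, _ => False
  | put u _ _ _ _, t => t = u
  | seq p q, t => p.wa t ∨ q.wa t
  | ite _ p q, t => p.wa t ∨ q.wa t
  | loop _ p, t => p.wa t

def block : List (Cmd ν α) → Cmd ν α
  | [] => skip
  | c :: cs => seq c (block cs)

/-- Repeat `c` for `x = 0, 1, …` up to (excluding) the value of `y`. -/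
def forUp (x y : ν) (c : Cmd ν α) : Cmd ν α :=
  seq (set x (.lit 0)) (loop (.var y - .var x) (seq c (set x (.var x + .lit 1))))

@[simp] theorem wv_block_nil (x : ν) : (block ([] : List (Cmd ν α))).wv x ↔ False := Iff.rfl
@[simp] theorem wv_block_cons (c : Cmd ν α) (cs : List (Cmd ν α)) (x : ν) :
    (block (c :: cs)).wv x ↔ c.wv x ∨ (block cs).wv x := Iff.rfl
@[simp] theorem wa_block_nil (x : α) : (block ([] : List (Cmd ν α))).wa x ↔ False := Iff.rfl
@[simp] theorem wa_block_cons (c : Cmd ν α) (cs : List (Cmd ν α)) (x : α) :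
    (block (c :: cs)).wa x ↔ c.wa x ∨ (block cs).wa x := Iff.rfl
@[simp] theorem wv_forUp (x y : ν) (c : Cmd ν α) (z : ν) :
    (forUp x y c).wv z ↔ z = x ∨ c.wv z := by simp [forUp, wv]; tauto
@[simp] theorem wa_forUp (x y : ν) (c : Cmd ν α) (t : α) :
    (forUp x y c).wa t ↔ c.wa t := by simp [forUp, wa]
@[simp] theorem wv_skip (z : ν) : (skip : Cmd ν α).wv z ↔ False := Iff.rfl
@[simp] theorem wv_set (x : ν) (e : Expr ν α) (z : ν) : (set x e).wv z ↔ z = x := Iff.rfl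
@[simp] theorem wv_put (t : α) (a b c e : Expr ν α) (z : ν) : (put t a b c e).wv z ↔ False :=
  Iff.rfl
@[simp] theorem wv_ite (e : Expr ν α) (p q : Cmd ν α) (z : ν) :
    (ite e p q).wv z ↔ p.wv z ∨ q.wv z := Iff.rfl
@[simp] theorem wv_loop (e : Expr ν α) (p : Cmd ν α) (z : ν) : (loop e p).wv z ↔ p.wv z := Iff.rfl
@[simp] theorem wa_skip (z : α) : (skip : Cmd ν α).wa z ↔ False := Iff.rfl
@[simp] theorem wa_set (x : ν) (e : Expr ν α) (z : α) : (set x e).wa z ↔ False := Iff.rfl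
@[simp] theorem wa_put (t : α) (a b c e : Expr ν α) (z : α) : (put t a b c e).wa z ↔ z = t :=
  Iff.rfl
@[simp] theorem wa_ite (e : Expr ν α) (p q : Cmd ν α) (z : α) :
    (ite e p q).wa z ↔ p.wa z ∨ q.wa z := Iff.rfl
@[simp] theorem wa_loop (e : Expr ν α) (p : Cmd ν α) (z : α) : (loop e p).wa z ↔ p.wa z := Iff.rfl

end Cmd

/-- `σ'` differs from `σ` only in what `c` may write. -/
structure Agree (c : Cmd ν α) (σ σ' : Store ν α) : Prop where
  v : ∀ x, ¬ c.wv x → σ'.v x = σ.v x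
  a : ∀ t, ¬ c.wa t → σ'.a t = σ.a t

theorem Agree.rfl' (c : Cmd ν α) (σ : Store ν α) : Agree c σ σ := ⟨fun _ _ => rfl, fun _ _ => rfl⟩

theorem Agree.trans {c : Cmd ν α} {σ σ' σ'' : Store ν α} (h : Agree c σ σ') (h' : Agree c σ' σ'') :
    Agree c σ σ'' :=
  ⟨fun x hx => (h'.v x hx).trans (h.v x hx), fun t ht => (h'.a t ht).trans (h.a t ht)⟩

theorem Agree.mono {c c' : Cmd ν α} {σ σ' : Store ν α} (h : Agree c σ σ')
    (hv : ∀ x, c.wv x → c'.wv x) (ha : ∀ t, c.wa t → c'.wa t) : Agree c' σ σ' :=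
  ⟨fun x hx => h.v x (fun h' => hx (hv x h')), fun t ht => h.a t (fun h' => ht (ha t h'))⟩

variable [DecidableEq ν] [DecidableEq α]

namespace Store

@[simp] theorem setV_v (σ : Store ν α) (x : ν) (k : ℤ) (y : ν) :
    (σ.setV x k).v y = if y = x then k else σ.v y := by
  simp [setV, Function.update_apply]

@[simp] theorem setV_a (σ : Store ν α) (x : ν) (k : ℤ) : (σ.setV x k).a = σ.a := rfl

@[simp] theorem setA_v (σ : Store ν α) (t : α) (i j l : ℕ) (k : ℤ) :
    (σ.setA t i j l k).v = σ.v := rfl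

@[simp] theorem setA_a (σ : Store ν α) (t : α) (i j l : ℕ) (k : ℤ) (t' : α) (i' j' l' : ℕ) :
    (σ.setA t i j l k).a t' i' j' l' =
      if t' = t ∧ i' = i ∧ j' = j ∧ l' = l then k else σ.a t' i' j' l' := rfl

theorem setA_a_ne (σ : Store ν α) {t t' : α} (h : t' ≠ t) (i j l : ℕ) (k : ℤ) :
    (σ.setA t i j l k).a t' = σ.a t' := by
  funext; simp [h]

end Store

/-- Started in `σ`, `c` halts after at most `T` steps in a store with property `Q`. -/
def Run (E : Env) (c : Cmd ν α) (σ : Store ν α) (T : ℕ) (Q : Store ν α → Prop) : Prop :=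
  ∃ t ≤ T, ∃ σ', HExec E.V E.len E.inp c σ t σ' ∧ Q σ'

/-- The frame rule. What a command may write is read off its syntax, and all facts about other
variables and arrays are transported along this relation. -/
theorem HExec.agree {V len : ℕ} {I : ℕ → ℤ} {c : Cmd ν α} {σ σ' : Store ν α} {t : ℕ}
    (h : HExec V len I c σ t σ') : Agree c σ σ' := by
  induction h with
  | skip σ => exact Agree.rfl' _ _
  | set σ x e => exact ⟨fun y hy => by simp [show y ≠ x from hy], fun _ _ => rfl⟩
  | put σ t a b c e i j l =>
    exact ⟨fun y hy => rfl, fun u hu => σ.setA_a_ne (show u ≠ t from hu) i j l _⟩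
  | seq _ _ h1 h2 =>
    exact (h1.mono (fun _ => Or.inl) (fun _ => Or.inl)).trans
      (h2.mono (fun _ => Or.inr) (fun _ => Or.inr))
  | iteT _ _ _ h => exact h.mono (fun _ => Or.inl) (fun _ => Or.inl)
  | iteF _ _ _ h => exact h.mono (fun _ => Or.inr) (fun _ => Or.inr)
  | loopF => exact Agree.rfl' _ _
  | loopT _ _ _ _ h1 h2 => exact (h1.mono (c' := .loop _ _) (fun _ => id) (fun _ => id)).trans h2

namespace Run

variable {E : Env} {σ : Store ν α} {T : ℕ} {Q : Store ν α → Prop}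

theorem mono {c : Cmd ν α} {T' : ℕ} {Q' : Store ν α → Prop} (h : Run E c σ T' Q') (hT : T' ≤ T)
    (hQ : ∀ σ', Agree c σ σ' → Q' σ' → Q σ') : Run E c σ T Q := by
  obtain ⟨t, ht, σ', h, hQ'⟩ := h
  exact ⟨t, ht.trans hT, σ', h, hQ σ' h.agree hQ'⟩

theorem skip (hT : 1 ≤ T) (hQ : Q σ) : Run E .skip σ T Q := ⟨1, hT, σ, .skip σ, hQ⟩

theorem set {x : ν} {e : Expr ν α} (k : ℤ) (he : Evals E σ e k) (hk : |k| ≤ E.V) (hT : 1 ≤ T)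
    (hQ : Q (σ.setV x k)) : Run E (.set x e) σ T Q := by
  obtain ⟨h1, rfl⟩ := he
  exact ⟨1, hT, _, .set σ x e h1 hk, hQ⟩

theorem setN {x : ν} {e : Expr ν α} (k : ℕ) (he : Evals E σ e k) (hk : k ≤ E.V) (hT : 1 ≤ T)
    (hQ : Q (σ.setV x k)) : Run E (.set x e) σ T Q :=
  set k he (by simpa using hk) hT hQ

theorem put {t : α} {a b c e : Expr ν α} (i j l : ℕ) (k : ℤ) (ha : Evals E σ a i)
    (hb : Evals E σ b j) (hc : Evals E σ c l) (he : Evals E σ e k) (hi : i ≤ E.V) (hj : j ≤ E.V)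
    (hl : l ≤ E.V) (hk : |k| ≤ E.V) (hT : 1 ≤ T) (hQ : Q (σ.setA t i j l k)) :
    Run E (.put t a b c e) σ T Q := by
  obtain ⟨h1, rfl⟩ := he
  exact ⟨1, hT, _, .put σ t a b c e i j l h1 hk ha.1 hb.1 hc.1 ha.2 hb.2 hc.2 hi hj hl, hQ⟩

theorem seq {p q : Cmd ν α} (T₁ : ℕ) (hT : T₁ ≤ T)
    (h : Run E p σ T₁ (fun σ' => Run E q σ' (T - T₁) Q)) : Run E (.seq p q) σ T Q := by
  obtain ⟨t, ht, σ', h, t', ht', σ'', h', hQ⟩ := h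
  exact ⟨t + t', by omega, σ'', h.seq h', hQ⟩

theorem nil (hT : 1 ≤ T) (hQ : Q σ) : Run E (.block []) σ T Q := skip hT hQ

theorem cons {p : Cmd ν α} {cs : List (Cmd ν α)} (T₁ : ℕ) (hT : T₁ ≤ T)
    (h : Run E p σ T₁ (fun σ' => Run E (.block cs) σ' (T - T₁) Q)) :
    Run E (.block (p :: cs)) σ T Q := seq T₁ hT h

theorem ite {e : Expr ν α} {p q : Cmd ν α} (k : ℤ) (he : Evals E σ e k) (hT : 1 ≤ T)
    (h1 : 0 < k → Run E p σ (T - 1) Q) (h2 : k ≤ 0 → Run E q σ (T - 1) Q) :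
    Run E (.ite e p q) σ T Q := by
  obtain ⟨hs, rfl⟩ := he
  rcases lt_or_ge 0 (e.eval E.inp σ) with h | h
  · obtain ⟨t, ht, σ', h', hQ⟩ := h1 h
    exact ⟨t + 1, by omega, σ', .iteT hs h h', hQ⟩
  · obtain ⟨t, ht, σ', h', hQ⟩ := h2 h
    exact ⟨t + 1, by omega, σ', .iteF hs h h', hQ⟩

/-- Loops with a potential that pays for the remaining time. -/
theorem loop {e : Expr ν α} {c : Cmd ν α} (Inv : Store ν α → Prop) (τ : Store ν α → ℕ)
    (h0 : Inv σ) (hT : τ σ ≤ T)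
    (hs : ∀ σ', Agree c σ σ' → Inv σ' → ∃ k, Evals E σ' e k ∧
      (k ≤ 0 → 1 ≤ τ σ' ∧ Q σ') ∧
      (0 < k → ∃ B, Run E c σ' B (fun σ'' => Inv σ'' ∧ B + 1 + τ σ'' ≤ τ σ'))) :
    Run E (.loop e c) σ T Q := by
  suffices H : ∀ N, ∀ σ', τ σ' = N → Agree c σ σ' → Inv σ' → Run E (.loop e c) σ' (τ σ') Q from
    (H _ σ rfl (Agree.rfl' _ _) h0).mono hT (fun _ _ h => h)
  intro N
  induction N using Nat.strong_induction_on with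
  | _ N ih =>
    intro σ' hN hag hI
    obtain ⟨k, ⟨hsafe, rfl⟩, h1, h2⟩ := hs σ' hag hI
    rcases lt_or_ge 0 (e.eval E.inp σ') with h | h
    · obtain ⟨B, t, ht, σ'', h', hI', hle⟩ := h2 h
      obtain ⟨t', ht', σ₃, h₃, hQ⟩ := ih (τ σ'') (by omega) σ'' rfl (hag.trans h'.agree) hI'
      exact ⟨t + t' + 1, by omega, σ₃, .loopT hsafe h h' h₃, hQ⟩
    · exact ⟨1, (h1 h).1, σ', .loopF hsafe h, (h1 h).2⟩

/-- A round costs `B k` and 2 more for the increment and the test; the 2 in front pays for the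
initialization and the last test. The invariant is demanded after the increment, hence `setV` in the
conclusions about the body. -/
theorem forUp {x y : ν} {c : Cmd ν α} {N : ℕ} (B : ℕ → ℕ) (Inv : ℕ → Store ν α → Prop)
    (hxy : y ≠ x) (hcx : ¬ c.wv x) (hcy : ¬ c.wv y) (hN : σ.v y = N) (hNV : N ≤ E.V)
    (hT : 2 + ∑ k ∈ Finset.range N, (B k + 2) ≤ T) (h0 : Inv 0 (σ.setV x 0))
    (hs : ∀ k : ℕ, k < N → ∀ σ' : Store ν α, σ'.v x = k → σ'.v y = N → Agree (.forUp x y c) σ σ' → Inv k σ' →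
      Run E c σ' (B k) (fun σ'' => Inv (k + 1) (σ''.setV x ((k + 1 : ℕ) : ℤ))))
    (hQ : ∀ σ' : Store ν α, σ'.v x = N → Agree (.forUp x y c) σ σ' → Inv N σ' → Q σ') :
    Run E (.forUp x y c) σ T Q := by
  unfold Cmd.forUp
  refine seq 1 (by omega) (setN 0 (by simp) (by omega) le_rfl ?_)
  have hag0 : Agree (.forUp x y c) σ (σ.setV x 0) :=
    ⟨fun z hz => by simp at hz; simp [hz.1], fun t _ => rfl⟩
  refine loop (fun σ' => ∃ k : ℕ, k ≤ N ∧ σ'.v x = k ∧ σ'.v y = N ∧ Inv k σ' ∧ Agree (.forUp x y c) σ σ')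
    (fun σ' => 1 + ∑ k ∈ Finset.Ico (σ'.v x).toNat N, (B k + 2))
    ⟨0, by omega, by simp, by simp [hxy, hN], by simpa using h0, by simpa using hag0⟩ ?_ ?_
  · simp; omega
  · rintro σ' - ⟨k, hk, hx, hy, hI, hag⟩
    refine ⟨N - k, (Evals.var hy).sub (Evals.var hx), ?_, ?_⟩
    · intro h
      obtain rfl : k = N := by omega
      exact ⟨by omega, hQ σ' hx hag hI⟩
    · intro h
      have hkN : k < N := by omega
      refine ⟨B k + 1, seq (B k) (by omega) ?_⟩
      refine (hs k hkN σ' hx hy hag hI).mono le_rfl ?_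
      intro σ'' hag' hI'
      have hx' : σ''.v x = k := by rw [hag'.v x hcx, hx]
      have hy' : σ''.v y = N := by rw [hag'.v y hcy, hy]
      refine setN (k + 1) ?_ (by omega) (by omega)
        ⟨⟨k + 1, by omega, by simp, by simp [hxy, hy'], hI', ?_⟩, ?_⟩
      · push_cast; exact (Evals.var hx').add (Evals.lit 1)
      · refine hag.trans ⟨fun z hz => ?_, fun t ht => ?_⟩
        · simp at hz
          simp [hz.1, hag'.v z hz.2]
        · simp at ht
          simp [hag'.a t ht]
      · have : ((((k + 1 : ℕ) : ℤ)).toNat) = k + 1 := by omega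
        simp only [Store.setV_v, if_true, this, hx, Int.toNat_natCast]
        rw [Finset.sum_eq_sum_Ico_succ_bot hkN]
        omega

end Run

set_option linter.constructorNameAsVariable false

/-! ### Variables and arrays of the graph algorithms -/

inductive Var
  | n | m | ans | lim | fin | out | row | run | bud | kl | km | off
  | x | y | z | i | t | v | w | u | a | b | c | d | p | q | g | h
  | ext (k : ℕ)
  deriving DecidableEq

/-- adjacency matrix, degrees, neighbour lists, marked vertices, list of rows, list of middle
vertices, memory of the matrix multiplications, accumulated counts, counts at vertices of low
degree, counts at edges -/
inductive Arr
  | adj | deg | nbr | mark | rows | mids | mm | acc | low | cnt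
  deriving DecidableEq

def Var.code : Var → ℕ
  | n => 0 | m => 1 | ans => 2 | lim => 3 | fin => 4 | out => 5 | row => 6 | run => 7 | bud => 8
  | kl => 9 | km => 10 | off => 11 | x => 12 | y => 13 | z => 14 | i => 15 | t => 16 | v => 17
  | w => 18 | u => 19 | a => 20 | b => 21 | c => 22 | d => 23 | p => 24 | q => 25 | g => 26
  | h => 27 | ext k => k + 28

def Var.decode : ℕ → Var
  | 0 => n | 1 => m | 2 => ans | 3 => lim | 4 => fin | 5 => out | 6 => row | 7 => run | 8 => bud
  | 9 => kl | 10 => km | 11 => off | 12 => x | 13 => y | 14 => z | 15 => i | 16 => t | 17 => v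
  | 18 => w | 19 => u | 20 => a | 21 => b | 22 => c | 23 => d | 24 => p | 25 => q | 26 => g
  | 27 => h | k + 28 => ext k

def Arr.code : Arr → ℕ
  | adj => 0 | deg => 1 | nbr => 2 | mark => 3 | rows => 4 | mids => 5 | mm => 6 | acc => 7
  | low => 8 | cnt => 9

/-- The code 0 puts the variable `n` into register 0, which holds the number of vertices at the
start and must hold the answer at the end. -/
def graphLayout : Layout Var Arr where
  vreg := Var.code
  vreg_inj := Function.LeftInverse.injective (g := Var.decode) (fun x => by cases x <;> rfl)
  aidx := Arr.code
  aidx_inj a b h := by cases a <;> cases b <;> first | rfl | simp [Arr.code] at h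
  J := 10
  aidx_lt t := by cases t <;> simp [Arr.code]

/-! ### Running a RAM program as a subroutine with a time limit -/

namespace Program

/-- Run `p` on the variables `ext 0, ext 1, …` and on row `run` of the array `mm`; every loop
iteration is charged to `bud`, and nothing is done any more when `bud` is used up. -/
def limited : Program → Cmd Var Arr
  | skip => .skip
  | const x k => .ite (.var .bud) (.set (.ext x) (.lit k)) .skip
  | arith o x y z => .ite (.var .bud) (.set (.ext x) (.op o (.var (.ext y)) (.var (.ext z)))) .skip
  | load x y => .ite (.var .bud)
      (.set (.ext x) (.get .mm (.var .run) (.lit 0) (.var (.ext y)))) .skip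
  | store x y => .ite (.var .bud)
      (.put .mm (.var .run) (.lit 0) (.var (.ext x)) (.var (.ext y))) .skip
  | flip _ => .skip
  | seq p q => .seq p.limited q.limited
  | branch x p q => .ite (.var (.ext x)) p.limited q.limited
  | loop x p => .loop (.band (.var .bud) (.var (.ext x)))
      (.seq p.limited (.ite (.var .bud) (.set .bud (.var .bud - .lit 1)) .skip))

/-- The limited program takes at most `size` steps for every unit of budget that it spends, plus
`size` once. For a loop, the additional `size` of each run of the body is paid by the unit charged
to that round, whence the factor 2. -/
def size : Program → ℕ
  | seq p q => p.size + q.size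
  | branch _ p q => p.size + q.size + 1
  | loop _ p => 2 * p.size + 5
  | _ => 2

theorem limited_wv {p : Program} {x : Var} (h : p.limited.wv x) : x = .bud ∨ ∃ k, x = .ext k := by
  induction p <;> simp [limited, Cmd.wv] at h <;> grind

theorem limited_wa {p : Program} {t : Arr} (h : p.limited.wa t) : t = .mm := by
  induction p <;> simp [limited, Cmd.wa] at h <;> grind

@[simp] theorem not_limited_wv {p : Program} {x : Var} (h : x ≠ .bud) (h' : ∀ k, x ≠ .ext k) :
    p.limited.wv x ↔ False := by
  refine ⟨fun hx => ?_, False.elim⟩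
  rcases limited_wv hx with rfl | ⟨k, rfl⟩
  exacts [h rfl, h' k rfl]

@[simp] theorem not_limited_wa {p : Program} {t : Arr} (h : t ≠ .mm) :
    p.limited.wa t ↔ False :=
  ⟨fun ht => h (limited_wa ht), False.elim⟩

/-- Every write tests the budget and every loop stops without it, so a program whose budget is used
up falls through to its end in bounded time. This replaces an abort mechanism. -/
theorem limited_of_bud_le (E : Env) (p : Program) {σ : Store Var Arr} (h : σ.v .bud ≤ 0) :
    Run E p.limited σ p.size (fun σ' => σ' = σ) := by
  have hb : Evals E σ (.var .bud) (σ.v .bud) := by simp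
  induction p with
  | skip => exact .skip (by simp [size]) rfl
  | const x k =>
    exact .ite _ hb (by simp [size]) (by omega) (fun _ => .skip (by simp [size]) rfl)
  | arith o x y z =>
    exact .ite _ hb (by simp [size]) (by omega) (fun _ => .skip (by simp [size]) rfl)
  | load x y =>
    exact .ite _ hb (by simp [size]) (by omega) (fun _ => .skip (by simp [size]) rfl)
  | store x y =>
    exact .ite _ hb (by simp [size]) (by omega) (fun _ => .skip (by simp [size]) rfl)
  | flip x => exact .skip (by simp [size]) rfl
  | seq p q ihp ihq =>
    refine .seq p.size (by simp [size]) (ihp.mono le_rfl ?_)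
    rintro _ - rfl
    exact ihq.mono (by simp [size]) (fun _ _ h => h)
  | branch x p q ihp ihq =>
    exact .ite (σ.v (.ext x)) (by simp) (by simp [size])
      (fun _ => ihp.mono (by simp [size]) (fun _ _ h => h))
      (fun _ => ihq.mono (by simp [size]) (fun _ _ h => h))
  | loop x p ih =>
    refine .loop (fun σ' => σ' = σ) (fun _ => 1) rfl (by simp [size]) ?_
    rintro _ - rfl
    refine ⟨_, hb.band (j := 0) (by omega), ?_, ?_⟩
    · simp
    · intro h'; split_ifs at h' <;> omega

end Program

/-- The RAM state is simulated on row `r` of the array `mm`. -/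
structure Simulates (r : ℕ) (s : RamState) (σ : Store Var Arr) : Prop where
  reg : ∀ x, σ.v (.ext x) = s.reg x
  mem : ∀ a, σ.a .mm r 0 a = s.mem a

/-- `load` and `store` move values without a check of their size, so the bound on all words has to
be carried along as an invariant. -/
theorem Exec.bounded {W : ℕ} {p : Program} {s s' : RamState} {bs : List Bool} {t : ℕ}
    (h : Exec W p s bs t s') (hp : p.Deterministic) (hr : ∀ x, |s.reg x| ≤ W)
    (hm : ∀ a, |s.mem a| ≤ W) :
    (∀ x, |s'.reg x| ≤ W) ∧ ∀ a, |s'.mem a| ≤ W := by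
  have hset : ∀ (s : RamState) (x : ℕ) (k : ℤ), |k| ≤ W → (∀ x, |s.reg x| ≤ W) →
      ∀ y, |(s.setReg x k).reg y| ≤ W := by
    intro s x k hk hr y
    simp only [RamState.setReg, Function.update_apply]
    split_ifs
    exacts [hk, hr y]
  induction h with
  | skip => exact ⟨hr, hm⟩
  | const s x k hk => exact ⟨hset s x k hk hr, hm⟩
  | arith s o x y z h => exact ⟨hset s x _ h hr, hm⟩
  | load s x y a ha hW => exact ⟨hset s x _ (hm a) hr, hm⟩
  | store s x y a ha hW =>
    refine ⟨hr, fun b => ?_⟩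
    simp only [RamState.setMem, Function.update_apply]
    split_ifs
    exacts [hr y, hm b]
  | flip => exact hp.elim
  | seq _ _ ih1 ih2 => obtain ⟨h1, h2⟩ := ih1 hp.1 hr hm; exact ih2 hp.2 h1 h2
  | branchPos _ _ ih => exact ih hp.1 hr hm
  | branchNonpos _ _ ih => exact ih hp.2 hr hm
  | loopDone => exact ⟨hr, hm⟩
  | loopStep _ _ _ ih1 ih2 => obtain ⟨h1, h2⟩ := ih1 hp hr hm; exact ih2 hp h1 h2

theorem Simulates.setV {r : ℕ} {s : RamState} {σ : Store Var Arr} (h : Simulates r s σ) (x : ℕ)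
    (k : ℤ) : Simulates r (s.setReg x k) (σ.setV (.ext x) k) where
  reg y := by simp [RamState.setReg, Function.update_apply, h.reg]
  mem := h.mem

theorem Simulates.setA {r : ℕ} {s : RamState} {σ : Store Var Arr} (h : Simulates r s σ) (a : ℕ)
    (k : ℤ) : Simulates r (s.setMem a k) (σ.setA .mm r 0 a k) where
  reg := h.reg
  mem b := by simp [RamState.setMem, Function.update_apply, h.mem]

/-- What a limited run of a program with execution time `t`, started in `σ`, achieves. -/
structure LimitedPost (r b t : ℕ) (s' : RamState) (σ : Store Var Arr) (b' : ℕ)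
    (σ' : Store Var Arr) : Prop where
  bud : σ'.v .bud = b'
  le : b' ≤ b
  spent : b ≤ b' + t
  sim : 0 < b' → Simulates r s' σ'
  rest : ∀ r', r' ≠ r → σ'.a .mm r' = σ.a .mm r'

/-- The simulation is exact as long as budget is left; afterwards only the other rows of `mm` are
known to be intact. A charged round takes at least one step of the original program, so no more than
its running time `t` is spent. -/
theorem Program.limited_exec {E : Env} {W r : ℕ} (hW : W ≤ E.V) (hrV : r ≤ E.V) {p : Program}
    {s s' : RamState} {bs : List Bool} {t : ℕ} (h : Exec W p s bs t s') (hp : p.Deterministic)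
    (hr : ∀ x, |s.reg x| ≤ W) (hm : ∀ a, |s.mem a| ≤ W) {b : ℕ} {σ : Store Var Arr}
    (hb : σ.v .bud = b) (hbV : b ≤ E.V) (hrun : σ.v .run = r) (hs : Simulates r s σ) :
    ∃ b', Run E p.limited σ (p.size * (b - b' + 1)) (LimitedPost r b t s' σ b') := by
  have hWV : (W : ℤ) ≤ E.V := by exact_mod_cast hW
  -- With no budget nothing happens, and the claim about the simulation is vacuous.
  have inert : ∀ (p : Program) (σ : Store Var Arr) (t : ℕ) (s' : RamState), σ.v .bud = (0 : ℕ) →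
      ∃ b', Run E p.limited σ (p.size * (0 - b' + 1)) (LimitedPost r 0 t s' σ b') := by
    intro p σ t s' h0
    refine ⟨0, (p.limited_of_bud_le E (by omega)).mono (by omega) ?_⟩
    rintro _ - rfl
    exact ⟨h0, le_rfl, by omega, by omega, fun _ _ => rfl⟩
  induction h generalizing b σ with
  | skip s =>
    exact ⟨b, .skip (by simp [size]) ⟨hb, le_rfl, by omega, fun _ => hs, fun _ _ => rfl⟩⟩
  | const s x k hk =>
    rcases Nat.eq_zero_or_pos b with rfl | hpos
    · exact inert _ _ _ _ hb
    refine ⟨b, .ite b (.var hb) (by simp [size]) (fun _ => ?_) (by omega)⟩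
    refine .set k (.lit k) (hk.trans hWV) (by simp [size]) ?_
    exact ⟨by simpa using hb, le_rfl, by omega, fun _ => hs.setV x k, fun _ _ => rfl⟩
  | arith s o x y z h =>
    rcases Nat.eq_zero_or_pos b with rfl | hpos
    · exact inert _ _ _ _ hb
    refine ⟨b, .ite b (.var hb) (by simp [size]) (fun _ => ?_) (by omega)⟩
    refine .set _ ((Evals.var (hs.reg y)).op (Evals.var (hs.reg z))) (h.trans hWV) (by simp [size]) ?_
    exact ⟨by simpa using hb, le_rfl, by omega, fun _ => hs.setV x _, fun _ _ => rfl⟩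
  | load s x y a ha hWa =>
    rcases Nat.eq_zero_or_pos b with rfl | hpos
    · exact inert _ _ _ _ hb
    refine ⟨b, .ite b (.var hb) (by simp [size]) (fun _ => ?_) (by omega)⟩
    refine .set (s.mem a) ?_ ((hm a).trans hWV) (by simp [size]) ?_
    · rw [← hs.mem a]
      exact Evals.get (.var hrun) (Evals.lit 0) (.var ((hs.reg y).trans ha)) hrV (by omega) (by omega)
    exact ⟨by simpa using hb, le_rfl, by omega, fun _ => hs.setV x _, fun _ _ => rfl⟩
  | store s x y a ha hWa =>
    rcases Nat.eq_zero_or_pos b with rfl | hpos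
    · exact inert _ _ _ _ hb
    refine ⟨b, .ite b (.var hb) (by simp [size]) (fun _ => ?_) (by omega)⟩
    refine .put r 0 a (s.reg y) (.var hrun) (.lit 0) (.var ((hs.reg x).trans ha))
      (.var (hs.reg y)) hrV (by omega) (by omega) ((hr y).trans hWV) (by simp [size]) ?_
    refine ⟨by simpa using hb, le_rfl, by omega, fun _ => hs.setA a _, fun r' hr' => ?_⟩
    funext i j
    simp [hr']
  | flip => exact hp.elim
  | @seq p q s s₁ s₂ bs bs' t t' e1 e2 ih1 ih2 =>
    obtain ⟨b1, h1⟩ := ih1 hp.1 hr hm hb hbV hrun hs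
    obtain ⟨hr1, hm1⟩ := e1.bounded hp.1 hr hm
    obtain ⟨t1, ht1, σ1, x1, p1⟩ := h1
    have hrun1 : σ1.v .run = r := by rw [x1.agree.v .run (by simp), hrun]
    have key : ∃ b', Run E q.limited σ1 (q.size * (b1 - b' + 1)) (LimitedPost r b1 t' s₂ σ1 b') := by
      rcases Nat.eq_zero_or_pos b1 with rfl | hpos
      · exact inert _ _ _ _ p1.bud
      · exact ih2 hp.2 hr1 hm1 p1.bud (p1.le.trans hbV) hrun1 (p1.sim hpos)
    obtain ⟨b2, t2, ht2, σ2, x2, p2⟩ := key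
    have l1 := p1.le
    have l2 := p2.le
    refine ⟨b2, t1 + t2, ?_, σ2, x1.seq x2, p2.bud, by omega, ?_, p2.sim, ?_⟩
    · have e1 : p.size * (b - b1 + 1) ≤ p.size * (b - b2 + 1) := Nat.mul_le_mul_left _ (by omega)
      have e2 : q.size * (b1 - b2 + 1) ≤ q.size * (b - b2 + 1) := Nat.mul_le_mul_left _ (by omega)
      simp only [size, add_mul]
      omega
    · have := p1.spent; have := p2.spent; omega
    · intro r' hr'; rw [p2.rest r' hr', p1.rest r' hr']
  | @branchPos x p q s s₁ bs t hx e1 ih =>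
    obtain ⟨b1, h1⟩ := ih hp.1 hr hm hb hbV hrun hs
    refine ⟨b1, .ite (s.reg x) (.var (hs.reg x)) ?_ (fun _ => h1.mono ?_ ?_) (by omega)⟩
    · simp only [size, add_mul]; omega
    · simp only [size, add_mul]; omega
    · intro σ' _ hp'
      exact ⟨hp'.bud, hp'.le, by have := hp'.spent; omega, hp'.sim, hp'.rest⟩
  | @branchNonpos x p q s s₁ bs t hx e1 ih =>
    obtain ⟨b1, h1⟩ := ih hp.2 hr hm hb hbV hrun hs
    refine ⟨b1, .ite (s.reg x) (.var (hs.reg x)) ?_ (by omega) (fun _ => h1.mono ?_ ?_)⟩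
    · simp only [size, add_mul]; omega
    · simp only [size, add_mul]; omega
    · intro σ' _ hp'
      exact ⟨hp'.bud, hp'.le, by have := hp'.spent; omega, hp'.sim, hp'.rest⟩
  | @loopDone x p s hx =>
    rcases Nat.eq_zero_or_pos b with rfl | hpos
    · exact inert _ _ _ _ hb
    have ev : Evals E σ (.band (.var .bud) (.var (.ext x))) (s.reg x) :=
      ((Evals.var hb).band (fun _ => .var (hs.reg x))).congr (by simp [hpos])
    refine ⟨b, 1, by simp [size], σ, .loopF ev.1 (by rw [ev.2]; exact hx), hb, le_rfl,
      by omega, fun _ => hs, fun _ _ => rfl⟩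
  | @loopStep x p s s₁ s₂ bs bs' t t' hx e1 e2 ih1 ih2 =>
    rcases Nat.eq_zero_or_pos b with rfl | hpos
    · exact inert _ _ _ _ hb
    have ev : Evals E σ (.band (.var .bud) (.var (.ext x))) (s.reg x) :=
      ((Evals.var hb).band (fun _ => .var (hs.reg x))).congr (by simp [hpos])
    obtain ⟨b1, t1, ht1, σ1, x1, p1⟩ := ih1 hp hr hm hb hbV hrun hs
    obtain ⟨hr1, hm1⟩ := e1.bounded hp hr hm
    have hrun1 : σ1.v .run = r := by rw [x1.agree.v .run (by simp), hrun]
    have l1 := p1.le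
    have d1 := p1.spent
    -- If the body has used up the budget, the decrement is skipped, so that `bud` stays 0 instead
    -- of becoming negative, and the loop stops.
    rcases Nat.eq_zero_or_pos b1 with rfl | hpos1
    · have hb1 : σ1.v .bud = 0 := by simpa using p1.bud
      have xdec : HExec E.V E.len E.inp
          (.ite (.var .bud) (.set .bud (.var .bud - .lit 1)) .skip) σ1 2 σ1 :=
        .iteF (by simp [Expr.Safe]) (by simp [Expr.eval, hb1]) (.skip _)
      have xl : HExec E.V E.len E.inp (Program.loop x p).limited σ1 1 σ1 :=
        .loopF (by simp [Expr.Safe, Expr.eval, hb1]) (by simp [Expr.eval, hb1])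
      refine ⟨0, _, ?_, σ1, .loopT ev.1 (by rw [ev.2]; exact hx) (x1.seq xdec) xl, p1.bud, p1.le,
        by omega, by omega, p1.rest⟩
      simp only [size]
      nlinarith
    · have hVb : |(b1 : ℤ) - 1| ≤ E.V := by rw [abs_of_nonneg (by omega)]; omega
      have evd : Evals E σ1 (.var .bud - .lit 1) ((b1 : ℤ) - 1) := (Evals.var p1.bud).sub (.lit 1)
      have xdec : HExec E.V E.len E.inp
          (.ite (.var .bud) (.set .bud (.var .bud - .lit 1)) .skip) σ1 2
            (σ1.setV .bud ((b1 : ℤ) - 1)) := by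
        refine .iteT (by simp [Expr.Safe]) (by simp [Expr.eval, p1.bud]; omega) ?_
        have := HExec.set (V := E.V) (len := E.len) (I := E.inp) σ1 .bud (.var .bud - .lit 1) evd.1
          (by rw [evd.2]; exact hVb)
        rwa [evd.2] at this
      have hs1 : Simulates r s₁ (σ1.setV .bud ((b1 : ℤ) - 1)) :=
        ⟨fun y => by simpa using (p1.sim hpos1).reg y, (p1.sim hpos1).mem⟩
      obtain ⟨b2, t2, ht2, σ2, x2, p2⟩ := ih2 hp hr1 hm1 (b := b1 - 1)
        (σ := σ1.setV .bud ((b1 : ℤ) - 1)) (by simp; omega) (by omega) (by simpa using hrun1) hs1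
      have l2 := p2.le
      have d2 := p2.spent
      refine ⟨b2, _, ?_, σ2, .loopT ev.1 (by rw [ev.2]; exact hx) (x1.seq xdec) x2, p2.bud,
        by omega, by omega, p2.sim, fun r' hr' => ?_⟩
      · simp only [size] at *
        obtain ⟨u, rfl⟩ := Nat.exists_eq_add_of_le l1
        obtain ⟨w, hw⟩ := Nat.exists_eq_add_of_le l2
        have e1 : b1 + u - b1 = u := by omega
        have e2 : b1 - 1 - b2 = w := by omega
        have e3 : b1 + u - b2 = u + w + 1 := by omega
        rw [e1] at ht1; rw [e2] at ht2; rw [e3]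
        nlinarith
      · rw [p2.rest r' hr', Store.setV_a, p1.rest r' hr']

namespace Program

/-- Reset the variables that `p.limited` may have changed. -/
def clear : Program → Cmd Var Arr
  | skip => .skip
  | const x _ => .set (.ext x) (.lit 0)
  | arith _ x _ _ => .set (.ext x) (.lit 0)
  | load x _ => .set (.ext x) (.lit 0)
  | store _ _ => .skip
  | flip _ => .skip
  | seq p q => .seq p.clear q.clear
  | branch _ p q => .seq p.clear q.clear
  | loop _ p => p.clear

theorem clear_wv {p : Program} {x : Var} (h : p.clear.wv x) :
    ∃ k, x = .ext k ∧ p.limited.wv (.ext k) := by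
  induction p <;> simp [limited, clear, Cmd.wv] at h ⊢ <;> grind

@[simp] theorem clear_wa {p : Program} {t : Arr} : p.clear.wa t ↔ False := by
  induction p <;> simp [clear, Cmd.wa, *]

@[simp] theorem not_clear_wv {p : Program} {x : Var} (h' : ∀ k, x ≠ .ext k) :
    p.clear.wv x ↔ False := by
  refine ⟨fun hx => ?_, False.elim⟩
  obtain ⟨k, rfl, -⟩ := clear_wv hx
  exact h' k rfl

theorem clear_run (E : Env) (p : Program) (σ : Store Var Arr) :
    Run E p.clear σ p.size (fun σ' => (∀ x, p.limited.wv (.ext x) → σ'.v (.ext x) = 0) ∧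
      (∀ x, σ.v (.ext x) = 0 → σ'.v (.ext x) = 0) ∧ σ'.a = σ.a) := by
  have base : ∀ (σ : Store Var Arr) (x : ℕ), Run E (.set (.ext x) (.lit 0)) σ 2 (fun σ' =>
      (∀ y, y = x → σ'.v (.ext y) = 0) ∧ (∀ y, σ.v (.ext y) = 0 → σ'.v (.ext y) = 0) ∧
        σ'.a = σ.a) := by
    intro σ x
    refine .set 0 (.lit 0) (by simp) (by omega) ⟨?_, ?_, rfl⟩
    · rintro y rfl; simp
    · intro y hy; simp [hy]
  have two : ∀ (p q : Program) (σ : Store Var Arr), (∀ σ, Run E p.clear σ p.size (fun σ' =>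
      (∀ x, p.limited.wv (.ext x) → σ'.v (.ext x) = 0) ∧
      (∀ x, σ.v (.ext x) = 0 → σ'.v (.ext x) = 0) ∧ σ'.a = σ.a)) → (∀ σ, Run E q.clear σ q.size
      (fun σ' => (∀ x, q.limited.wv (.ext x) → σ'.v (.ext x) = 0) ∧
      (∀ x, σ.v (.ext x) = 0 → σ'.v (.ext x) = 0) ∧ σ'.a = σ.a)) →
      Run E (.seq p.clear q.clear) σ (p.size + q.size) (fun σ' =>
        (∀ x, p.limited.wv (.ext x) ∨ q.limited.wv (.ext x) → σ'.v (.ext x) = 0) ∧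
        (∀ x, σ.v (.ext x) = 0 → σ'.v (.ext x) = 0) ∧ σ'.a = σ.a) := by
    intro p q σ hp hq
    refine .seq p.size (by omega) ((hp σ).mono le_rfl ?_)
    rintro σ1 - ⟨h1, h2, h3⟩
    refine (hq σ1).mono (by omega) ?_
    rintro σ2 - ⟨h4, h5, h6⟩
    refine ⟨fun x hx => ?_, fun x hx => h5 x (h2 x hx), h6.trans h3⟩
    rcases hx with hx | hx
    exacts [h5 x (h1 x hx), h4 x hx]
  induction p generalizing σ with
  | skip => exact .skip (by simp [size]) ⟨by simp [limited], fun _ h => h, rfl⟩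
  | const x k => simpa [limited, Cmd.wv, clear, size] using base σ x
  | arith o x y z => simpa [limited, Cmd.wv, clear, size] using base σ x
  | load x y => simpa [limited, Cmd.wv, clear, size] using base σ x
  | store x y => exact .skip (by simp [size]) ⟨by simp [limited], fun _ h => h, rfl⟩
  | flip x => exact .skip (by simp [size]) ⟨by simp [limited], fun _ h => h, rfl⟩
  | seq p q ihp ihq => exact two p q σ ihp ihq
  | branch x p q ihp ihq =>
    exact (two p q σ ihp ihq).mono (by simp [size]) (fun _ _ h => h)
  | loop x p ih =>
    refine (ih σ).mono (by simp [size]; omega) ?_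
    rintro σ' - ⟨h1, h2⟩
    refine ⟨fun x hx => h1 x ?_, h2⟩
    simpa [limited, Cmd.wv] using hx

end Program

/-! ### One matrix multiplication as a subroutine -/

/-- The indicator of a proposition, as an integer. -/
noncomputable def ind (P : Prop) : ℤ := open Classical in if P then 1 else 0

theorem ind_nonneg (P : Prop) : 0 ≤ ind P := by unfold ind; split_ifs <;> simp
theorem ind_le_one (P : Prop) : ind P ≤ 1 := by unfold ind; split_ifs <;> simp
@[simp] theorem ind_of {P : Prop} (h : P) : ind P = 1 := by simp [ind, h]
@[simp] theorem ind_not {P : Prop} (h : ¬ P) : ind P = 0 := by simp [ind, h]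
theorem ind_congr {P Q : Prop} (h : P ↔ Q) : ind P = ind Q := by rw [propext h]
theorem ind_mul (P Q : Prop) : ind P * ind Q = ind (P ∧ Q) := by
  by_cases hP : P <;> by_cases hQ : Q <;> simp [hP, hQ]
theorem abs_ind_le (P : Prop) : |ind P| ≤ 1 := by
  rw [abs_of_nonneg (ind_nonneg P)]; exact ind_le_one P

/-- `p` multiplies `k × k` matrices with entries `-1, 0, 1` in time `F k`. -/
def Multiplies (p : Program) (c : ℕ) (F : ℕ → ℕ) : Prop :=
  ∀ k : ℕ, 0 < k → ∀ A B : Matrix (Fin k) (Fin k) ℤ, (∀ i j, |A i j| ≤ 1) → (∀ i j, |B i j| ≤ 1) →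
    ∀ s, MatMulInput A B s → ∃ t ≤ F k, ∃ s', Exec ((k + 2) ^ c) p s [] t s' ∧
      MatMulOutput (A * B) s'

abbrev GExpr := Expr Var Arr
abbrev GCmd := Cmd Var Arr
abbrev GStore := Store Var Arr

abbrev vr (x : Var) : GExpr := .var x
abbrev lt (k : ℤ) : GExpr := .lit k
/-- access to a one-dimensional array -/
abbrev get1 (t : Arr) (e : GExpr) : GExpr := .get t (.lit 0) (.lit 0) e
/-- access to a two-dimensional array -/
abbrev get2 (t : Arr) (e f : GExpr) : GExpr := .get t (.lit 0) e f

/-- Write the entries at `(p, q)` and `(q, p)` of the two factors. -/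
def fillEntry : GCmd := .block [
  .set .g (vr .off + vr .q),
  .ite (vr .km - vr .g) (.block [
    .set .h (get1 .mids (vr .g)),
    .set .g (get1 .rows (vr .p)),
    .put .mm (vr .run) (lt 0) (vr .p * vr .kl + vr .q)
      (get2 .adj (vr .g) (vr .h) * get1 .mark (vr .h)),
    .put .mm (vr .run) (lt 0) (vr .kl * vr .kl + (vr .q * vr .kl + vr .p))
      (get2 .adj (vr .h) (vr .g))])
    .skip]

def fillFactors : GCmd := .forUp .p .kl (.forUp .q .kl fillEntry)

def addEntry : GCmd := .block [
  .set .g (get1 .rows (vr .p)),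
  .set .h (get1 .rows (vr .q)),
  .put .acc (vr .row) (vr .g) (vr .h) (.get .acc (vr .row) (vr .g) (vr .h) +
    .get .mm (vr .run) (lt 0) (lt 2 * (vr .kl * vr .kl) + (vr .p * vr .kl + vr .q)))]

def addProduct : GCmd := .forUp .p .kl (.forUp .q .kl addEntry)

/-- For all pairs of vertices in `rows`, add to `acc` the number of their marked common neighbours
among `kl` vertices of `mids`, starting at `off`; nothing is added if the time limit `bud` is
exceeded, and then `bud` becomes `0`. -/
def countBlock (p : Program) : GCmd := .block [
  fillFactors,
  p.clear,
  .set (.ext 0) (vr .kl),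
  p.limited,
  .ite (vr .bud) addProduct .skip,
  .set .run (vr .run + lt 1)]

/-- `lst` lists the k vertices that index rows and columns of the product; `md` lists b middle
vertices, of which those from position o on, at most k of them, form the present block. `R` is the
marked set, `r` the row of `mm` that is used up and `r₀` the row of `acc` that collects the counts.
-/
structure BlockSetup (E : Env) (N : ℕ → Finset ℕ) (R : Finset ℕ) (n k b o r r₀ : ℕ)
    (lst md : ℕ → ℕ) (σ : GStore) : Prop where
  kl : σ.v .kl = k
  km : σ.v .km = b
  off : σ.v .off = o
  run : σ.v .run = r
  row : σ.v .row = r₀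
  rows : ∀ i < k, σ.a .rows 0 0 i = lst i ∧ lst i < n
  mids : ∀ i < b, σ.a .mids 0 0 i = md i ∧ md i < n
  adj : ∀ u < n, ∀ v < n, σ.a .adj 0 u v = ind (v ∈ N u)
  mark : ∀ v < n, σ.a .mark 0 0 v = ind (v ∈ R)

/-- The term `n + k³` is a crude bound for the partial sums in `acc`; the quadratic terms are for
the positions in the row of `mm`. -/
structure BlockBounds (E : Env) (n k b o r r₀ : ℕ) : Prop where
  kpos : 0 < k
  cube : n + k * k * k + 3 * (k * k) + 2 * k ≤ E.V
  off : o + k ≤ E.V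
  km : b ≤ E.V
  run : r + 1 ≤ E.V
  row : r₀ ≤ E.V

theorem BlockSetup.congr {E : Env} {N : ℕ → Finset ℕ} {R : Finset ℕ} {n k b o r r₀ : ℕ}
    {lst md : ℕ → ℕ} {σ σ' : GStore} (h : BlockSetup E N R n k b o r r₀ lst md σ) {c : GCmd}
    (hag : Agree c σ σ')
    (hv : ∀ x, x = .kl ∨ x = .km ∨ x = .off ∨ x = .run ∨ x = .row → ¬ c.wv x)
    (ha : ∀ t, t = .rows ∨ t = .mids ∨ t = .adj ∨ t = .mark → ¬ c.wa t) :
    BlockSetup E N R n k b o r r₀ lst md σ' where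
  kl := by rw [hag.v _ (hv _ (by simp)), h.kl]
  km := by rw [hag.v _ (hv _ (by simp)), h.km]
  off := by rw [hag.v _ (hv _ (by simp)), h.off]
  run := by rw [hag.v _ (hv _ (by simp)), h.run]
  row := by rw [hag.v _ (hv _ (by simp)), h.row]
  rows := by rw [hag.a _ (ha _ (by simp))]; exact h.rows
  mids := by rw [hag.a _ (ha _ (by simp))]; exact h.mids
  adj := by rw [hag.a _ (ha _ (by simp))]; exact h.adj
  mark := by rw [hag.a _ (ha _ (by simp))]; exact h.mark

section

variable (N : ℕ → Finset ℕ) (R : Finset ℕ) (b o : ℕ) (lst md : ℕ → ℕ)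

/-- The factors of the matrix product. -/
noncomputable def factorA (i l : ℕ) : ℤ :=
  if o + l < b then ind (md (o + l) ∈ N (lst i)) * ind (md (o + l) ∈ R) else 0

noncomputable def factorB (l j : ℕ) : ℤ :=
  if o + l < b then ind (lst j ∈ N (md (o + l))) else 0

/-- This counts the marked middle vertices of the block adjacent to both `lst i` and `lst j`. The
mark enters one factor only, and positions beyond the end of `md` contribute 0, which pads the last
block to a square. -/
noncomputable def blockEntry (k i j : ℕ) : ℤ :=
  ∑ l ∈ Finset.range k, factorA N R b o lst md i l * factorB N b o lst md l j

theorem abs_factorA_le (i l : ℕ) : |factorA N R b o lst md i l| ≤ 1 := by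
  unfold factorA
  split_ifs
  · rw [ind_mul]; exact abs_ind_le _
  · simp

theorem abs_factorB_le (l j : ℕ) : |factorB N b o lst md l j| ≤ 1 := by
  unfold factorB
  split_ifs
  · exact abs_ind_le _
  · simp

theorem abs_blockEntry_le (k i j : ℕ) : |blockEntry N R b o lst md k i j| ≤ k := by
  unfold blockEntry
  refine (Finset.abs_sum_le_sum_abs _ _).trans ?_
  have : ∀ l ∈ Finset.range k, |factorA N R b o lst md i l * factorB N b o lst md l j| ≤ 1 := by
    intro l _
    rw [abs_mul]
    exact mul_le_one₀ (abs_factorA_le ..) (abs_nonneg _) (abs_factorB_le ..)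
  simpa using Finset.sum_le_sum this

end

/-- Row `r` of `mm` holds the entries of the factors with index below `s`, and otherwise `0`. -/
structure Filled (fA fB : ℕ → ℕ → ℤ) (k r s : ℕ) (σ : GStore) : Prop where
  left : ∀ i < k, ∀ l < k, σ.a .mm r 0 (i * k + l) = if i * k + l < s then fA i l else 0
  right : ∀ i < k, ∀ l < k, σ.a .mm r 0 (k * k + (l * k + i)) =
    if i * k + l < s then fB l i else 0
  rest : ∀ a, 2 * (k * k) ≤ a → σ.a .mm r 0 a = 0

theorem index_lt {k i l : ℕ} (hi : i < k) (hl : l < k) : i * k + l < k * k := by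
  nlinarith [Nat.mul_le_mul_right k (show i + 1 ≤ k from hi)]

theorem index_inj {k i l i' l' : ℕ} (hl : l < k) (hl' : l' < k) (h : i * k + l = i' * k + l') :
    i = i' ∧ l = l' := by
  have h1 : (i * k + l) / k = i := by
    rw [mul_comm, Nat.mul_add_div (by omega), Nat.div_eq_of_lt hl, add_zero]
  have h2 : (i' * k + l') / k = i' := by
    rw [mul_comm, Nat.mul_add_div (by omega), Nat.div_eq_of_lt hl', add_zero]
  have h3 : i = i' := by rw [← h1, ← h2, h]
  exact ⟨h3, by subst h3; omega⟩

/-- Round (p, q) writes entry (p, q) of the first factor and entry (q, p) of the second, so the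
second factor is filled in transposed order. -/
theorem Filled.step {fA fB : ℕ → ℕ → ℤ} {k r s p q : ℕ} {σ σ' : GStore}
    (h : Filled fA fB k r s σ) (hs : s = p * k + q) (hp : p < k) (hq : q < k)
    (h1 : σ'.a .mm r 0 (p * k + q) = fA p q)
    (h2 : σ'.a .mm r 0 (k * k + (q * k + p)) = fB q p)
    (h3 : ∀ a, a ≠ p * k + q → a ≠ k * k + (q * k + p) → σ'.a .mm r 0 a = σ.a .mm r 0 a) :
    Filled fA fB k r (s + 1) σ' where
  left i hi l hl := by
    by_cases heq : i * k + l = p * k + q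
    · obtain ⟨rfl, rfl⟩ := index_inj hl hq heq
      rw [h1, if_pos (by omega)]
    · have := index_lt hi hl
      rw [h3 _ heq (by omega), h.left i hi l hl]
      exact if_congr (by omega) rfl rfl
  right i hi l hl := by
    by_cases heq : l * k + i = q * k + p
    · obtain ⟨rfl, rfl⟩ := index_inj hi hp heq
      rw [h2, if_pos (by omega)]
    · have := index_lt hp hq
      rw [h3 _ (by omega) (by omega), h.right i hi l hl]
      refine if_congr ⟨fun _ => by omega, fun _ => ?_⟩ rfl rfl
      have : i * k + l ≠ p * k + q := fun h' => by
        obtain ⟨rfl, rfl⟩ := index_inj hl hq h'; exact heq rfl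
      omega
  rest a ha := by
    have := index_lt hp hq
    have := index_lt hq hp
    rw [h3 a (by omega) (by omega), h.rest a ha]

section

variable {E : Env} {N : ℕ → Finset ℕ} {R : Finset ℕ} {n k b o r r₀ : ℕ} {lst md : ℕ → ℕ}

theorem fillEntry_run {σ : GStore} (hB : BlockBounds E n k b o r r₀)
    (hS : BlockSetup E N R n k b o r r₀ lst md σ) {p q : ℕ} (hp : p < k) (hq : q < k)
    (hvp : σ.v .p = p) (hvq : σ.v .q = q)
    (hF : Filled (factorA N R b o lst md) (factorB N b o lst md) k r (p * k + q) σ) :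
    Run E fillEntry σ 8 (fun σ' =>
      Filled (factorA N R b o lst md) (factorB N b o lst md) k r (p * k + q + 1) σ' ∧
      ∀ r', r' ≠ r → σ'.a .mm r' = σ.a .mm r') := by
  obtain ⟨hk, hcube, hoV, hbV, hrV, hr0V⟩ := hB
  have hpk := index_lt hp hq
  have hqk := index_lt hq hp
  unfold fillEntry
  refine .cons 1 (by omega) (.setN (o + q) ?_ (by omega) le_rfl ?_)
  · push_cast; exact (Evals.var hS.off).add (.var hvq)
  refine .cons 6 (by omega) (.ite (b - (o + q : ℕ)) ?_ (by omega) (fun h => ?_) (fun h => ?_))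
  · exact (Evals.var (by simpa using hS.km)).sub (.var (by simp))
  · have hlt : o + q < b := by omega
    obtain ⟨hm, hmn⟩ := hS.mids _ hlt
    obtain ⟨hl, hln⟩ := hS.rows _ hp
    refine .cons 1 (by omega) (.setN (md (o + q)) ?_ (by omega) le_rfl ?_)
    · rw [← hm]
      exact Evals.get (i := 0) (j := 0) (.lit 0) (.lit 0) (.var (by simp)) (by omega) (by omega)
        (by omega)
    refine .cons 1 (by omega) (.setN (lst p) ?_ (by omega) le_rfl ?_)
    · rw [← hl]
      exact Evals.get (i := 0) (j := 0) (.lit 0) (.lit 0) (.var (by simpa using hvp)) (by omega)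
        (by omega) (by omega)
    have eA : factorA N R b o lst md p q = ind (md (o + q) ∈ N (lst p)) * ind (md (o + q) ∈ R) := by
      simp [factorA, hlt]
    have eB : factorB N b o lst md q p = ind (lst p ∈ N (md (o + q))) := by
      simp [factorB, hlt]
    refine .cons 1 (by omega) (.put r 0 (p * k + q) (factorA N R b o lst md p q) ?_ ?_ ?_ ?_
      (by omega) (by omega) (by omega) ?_ le_rfl ?_)
    · exact .var (by simpa using hS.run)
    · exact .lit 0
    · push_cast
      exact ((Evals.var (by simpa using hvp)).mul (.var (by simpa using hS.kl))).add
        (.var (by simpa using hvq))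
    · rw [eA, ← hS.adj _ hln _ hmn, ← hS.mark _ hmn]
      exact (Evals.get (i := 0) (.lit 0) (.var (by simp)) (.var (by simp)) (by omega) (by omega)
        (by omega)).mul (Evals.get (i := 0) (j := 0) (.lit 0) (.lit 0) (.var (by simp))
        (by omega) (by omega) (by omega))
    · exact (abs_factorA_le ..).trans (by omega)
    refine .cons 1 (by omega) (.put r 0 (k * k + (q * k + p)) (factorB N b o lst md q p) ?_ ?_ ?_
      ?_ (by omega) (by omega) (by omega) ?_ le_rfl ?_)
    · exact .var (by simpa using hS.run)
    · exact .lit 0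
    · push_cast
      exact ((Evals.var (by simpa using hS.kl)).mul (.var (by simpa using hS.kl))).add
        (((Evals.var (by simpa using hvq)).mul (.var (by simpa using hS.kl))).add
        (.var (by simpa using hvp)))
    · rw [eB, ← hS.adj _ hmn _ hln]
      have : (σ.a .adj 0 (md (o + q)) (lst p)) = ((((σ.setV .g ((o + q : ℕ) : ℤ)).setV .h
        (md (o + q))).setV .g (lst p)).setA .mm r 0 (p * k + q)
          (factorA N R b o lst md p q)).a .adj 0 (md (o + q)) (lst p) := by simp
      rw [this]
      exact Evals.get (i := 0) (.lit 0) (.var (by simp)) (.var (by simp)) (by omega)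
        (by omega) (by omega)
    · exact (abs_factorB_le ..).trans (by omega)
    refine .nil (by omega) (.nil (by omega) ⟨hF.step rfl hp hq ?_ ?_ ?_, ?_⟩)
    · have : p * k + q ≠ k * k + (q * k + p) := by omega
      simp [this]
    · simp
    · intro a h1 h2; simp [h1, h2]
    · intro r' hr'; funext i j; simp [hr']
  · refine .skip (by omega) (.nil (by omega) ⟨hF.step rfl hp hq ?_ ?_ ?_, ?_⟩)
    · simp only [Store.setV_a]
      rw [hF.left p hp q hq, if_neg (by omega), factorA, if_neg (by omega)]
    · simp only [Store.setV_a]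
      rw [hF.right p hp q hq, if_neg (by omega), factorB, if_neg (by omega)]
    · intro a h1 h2; rfl
    · intro r' hr'; rfl

theorem sum_const_range (N B : ℕ) : ∑ _k ∈ Finset.range N, B = N * B := by simp

theorem fillFactors_run {σ : GStore} (hB : BlockBounds E n k b o r r₀)
    (hS : BlockSetup E N R n k b o r r₀ lst md σ)
    (h0 : ∀ a, σ.a .mm r 0 a = 0) :
    Run E fillFactors σ (14 * (k * k) + 2) (fun σ' =>
      Filled (factorA N R b o lst md) (factorB N b o lst md) k r (k * k) σ' ∧
      ∀ r', r' ≠ r → σ'.a .mm r' = σ.a .mm r') := by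
  have hk := hB.kpos
  have hkV : k ≤ E.V := by have := hB.cube; omega
  unfold fillFactors
  refine .forUp (N := k) (fun _ => 10 * k + 2) (fun s σ' =>
    Filled (factorA N R b o lst md) (factorB N b o lst md) k r (s * k) σ' ∧
      ∀ r', r' ≠ r → σ'.a .mm r' = σ.a .mm r') (by simp) (by simp [fillEntry])
      (by simp [fillEntry]) hS.kl hkV ?_ ?_ ?_ ?_
  · rw [sum_const_range]; nlinarith
  · exact ⟨⟨by simp [h0], by simp [h0], by simp [h0]⟩, fun _ _ => rfl⟩
  · intro p hp σ₁ hvp hkl hag₁ ⟨hF, hrest⟩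
    have hS₁ := hS.congr hag₁ (by simp [fillEntry]) (by simp [fillEntry])
    refine .forUp (N := k) (fun _ => 8) (fun q σ' =>
      Filled (factorA N R b o lst md) (factorB N b o lst md) k r (p * k + q) σ' ∧
        ∀ r', r' ≠ r → σ'.a .mm r' = σ.a .mm r') (by simp) (by simp [fillEntry])
        (by simp [fillEntry]) hS₁.kl hkV ?_ ?_ ?_ ?_
    · rw [sum_const_range]; omega
    · exact ⟨⟨by simpa using hF.left, by simpa using hF.right, by simpa using hF.rest⟩,
        by simpa using hrest⟩
    · intro q hq σ₂ hvq _ hag₂ ⟨hF₂, hrest₂⟩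
      have hS₂ := hS₁.congr hag₂ (by simp [fillEntry]) (by simp [fillEntry])
      have hvp₂ : σ₂.v .p = p := by rw [hag₂.v _ (by simp [fillEntry]), hvp]
      refine (fillEntry_run hB hS₂ hp hq hvp₂ hvq hF₂).mono le_rfl ?_
      rintro σ₃ - ⟨hF₃, hrest₃⟩
      exact ⟨⟨hF₃.left, hF₃.right, hF₃.rest⟩, fun r' hr' => (hrest₃ r' hr').trans (hrest₂ r' hr')⟩
    · rintro σ₂ - - ⟨hF₂, hrest₂⟩
      rw [← Nat.succ_mul] at hF₂
      exact ⟨⟨hF₂.left, hF₂.right, hF₂.rest⟩, hrest₂⟩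
  · rintro σ₂ - - h
    exact h

end

/-- What the first `s` entries of a `k × k` matrix `C` contribute to the pair `(y, z)`. -/
def pairSum (lst : ℕ → ℕ) (C : ℕ → ℕ → ℤ) (k s y z : ℕ) : ℤ :=
  ∑ a ∈ Finset.range s, if lst (a / k) = y ∧ lst (a % k) = z then C (a / k) (a % k) else 0

theorem abs_pairSum_le {lst : ℕ → ℕ} {C : ℕ → ℕ → ℤ} {k : ℕ} (hC : ∀ i j, |C i j| ≤ k)
    (s y z : ℕ) : |pairSum lst C k s y z| ≤ (s * k : ℕ) := by
  unfold pairSum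
  refine (Finset.abs_sum_le_sum_abs _ _).trans ?_
  have : ∀ a ∈ Finset.range s, |if lst (a / k) = y ∧ lst (a % k) = z then C (a / k) (a % k) else 0|
      ≤ (k : ℤ) := by
    intro a _
    split_ifs
    · exact hC _ _
    · simp
  simpa using Finset.sum_le_sum this

/-- The list has no repetitions, so exactly one entry of the matrix is added at the given pair of
vertices. -/
theorem pairSum_eq {lst : ℕ → ℕ} {C : ℕ → ℕ → ℤ} {k i j : ℕ} (hi : i < k) (hj : j < k)
    (hinj : ∀ i < k, ∀ j < k, lst i = lst j → i = j) :
    pairSum lst C k (k * k) (lst i) (lst j) = C i j := by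
  have hk : 0 < k := by omega
  have e1 : (i * k + j) / k = i := by
    rw [mul_comm, Nat.mul_add_div hk, Nat.div_eq_of_lt hj, add_zero]
  have e2 : (i * k + j) % k = j := by
    rw [mul_comm, Nat.mul_add_mod, Nat.mod_eq_of_lt hj]
  unfold pairSum
  rw [Finset.sum_eq_single (i * k + j)]
  · simp [e1, e2]
  · intro a ha hne
    rw [if_neg]
    rintro ⟨h1, h2⟩
    have h3 := hinj _ (Nat.div_lt_of_lt_mul (Finset.mem_range.1 ha)) _ hi h1
    have h4 := hinj _ (Nat.mod_lt a hk) _ hj h2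
    apply hne
    rw [← h3, ← h4]
    exact (Nat.div_add_mod' a k).symm
  · intro h
    exact absurd (Finset.mem_range.2 (index_lt hi hj)) h

theorem pairSum_eq_zero {lst : ℕ → ℕ} {C : ℕ → ℕ → ℤ} {k y z : ℕ}
    (h : ¬ ((∃ i < k, lst i = y) ∧ ∃ j < k, lst j = z)) :
    pairSum lst C k (k * k) y z = 0 := by
  unfold pairSum
  refine Finset.sum_eq_zero (fun a ha => if_neg ?_)
  rintro ⟨h1, h2⟩
  have ha := Finset.mem_range.1 ha
  have hk : 0 < k := by
    rcases Nat.eq_zero_or_pos k with rfl | hk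
    · simp at ha
    · exact hk
  exact h ⟨⟨_, Nat.div_lt_of_lt_mul ha, h1⟩, ⟨_, Nat.mod_lt a hk, h2⟩⟩

section

variable {E : Env} {N : ℕ → Finset ℕ} {R : Finset ℕ} {n k b o r r₀ : ℕ} {lst md : ℕ → ℕ}

/-- The first `s` entries of `C` have been added to row `r₀` of `acc`. -/
structure Added (lst : ℕ → ℕ) (C : ℕ → ℕ → ℤ) (k r₀ s : ℕ) (σ₀ σ : GStore) : Prop where
  here : ∀ y z, σ.a .acc r₀ y z = σ₀.a .acc r₀ y z + pairSum lst C k s y z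
  rest : ∀ r, r ≠ r₀ → σ.a .acc r = σ₀.a .acc r

theorem addEntry_run {σ₀ σ : GStore} {C : ℕ → ℕ → ℤ} (hC : ∀ i j, |C i j| ≤ k)
    (hB : BlockBounds E n k b o r r₀)
    (hS : BlockSetup E N R n k b o r r₀ lst md σ) {p q : ℕ} (hp : p < k) (hq : q < k)
    (hvp : σ.v .p = p) (hvq : σ.v .q = q) (hacc : ∀ y z, |σ₀.a .acc r₀ y z| ≤ n)
    (hm : ∀ i < k, ∀ j < k, σ.a .mm r 0 (2 * (k * k) + (i * k + j)) = C i j)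
    (hA : Added lst C k r₀ (p * k + q) σ₀ σ) :
    Run E addEntry σ 4 (Added lst C k r₀ (p * k + q + 1) σ₀) := by
  obtain ⟨hk, hcube, hoV, hbV, hrV, hr0V⟩ := hB
  have hpk := index_lt hp hq
  obtain ⟨hl1, hln1⟩ := hS.rows _ hp
  obtain ⟨hl2, hln2⟩ := hS.rows _ hq
  have e1 : (p * k + q) / k = p := by
    rw [mul_comm, Nat.mul_add_div hk, Nat.div_eq_of_lt hq, add_zero]
  have e2 : (p * k + q) % k = q := by
    rw [mul_comm, Nat.mul_add_mod, Nat.mod_eq_of_lt hq]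
  have hps : ∀ y z, pairSum lst C k (p * k + q + 1) y z = pairSum lst C k (p * k + q) y z +
      if lst p = y ∧ lst q = z then C p q else 0 := by
    intro y z
    unfold pairSum
    rw [Finset.sum_range_succ, e1, e2]
  unfold addEntry
  refine .cons 1 (by omega) (.setN (lst p) ?_ (by omega) le_rfl ?_)
  · rw [← hl1]
    exact Evals.get (i := 0) (j := 0) (.lit 0) (.lit 0) (.var (by simpa using hvp)) (by omega)
      (by omega) (by omega)
  refine .cons 1 (by omega) (.setN (lst q) ?_ (by omega) le_rfl ?_)
  · rw [← hl2]
    exact Evals.get (i := 0) (j := 0) (.lit 0) (.lit 0) (.var (by simpa using hvq)) (by omega)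
      (by omega) (by omega)
  refine .cons 1 (by omega) (.put r₀ (lst p) (lst q)
    (σ.a .acc r₀ (lst p) (lst q) + C p q) ?_ ?_ ?_ ?_
    (by omega) (by omega) (by omega) ?_ le_rfl (.nil (by omega) ⟨?_, ?_⟩))
  · exact .var (by simpa using hS.row)
  · exact .var (by simp)
  · exact .var (by simp)
  · rw [← hm p hp q hq]
    refine Evals.add (Evals.get (.var (by simpa using hS.row)) (.var (by simp)) (.var (by simp))
      (by omega) (by omega) (by omega)) (Evals.get (j := 0) (.var (by simpa using hS.run)) (.lit 0)
      ?_ (by omega) (by omega) (by omega))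
    push_cast
    exact ((Evals.lit 2).mul ((Evals.var (by simpa using hS.kl)).mul
      (.var (by simpa using hS.kl)))).add (((Evals.var (by simpa using hvp)).mul
      (.var (by simpa using hS.kl))).add (.var (by simpa using hvq)))
  · have h1 := hA.here (lst p) (lst q)
    have h2 := hps (lst p) (lst q)
    rw [if_pos ⟨rfl, rfl⟩] at h2
    rw [h1, add_assoc, ← h2]
    refine (abs_add_le _ _).trans ((add_le_add (hacc _ _) (abs_pairSum_le hC _ _ _)).trans ?_)
    have : (p * k + q + 1) * k ≤ k * k * k := Nat.mul_le_mul_right _ (by omega)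
    have : n + (p * k + q + 1) * k ≤ E.V := by omega
    exact_mod_cast this
  · intro y z
    rw [hps, Store.setA_a]
    by_cases h : lst p = y ∧ lst q = z
    · obtain ⟨rfl, rfl⟩ := h
      simp [hA.here]; ring
    · have h' : ¬ (y = lst p ∧ z = lst q) := fun h' => h ⟨h'.1.symm, h'.2.symm⟩
      simp [h, h', hA.here]
  · intro r' hr'
    rw [← hA.rest r' hr']
    funext i j; simp [hr']

theorem addProduct_run {σ : GStore} {C : ℕ → ℕ → ℤ} (hC : ∀ i j, |C i j| ≤ k)
    (hB : BlockBounds E n k b o r r₀)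
    (hS : BlockSetup E N R n k b o r r₀ lst md σ) (hacc : ∀ y z, |σ.a .acc r₀ y z| ≤ n)
    (hm : ∀ i < k, ∀ j < k, σ.a .mm r 0 (2 * (k * k) + (i * k + j)) = C i j) :
    Run E addProduct σ (10 * (k * k) + 2) (Added lst C k r₀ (k * k) σ) := by
  have hk := hB.kpos
  have hkV : k ≤ E.V := by have := hB.cube; omega
  unfold addProduct
  refine .forUp (N := k) (fun _ => 6 * k + 2) (fun s => Added lst C k r₀ (s * k) σ)
    (by simp) (by simp [addEntry]) (by simp [addEntry]) hS.kl hkV ?_ ?_ ?_ ?_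
  · rw [sum_const_range]; nlinarith
  · exact ⟨by simp [pairSum], fun _ _ => rfl⟩
  · intro p hp σ₁ hvp hkl hag₁ hA
    have hS₁ := hS.congr hag₁ (by simp [addEntry]) (by simp [addEntry])
    refine .forUp (N := k) (fun _ => 4) (fun q => Added lst C k r₀ (p * k + q) σ)
      (by simp) (by simp [addEntry]) (by simp [addEntry]) hS₁.kl hkV ?_ ?_ ?_ ?_
    · rw [sum_const_range]; omega
    · exact ⟨hA.here, hA.rest⟩
    · intro q hq σ₂ hvq _ hag₂ hA₂
      have hS₂ := hS₁.congr hag₂ (by simp [addEntry]) (by simp [addEntry])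
      have hvp₂ : σ₂.v .p = p := by rw [hag₂.v _ (by simp [addEntry]), hvp]
      have hm₂ : σ₂.a .mm = σ.a .mm := by
        rw [hag₂.a _ (by simp [addEntry]), hag₁.a _ (by simp [addEntry])]
      refine (addEntry_run hC hB hS₂ hp hq hvp₂ hvq hacc (by rw [hm₂]; exact hm) hA₂).mono le_rfl ?_
      rintro σ₃ - hA₃
      exact ⟨hA₃.here, hA₃.rest⟩
    · rintro σ₂ - - hA₂
      rw [← Nat.succ_mul] at hA₂
      exact ⟨hA₂.here, hA₂.rest⟩
  · rintro σ₂ - - h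
    exact h

end

/-- The variables and array rows that the next multiplication relies on are still `0`. -/
structure Fresh (p : Program) (r : ℕ) (σ : GStore) : Prop where
  ext : ∀ x, x ≠ 0 → ¬ p.limited.wv (.ext x) → σ.v (.ext x) = 0
  mm : ∀ r' i j, r ≤ r' → σ.a .mm r' i j = 0

/-- `β'` is the budget left over. The value 0 means that the multiplication was cut off, and then
`acc` is untouched. -/
structure CountBlockPost (p : Program) (F : ℕ → ℕ) (N : ℕ → Finset ℕ) (R : Finset ℕ)
    (k b o r r₀ β : ℕ) (lst md : ℕ → ℕ) (σ σ' : GStore) (β' : ℕ) : Prop where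
  run : σ'.v .run = (r + 1 : ℕ)
  fresh : Fresh p (r + 1) σ'
  bud : σ'.v .bud = β'
  le : β' ≤ β
  spent : β ≤ β' + F k
  fail : β' = 0 → σ'.a .acc = σ.a .acc
  done : 0 < β' → Added lst (blockEntry N R b o lst md k) k r₀ (k * k) σ σ'

/-- The row of `mm` is still zero and all registers that the program can have changed are cleared,
so after the factors are filled in, row and registers are exactly an admissible input of the
multiplication program. The limited run costs at most the smaller of the budget and the true running
time. -/
theorem countBlock_run {E : Env} {N : ℕ → Finset ℕ} {R : Finset ℕ} {n k b o r r₀ β : ℕ}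
    {lst md : ℕ → ℕ} {p : Program} {c : ℕ} {F : ℕ → ℕ} (hp : p.Deterministic)
    (hmul : Multiplies p c F) {σ : GStore} (hB : BlockBounds E n k b o r r₀)
    (hS : BlockSetup E N R n k b o r r₀ lst md σ) (hF : Fresh p r σ)
    (hW : (k + 2) ^ c ≤ E.V) (hW' : k ≤ (k + 2) ^ c) (hβ : σ.v .bud = β) (hβV : β ≤ E.V)
    (hacc : ∀ y z, |σ.a .acc r₀ y z| ≤ n) :
    Run E (countBlock p) σ (40 * (k * k) + p.size * (min β (F k) + 2)) (fun σ' =>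
      ∃ β', CountBlockPost p F N R k b o r r₀ β lst md σ σ' β') := by
  have hk := hB.kpos
  have hkV : k ≤ E.V := by have := hB.cube; omega
  have hrV := hB.run
  have hkk : 1 ≤ k * k := Nat.mul_pos hk hk
  set A : Matrix (Fin k) (Fin k) ℤ := Matrix.of fun i l => factorA N R b o lst md i l with hA
  set B : Matrix (Fin k) (Fin k) ℤ := Matrix.of fun l j => factorB N b o lst md l j with hBm
  unfold countBlock
  refine .cons (14 * (k * k) + 2) (by omega) ((fillFactors_run hB hS
    (fun a => hF.mm r 0 a le_rfl)).mono le_rfl ?_)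
  rintro σ₁ hag₁ ⟨hfill, hrest⟩
  have hS₁ := hS.congr hag₁ (by simp [fillFactors, fillEntry]) (by simp [fillFactors, fillEntry])
  have hβ₁ : σ₁.v .bud = β := by rw [hag₁.v _ (by simp [fillFactors, fillEntry]), hβ]
  have hacc₁ : σ₁.a .acc = σ.a .acc := hag₁.a _ (by simp [fillFactors, fillEntry])
  have hext₁ : ∀ x, σ₁.v (.ext x) = σ.v (.ext x) := fun x =>
    hag₁.v _ (by simp [fillFactors, fillEntry])
  have hz : p.size * (min β (F k) + 2) = p.size * (min β (F k) + 1) + p.size := by ring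
  refine .cons p.size (by rw [hz]; omega) ((p.clear_run E σ₁).mono le_rfl ?_)
  rintro σ₂ hag₂ ⟨hc1, hc2, hc3⟩
  have hS₂ := hS₁.congr hag₂ (by simp) (by simp)
  have hβ₂ : σ₂.v .bud = β := by rw [hag₂.v _ (by simp), hβ₁]
  refine .cons 1 (by omega) (.setN k (.var hS₂.kl) hkV le_rfl ?_)
  set σ₃ := σ₂.setV (.ext 0) k with hσ₃
  have hag₃ : Agree (.set (.ext 0) (vr .kl)) σ₂ σ₃ :=
    ⟨fun x hx => by simp [hσ₃, show x ≠ .ext 0 from hx], fun _ _ => rfl⟩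
  have hS₃ := hS₂.congr hag₃ (by simp) (by simp)
  have hβ₃ : σ₃.v .bud = β := by simp [hσ₃, hβ₂]
  have hext₃ : ∀ x, x ≠ 0 → σ₃.v (.ext x) = 0 := by
    intro x hx
    by_cases hw : p.limited.wv (.ext x)
    · simp [hσ₃, hx, hc1 x hw]
    · have : σ₂.v (.ext x) = 0 := hc2 x (by rw [hext₁, hF.ext x hx hw])
      simp [hσ₃, hx, this]
  have hmm₃ : σ₃.a .mm = σ₁.a .mm := by rw [hσ₃, Store.setV_a, hc3]
  -- The machine state that the multiplication program sees: the variables `ext` as registers and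
  -- one row of `mm` as memory.
  let s : RamState := ⟨fun x => σ₃.v (.ext x), σ₃.a .mm r 0⟩
  have hin : MatMulInput A B s := by
    refine ⟨by simp [s, hσ₃], fun x hx => hext₃ x hx, fun i j => ?_, fun i j => ?_, fun a ha => ?_⟩
    · have := hfill.left i i.2 j j.2
      rw [if_pos (index_lt i.2 j.2)] at this
      simpa [s, hmm₃, hA] using this
    · have := hfill.right j j.2 i i.2
      rw [if_pos (index_lt j.2 i.2)] at this
      simpa [s, hmm₃, hBm, sq] using this
    · have := hfill.rest a (by rwa [sq] at ha)
      simpa [s, hmm₃] using this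
  obtain ⟨t, ht, s', hex, hout⟩ := hmul k hk A B (fun i j => abs_factorA_le ..)
    (fun i j => abs_factorB_le ..) s hin
  have hsim : Simulates r s σ₃ := ⟨fun _ => rfl, fun _ => rfl⟩
  have h1W : 1 ≤ (k + 2) ^ c := Nat.one_le_pow _ _ (by omega)
  have hsr : ∀ x, |s.reg x| ≤ ((k + 2) ^ c : ℕ) := by
    intro x
    by_cases hx : x = 0
    · subst hx
      rw [hin.1, abs_of_nonneg (by positivity)]; exact_mod_cast hW'
    · rw [hin.2.1 x hx, abs_zero]; positivity
  have hsm : ∀ a, |s.mem a| ≤ ((k + 2) ^ c : ℕ) := by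
    have h1 : ∀ x : ℤ, |x| ≤ 1 → |x| ≤ ((k + 2) ^ c : ℕ) := fun x hx => by omega
    intro a
    rcases lt_or_ge a (2 * (k * k)) with ha | ha
    · rcases lt_or_ge a (k * k) with ha' | ha'
      · have e := hfill.left (a / k) (Nat.div_lt_of_lt_mul ha') (a % k) (Nat.mod_lt _ hk)
        rw [Nat.div_add_mod'] at e
        have : s.mem a = σ₁.a .mm r 0 a := by simp [s, hmm₃]
        rw [this, e, if_pos ha']
        exact h1 _ (abs_factorA_le ..)
      · have ha2 : a - k * k < k * k := by omega
        have e := hfill.right ((a - k * k) % k) (Nat.mod_lt _ hk) ((a - k * k) / k)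
          (Nat.div_lt_of_lt_mul ha2)
        rw [Nat.div_add_mod', Nat.add_sub_cancel' ha'] at e
        have : s.mem a = σ₁.a .mm r 0 a := by simp [s, hmm₃]
        rw [this, e, if_pos (index_lt (Nat.mod_lt _ hk) (Nat.div_lt_of_lt_mul ha2))]
        exact h1 _ (abs_factorB_le ..)
    · have : s.mem a = σ₁.a .mm r 0 a := by simp [s, hmm₃]
      rw [this, hfill.rest a ha, abs_zero]; positivity
  obtain ⟨β', hlim⟩ := Program.limited_exec hW (by omega) hex hp hsr hsm hβ₃ hβV hS₃.run hsim
  have hβ't : β' ≤ β ∧ β - β' ≤ min β (F k) := by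
    obtain ⟨_, _, _, _, h⟩ := hlim
    have := h.le; have := h.spent
    omega
  have hz1 : p.size * (β - β' + 1) ≤ p.size * (min β (F k) + 1) := Nat.mul_le_mul_left _ (by omega)
  refine .cons (p.size * (min β (F k) + 1)) (by omega) (hlim.mono hz1 ?_)
  intro σ₄ hag₄ hl
  have hS₄ := hS₃.congr hag₄ (by simp) (by simp)
  have hacc₄ : σ₄.a .acc = σ.a .acc := by
    rw [hag₄.a _ (by simp), hσ₃, Store.setV_a, hc3, hacc₁]
  have hfr : ∀ σ' : GStore, (∀ x, σ'.v (.ext x) = σ₄.v (.ext x)) → σ'.a .mm = σ₄.a .mm →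
      Fresh p (r + 1) σ' := by
    intro σ' h1 h2
    refine ⟨fun x hx hw => ?_, fun r' i j hr' => ?_⟩
    · rw [h1, hag₄.v _ hw, hext₃ x hx]
    · rw [h2, hl.rest r' (by omega), hmm₃, hrest r' (by omega), hF.mm r' i j (by omega)]
  have hev : ∀ σ' : GStore, σ'.v .run = r → Evals E σ' (vr .run + lt 1) (r + 1 : ℕ) := by
    intro σ' h; push_cast; exact (Evals.var h).add (.lit 1)
  refine .cons (10 * (k * k) + 3) (by omega) (.ite β' (.var hl.bud) (by omega) (fun hpos => ?_)
    (fun hneg => ?_))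
  · have hpos' : 0 < β' := by exact_mod_cast hpos
    have hs' := hl.sim hpos'
    refine (addProduct_run (C := blockEntry N R b o lst md k) (abs_blockEntry_le N R b o lst md k)
      hB hS₄ (by rw [hacc₄]; exact hacc) ?_).mono (by omega) ?_
    · intro i hi j hj
      have := hout ⟨i, hi⟩ ⟨j, hj⟩
      rw [hs'.mem, ← sq, this, Matrix.mul_apply, blockEntry, ← Fin.sum_univ_eq_sum_range
        (fun l => factorA N R b o lst md i l * factorB N b o lst md l j)]
      rfl
    · intro σ₅ hag₅ hadd
      have hr₅ : σ₅.v .run = r := by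
        rw [hag₅.v _ (by simp [addProduct, addEntry]), hS₄.run]
      refine .cons 1 (by omega) (.setN (r + 1) (hev _ hr₅) hrV le_rfl (.nil (by omega)
        ⟨β', by simp, hfr _ ?_ ?_, ?_, hl.le, ?_, by omega, fun _ => ⟨?_, ?_⟩⟩))
      · intro x; simp [hag₅.v (.ext x) (by simp [addProduct, addEntry])]
      · rw [Store.setV_a, hag₅.a _ (by simp [addProduct, addEntry])]
      · simp [hag₅.v .bud (by simp [addProduct, addEntry]), hl.bud]
      · have := hl.spent; omega
      · intro y z; rw [Store.setV_a, hadd.here, hacc₄]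
      · intro r' hr'; rw [Store.setV_a, hadd.rest r' hr', hacc₄]
  · refine .skip (by omega) (.cons 1 (by omega) (.setN (r + 1) (hev _ hS₄.run) hrV le_rfl
      (.nil (by omega) ⟨β', by simp, hfr _ (by simp) rfl, ?_, hl.le, ?_, fun _ => ?_, by omega⟩)))
    · simp [hl.bud]
    · have := hl.spent; omega
    · rw [Store.setV_a, hacc₄]

/-! ### Reading the graph -/

/-- `f 0, …, f (k - 1)` lists the elements of `S` without repetition. -/
structure Enumerates (f : ℕ → ℕ) (k : ℕ) (S : Finset ℕ) : Prop where
  inj : ∀ i < k, ∀ j < k, f i = f j → i = j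
  mem : ∀ v, v ∈ S ↔ ∃ i < k, f i = v

namespace Enumerates

variable {f : ℕ → ℕ} {k : ℕ} {S : Finset ℕ}

theorem sum_eq {M : Type*} [AddCommMonoid M] (h : Enumerates f k S) (g : ℕ → M) :
    ∑ i ∈ Finset.range k, g (f i) = ∑ v ∈ S, g v := by
  have : S = (Finset.range k).image f := by
    ext v; simp [h.mem]
  rw [this, Finset.sum_image]
  intro i hi j hj hij
  exact h.inj i (by simpa using hi) j (by simpa using hj) hij

theorem apply_mem (h : Enumerates f k S) {i : ℕ} (hi : i < k) : f i ∈ S := (h.mem _).2 ⟨i, hi, rfl⟩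

theorem push (h : Enumerates f k S) {b : ℕ} (hb : b ∉ S) :
    Enumerates (Function.update f k b) (k + 1) (insert b S) where
  inj i hi j hj hij := by
    simp only [Function.update_apply] at hij
    split_ifs at hij with h1 h2 h2
    · omega
    · exact absurd (hij ▸ h.apply_mem (by omega)) hb
    · exact absurd (hij ▸ h.apply_mem (by omega)) hb
    · exact h.inj i (by omega) j (by omega) hij
  mem v := by
    rw [Finset.mem_insert, h.mem]
    constructor
    · rintro (rfl | ⟨i, hi, rfl⟩)
      · exact ⟨k, by omega, by simp⟩
      · exact ⟨i, by omega, by simp [show i ≠ k by omega]⟩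
    · rintro ⟨i, hi, rfl⟩
      by_cases hik : i = k
      · left; simp [hik]
      · right; exact ⟨i, by omega, by simp [hik]⟩

end Enumerates

/-- A simple graph on `0, …, n - 1` with `m` edges, given by its neighbourhoods. -/
structure IsGraph (n m : ℕ) (N : ℕ → Finset ℕ) : Prop where
  lt : ∀ u v, u ∈ N v → u < n
  symm : ∀ u v, u ∈ N v → v ∈ N u
  irrefl : ∀ v, v ∉ N v
  handshake : ∑ v ∈ Finset.range n, (N v).card = 2 * m

/-- The tables of the graph are stored in the memory. -/
structure Tables (N : ℕ → Finset ℕ) (nb : ℕ → ℕ → ℕ) (σ : GStore) : Prop where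
  lists : ∀ v, Enumerates (nb v) (N v).card (N v)
  adj : ∀ u v, σ.a .adj 0 u v = ind (v ∈ N u)
  deg : ∀ v, σ.a .deg 0 0 v = (N v).card
  nbr : ∀ v, ∀ i < (N v).card, σ.a .nbr 0 v i = nb v i

theorem Tables.congr {N : ℕ → Finset ℕ} {nb : ℕ → ℕ → ℕ} {σ σ' : GStore} (h : Tables N nb σ)
    {c : GCmd} (hag : Agree c σ σ') (ha : ∀ t, t = .adj ∨ t = .deg ∨ t = .nbr → ¬ c.wa t) :
    Tables N nb σ' where
  lists := h.lists
  adj := by rw [hag.a _ (ha _ (by simp))]; exact h.adj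
  deg := by rw [hag.a _ (ha _ (by simp))]; exact h.deg
  nbr := by rw [hag.a _ (ha _ (by simp))]; exact h.nbr

/-- Append the vertex in `t` to the neighbours of the vertex in `s`. -/
def pushNbr (s t : Var) : GCmd := .block [
  .put .nbr (lt 0) (vr s) (get1 .deg (vr s)) (vr t),
  .put .deg (lt 0) (lt 0) (vr s) (get1 .deg (vr s) + lt 1),
  .put .adj (lt 0) (vr s) (vr t) (lt 1)]

def readGraph : GCmd := .forUp .i .m (.block [
  .set .a (.inp (lt 2 * vr .i)),
  .set .b (.inp (lt 2 * vr .i + lt 1)),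
  pushNbr .a .b,
  pushNbr .b .a])

theorem pushNbr_run {E : Env} {N : ℕ → Finset ℕ} {nb : ℕ → ℕ → ℕ} {σ : GStore}
    (h : Tables N nb σ) {s t : Var} {a b : ℕ} (ha : σ.v s = a) (hb : σ.v t = b) (haV : a ≤ E.V)
    (hbV : b ≤ E.V) (hdV : (N a).card + 1 ≤ E.V) (hab : b ∉ N a) :
    Run E (pushNbr s t) σ 4 (Tables (Function.update N a (insert b (N a)))
      (Function.update nb a (Function.update (nb a) (N a).card b))) := by
  have hd := h.deg a
  unfold pushNbr
  refine .cons 1 (by omega) (.put 0 a (N a).card b (.lit 0) (.var ha) ?_ (.var hb)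
    (by omega) haV (by omega) (by simpa using hbV) le_rfl ?_)
  · rw [← hd]
    exact Evals.get (i := 0) (j := 0) (.lit 0) (.lit 0) (.var ha) (by omega) (by omega) (by omega)
  refine .cons 1 (by omega) (.put 0 0 a ((N a).card + 1 : ℕ) (.lit 0) (.lit 0) (.var ha) ?_
    (by omega) (by omega) haV (by simpa using (by exact_mod_cast hdV)) le_rfl ?_)
  · push_cast
    rw [← hd]
    exact (Evals.get (i := 0) (j := 0) (σ := Store.setA _ _ _ _ _ _) (.lit 0) (.lit 0) (.var ha)
      (by omega) (by omega) (by omega)).add (.lit 1)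
  refine .cons 1 (by omega) (.put 0 a b 1 (.lit 0) (.var ha) (.var hb) (.lit 1)
    (by omega) haV hbV (by simp; omega) le_rfl (.nil (by omega) ?_))
  constructor
  · intro v
    by_cases hv : v = a
    · subst hv
      simpa [Finset.card_insert_of_notMem hab] using (h.lists v).push hab
    · simpa [hv] using h.lists v
  · intro u v
    by_cases hu : u = a
    · subst hu
      by_cases hv : v = b
      · simp [hv]
      · simp [hv, h.adj, Finset.mem_insert]
    · simp [hu, h.adj]
  · intro v
    by_cases hv : v = a
    · subst hv
      simp [Finset.card_insert_of_notMem hab]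
    · simp [hv, h.deg]
  · intro v i hi
    by_cases hv : v = a
    · subst hv
      simp only [Function.update_self, Finset.card_insert_of_notMem hab] at hi ⊢
      by_cases hiv : i = (N v).card
      · simp [hiv]
      · simp [hiv, h.nbr v i (by omega)]
    · simp only [Function.update_of_ne hv] at hi ⊢
      simp [hv, h.nbr v i hi]

/-- The neighbourhoods after the first `k` edges. -/
def nbrsUpTo (e : ℕ → ℕ × ℕ) : ℕ → ℕ → Finset ℕ
  | 0 => fun _ => ∅
  | k + 1 =>
    let Q := Function.update (nbrsUpTo e k) (e k).1 (insert (e k).2 (nbrsUpTo e k (e k).1))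
    Function.update Q (e k).2 (insert (e k).1 (Q (e k).2))

/-- The list of edges `e 0, …, e (m - 1)` is valid. -/
structure IsEdges (n m : ℕ) (e : ℕ → ℕ × ℕ) : Prop where
  lt : ∀ i < m, (e i).1 < n ∧ (e i).2 < n
  ne : ∀ i < m, (e i).1 ≠ (e i).2
  nodup : ∀ i < m, ∀ j < i, e j ≠ e i ∧ e j ≠ (e i).swap

theorem mem_nbrsUpTo {n m : ℕ} {e : ℕ → ℕ × ℕ} (he : IsEdges n m e) {k : ℕ} (hk : k ≤ m) (u v : ℕ) :
    u ∈ nbrsUpTo e k v ↔ ∃ i < k, e i = (u, v) ∨ e i = (v, u) := by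
  induction k generalizing u v with
  | zero => simp [nbrsUpTo]
  | succ k ih =>
    have ih := ih (by omega)
    have hne := he.ne k (by omega)
    have e1 : (∃ i < k + 1, e i = (u, v) ∨ e i = (v, u)) ↔
        (∃ i < k, e i = (u, v) ∨ e i = (v, u)) ∨ (e k = (u, v) ∨ e k = (v, u)) := by
      constructor
      · rintro ⟨i, hi, h⟩
        rcases Nat.lt_succ_iff_lt_or_eq.1 hi with hi | rfl
        · exact Or.inl ⟨i, hi, h⟩
        · exact Or.inr h
      · rintro (⟨i, hi, h⟩ | h)
        · exact ⟨i, by omega, h⟩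
        · exact ⟨k, by omega, h⟩
    rw [e1, ← ih]
    simp only [nbrsUpTo, Function.update_apply, Prod.ext_iff, if_neg hne.symm]
    by_cases h2 : v = (e k).2
    · subst h2
      simp only [if_true, Finset.mem_insert]
      constructor
      · rintro (rfl | h)
        · simp
        · exact Or.inl h
      · rintro (h | h | h)
        · exact Or.inr h
        · exact Or.inl h.1.symm
        · exact absurd h.1 hne
    · by_cases h1 : v = (e k).1
      · subst h1
        simp only [if_neg hne, if_true, Finset.mem_insert]
        constructor
        · rintro (rfl | h)
          · simp
          · exact Or.inl h
        · rintro (h | h | h)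
          · exact Or.inr h
          · exact absurd h.2.symm hne
          · exact Or.inl h.2.symm
      · simp only [if_neg h1, if_neg h2]
        constructor
        · exact Or.inl
        · rintro (h | h | h)
          · exact h
          · exact absurd h.2.symm h2
          · exact absurd h.1.symm h1

/-- A valid list repeats no edge in either orientation, so each edge raises the degrees of exactly
its two ends by one. -/
theorem isGraph_nbrsUpTo {n m : ℕ} {e : ℕ → ℕ × ℕ} (he : IsEdges n m e) {k : ℕ} (hk : k ≤ m) :
    IsGraph n k (nbrsUpTo e k) where
  lt u v h := by
    obtain ⟨i, hi, h | h⟩ := (mem_nbrsUpTo he hk u v).1 h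
    · have := (he.lt i (by omega)).1; rwa [h] at this
    · have := (he.lt i (by omega)).2; rwa [h] at this
  symm u v h := by
    rw [mem_nbrsUpTo he hk] at h ⊢
    obtain ⟨i, hi, h⟩ := h
    exact ⟨i, hi, h.symm⟩
  irrefl v h := by
    obtain ⟨i, hi, h | h⟩ := (mem_nbrsUpTo he hk v v).1 h
    · exact he.ne i (by omega) (by rw [h])
    · exact he.ne i (by omega) (by rw [h])
  handshake := by
    induction k with
    | zero => simp [nbrsUpTo]
    | succ k ih =>
      have hne := he.ne k (by omega)
      obtain ⟨hl1, hl2⟩ := he.lt k (by omega)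
      have n1 : (e k).2 ∉ nbrsUpTo e k (e k).1 := by
        rw [mem_nbrsUpTo he (by omega)]
        rintro ⟨i, hi, h | h⟩
        · exact (he.nodup k (by omega) i hi).2 h
        · exact (he.nodup k (by omega) i hi).1 h
      have n2 : (e k).1 ∉ nbrsUpTo e k (e k).2 := by
        rw [mem_nbrsUpTo he (by omega)]
        rintro ⟨i, hi, h | h⟩
        · exact (he.nodup k (by omega) i hi).1 h
        · exact (he.nodup k (by omega) i hi).2 h
      have : ∀ v, (nbrsUpTo e (k + 1) v).card = (nbrsUpTo e k v).card +
          ((if v = (e k).1 then 1 else 0) + (if v = (e k).2 then 1 else 0)) := by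
        intro v
        simp only [nbrsUpTo, Function.update_apply, if_neg hne.symm]
        by_cases h2 : v = (e k).2
        · subst h2; simp [hne.symm, Finset.card_insert_of_notMem n2]
        · by_cases h1 : v = (e k).1
          · subst h1; simp [hne, Finset.card_insert_of_notMem n1]
          · simp [h1, h2]
      rw [Finset.sum_congr rfl (fun v _ => this v), Finset.sum_add_distrib, ih (by omega),
        Finset.sum_add_distrib]
      simp [hl1, hl2]; ring

theorem IsGraph.card_lt {n m : ℕ} {N : ℕ → Finset ℕ} (h : IsGraph n m N) (hn : 0 < n) (v : ℕ) :
    (N v).card < n := by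
  by_cases hv : v < n
  · have : N v ⊆ (Finset.range n).erase v := by
      intro u hu
      rw [Finset.mem_erase, Finset.mem_range]
      exact ⟨fun h' => h.irrefl v (h' ▸ hu), h.lt u v hu⟩
    have := Finset.card_le_card this
    rw [Finset.card_erase_of_mem (by simpa using hv), Finset.card_range] at this
    omega
  · have : N v = ∅ := by
      refine Finset.eq_empty_of_forall_notMem fun u hu => hv (h.lt v u (h.symm u v hu))
    simp [this, hn]

theorem readGraph_run {E : Env} {n m : ℕ} {e : ℕ → ℕ × ℕ} (he : IsEdges n m e) {σ : GStore}
    (hm : σ.v .m = m) (hnV : n ≤ E.V) (hmV : 2 * m ≤ E.V) (hlen : E.len = 2 * m)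
    (hin : ∀ i < m, E.inp (2 * i) = (e i).1 ∧ E.inp (2 * i + 1) = (e i).2)
    (h1 : ∀ i j, σ.a .adj 0 i j = 0) (h2 : ∀ v, σ.a .deg 0 0 v = 0) :
    Run E readGraph σ (13 * m + 2) (fun σ' => ∃ nb, Tables (nbrsUpTo e m) nb σ') := by
  unfold readGraph
  refine .forUp (N := m) (fun _ => 11) (fun k σ' => ∃ nb, Tables (nbrsUpTo e k) nb σ') (by simp)
    (by simp [pushNbr]) (by simp [pushNbr]) hm (by omega) ?_ ?_ ?_ ?_
  · rw [sum_const_range]; omega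
  · exact ⟨fun _ _ => 0, fun v => ⟨by simp [nbrsUpTo], by simp [nbrsUpTo]⟩, by simp [nbrsUpTo, h1],
      by simp [nbrsUpTo, h2], by simp [nbrsUpTo]⟩
  · rintro k hk σ₁ hvi - - ⟨nb, hT⟩
    obtain ⟨hi1, hi2⟩ := hin k hk
    obtain ⟨hl1, hl2⟩ := he.lt k hk
    have hne := he.ne k hk
    have hG := isGraph_nbrsUpTo he (k := k) hk.le
    have n1 : (e k).2 ∉ nbrsUpTo e k (e k).1 := by
      rw [mem_nbrsUpTo he hk.le]
      rintro ⟨i, hi, h | h⟩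
      · exact (he.nodup k hk i hi).2 h
      · exact (he.nodup k hk i hi).1 h
    have n2 : (e k).1 ∉ nbrsUpTo e k (e k).2 := fun h => n1 (hG.symm _ _ h)
    refine .cons 1 (by omega) (.setN (e k).1 ?_ (by omega) le_rfl ?_)
    · rw [← hi1]
      exact Evals.inp (by push_cast; exact (Evals.lit 2).mul (.var hvi)) (by omega)
    refine .cons 1 (by omega) (.setN (e k).2 ?_ (by omega) le_rfl ?_)
    · rw [← hi2]
      refine Evals.inp ?_ (by omega)
      push_cast
      exact ((Evals.lit 2).mul (.var (by simpa using hvi))).add (.lit 1)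
    have hT' : Tables (nbrsUpTo e k) nb ((σ₁.setV .a (e k).1).setV .b (e k).2) :=
      ⟨hT.lists, hT.adj, hT.deg, hT.nbr⟩
    have hc1 := hG.card_lt (by omega) (e k).1
    have hc2 := hG.card_lt (by omega) (e k).2
    refine .cons 4 (by omega) ((pushNbr_run hT' (a := (e k).1) (b := (e k).2) (by simp) (by simp)
      (by omega) (by omega) (by omega) n1).mono le_rfl ?_)
    intro σ₂ hag₂ hT₂
    refine .cons 4 (by omega) ((pushNbr_run hT₂ (a := (e k).2) (b := (e k).1)
      (by rw [hag₂.v _ (by simp [pushNbr])]; simp) (by rw [hag₂.v _ (by simp [pushNbr])]; simp)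
      (by omega) (by omega) (by simp [hne.symm]; omega)
      (by simp [hne.symm, n2])).mono le_rfl ?_)
    intro σ₃ _ hT₃
    exact .nil (by omega) ⟨_, hT₃.lists, hT₃.adj, hT₃.deg, hT₃.nbr⟩
  · rintro σ₂ - - h
    exact h

/-! ### Common neighbours of adjacent vertices -/

/-- List the vertices of degree more than `lim` in `rows` and in `mids`. -/
def collectHigh : GCmd := .block [
  .set .kl (lt 0),
  .forUp .v .n (.ite (get1 .deg (vr .v) - vr .lim) (.block [
      .put .rows (lt 0) (lt 0) (vr .kl) (vr .v),
      .put .mids (lt 0) (lt 0) (vr .kl) (vr .v),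
      .set .kl (vr .kl + lt 1)])
    .skip)]

/-- Count via the vertices of degree more than `lim`, in time at most `m * lim`; double `lim` if
this fails. -/
def tryLimit (p : Program) : GCmd := .block [
  collectHigh,
  .set .row (vr .run),
  .set .bud (vr .m * vr .lim + lt 1),
  .set .off (lt 0),
  .set .km (vr .kl),
  .ite (vr .kl) (countBlock p) (.set .run (vr .run + lt 1)),
  .ite (vr .bud) (.set .fin (lt 1)) (.set .lim (lt 2 * vr .lim))]

def findLimit (p : Program) : GCmd := .block [
  .set .lim (lt 1),
  .loop (lt 4 * vr .m - vr .lim * (vr .lim * vr .lim)) (.set .lim (lt 2 * vr .lim)),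
  .set .fin (lt 0),
  .loop (lt 1 - vr .fin) (tryLimit p)]

def lowEntry : GCmd := .block [
  .set .u (get2 .nbr (vr .v) (vr .b)),
  .set .c (vr .c + get2 .adj (vr .w) (vr .u) * get1 .mark (vr .u)),
  .put .acc (vr .row) (vr .w) (vr .u) (.get .acc (vr .row) (vr .w) (vr .u) + get1 .mark (vr .v))]

def lowRow : GCmd := .block [
  .set .w (get2 .nbr (vr .v) (vr .a)),
  .set .c (lt 0),
  .forUp .b .d lowEntry,
  .put .low (lt 0) (vr .v) (vr .w) (vr .c)]

/-- Treat all triangles with a vertex of degree at most `lim`. -/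
def lowPass : GCmd := .forUp .v .n (.block [
  .set .d (get1 .deg (vr .v)),
  .ite (vr .lim + lt 1 - vr .d) (.forUp .a .d lowRow) .skip])

def copyEntry : GCmd := .block [
  .set .w (get2 .nbr (vr .v) (vr .a)),
  .ite (vr .lim + lt 1 - vr .d)
    (.put .cnt (vr .out) (vr .v) (vr .w) (get2 .low (vr .v) (vr .w)))
    (.ite (vr .lim + lt 1 - get1 .deg (vr .w))
      (.put .cnt (vr .out) (vr .v) (vr .w) (get2 .low (vr .w) (vr .v)))
      (.put .cnt (vr .out) (vr .v) (vr .w) (.get .acc (vr .row) (vr .v) (vr .w))))]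

def copyPass : GCmd := .forUp .v .n (.block [
  .set .d (get1 .deg (vr .v)),
  .forUp .a .d copyEntry])

/-- For all pairs of adjacent vertices, store the number of marked common neighbours in row `out`
of `cnt`. -/
def edgeCounts (p : Program) : GCmd := .block [findLimit p, lowPass, copyPass]

/-- The graph is in the memory and the set `R` is marked. -/
structure Loaded (n m : ℕ) (N : ℕ → Finset ℕ) (nb : ℕ → ℕ → ℕ) (R : Finset ℕ) (σ : GStore) :
    Prop where
  varN : σ.v .n = n
  varM : σ.v .m = m
  tables : Tables N nb σ
  mark : ∀ v < n, σ.a .mark 0 0 v = ind (v ∈ R)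

theorem Loaded.congr {n m : ℕ} {N : ℕ → Finset ℕ} {nb : ℕ → ℕ → ℕ} {R : Finset ℕ} {σ σ' : GStore}
    (h : Loaded n m N nb R σ) {c : GCmd} (hag : Agree c σ σ')
    (hv : ∀ x, x = .n ∨ x = .m → ¬ c.wv x)
    (ha : ∀ t, t = .mark ∨ t = .adj ∨ t = .deg ∨ t = .nbr → ¬ c.wa t) :
    Loaded n m N nb R σ' where
  varN := by rw [hag.v _ (hv _ (by simp)), h.varN]
  varM := by rw [hag.v _ (hv _ (by simp)), h.varM]
  tables := h.tables.congr hag (fun t ht => ha t (Or.inr ht))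
  mark := by rw [hag.a _ (ha _ (by simp))]; exact h.mark

/-- Nothing has been written to the rows of `mm` and `acc` from `run` on. -/
structure Clean (p : Program) (r : ℕ) (σ : GStore) : Prop where
  run : σ.v .run = r
  fresh : Fresh p r σ
  acc : ∀ r' y z, r ≤ r' → σ.a .acc r' y z = 0

theorem Clean.congr {p : Program} {r : ℕ} {σ σ' : GStore} (h : Clean p r σ) {c : GCmd}
    (hag : Agree c σ σ') (hv : ∀ x, (x = .run ∨ ∃ k, x = .ext k) → ¬ c.wv x)
    (ha : ∀ t, t = .mm ∨ t = .acc → ¬ c.wa t) : Clean p r σ' where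
  run := by rw [hag.v _ (hv _ (by simp)), h.run]
  fresh := ⟨fun x hx hw => by rw [hag.v _ (hv _ (by simp)), h.fresh.ext x hx hw],
    by rw [hag.a _ (ha _ (by simp))]; exact h.fresh.mm⟩
  acc := by rw [hag.a _ (ha _ (by simp))]; exact h.acc

/-! ### Vertices of high degree and the search for a degree limit -/

/-- The vertices of degree more than `Δ`. -/
def high (N : ℕ → Finset ℕ) (n Δ : ℕ) : Finset ℕ := (Finset.range n).filter fun v => Δ < (N v).card

theorem mem_high {N : ℕ → Finset ℕ} {n Δ v : ℕ} : v ∈ high N n Δ ↔ v < n ∧ Δ < (N v).card := by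
  simp [high]

theorem high_card_le (N : ℕ → Finset ℕ) (n Δ : ℕ) : (high N n Δ).card ≤ n := by
  simpa [high] using Finset.card_filter_le (Finset.range n) (fun v => Δ < (N v).card)

/-- Each of these vertices contributes at least `Δ + 1` to the degree sum `2 * m`. -/
theorem IsGraph.high_card_mul_le {n m : ℕ} {N : ℕ → Finset ℕ} (h : IsGraph n m N) (Δ : ℕ) :
    (high N n Δ).card * (Δ + 1) ≤ 2 * m := by
  rw [← h.handshake, ← smul_eq_mul]
  refine (Finset.card_nsmul_le_sum (high N n Δ) (fun v => (N v).card) (Δ + 1) ?_).trans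
    (Finset.sum_le_sum_of_subset (Finset.filter_subset _ _))
  intro v hv
  exact (mem_high.1 hv).2

/-- `S` is listed in `rows` and in `mids`. -/
structure Listed (S : Finset ℕ) (lst : ℕ → ℕ) (σ : GStore) : Prop where
  enum : Enumerates lst S.card S
  kl : σ.v .kl = S.card
  rows : ∀ i < S.card, σ.a .rows 0 0 i = lst i
  mids : ∀ i < S.card, σ.a .mids 0 0 i = lst i

theorem collectHigh_run {E : Env} {n m Δ : ℕ} {N : ℕ → Finset ℕ} {nb : ℕ → ℕ → ℕ} {R : Finset ℕ}
    {σ : GStore} (hL : Loaded n m N nb R σ) (hlim : σ.v .lim = Δ) (hnV : n ≤ E.V) :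
    Run E collectHigh σ (7 * n + 4) (fun σ' => ∃ lst, Listed (high N n Δ) lst σ') := by
  unfold collectHigh
  refine .cons 1 (by omega) (.setN 0 (.lit 0) (by omega) le_rfl ?_)
  refine .cons (7 * n + 2) (by omega) (.forUp (N := n) (fun _ => 5)
    (fun s σ' => ∃ lst, Listed (high N s Δ) lst σ') (by simp) (by simp) (by simp)
    (by simpa using hL.varN) hnV ?_ ?_ ?_ ?_)
  · rw [sum_const_range]; omega
  · exact ⟨fun _ => 0, ⟨⟨by simp [high], by simp [high]⟩, by simp [high], by simp [high],
      by simp [high]⟩⟩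
  · intro s hs σ₁ hvs _ hag₁ ⟨lst, hl⟩
    have hdeg : σ₁.a .deg 0 0 s = (N s).card := by
      rw [hag₁.a _ (by simp), Store.setV_a]; exact hL.tables.deg s
    have hlim₁ : σ₁.v .lim = Δ := by rw [hag₁.v _ (by simp)]; simpa using hlim
    have hkn : (high N s Δ).card ≤ s := high_card_le N s Δ
    refine .ite ((N s).card - Δ) ?_ (by omega) (fun h => ?_) (fun h => ?_)
    · rw [← hdeg]
      exact (Evals.get (i := 0) (j := 0) (.lit 0) (.lit 0) (.var hvs) (by omega) (by omega)
        (by omega)).sub (.var hlim₁)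
    · have hS : high N (s + 1) Δ = insert s (high N s Δ) := by
        unfold high
        rw [Finset.range_add_one, Finset.filter_insert, if_pos (by omega)]
      have hnot : s ∉ high N s Δ := by simp [high]
      have hcard : (high N (s + 1) Δ).card = (high N s Δ).card + 1 := by
        rw [hS, Finset.card_insert_of_notMem hnot]
      refine .cons 1 (by omega) (.put 0 0 (high N s Δ).card s (.lit 0) (.lit 0) (.var hl.kl)
        (.var hvs) (by omega) (by omega) (by omega) (by simp; omega) le_rfl ?_)
      refine .cons 1 (by omega) (.put 0 0 (high N s Δ).card s (.lit 0) (.lit 0) (.var hl.kl)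
        (.var hvs) (by omega) (by omega) (by omega) (by simp; omega) le_rfl ?_)
      refine .cons 1 (by omega) (.setN ((high N s Δ).card + 1) ?_ (by omega) le_rfl
        (.nil (by omega) ⟨Function.update lst (high N s Δ).card s, ?_, ?_, ?_, ?_⟩))
      · push_cast; exact (Evals.var (by simpa using hl.kl)).add (.lit 1)
      · rw [hcard, hS]; exact hl.enum.push hnot
      · simp [hcard]
      · intro i hi
        rw [hcard] at hi
        by_cases hik : i = (high N s Δ).card
        · simp [hik]
        · simp [hik, hl.rows i (by omega)]
      · intro i hi
        rw [hcard] at hi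
        by_cases hik : i = (high N s Δ).card
        · simp [hik]
        · simp [hik, hl.mids i (by omega)]
    · have hS : high N (s + 1) Δ = high N s Δ := by
        unfold high
        rw [Finset.range_add_one, Finset.filter_insert, if_neg (by omega)]
      exact .skip (by omega) ⟨lst, by rw [hS]; exact hl.enum, by simpa [hS] using hl.kl,
        by simpa [hS] using hl.rows, by simpa [hS] using hl.mids⟩
  · rintro σ₂ - - h
    exact .nil (by omega) h

/-- The common neighbours of `y` and `z` in `R`. -/
def common (N : ℕ → Finset ℕ) (R : Finset ℕ) (y z : ℕ) : ℕ := ((N y ∩ N z) ∩ R).card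

theorem sum_ind_eq_card (S : Finset ℕ) (P : ℕ → Prop) [DecidablePred P] :
    ∑ v ∈ S, ind (P v) = ((S.filter P).card : ℤ) := by
  rw [Finset.card_filter]
  push_cast
  refine Finset.sum_congr rfl fun v _ => ?_
  by_cases h : P v <;> simp [h]

/-- After a successful attempt, `acc` counts the common neighbours of high degree. -/
structure HighCounted (n : ℕ) (N : ℕ → Finset ℕ) (R : Finset ℕ) (Δ r₀ : ℕ) (σ : GStore) :
    Prop where
  lim : σ.v .lim = Δ
  row : σ.v .row = r₀
  count : ∀ y ∈ high N n Δ, ∀ z ∈ high N n Δ,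
    σ.a .acc r₀ y z = ((((N y ∩ N z) ∩ R) ∩ high N n Δ).card : ℕ)
  bound : ∀ y z, |σ.a .acc r₀ y z| ≤ n

theorem pairSum_bound {lst : ℕ → ℕ} {C : ℕ → ℕ → ℤ} {k : ℕ} (hC : ∀ i j, |C i j| ≤ k)
    (hinj : ∀ i < k, ∀ j < k, lst i = lst j → i = j) (y z : ℕ) :
    |pairSum lst C k (k * k) y z| ≤ k := by
  by_cases h : (∃ i < k, lst i = y) ∧ ∃ j < k, lst j = z
  · obtain ⟨⟨i, hi, rfl⟩, j, hj, rfl⟩ := h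
    rw [pairSum_eq hi hj hinj]; exact hC i j
  · rw [pairSum_eq_zero h]; simp

/-- Adjacency is symmetric, so a path from y through a middle vertex to z is a common neighbour. In
this form the blocks simply add up to one sum over all middle vertices. -/
theorem pairSum_blockEntry {N : ℕ → Finset ℕ} {R S : Finset ℕ} {k o b : ℕ} {lst md : ℕ → ℕ}
    (hS : Enumerates lst k S) (hsymm : ∀ u v, u ∈ N v → v ∈ N u) {y z : ℕ} (hy : y ∈ S)
    (hz : z ∈ S) :
    pairSum lst (blockEntry N R b o lst md k) k (k * k) y z =
      ∑ l ∈ Finset.range k, if o + l < b then ind (md (o + l) ∈ (N y ∩ N z) ∩ R) else 0 := by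
  obtain ⟨i, hi, rfl⟩ := (hS.mem y).1 hy
  obtain ⟨j, hj, rfl⟩ := (hS.mem z).1 hz
  rw [pairSum_eq hi hj hS.inj, blockEntry]
  refine Finset.sum_congr rfl fun l _ => ?_
  unfold factorA factorB
  split_ifs with h
  · rw [ind_mul, ind_mul]
    refine ind_congr ?_
    simp only [Finset.mem_inter]
    constructor
    · rintro ⟨⟨h1, h2⟩, h3⟩; exact ⟨⟨h1, hsymm _ _ h3⟩, h2⟩
    · rintro ⟨⟨h1, h2⟩, h3⟩; exact ⟨⟨h1, h3⟩, hsymm _ _ h2⟩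
  · simp

/-- The word size suffices for graphs with `n` vertices and `m` edges. -/
structure Roomy (E : Env) (n m c : ℕ) : Prop where
  poly : 64 * (n + m + 2) ^ 4 ≤ E.V
  mul : (n + 2) ^ c ≤ E.V
  cpos : 1 ≤ c

theorem Roomy.cube {E : Env} {n m c : ℕ} (h : Roomy E n m c) {k : ℕ} (hk : k ≤ n) :
    n + k * k * k + 3 * (k * k) + 2 * k ≤ E.V := by
  refine le_trans ?_ h.poly
  have h1 : k * k ≤ n * n := Nat.mul_le_mul hk hk
  have h2 : k * k * k ≤ n * n * n := Nat.mul_le_mul h1 hk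
  have h3 : (n + 2) ^ 4 ≤ (n + m + 2) ^ 4 := Nat.pow_le_pow_left (by omega) 4
  nlinarith [h3, Nat.zero_le (n ^ 4), Nat.zero_le n]

theorem Roomy.square {E : Env} {n m c : ℕ} (h : Roomy E n m c) :
    64 * ((n + m + 2) * (n + m + 2)) ≤ E.V := by
  refine le_trans ?_ h.poly
  have : (n + m + 2) ^ 2 ≤ (n + m + 2) ^ 4 := Nat.pow_le_pow_right (by omega) (by omega)
  nlinarith

theorem Roomy.linear {E : Env} {n m c : ℕ} (h : Roomy E n m c) : 64 * (n + m + 2) ≤ E.V :=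
  le_trans (by nlinarith) h.square

theorem Roomy.mul_le {E : Env} {n m c : ℕ} (h : Roomy E n m c) {k : ℕ} (hk : k ≤ n) :
    (k + 2) ^ c ≤ E.V := (Nat.pow_le_pow_left (by omega) c).trans h.mul

theorem Roomy.le_mul {E : Env} {n m c : ℕ} (h : Roomy E n m c) (k : ℕ) : k ≤ (k + 2) ^ c :=
  le_trans (by omega) (Nat.le_self_pow (by have := h.cpos; omega) (k + 2))

/-- The cost of an attempt to find a limit, up to the factor `m * Δ`. -/
def tryCost (p : Program) : ℕ := 100 + 4 * p.size

/-- A failure comes with a certificate: a size `k`, possible for this limit, whose multiplication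
may need more than `m * Δ` steps. So `Δ` is below every `GoodLimit`. -/
structure TryPost (p : Program) (F : ℕ → ℕ) (n m : ℕ) (N : ℕ → Finset ℕ) (nb : ℕ → ℕ → ℕ)
    (R : Finset ℕ) (Δ r : ℕ) (σ : GStore) : Prop where
  loaded : Loaded n m N nb R σ
  clean : Clean p (r + 1) σ
  cases : (σ.v .fin = 1 ∧ HighCounted n N R Δ r σ) ∨
    (σ.v .fin = 0 ∧ σ.v .lim = (2 * Δ : ℕ) ∧ Δ < n ∧
      ∃ k, 0 < k ∧ k * Δ ≤ 2 * m ∧ m * Δ < F k)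

/-- The budget caps the multiplication at `O(m * Δ)`, and the condition `4 * m ≤ Δ³` does the same
for writing the factors and reading the product. So the cost is known before the attempt, whether or
not it succeeds. -/
theorem tryLimit_run {E : Env} {n m c Δ r : ℕ} {N : ℕ → Finset ℕ} {nb : ℕ → ℕ → ℕ} {R : Finset ℕ}
    {p : Program} {F : ℕ → ℕ} (hp : p.Deterministic) (hmul : Multiplies p c F)
    (hE : Roomy E n m c) (hG : IsGraph n m N) {σ : GStore} (hL : Loaded n m N nb R σ)
    (hC : Clean p r σ) (hlim : σ.v .lim = Δ) (hfin : σ.v .fin = 0) (hm : 0 < m) (hnm : n ≤ 2 * m)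
    (hΔ : 4 * m ≤ Δ * (Δ * Δ)) (hΔV : Δ ≤ 2 * n + 32 * m) (hrV : r + 1 ≤ E.V) :
    Run E (tryLimit p) σ (tryCost p * (m * Δ)) (TryPost p F n m N nb R Δ r) := by
  have hlin := hE.linear
  have hsq := hE.square
  have hΔ1 : 1 ≤ Δ := by
    rcases Nat.eq_zero_or_pos Δ with rfl | h
    · simp at hΔ; omega
    · exact h
  have hmΔ : m ≤ m * Δ := Nat.le_mul_of_pos_right _ hΔ1
  have hβV : m * Δ + 1 ≤ E.V := by
    have : m * Δ ≤ m * (2 * n + 32 * m) := Nat.mul_le_mul_left _ hΔV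
    nlinarith
  set k := (high N n Δ).card with hk
  have hkn : k ≤ n := high_card_le N n Δ
  have hkΔ : k * Δ ≤ 2 * m := le_trans (Nat.mul_le_mul_left _ (by omega)) (hG.high_card_mul_le Δ)
  -- From kΔ ≤ 2m follows k²Δ² ≤ 4m² ≤ mΔ³; this is the reason for starting the search at the cube
  -- root of 4m.
  have hkk : k * k ≤ m * Δ := by
    have h1 : (k * k) * (Δ * Δ) ≤ (m * Δ) * (Δ * Δ) := by
      calc (k * k) * (Δ * Δ) = (k * Δ) * (k * Δ) := by ring
        _ ≤ (2 * m) * (2 * m) := Nat.mul_le_mul hkΔ hkΔ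
        _ = m * (4 * m) := by ring
        _ ≤ m * (Δ * (Δ * Δ)) := Nat.mul_le_mul_left _ hΔ
        _ = (m * Δ) * (Δ * Δ) := by ring
    exact Nat.le_of_mul_le_mul_right h1 (Nat.mul_pos hΔ1 hΔ1)
  have hps : p.size * (min (m * Δ + 1) (F k) + 2) ≤ p.size * (4 * (m * Δ)) :=
    Nat.mul_le_mul_left _ (by omega)
  have hcost : tryCost p * (m * Δ) = 100 * (m * Δ) + p.size * (4 * (m * Δ)) := by
    unfold tryCost; ring
  rw [hcost]
  unfold tryLimit
  refine .cons (7 * n + 4) (by omega) ((collectHigh_run hL hlim (by omega)).mono le_rfl ?_)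
  rintro σ₁ hag₁ ⟨lst, hl⟩
  have hL₁ := hL.congr hag₁ (by simp [collectHigh]) (by simp [collectHigh])
  have hC₁ := hC.congr hag₁ (by simp [collectHigh]) (by simp [collectHigh])
  have hlim₁ : σ₁.v .lim = Δ := by rw [hag₁.v _ (by simp [collectHigh]), hlim]
  have hfin₁ : σ₁.v .fin = 0 := by rw [hag₁.v _ (by simp [collectHigh]), hfin]
  refine .cons 1 (by omega) (.setN r (.var hC₁.run) (by omega) le_rfl ?_)
  -- The additional unit ensures that a multiplication of at most `m * Δ` steps leaves a positive
  -- budget and is recognized as successful.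
  refine .cons 1 (by omega) (.setN (m * Δ + 1) ?_ hβV le_rfl ?_)
  · push_cast
    exact ((Evals.var (by simpa using hL₁.varM)).mul (.var (by simpa using hlim₁))).add (.lit 1)
  refine .cons 1 (by omega) (.setN 0 (.lit 0) (by omega) le_rfl ?_)
  refine .cons 1 (by omega) (.setN k (.var (by simpa using hl.kl)) (by omega) le_rfl ?_)
  set σ₂ := (((σ₁.setV .row r).setV .bud (m * Δ + 1 : ℕ)).setV .off (0 : ℕ)).setV .km k with hσ₂
  have hL₂ : Loaded n m N nb R σ₂ := ⟨by simpa [hσ₂] using hL₁.varN, by simpa [hσ₂] using hL₁.varM,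
    ⟨hL₁.tables.lists, hL₁.tables.adj, hL₁.tables.deg, hL₁.tables.nbr⟩, hL₁.mark⟩
  have hC₂ : Clean p r σ₂ := ⟨by simpa [hσ₂] using hC₁.run,
    ⟨by simpa [hσ₂] using hC₁.fresh.ext, hC₁.fresh.mm⟩, hC₁.acc⟩
  have hlim₂ : σ₂.v .lim = Δ := by simpa [hσ₂] using hlim₁
  have hfin₂ : σ₂.v .fin = 0 := by simpa [hσ₂] using hfin₁
  have hrow₂ : σ₂.v .row = r := by simp [hσ₂]
  have hbud₂ : σ₂.v .bud = (m * Δ + 1 : ℕ) := by simp [hσ₂]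
  have hkl₂ : σ₂.v .kl = k := by simpa [hσ₂] using hl.kl
  refine .cons (40 * (k * k) + p.size * (min (m * Δ + 1) (F k) + 2) + 2) (by omega)
    (.ite k (.var hkl₂) (by omega) (fun hpos => ?_) (fun hneg => ?_))
  · have hk0 : 0 < k := by exact_mod_cast hpos
    have hB : BlockBounds E n k k 0 r r :=
      ⟨hk0, hE.cube hkn, by omega, by omega, hrV, by omega⟩
    have hSet : BlockSetup E N R n k k 0 r r lst lst σ₂ :=
      ⟨hkl₂, by simp [hσ₂], by simp [hσ₂], hC₂.run, hrow₂,
        fun i hi => ⟨hl.rows i hi, (mem_high.1 (hl.enum.apply_mem hi)).1⟩,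
        fun i hi => ⟨hl.mids i hi, (mem_high.1 (hl.enum.apply_mem hi)).1⟩,
        fun u _ v _ => hL₂.tables.adj u v, hL₂.mark⟩
    refine (countBlock_run hp hmul hB hSet hC₂.fresh (hE.mul_le hkn) (hE.le_mul k) hbud₂ hβV
      (fun y z => by rw [hC₂.acc r y z le_rfl]; simp)).mono (by omega) ?_
    rintro σ₃ hag₃ ⟨β', hpost⟩
    have w1 : ∀ x, x ≠ .run → x ≠ .p → x ≠ .q → x ≠ .g → x ≠ .h → x ≠ .bud → (∀ k, x ≠ .ext k) →
        σ₃.v x = σ₂.v x := by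
      intro x h1 h2 h3 h4 h5 h6 h7
      exact hag₃.v _ (by
        simp [countBlock, fillFactors, fillEntry, addProduct, addEntry, h1, h2, h3, h4, h5, h6, h7])
    have hL₃ := hL₂.congr hag₃
      (by simp [countBlock, fillFactors, fillEntry, addProduct, addEntry])
      (by simp [countBlock, fillFactors, fillEntry, addProduct, addEntry])
    have hlim₃ : σ₃.v .lim = Δ := by rw [w1 .lim] <;> simp [hlim₂]
    have hfin₃ : σ₃.v .fin = 0 := by rw [w1 .fin] <;> simp [hfin₂]
    have hrow₃ : σ₃.v .row = r := by rw [w1 .row] <;> simp [hrow₂]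
    refine .cons 2 (by omega) (.ite β' (.var hpost.bud) (by omega) (fun hpos => ?_)
      (fun hneg => ?_))
    · have hadd := hpost.done (by exact_mod_cast hpos)
      refine .setN 1 (.lit 1) (by omega) (by omega) (.nil (by omega) ⟨?_, ?_, Or.inl ⟨by simp,
        ⟨by simpa using hlim₃, by simpa using hrow₃, ?_, ?_⟩⟩⟩)
      · exact ⟨by simpa using hL₃.varN, by simpa using hL₃.varM,
          ⟨hL₃.tables.lists, hL₃.tables.adj, hL₃.tables.deg, hL₃.tables.nbr⟩, hL₃.mark⟩
      · refine ⟨by simpa using hpost.run, ⟨by simpa using hpost.fresh.ext, hpost.fresh.mm⟩, ?_⟩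
        intro r' y z hr'
        rw [Store.setV_a, hadd.rest r' (by omega)]
        exact hC₂.acc r' y z (by omega)
      · intro y hy z hz
        rw [Store.setV_a, hadd.here, hC₂.acc r y z le_rfl, zero_add,
          pairSum_blockEntry hl.enum hG.symm hy hz]
        have e : ∑ l ∈ Finset.range k, (if 0 + l < k then
            ind (lst (0 + l) ∈ (N y ∩ N z) ∩ R) else 0) =
            ∑ l ∈ Finset.range k, ind (lst l ∈ (N y ∩ N z) ∩ R) := by
          refine Finset.sum_congr rfl fun l hl => ?_
          rw [zero_add, if_pos (Finset.mem_range.1 hl)]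
        rw [e, hl.enum.sum_eq (fun v => ind (v ∈ (N y ∩ N z) ∩ R)), sum_ind_eq_card,
          Finset.filter_mem_eq_inter, Finset.inter_comm]
      · intro y z
        rw [Store.setV_a, hadd.here, hC₂.acc r y z le_rfl, zero_add]
        refine (pairSum_bound (abs_blockEntry_le N R k 0 lst lst k) hl.enum.inj y z).trans ?_
        exact_mod_cast hkn
    · have h0 : β' = 0 := by omega
      have hsp := hpost.spent
      -- Only a product with at least one row can fail, and its row is a vertex of degree more than
      -- `Δ`. This keeps the limit, and with it the number of rows used, linear in the input size.
      have hΔn : Δ < n := by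
        obtain ⟨v, hv⟩ := Finset.card_pos.1 hk0
        have := hG.card_lt (by omega) v
        have := (mem_high.1 hv).2
        omega
      refine .setN (2 * Δ) ?_ (by omega) (by omega) (.nil (by omega) ⟨?_, ?_, Or.inr
        ⟨by simpa using hfin₃, by simp, hΔn, k, hk0, hkΔ, by omega⟩⟩)
      · push_cast; exact (Evals.lit 2).mul (.var hlim₃)
      · exact ⟨by simpa using hL₃.varN, by simpa using hL₃.varM,
          ⟨hL₃.tables.lists, hL₃.tables.adj, hL₃.tables.deg, hL₃.tables.nbr⟩, hL₃.mark⟩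
      · refine ⟨by simpa using hpost.run, ⟨by simpa using hpost.fresh.ext, hpost.fresh.mm⟩, ?_⟩
        intro r' y z hr'
        rw [Store.setV_a, hpost.fail h0]
        exact hC₂.acc r' y z (by omega)
  -- Without vertices of high degree there is nothing to multiply; the row number advances all the
  -- same, so that both cases leave the same kind of state.
  · have hk0 : k = 0 := by omega
    refine .setN (r + 1) ?_ hrV (by omega) ?_
    · push_cast; exact (Evals.var hC₂.run).add (.lit 1)
    refine .cons 2 (by omega) (.ite (m * Δ + 1 : ℕ) (.var (by simpa using hbud₂)) (by omega)
      (fun hpos => ?_) (fun hneg => by omega))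
    refine .setN 1 (.lit 1) (by omega) (by omega) (.nil (by omega) ⟨?_, ?_, Or.inl ⟨by simp,
      ⟨by simpa using hlim₂, by simpa using hrow₂, ?_, ?_⟩⟩⟩)
    · exact ⟨by simpa using hL₂.varN, by simpa using hL₂.varM,
        ⟨hL₂.tables.lists, hL₂.tables.adj, hL₂.tables.deg, hL₂.tables.nbr⟩, hL₂.mark⟩
    · exact ⟨by simp, ⟨by simpa using hC₂.fresh.ext, fun r' i j h => hC₂.fresh.mm r' i j (by omega)⟩,
        fun r' y z h => hC₂.acc r' y z (by omega)⟩
    · intro y hy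
      have : high N n Δ = ∅ := Finset.card_eq_zero.1 (by omega)
      simp [this] at hy
    · intro y z
      have := hC₂.acc r y z le_rfl
      simp [this]

/-- From the limit `D` on, the multiplications fit into their time limit. -/
structure GoodLimit (F : ℕ → ℕ) (m D : ℕ) : Prop where
  cube : 32 * m ≤ D * (D * D)
  fits : ∀ Δ k, D ≤ Δ → 0 < k → k * Δ ≤ 2 * m → F k ≤ m * Δ

theorem cube_lt {a b : ℕ} (h : a * (a * a) < b * (b * b)) : a < b := by
  by_contra h'
  have h' : b ≤ a := by omega
  have := Nat.mul_le_mul h' (Nat.mul_le_mul h' h')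
  omega

structure FindPost (p : Program) (n m D : ℕ) (N : ℕ → Finset ℕ) (nb : ℕ → ℕ → ℕ)
    (R : Finset ℕ) (r Δ r' : ℕ) (σ : GStore) : Prop where
  loaded : Loaded n m N nb R σ
  clean : Clean p (r' + 1) σ
  counted : HighCounted n N R Δ r' σ
  pos : 1 ≤ Δ
  le : Δ ≤ 2 * D
  le' : Δ ≤ 2 * n + 32 * m
  run : r ≤ r'
  run_le : r' ≤ r + Δ

/-- The program does not contain `D`: any good limit, chosen in the analysis, bounds the time.
Failures happen only below `D`, so the last limit is at most `2 * D`, and the costs of the attempts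
double from one to the next. -/
theorem findLimit_run {E : Env} {n m c r D : ℕ} {N : ℕ → Finset ℕ} {nb : ℕ → ℕ → ℕ} {R : Finset ℕ}
    {p : Program} {F : ℕ → ℕ} (hp : p.Deterministic) (hmul : Multiplies p c F)
    (hE : Roomy E n m c) (hG : IsGraph n m N) {σ : GStore} (hL : Loaded n m N nb R σ)
    (hC : Clean p r σ) (hm : 0 < m) (hnm : n ≤ 2 * m)
    (hrV : r + 2 * n + 32 * m + 2 ≤ E.V) (hD : GoodLimit F m D) :
    Run E (findLimit p) σ ((4 * tryCost p + 10) * (m * D))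
      (fun σ' => ∃ Δ r', FindPost p n m D N nb R r Δ r' σ') := by
  have hlin := hE.linear
  have hD1 : 1 ≤ D := by
    rcases Nat.eq_zero_or_pos D with rfl | h
    · have := hD.cube; simp at this; omega
    · exact h
  have hmD : m ≤ m * D := Nat.le_mul_of_pos_right _ hD1
  have hDm : D ≤ m * D := Nat.le_mul_of_pos_left _ hm
  have hcost : (4 * tryCost p + 10) * (m * D) = (tryCost p + 1) * (m * (4 * D)) + 6 * (m * D) := by
    ring
  have hcubeD : ∀ Δ, Δ * (Δ * Δ) < 32 * m → Δ < D := fun Δ h => cube_lt (h.trans_le hD.cube)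
  rw [hcost]
  unfold findLimit
  refine .cons 1 (by omega) (.setN 1 (.lit 1) (by omega) le_rfl ?_)
  -- Doubling from 1 stops at the first `Δ` with 4m ≤ Δ³; since the previous value was too small, Δ³
  -- < 32m, and therefore Δ < D by `GoodLimit.cube`.
  refine .cons (2 * D) (by omega) (Run.mono (T' := 2 * D)
    (Q' := fun σ' => ∃ Δ : ℕ, σ'.v .lim = Δ ∧ Δ * (Δ * Δ) < 32 * m ∧ 4 * m ≤ Δ * (Δ * Δ))
    (.loop (fun σ' => ∃ Δ : ℕ, σ'.v .lim = Δ ∧ 1 ≤ Δ ∧ Δ * (Δ * Δ) < 32 * m)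
      (fun σ' => 1 + 2 * (D - (σ'.v .lim).toNat)) ⟨1, by simp, le_rfl, by omega⟩
      (by simp; omega) ?_) le_rfl ?_)
  · rintro σ₁ hag₁ ⟨Δ, hΔ, hΔ1, hlt⟩
    have hag₁' : σ₁.v .m = m := by rw [hag₁.v _ (by simp)]; simpa using hL.varM
    have hDΔ := hcubeD Δ hlt
    refine ⟨4 * m - Δ * (Δ * Δ), ((Evals.lit 4).mul (.var hag₁')).sub
      ((Evals.var hΔ).mul ((Evals.var hΔ).mul (.var hΔ))), fun h => ⟨by omega, Δ, hΔ, hlt, ?_⟩,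
      fun h => ⟨1, .setN (2 * Δ) ?_ ?_ le_rfl ⟨⟨2 * Δ, by simp, by omega, ?_⟩, ?_⟩⟩⟩
    · have : (4 * m : ℤ) ≤ ((Δ * (Δ * Δ) : ℕ) : ℤ) := by push_cast; linarith
      exact_mod_cast this
    · push_cast; exact (Evals.lit 2).mul (.var hΔ)
    · have : Δ ≤ Δ * (Δ * Δ) := Nat.le_mul_of_pos_right _ (Nat.mul_pos hΔ1 hΔ1)
      omega
    · have : ((Δ * (Δ * Δ) : ℕ) : ℤ) < ((4 * m : ℕ) : ℤ) := by push_cast; linarith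
      have : Δ * (Δ * Δ) < 4 * m := by exact_mod_cast this
      calc 2 * Δ * (2 * Δ * (2 * Δ)) = 8 * (Δ * (Δ * Δ)) := by ring
        _ < 32 * m := by omega
    · have : ((Δ * (Δ * Δ) : ℕ) : ℤ) < ((4 * m : ℕ) : ℤ) := by push_cast; linarith
      have h3 : Δ * (Δ * Δ) < 4 * m := by exact_mod_cast this
      have h4 : 2 * Δ < D := hcubeD _ (by
        calc 2 * Δ * (2 * Δ * (2 * Δ)) = 8 * (Δ * (Δ * Δ)) := by ring
          _ < 32 * m := by omega)
      simp [hΔ]; omega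
  rintro σ₁ hag₁ ⟨Δ₀, hΔ₀, hlt₀, hge₀⟩
  have hL₁ : Loaded n m N nb R σ₁ := Loaded.congr (σ := σ.setV .lim (1 : ℕ))
    ⟨by simpa using hL.varN, by simpa using hL.varM,
      ⟨hL.tables.lists, hL.tables.adj, hL.tables.deg, hL.tables.nbr⟩, hL.mark⟩ hag₁ (by simp) (by simp)
  have hC₁ : Clean p r σ₁ := Clean.congr (σ := σ.setV .lim (1 : ℕ))
    ⟨by simpa using hC.run, ⟨by simpa using hC.fresh.ext, hC.fresh.mm⟩, hC.acc⟩ hag₁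
      (by simp) (by simp)
  have hΔ₀D := hcubeD Δ₀ hlt₀
  have hΔ₀1 : 1 ≤ Δ₀ := by
    rcases Nat.eq_zero_or_pos Δ₀ with rfl | h
    · simp at hge₀; omega
    · exact h
  have hΔ₀m : Δ₀ ≤ 32 * m := by
    have : Δ₀ ≤ Δ₀ * (Δ₀ * Δ₀) := Nat.le_mul_of_pos_right _ (Nat.mul_pos hΔ₀1 hΔ₀1)
    omega
  refine .cons 1 (by omega) (.setN 0 (.lit 0) (by omega) le_rfl ?_)
  -- The potential is proportional to m(4D - Δ). An attempt costs a multiple of mΔ, and doubling `Δ`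
  -- lowers 4D - Δ by exactly `Δ`. Since `Δ` stays at most 2D, enough is left for the last attempt.
  refine .cons (1 + (tryCost p + 1) * (m * (4 * D))) (by omega) (.loop
    (fun σ' => (σ'.v .fin = 0 ∧ ∃ Δ r₁ : ℕ, σ'.v .lim = Δ ∧ 4 * m ≤ Δ * (Δ * Δ) ∧ Δ ≤ 2 * D ∧
        Δ ≤ 2 * n + 32 * m ∧ r ≤ r₁ ∧ r₁ ≤ r + Δ ∧ Loaded n m N nb R σ' ∧ Clean p r₁ σ') ∨
      (σ'.v .fin = 1 ∧ ∃ Δ r', FindPost p n m D N nb R r Δ r' σ'))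
    (fun σ' => if 0 < σ'.v .fin then 1 else
      1 + (tryCost p + 1) * (m * (4 * D - (σ'.v .lim).toNat))) ?_ ?_ ?_)
  · refine Or.inl ⟨by simp, Δ₀, r, by simpa using hΔ₀, hge₀, by omega, by omega, le_rfl, by omega,
      ?_, ?_⟩
    · exact ⟨by simpa using hL₁.varN, by simpa using hL₁.varM,
        ⟨hL₁.tables.lists, hL₁.tables.adj, hL₁.tables.deg, hL₁.tables.nbr⟩, hL₁.mark⟩
    · exact ⟨by simpa using hC₁.run, ⟨by simpa using hC₁.fresh.ext, hC₁.fresh.mm⟩, hC₁.acc⟩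
  · simp only [Store.setV_v, if_true]
    simp only [Nat.cast_zero, lt_self_iff_false, if_false]
    gcongr
    omega
  · rintro σ₂ - (⟨hfin, Δ, r₁, hlim, hcube, hΔD, hΔV, hr1, hr2, hL₂, hC₂⟩ | ⟨hfin, hpost⟩)
    · refine ⟨1 - 0, (Evals.lit 1).sub (.var hfin), by simp, fun _ => ⟨tryCost p * (m * Δ), ?_⟩⟩
      have hΔ1 : 1 ≤ Δ := by
        rcases Nat.eq_zero_or_pos Δ with rfl | h
        · simp at hcube; omega
        · exact h
      have hmΔ : 1 ≤ m * Δ := Nat.mul_pos hm hΔ1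
      refine (tryLimit_run hp hmul hE hG hL₂ hC₂ hlim hfin hm hnm hcube hΔV (by omega)).mono
        le_rfl ?_
      rintro σ₃ - ⟨hL₃, hC₃, h3⟩
      obtain ⟨w, hw⟩ := Nat.exists_eq_add_of_le hΔD
      have e0 : (tryCost p + 1) * (m * Δ) ≤ (tryCost p + 1) * (m * (2 * D + w)) :=
        Nat.mul_le_mul_left _ (Nat.mul_le_mul_left _ (by omega))
      have e1 : 4 * D - Δ = 2 * D + w := by omega
      have e3 : (tryCost p + 1) * (m * Δ) = tryCost p * (m * Δ) + m * Δ := by ring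
      simp only [hfin, hlim, Int.toNat_natCast, lt_self_iff_false, if_false, e1]
      rcases h3 with ⟨hfin₃, hcount⟩ | ⟨hfin₃, hlim₃, hΔn, k, hk, hkΔ, hFk⟩
      · refine ⟨Or.inr ⟨hfin₃, Δ, r₁, hL₃, hC₃, hcount, hΔ1, hΔD, hΔV, hr1, hr2⟩, ?_⟩
        simp only [hfin₃, zero_lt_one, if_true]
        omega
      · have hΔlt : Δ < D := by
          by_contra h
          have := hD.fits Δ k (by omega) hk hkΔ
          omega
        refine ⟨Or.inl ⟨hfin₃, 2 * Δ, r₁ + 1, hlim₃, ?_, by omega, by omega, by omega, by omega,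
          hL₃, hC₃⟩, ?_⟩
        · calc 4 * m ≤ Δ * (Δ * Δ) := hcube
            _ ≤ 8 * (Δ * (Δ * Δ)) := by omega
            _ = 2 * Δ * (2 * Δ * (2 * Δ)) := by ring
        · simp only [hfin₃, hlim₃, Int.toNat_natCast, lt_self_iff_false, if_false]
          have e4 : 4 * D - 2 * Δ + Δ = 2 * D + w := by omega
          have e5 : (tryCost p + 1) * (m * (4 * D - 2 * Δ)) + (tryCost p + 1) * (m * Δ) =
              (tryCost p + 1) * (m * (2 * D + w)) := by rw [← e4]; ring
          omega
    · refine ⟨1 - 1, (Evals.lit 1).sub (.var hfin), fun _ => ⟨by simp [hfin], ?_⟩, by simp⟩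
      exact .nil (by omega) hpost

/-! ### Common neighbours of low degree and the counts at the edges -/

theorem Loaded.get_nbr {E : Env} {n m : ℕ} {N : ℕ → Finset ℕ} {nb : ℕ → ℕ → ℕ} {R : Finset ℕ}
    {σ : GStore} (h : Loaded n m N nb R σ) {e f : GExpr} {v i : ℕ} (he : Evals E σ e v)
    (hf : Evals E σ f i) (hv : v ≤ E.V) (hi : i < (N v).card) (hi' : i ≤ E.V) :
    Evals E σ (get2 .nbr e f) (nb v i) := by
  rw [← h.tables.nbr v i hi]
  exact Evals.get (i := 0) (.lit 0) he hf (by omega) hv hi'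

theorem Loaded.get_adj {E : Env} {n m : ℕ} {N : ℕ → Finset ℕ} {nb : ℕ → ℕ → ℕ} {R : Finset ℕ}
    {σ : GStore} (h : Loaded n m N nb R σ) {e f : GExpr} {u v : ℕ} (he : Evals E σ e u)
    (hf : Evals E σ f v) (hu : u ≤ E.V) (hv : v ≤ E.V) :
    Evals E σ (get2 .adj e f) (ind (v ∈ N u)) := by
  rw [← h.tables.adj u v]
  exact Evals.get (i := 0) (.lit 0) he hf (by omega) hu hv

theorem Loaded.get_deg {E : Env} {n m : ℕ} {N : ℕ → Finset ℕ} {nb : ℕ → ℕ → ℕ} {R : Finset ℕ}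
    {σ : GStore} (h : Loaded n m N nb R σ) {e : GExpr} {v : ℕ} (he : Evals E σ e v)
    (hv : v ≤ E.V) : Evals E σ (get1 .deg e) (N v).card := by
  rw [← h.tables.deg v]
  exact Evals.get (i := 0) (j := 0) (.lit 0) (.lit 0) he (by omega) (by omega) hv

theorem Loaded.get_mark {E : Env} {n m : ℕ} {N : ℕ → Finset ℕ} {nb : ℕ → ℕ → ℕ} {R : Finset ℕ}
    {σ : GStore} (h : Loaded n m N nb R σ) {e : GExpr} {v : ℕ} (he : Evals E σ e v)
    (hn : v < n) (hv : v ≤ E.V) : Evals E σ (get1 .mark e) (ind (v ∈ R)) := by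
  rw [← h.mark v hn]
  exact Evals.get (i := 0) (j := 0) (.lit 0) (.lit 0) he (by omega) (by omega) hv

theorem Loaded.nb_mem {n m : ℕ} {N : ℕ → Finset ℕ} {nb : ℕ → ℕ → ℕ} {R : Finset ℕ} {σ : GStore}
    (h : Loaded n m N nb R σ) {v i : ℕ} (hi : i < (N v).card) : nb v i ∈ N v :=
  (h.tables.lists v).apply_mem hi

theorem Loaded.setV {n m : ℕ} {N : ℕ → Finset ℕ} {nb : ℕ → ℕ → ℕ} {R : Finset ℕ} {σ : GStore}
    (h : Loaded n m N nb R σ) (x : Var) (k : ℤ) (h1 : x ≠ .n) (h2 : x ≠ .m) :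
    Loaded n m N nb R (σ.setV x k) :=
  ⟨by simpa [h1.symm] using h.varN, by simpa [h2.symm] using h.varM,
    ⟨h.tables.lists, h.tables.adj, h.tables.deg, h.tables.nbr⟩, h.mark⟩

theorem Clean.setV {p : Program} {r : ℕ} {σ : GStore} (h : Clean p r σ) (x : Var) (k : ℤ)
    (h1 : x ≠ .run) (h2 : ∀ j, x ≠ .ext j) : Clean p r (σ.setV x k) :=
  ⟨by simpa [h1.symm] using h.run,
    ⟨fun y hy hw => by simpa [(h2 y).symm] using h.fresh.ext y hy hw, h.fresh.mm⟩, h.acc⟩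

theorem common_comm (N : ℕ → Finset ℕ) (R : Finset ℕ) (y z : ℕ) : common N R y z = common N R z y := by
  unfold common; rw [Finset.inter_comm (N y)]

/-- For a vertex v and its neighbour w, one pass over the neighbours u of v does two things: it
counts the marked u adjacent to w, which gives the entry of `low` at (v, w), and it records v, if
marked, as a common neighbour of w and u in `acc`. The slack `n` in the bound on `A` is for these
additions. -/
theorem lowRow_run {E : Env} {n m : ℕ} {N : ℕ → Finset ℕ} {nb : ℕ → ℕ → ℕ} {R : Finset ℕ}
    (hG : IsGraph n m N) {σ : GStore} (hL : Loaded n m N nb R σ) {v a r : ℕ} {A : ℕ → ℕ → ℤ}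
    (hnV : 4 * n ≤ E.V) (hA : ∀ y z, |A y z| ≤ E.V - n) (hacc : ∀ y z, σ.a .acc r y z = A y z)
    (hv : σ.v .v = v) (hvn : v < n) (ha : σ.v .a = a) (han : a < (N v).card)
    (hd : σ.v .d = (N v).card) (hr : σ.v .row = r) (hrV : r ≤ E.V) :
    Run E lowRow σ (6 * (N v).card + 6) (fun σ' =>
      (∀ y z, σ'.a .acc r y z = A y z + ∑ b ∈ Finset.range (N v).card,
        ind (nb v a = y ∧ nb v b = z) * ind (v ∈ R)) ∧
      (∀ r', r' ≠ r → σ'.a .acc r' = σ.a .acc r') ∧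
      σ'.a .low 0 v (nb v a) = (common N R v (nb v a) : ℕ) ∧
      ∀ y z, ¬ (y = v ∧ z = nb v a) → σ'.a .low 0 y z = σ.a .low 0 y z) := by
  have hdn := hG.card_lt (by omega) v
  have hwn : nb v a < n := hG.lt _ _ (hL.nb_mem han)
  have hcn : common N R v (nb v a) ≤ n := le_trans (Finset.card_le_card
    (Finset.inter_subset_left.trans Finset.inter_subset_left)) hdn.le
  unfold lowRow
  refine .cons 1 (by omega) (.setN (nb v a) (hL.get_nbr (.var hv) (.var ha) (by omega) han
    (by omega)) (by omega) le_rfl ?_)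
  refine .cons 1 (by omega) (.setN 0 (.lit 0) (by omega) le_rfl ?_)
  have hL₀ := (hL.setV .w (nb v a) (by simp) (by simp)).setV .c (0 : ℕ) (by simp) (by simp)
  refine .cons (6 * (N v).card + 2) (by omega) (.forUp (N := (N v).card) (fun _ => 4)
    (fun j σ' => (∀ y z, σ'.a .acc r y z = A y z + ∑ b ∈ Finset.range j,
        ind (nb v a = y ∧ nb v b = z) * ind (v ∈ R)) ∧
      (∀ r', r' ≠ r → σ'.a .acc r' = σ.a .acc r') ∧
      σ'.v .c = ∑ b ∈ Finset.range j, ind ((nb v b ∈ N (nb v a)) ∧ nb v b ∈ R))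
    (by simp) (by simp [lowEntry]) (by simp [lowEntry]) (by simpa using hd) (by omega) ?_ ?_ ?_ ?_)
  · rw [sum_const_range]; omega
  · exact ⟨by simpa using hacc, fun _ _ => rfl, by simp⟩
  · rintro j hj σ₁ hvb - hag₁ ⟨h1, h2, h3⟩
    have hL₁ := hL₀.congr hag₁ (by simp [lowEntry]) (by simp [lowEntry])
    have hv₁ : σ₁.v .v = v := by rw [hag₁.v _ (by simp [lowEntry])]; simpa using hv
    have hw₁ : σ₁.v .w = nb v a := by rw [hag₁.v _ (by simp [lowEntry])]; simp
    have hr₁ : σ₁.v .row = r := by rw [hag₁.v _ (by simp [lowEntry])]; simpa using hr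
    have hun : nb v j < n := hG.lt _ _ (hL.nb_mem hj)
    have b1 : 0 ≤ ∑ b ∈ Finset.range j, ind ((nb v b ∈ N (nb v a)) ∧ nb v b ∈ R) :=
      Finset.sum_nonneg fun _ _ => ind_nonneg _
    have b2 : ∑ b ∈ Finset.range j, ind ((nb v b ∈ N (nb v a)) ∧ nb v b ∈ R) ≤ j := by
      simpa using Finset.sum_le_sum (s := Finset.range j)
        (fun b _ => ind_le_one ((nb v b ∈ N (nb v a)) ∧ nb v b ∈ R))
    have b3 : ∀ y z, 0 ≤ ∑ b ∈ Finset.range j, ind (nb v a = y ∧ nb v b = z) * ind (v ∈ R) :=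
      fun y z => Finset.sum_nonneg fun _ _ => mul_nonneg (ind_nonneg _) (ind_nonneg _)
    have b4 : ∀ y z, ∑ b ∈ Finset.range j, ind (nb v a = y ∧ nb v b = z) * ind (v ∈ R) ≤ j := by
      intro y z
      have := Finset.sum_le_sum (s := Finset.range j) (g := fun _ => (1 : ℤ))
        (f := fun b => ind (nb v a = y ∧ nb v b = z) * ind (v ∈ R))
        (fun b _ => by rw [ind_mul]; exact ind_le_one _)
      simpa using this
    have i1 := ind_nonneg ((nb v j ∈ N (nb v a)) ∧ nb v j ∈ R)
    have i2 := ind_le_one ((nb v j ∈ N (nb v a)) ∧ nb v j ∈ R)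
    have i3 := ind_nonneg (v ∈ R)
    have i4 := ind_le_one (v ∈ R)
    unfold lowEntry
    refine .cons 1 (by omega) (.setN (nb v j) (hL₁.get_nbr (.var hv₁) (.var hvb) (by omega) hj
      (by omega)) (by omega) le_rfl ?_)
    have hL₂ := hL₁.setV .u (nb v j) (by simp) (by simp)
    refine .cons 1 (by omega) (.set (∑ b ∈ Finset.range (j + 1),
      ind ((nb v b ∈ N (nb v a)) ∧ nb v b ∈ R)) ?_ ?_ le_rfl ?_)
    · rw [Finset.sum_range_succ, ← h3, ← ind_mul]
      exact (Evals.var (by simp)).add ((hL₂.get_adj (.var (by simpa using hw₁)) (.var (by simp))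
        (by omega) (by omega)).mul (hL₂.get_mark (.var (by simp)) hun (by omega)))
    · rw [Finset.sum_range_succ, abs_of_nonneg (by omega)]; omega
    have hL₃ := hL₂.setV .c (∑ b ∈ Finset.range (j + 1),
      ind ((nb v b ∈ N (nb v a)) ∧ nb v b ∈ R)) (by simp) (by simp)
    refine .cons 1 (by omega) (.put r (nb v a) (nb v j) (σ₁.a .acc r (nb v a) (nb v j) +
      ind (v ∈ R)) (.var (by simpa using hr₁)) (.var (by simpa using hw₁)) (.var (by simp)) ?_
      (by omega) (by omega) (by omega) ?_ le_rfl (.nil (by omega) ⟨?_, ?_, by simp⟩))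
    · exact (Evals.get (σ := Store.setV _ _ _) (.var (by simpa using hr₁))
        (.var (by simpa using hw₁)) (.var (by simp)) (by omega)
        (by omega) (by omega)).add (hL₃.get_mark (.var (by simpa using hv₁)) hvn (by omega))
    · rw [h1]
      have := abs_le.1 (hA (nb v a) (nb v j))
      have := b3 (nb v a) (nb v j)
      have := b4 (nb v a) (nb v j)
      rw [abs_le]; constructor <;> omega
    · intro y z
      conv_rhs => rw [Finset.sum_range_succ, ← add_assoc, ← h1 y z]
      by_cases h : nb v a = y ∧ nb v j = z
      · obtain ⟨rfl, rfl⟩ := h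
        simp
      · have h' : ¬ (y = nb v a ∧ z = nb v j) := fun hh => h ⟨hh.1.symm, hh.2.symm⟩
        simp [h, h']
    · intro r' hr'
      rw [← h2 r' hr']
      funext y z; simp [hr']
  · rintro σ₁ - hag₁ ⟨h1, h2, h3⟩
    have hv₁ : σ₁.v .v = v := by rw [hag₁.v _ (by simp [lowEntry])]; simpa using hv
    have hw₁ : σ₁.v .w = nb v a := by rw [hag₁.v _ (by simp [lowEntry])]; simp
    have hlow : σ₁.a .low = σ.a .low := by rw [hag₁.a _ (by simp [lowEntry])]; simp
    have hc : σ₁.v .c = (common N R v (nb v a) : ℕ) := by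
      rw [h3, (hL.tables.lists v).sum_eq (fun u => ind (u ∈ N (nb v a) ∧ u ∈ R)), sum_ind_eq_card]
      congr 2
      ext u; simp
    refine .cons 1 (by omega) (.put 0 v (nb v a) (common N R v (nb v a) : ℕ) (.lit 0) (.var hv₁)
      (.var hw₁) (.var hc) (by omega) (by omega) (by omega) (by simp; omega) le_rfl
      (.nil (by omega) ⟨by simpa using h1, ?_, by simp, ?_⟩))
    · intro r' hr'
      rw [← h2 r' hr']
      funext y z; simp
    · intro y z h
      simp [h, hlow]

/-- The number of common neighbours of low degree among the first `s` vertices. -/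
noncomputable def lowSum (N : ℕ → Finset ℕ) (R : Finset ℕ) (Δ s y z : ℕ) : ℤ :=
  ∑ v ∈ Finset.range s, ind ((N v).card ≤ Δ ∧ (y ∈ N v ∧ z ∈ N v) ∧ v ∈ R)

theorem abs_lowSum_le (N : ℕ → Finset ℕ) (R : Finset ℕ) (Δ s y z : ℕ) :
    |lowSum N R Δ s y z| ≤ s := by
  unfold lowSum
  refine (Finset.abs_sum_le_sum_abs _ _).trans ?_
  simpa using Finset.sum_le_sum (s := Finset.range s)
    (fun v _ => abs_ind_le ((N v).card ≤ Δ ∧ (y ∈ N v ∧ z ∈ N v) ∧ v ∈ R))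

/-- The double loop over the neighbours meets every ordered pair of them exactly once. -/
theorem sum_sum_ind {f : ℕ → ℕ} {S : Finset ℕ} (h : Enumerates f S.card S) (c : ℤ) (y z : ℕ) :
    ∑ a ∈ Finset.range S.card, ∑ b ∈ Finset.range S.card, ind (f a = y ∧ f b = z) * c =
      ind (y ∈ S ∧ z ∈ S) * c := by
  have h1 : ∀ a, ∑ b ∈ Finset.range S.card, ind (f a = y ∧ f b = z) * c =
      ind (f a = y) * (ind (z ∈ S) * c) := by
    intro a
    have : ∀ b, ind (f a = y ∧ f b = z) * c = ind (f a = y) * (c * ind (f b = z)) := by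
      intro b; rw [← ind_mul]; ring
    simp only [this, ← Finset.mul_sum]
    rw [h.sum_eq (fun u => ind (u = z)), sum_ind_eq_card, Finset.filter_eq']
    by_cases hz : z ∈ S <;> simp [hz]
  simp only [h1, ← Finset.sum_mul]
  rw [h.sum_eq (fun u => ind (u = y)), sum_ind_eq_card, Finset.filter_eq', ← ind_mul]
  by_cases hy : y ∈ S <;> simp [hy]

structure LowPost (N : ℕ → Finset ℕ) (R : Finset ℕ) (Δ r s : ℕ) (A : ℕ → ℕ → ℤ) (σ₀ σ : GStore) :
    Prop where
  acc : ∀ y z, σ.a .acc r y z = A y z + lowSum N R Δ s y z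
  rest : ∀ r', r' ≠ r → σ.a .acc r' = σ₀.a .acc r'
  low : ∀ v < s, (N v).card ≤ Δ → ∀ w ∈ N v, σ.a .low 0 v w = (common N R v w : ℕ)

/-- The squares of the degrees that are at most `Δ` sum up to at most Δ times the degree sum 2m.
After the pass, `acc` has been increased at every pair by the number of its marked common neighbours
of low degree. -/
theorem lowPass_run {E : Env} {n m : ℕ} {N : ℕ → Finset ℕ} {nb : ℕ → ℕ → ℕ} {R : Finset ℕ}
    (hG : IsGraph n m N) {σ : GStore} (hL : Loaded n m N nb R σ) {Δ r : ℕ} {A : ℕ → ℕ → ℤ}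
    (hV : 4 * (n * n) + 8 * n ≤ E.V) (hA : ∀ y z, |A y z| ≤ n)
    (hacc : ∀ y z, σ.a .acc r y z = A y z) (hlim : σ.v .lim = Δ) (hr : σ.v .row = r)
    (hrV : r ≤ E.V) (hΔ : 1 ≤ Δ) (hm : 0 < m) (hnm : n ≤ 2 * m) :
    Run E lowPass σ (44 * (m * Δ)) (LowPost N R Δ r n A σ) := by
  have hmΔ : m ≤ m * Δ := Nat.le_mul_of_pos_right _ hΔ
  unfold lowPass
  refine .forUp (N := n) (fun v => 14 * Δ * (N v).card + 5) (fun s σ' => LowPost N R Δ r s A σ σ')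
    (by simp) (by simp [lowRow, lowEntry]) (by simp [lowRow, lowEntry]) hL.varN (by omega) ?_ ?_ ?_
    (fun _ _ _ h => h)
  · rw [Finset.sum_add_distrib, Finset.sum_add_distrib, sum_const_range, sum_const_range,
      ← Finset.mul_sum, hG.handshake]
    have : 14 * Δ * (2 * m) = 28 * (m * Δ) := by ring
    omega
  · exact ⟨by simpa [lowSum] using hacc, fun _ _ => rfl, by simp⟩
  · rintro v hvn σ₁ hv - hag₁ ⟨h1, h2, h3⟩
    have hL₁ := hL.congr hag₁ (by simp [lowRow, lowEntry]) (by simp [lowRow, lowEntry])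
    have hlim₁ : σ₁.v .lim = Δ := by rw [hag₁.v _ (by simp [lowRow, lowEntry]), hlim]
    have hr₁ : σ₁.v .row = r := by rw [hag₁.v _ (by simp [lowRow, lowEntry]), hr]
    have hdn := hG.card_lt (by omega) v
    refine .cons 1 (by omega) (.setN (N v).card (hL₁.get_deg (.var hv) (by omega)) (by omega)
      le_rfl ?_)
    have hL₂ := hL₁.setV .d (N v).card (by simp) (by simp)
    refine .cons (14 * Δ * (N v).card + 3) (by omega) (.ite (Δ + 1 - (N v).card)
      (((Evals.var (by simpa using hlim₁)).add (.lit 1)).sub (.var (by simp))) (by omega)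
      (fun hpos => ?_) (fun hneg => ?_))
    · have hdΔ : (N v).card ≤ Δ := by omega
      -- For a degree d ≤ Δ and Δ ≥ 1 one has 6d + 8 ≤ 14Δ, which makes the cost linear in d, and
      -- the handshake formula applies.
      have hcost : (N v).card * (6 * (N v).card + 6 + 2) ≤ 14 * Δ * (N v).card := by
        rw [mul_comm (14 * Δ) (N v).card]
        exact Nat.mul_le_mul_left _ (by omega)
      have hdd : (N v).card * (N v).card ≤ n * n := Nat.mul_le_mul hdn.le hdn.le
      refine .forUp (N := (N v).card) (fun _ => 6 * (N v).card + 6) (fun i σ' =>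
        (∀ y z, σ'.a .acc r y z = A y z + lowSum N R Δ v y z + ∑ a ∈ Finset.range i,
          ∑ b ∈ Finset.range (N v).card, ind (nb v a = y ∧ nb v b = z) * ind (v ∈ R)) ∧
        (∀ r', r' ≠ r → σ'.a .acc r' = σ.a .acc r') ∧
        (∀ v' < v, (N v').card ≤ Δ → ∀ w ∈ N v', σ'.a .low 0 v' w = (common N R v' w : ℕ)) ∧
        ∀ a < i, σ'.a .low 0 v (nb v a) = (common N R v (nb v a) : ℕ)) (by simp)
        (by simp [lowRow, lowEntry]) (by simp [lowRow, lowEntry]) (by simp) (by omega) ?_ ?_ ?_ ?_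
      · rw [sum_const_range]; omega
      · exact ⟨by simpa using h1, by simpa using h2, by simpa using h3, by simp⟩
      · rintro i hi σ₃ hva hvd hag₃ ⟨g1, g2, g3, g4⟩
        have hL₃ := hL₂.congr hag₃ (by simp [lowRow, lowEntry]) (by simp [lowRow, lowEntry])
        have hv₃ : σ₃.v .v = v := by
          rw [hag₃.v _ (by simp [lowRow, lowEntry])]; simpa using hv
        have hr₃ : σ₃.v .row = r := by
          rw [hag₃.v _ (by simp [lowRow, lowEntry])]; simpa using hr₁
        have hbd : ∀ y z, |A y z + lowSum N R Δ v y z + ∑ a ∈ Finset.range i,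
            ∑ b ∈ Finset.range (N v).card, ind (nb v a = y ∧ nb v b = z) * ind (v ∈ R)| ≤
            E.V - n := by
          intro y z
          have t1 := abs_le.1 (hA y z)
          have t2 := abs_le.1 (abs_lowSum_le N R Δ v y z)
          have t3 : 0 ≤ ∑ a ∈ Finset.range i, ∑ b ∈ Finset.range (N v).card,
              ind (nb v a = y ∧ nb v b = z) * ind (v ∈ R) :=
            Finset.sum_nonneg fun _ _ => Finset.sum_nonneg fun _ _ =>
              mul_nonneg (ind_nonneg _) (ind_nonneg _)
          have t4 : ∑ a ∈ Finset.range i, ∑ b ∈ Finset.range (N v).card,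
              ind (nb v a = y ∧ nb v b = z) * ind (v ∈ R) ≤ ((n * n : ℕ) : ℤ) := by
            refine le_trans (b := ((i * (N v).card : ℕ) : ℤ)) ?_ ?_
            · have := Finset.sum_le_sum (s := Finset.range i) (g := fun _ => ((N v).card : ℤ))
                (f := fun a => ∑ b ∈ Finset.range (N v).card,
                  ind (nb v a = y ∧ nb v b = z) * ind (v ∈ R)) (fun a _ => by
                    have := Finset.sum_le_sum (s := Finset.range (N v).card) (g := fun _ => (1 : ℤ))
                      (f := fun b => ind (nb v a = y ∧ nb v b = z) * ind (v ∈ R))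
                      (fun b _ => by rw [ind_mul]; exact ind_le_one _)
                    simpa using this)
              simpa using this
            · exact_mod_cast Nat.mul_le_mul (by omega) hdn.le
          rw [abs_le]; constructor <;> omega
        refine (lowRow_run hG hL₃ (by omega) hbd g1 hv₃ hvn hva hi hvd hr₃ hrV).mono le_rfl ?_
        rintro σ₄ - ⟨k1, k2, k3, k4⟩
        refine ⟨?_, ?_, ?_, ?_⟩
        · intro y z
          rw [Store.setV_a, k1, Finset.sum_range_succ (n := i)]; ring
        · intro r' hr'
          rw [Store.setV_a, k2 r' hr', g2 r' hr']
        · intro v' hv' hd' w hw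
          rw [Store.setV_a, k4 _ _ (by omega), g3 v' hv' hd' w hw]
        · intro a ha
          rcases Nat.lt_succ_iff_lt_or_eq.1 ha with ha | rfl
          · rw [Store.setV_a, k4 _ _ ?_, g4 a ha]
            rintro ⟨-, h⟩
            have := (hL.tables.lists v).inj a (by omega) i hi h
            omega
          · exact k3
      · rintro σ₃ - - ⟨g1, g2, g3, g4⟩
        refine .nil (by omega) ⟨?_, g2, ?_⟩
        · intro y z
          rw [Store.setV_a, g1, sum_sum_ind (hL.tables.lists v), lowSum, lowSum,
            Finset.sum_range_succ, ind_mul]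
          simp [hdΔ, add_assoc]
        · intro v' hv' hd' w hw
          rcases Nat.lt_succ_iff_lt_or_eq.1 hv' with hv' | rfl
          · exact g3 v' hv' hd' w hw
          · obtain ⟨a, ha, rfl⟩ := ((hL.tables.lists v').mem w).1 hw
            exact g4 a ha
    · refine .skip (by omega) (.nil (by omega) ⟨?_, by simpa using h2, ?_⟩)
      · intro y z
        simp only [Store.setV_a]
        rw [h1, lowSum, lowSum, Finset.sum_range_succ, ind_not (by omega), add_zero]
      · intro v' hv' hd' w hw
        rcases Nat.lt_succ_iff_lt_or_eq.1 hv' with hv' | rfl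
        · exact h3 v' hv' hd' w hw
        · omega

/-- A common neighbour has either high or low degree: the former are counted by the matrix product,
the latter by the enumeration. -/
theorem lowSum_add_high {n m : ℕ} {N : ℕ → Finset ℕ} (hG : IsGraph n m N) (R : Finset ℕ)
    (Δ y z : ℕ) : ((((N y ∩ N z) ∩ R) ∩ high N n Δ).card : ℤ) + lowSum N R Δ n y z =
      (common N R y z : ℕ) := by
  unfold lowSum common
  rw [sum_ind_eq_card]
  have : (N y ∩ N z) ∩ R = (((N y ∩ N z) ∩ R) ∩ high N n Δ) ∪ (Finset.range n).filter
      (fun v => (N v).card ≤ Δ ∧ (y ∈ N v ∧ z ∈ N v) ∧ v ∈ R) := by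
    ext v
    simp only [Finset.mem_union, Finset.mem_inter, mem_high, Finset.mem_filter, Finset.mem_range]
    constructor
    · rintro ⟨⟨h1, h2⟩, h3⟩
      have hv := hG.lt _ _ h1
      rcases lt_or_ge Δ (N v).card with h | h
      · exact Or.inl ⟨⟨⟨h1, h2⟩, h3⟩, hv, h⟩
      · exact Or.inr ⟨hv, h, ⟨hG.symm _ _ h1, hG.symm _ _ h2⟩, h3⟩
    · rintro (⟨h, -⟩ | ⟨-, -, ⟨h1, h2⟩, h3⟩)
      · exact h
      · exact ⟨⟨hG.symm _ _ h1, hG.symm _ _ h2⟩, h3⟩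
  conv_rhs => rw [this]
  rw [Finset.card_union_of_disjoint]
  · push_cast; rfl
  · rw [Finset.disjoint_left]
    intro v hv hv'
    simp only [Finset.mem_inter, mem_high, Finset.mem_filter] at hv hv'
    omega

/-- Row `o` of `cnt` holds the numbers of common neighbours in `R` of adjacent vertices. -/
def Counted (N : ℕ → Finset ℕ) (R : Finset ℕ) (o : ℕ) (σ : GStore) : Prop :=
  ∀ y, ∀ z ∈ N y, σ.a .cnt o y z = (common N R y z : ℕ)

theorem common_lt {n m : ℕ} {N : ℕ → Finset ℕ} (hG : IsGraph n m N) (hn : 0 < n) (R : Finset ℕ)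
    (y z : ℕ) : common N R y z < n :=
  (Finset.card_le_card (Finset.inter_subset_left.trans Finset.inter_subset_left)).trans_lt
    (hG.card_lt hn y)

/-- The tables from which the numbers of common neighbours can be read. -/
structure Prepared (n : ℕ) (N : ℕ → Finset ℕ) (R : Finset ℕ) (Δ r : ℕ) (σ : GStore) : Prop where
  low : ∀ v < n, (N v).card ≤ Δ → ∀ w ∈ N v, σ.a .low 0 v w = (common N R v w : ℕ)
  acc : ∀ y ∈ high N n Δ, ∀ z ∈ high N n Δ, σ.a .acc r y z = (common N R y z : ℕ)
  lim : σ.v .lim = Δ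
  row : σ.v .row = r

theorem Prepared.congr {n Δ r : ℕ} {N : ℕ → Finset ℕ} {R : Finset ℕ} {σ σ' : GStore}
    (h : Prepared n N R Δ r σ) {c : GCmd} (hag : Agree c σ σ')
    (hv : ∀ x, x = .lim ∨ x = .row → ¬ c.wv x) (ha : ∀ t, t = .low ∨ t = .acc → ¬ c.wa t) :
    Prepared n N R Δ r σ' where
  low := by rw [hag.a _ (ha _ (by simp))]; exact h.low
  acc := by rw [hag.a _ (ha _ (by simp))]; exact h.acc
  lim := by rw [hag.v _ (hv _ (by simp)), h.lim]
  row := by rw [hag.v _ (hv _ (by simp)), h.row]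

/-- If one of the two ends has low degree, the count is in `low`, in the row of that end; if both
are high, it is in `acc`, which by then contains the common neighbours of all degrees. -/
theorem copyEntry_run {E : Env} {n m : ℕ} {N : ℕ → Finset ℕ} {nb : ℕ → ℕ → ℕ} {R : Finset ℕ}
    (hG : IsGraph n m N) {σ : GStore} (hL : Loaded n m N nb R σ) {Δ r o v a : ℕ}
    (hP : Prepared n N R Δ r σ) (hnV : n ≤ E.V) (hrV : r ≤ E.V) (hoV : o ≤ E.V)
    (ho : σ.v .out = o) (hv : σ.v .v = v) (hvn : v < n) (ha : σ.v .a = a) (han : a < (N v).card)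
    (hd : σ.v .d = (N v).card) :
    Run E copyEntry σ 5 (fun σ' => σ'.a .cnt = (σ.setA .cnt o v (nb v a)
      (common N R v (nb v a) : ℕ)).a .cnt) := by
  have hdn := hG.card_lt (by omega) v
  have hwN := hL.nb_mem han
  have hwn : nb v a < n := hG.lt _ _ hwN
  have hcn := common_lt hG (by omega) R v (nb v a)
  unfold copyEntry
  refine .cons 1 (by omega) (.setN (nb v a) (hL.get_nbr (.var hv) (.var ha) (by omega) han
    (by omega)) (by omega) le_rfl ?_)
  have hL₁ := hL.setV .w (nb v a) (by simp) (by simp)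
  have hv₁ : Evals E (σ.setV .w (nb v a)) (vr .v) v := .var (by simpa using hv)
  have hw₁ : Evals E (σ.setV .w (nb v a)) (vr .w) (nb v a) := .var (by simp)
  have ho₁ : Evals E (σ.setV .w (nb v a)) (vr .out) o := .var (by simpa using ho)
  have fin : ∀ (T : ℕ) (e : GExpr), 1 ≤ T →
      Evals E (σ.setV .w (nb v a)) e (common N R v (nb v a) : ℕ) →
      Run E (.put .cnt (vr .out) (vr .v) (vr .w) e) (σ.setV .w (nb v a)) T
        (fun σ₂ => Run E (.block []) σ₂ 1 (fun σ' => σ'.a .cnt = (σ.setA .cnt o v (nb v a)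
          (common N R v (nb v a) : ℕ)).a .cnt)) := by
    intro T e hT he
    exact .put o v (nb v a) _ ho₁ hv₁ hw₁ he (by omega) (by omega) (by omega) (by simp; omega) hT
      (.nil le_rfl rfl)
  refine .cons 3 (by omega) (.ite (Δ + 1 - (N v).card)
    (((Evals.var (by simpa using hP.lim)).add (.lit 1)).sub (.var (by simpa using hd))) (by omega)
    (fun hpos => ?_) (fun hneg => ?_))
  · refine fin _ _ (by omega) ?_
    rw [← hP.low v hvn (by omega) _ hwN]
    exact Evals.get (i := 0) (σ := Store.setV _ _ _) (.lit 0) hv₁ hw₁ (by omega) (by omega)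
      (by omega)
  · refine .ite (Δ + 1 - (N (nb v a)).card) (((Evals.var (by simpa using hP.lim)).add
      (.lit 1)).sub (hL₁.get_deg hw₁ (by omega))) (by omega) (fun hpos => ?_) (fun hneg' => ?_)
    · refine fin _ _ (by omega) ?_
      rw [common_comm, ← hP.low _ hwn (by omega) v (hG.symm _ _ hwN)]
      exact Evals.get (i := 0) (σ := Store.setV _ _ _) (.lit 0) hw₁ hv₁ (by omega) (by omega)
        (by omega)
    · refine fin _ _ (by omega) ?_
      rw [← hP.acc v (mem_high.2 ⟨hvn, by omega⟩) _ (mem_high.2 ⟨hwn, by omega⟩)]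
      exact Evals.get (σ := Store.setV _ _ _) (.var (by simpa using hP.row)) hv₁ hw₁ (by omega)
        (by omega) (by omega)

theorem copyPass_run {E : Env} {n m : ℕ} {N : ℕ → Finset ℕ} {nb : ℕ → ℕ → ℕ} {R : Finset ℕ}
    (hG : IsGraph n m N) {σ : GStore} (hL : Loaded n m N nb R σ) {Δ r o : ℕ}
    (hP : Prepared n N R Δ r σ) (hnV : n ≤ E.V) (hrV : r ≤ E.V) (hoV : o ≤ E.V)
    (ho : σ.v .out = o) (hm : 0 < m) (hnm : n ≤ 2 * m) :
    Run E copyPass σ (28 * m) (fun σ' => Counted N R o σ' ∧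
      ∀ o', o' ≠ o → σ'.a .cnt o' = σ.a .cnt o') := by
  unfold copyPass
  refine .forUp (N := n) (fun v => 7 * (N v).card + 4) (fun s σ' =>
    (∀ v < s, ∀ w ∈ N v, σ'.a .cnt o v w = (common N R v w : ℕ)) ∧
      ∀ o', o' ≠ o → σ'.a .cnt o' = σ.a .cnt o')
    (by simp) (by simp [copyEntry]) (by simp [copyEntry]) hL.varN (by omega) ?_ ?_ ?_ ?_
  · rw [Finset.sum_add_distrib, Finset.sum_add_distrib, sum_const_range, sum_const_range,
      ← Finset.mul_sum, hG.handshake]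
    omega
  · exact ⟨by simp, fun _ _ => rfl⟩
  · rintro v hvn σ₁ hv - hag₁ ⟨h1, h2⟩
    have hL₁ := hL.congr hag₁ (by simp [copyEntry]) (by simp [copyEntry])
    have hP₁ := hP.congr hag₁ (by simp [copyEntry]) (by simp [copyEntry])
    have ho₁ : σ₁.v .out = o := by rw [hag₁.v _ (by simp [copyEntry]), ho]
    have hdn := hG.card_lt (by omega) v
    refine .cons 1 (by omega) (.setN (N v).card (hL₁.get_deg (.var hv) (by omega)) (by omega)
      le_rfl ?_)
    have hL₂ := hL₁.setV .d (N v).card (by simp) (by simp)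
    refine .cons (7 * (N v).card + 2) (by omega) (.forUp (N := (N v).card) (fun _ => 5)
      (fun i σ' => (∀ v' < v, ∀ w ∈ N v', σ'.a .cnt o v' w = (common N R v' w : ℕ)) ∧
        (∀ a < i, σ'.a .cnt o v (nb v a) = (common N R v (nb v a) : ℕ)) ∧
        ∀ o', o' ≠ o → σ'.a .cnt o' = σ.a .cnt o') (by simp)
        (by simp [copyEntry]) (by simp [copyEntry]) (by simp) (by omega) ?_ ?_ ?_ ?_)
    · rw [sum_const_range]; omega
    · exact ⟨by simpa using h1, by simp, by simpa using h2⟩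
    · rintro i hi σ₃ hva hvd hag₃ ⟨g1, g2, g3⟩
      have hL₃ := hL₂.congr hag₃ (by simp [copyEntry]) (by simp [copyEntry])
      have hP₃ : Prepared n N R Δ r σ₃ := Prepared.congr (σ := σ₁.setV .d (N v).card)
        ⟨hP₁.low, hP₁.acc, by simpa using hP₁.lim, by simpa using hP₁.row⟩ hag₃
        (by simp [copyEntry]) (by simp [copyEntry])
      have hv₃ : σ₃.v .v = v := by
        rw [hag₃.v _ (by simp [copyEntry])]; simpa using hv
      have ho₃ : σ₃.v .out = o := by
        rw [hag₃.v _ (by simp [copyEntry])]; simpa using ho₁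
      refine (copyEntry_run hG hL₃ hP₃ hnV hrV hoV ho₃ hv₃ hvn hva hi hvd).mono le_rfl ?_
      intro σ₄ _ k1
      simp only [Store.setV_a, k1]
      refine ⟨?_, ?_, ?_⟩
      · intro v' hv' w hw
        rw [Store.setA_a, if_neg (by omega), g1 v' hv' w hw]
      · intro a ha
        rw [Store.setA_a]
        split_ifs with h
        · rw [h.2.2.2]
        · refine g2 a ?_
          rcases Nat.lt_succ_iff_lt_or_eq.1 ha with ha | rfl
          · exact ha
          · exact absurd ⟨rfl, rfl, rfl, rfl⟩ h
      · intro o' ho'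
        rw [← g3 o' ho']
        funext y z; simp [ho']
    · rintro σ₃ - - ⟨g1, g2, g3⟩
      refine .nil (by omega) ⟨?_, g3⟩
      intro v' hv' w hw
      rcases Nat.lt_succ_iff_lt_or_eq.1 hv' with hv' | rfl
      · exact g1 v' hv' w hw
      · obtain ⟨a, ha, rfl⟩ := ((hL.tables.lists v').mem w).1 hw
        exact g2 a ha
  · rintro σ₁ - - ⟨h1, h2⟩
    exact ⟨fun y z hz => h1 y (hG.lt _ _ (hG.symm _ _ hz)) z hz, h2⟩

/-- The cost of `edgeCounts`, up to the factor `m * D`. -/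
def edgeCost (p : Program) : ℕ := 4 * tryCost p + 130

structure EdgePost (p : Program) (n m : ℕ) (N : ℕ → Finset ℕ) (nb : ℕ → ℕ → ℕ) (R : Finset ℕ)
    (r o r' : ℕ) (σ₀ σ : GStore) : Prop where
  loaded : Loaded n m N nb R σ
  clean : Clean p r' σ
  counted : Counted N R o σ
  rest : ∀ o', o' ≠ o → σ.a .cnt o' = σ₀.a .cnt o'
  run : r ≤ r'
  run_le : r' ≤ r + (2 * n + 32 * m + 1)

theorem findLimit_wv {p : Program} {x : Var} (h : (findLimit p).wv x) :
    (∃ k, x = .ext k) ∨ x = .lim ∨ x = .fin ∨ x = .kl ∨ x = .v ∨ x = .row ∨ x = .bud ∨ x = .off ∨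
      x = .km ∨ x = .p ∨ x = .q ∨ x = .g ∨ x = .h ∨ x = .run := by
  by_contra hx
  push Not at hx
  obtain ⟨h0, h⟩ := hx
  simp_all [findLimit, tryLimit, collectHigh, countBlock, fillFactors, fillEntry, addProduct,
    addEntry]

theorem findLimit_wa {p : Program} {t : Arr} (h : (findLimit p).wa t) :
    t = .rows ∨ t = .mids ∨ t = .mm ∨ t = .acc := by
  by_contra hx
  push Not at hx
  simp_all [findLimit, tryLimit, collectHigh, countBlock, fillFactors, fillEntry, addProduct,
    addEntry]

/-- The final limit is at most `2 * D`, so all three phases take time `O(m * D)`. Only row `o` of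
`cnt` is written: the counts for all vertices and those for a neighbourhood can be kept side by
side. -/
theorem edgeCounts_run {E : Env} {n m c r o D : ℕ} {N : ℕ → Finset ℕ} {nb : ℕ → ℕ → ℕ}
    {R : Finset ℕ} {p : Program} {F : ℕ → ℕ} (hp : p.Deterministic) (hmul : Multiplies p c F)
    (hE : Roomy E n m c) (hG : IsGraph n m N) {σ : GStore} (hL : Loaded n m N nb R σ)
    (hC : Clean p r σ) (hm : 0 < m) (hnm : n ≤ 2 * m) (ho : σ.v .out = o) (hoV : o ≤ E.V)
    (hrV : r + 2 * n + 32 * m + 2 ≤ E.V) (hD : GoodLimit F m D) :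
    Run E (edgeCounts p) σ (edgeCost p * (m * D))
      (fun σ' => ∃ r', EdgePost p n m N nb R r o r' σ σ') := by
  have hsq := hE.square
  have hlin := hE.linear
  have hD1 : 1 ≤ D := by
    rcases Nat.eq_zero_or_pos D with rfl | h
    · have := hD.cube; simp at this; omega
    · exact h
  have hmD : m ≤ m * D := Nat.le_mul_of_pos_right _ hD1
  have hcost : edgeCost p * (m * D) = (4 * tryCost p + 10) * (m * D) + 120 * (m * D) := by
    unfold edgeCost; ring
  rw [hcost]
  unfold edgeCounts
  refine .cons _ (by omega) ((findLimit_run hp hmul hE hG hL hC hm hnm hrV hD).mono le_rfl ?_)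
  rintro σ₁ hag₁ ⟨Δ, r', h1⟩
  have hr1 := h1.run
  have hr2 := h1.run_le
  have hΔ2 := h1.le'
  have hmΔ : m * Δ ≤ 2 * (m * D) := by
    have := Nat.mul_le_mul_left m h1.le
    linarith
  have hcnt₁ : σ₁.a .cnt = σ.a .cnt := hag₁.a _ (fun h => by simpa using findLimit_wa h)
  have ho₁ : σ₁.v .out = o := by rw [hag₁.v _ (fun h => by simpa using findLimit_wv h), ho]
  refine .cons (88 * (m * D)) (by omega) ((lowPass_run hG h1.loaded (r := r') (by nlinarith)
    h1.counted.bound (fun _ _ => rfl) h1.counted.lim h1.counted.row (by omega) h1.pos hm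
    hnm).mono (by omega) ?_)
  intro σ₂ hag₂ h2
  have hL₂ := h1.loaded.congr hag₂ (by simp [lowPass, lowRow, lowEntry])
    (by simp [lowPass, lowRow, lowEntry])
  have hP₂ : Prepared n N R Δ r' σ₂ := by
    refine ⟨h2.low, ?_, ?_, ?_⟩
    · intro y hy z hz
      rw [h2.acc, h1.counted.count y hy z hz, lowSum_add_high hG]
    · rw [hag₂.v _ (by simp [lowPass, lowRow, lowEntry]), h1.counted.lim]
    · rw [hag₂.v _ (by simp [lowPass, lowRow, lowEntry]), h1.counted.row]
  have hcnt₂ : σ₂.a .cnt = σ₁.a .cnt := hag₂.a _ (by simp [lowPass, lowRow, lowEntry])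
  have ho₂ : σ₂.v .out = o := by rw [hag₂.v _ (by simp [lowPass, lowRow, lowEntry]), ho₁]
  have hC₂ : Clean p (r' + 1) σ₂ := by
    refine ⟨?_, ⟨?_, ?_⟩, ?_⟩
    · rw [hag₂.v _ (by simp [lowPass, lowRow, lowEntry]), h1.clean.run]
    · intro x hx hw
      rw [hag₂.v _ (by simp [lowPass, lowRow, lowEntry]), h1.clean.fresh.ext x hx hw]
    · rw [hag₂.a _ (by simp [lowPass, lowRow, lowEntry])]; exact h1.clean.fresh.mm
    · intro r'' y z hr''
      rw [h2.rest r'' (by omega)]; exact h1.clean.acc r'' y z hr''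
  refine .cons (28 * m) (by omega) ((copyPass_run hG hL₂ hP₂ (by omega) (by omega) hoV ho₂ hm
    hnm).mono le_rfl ?_)
  rintro σ₃ hag₃ ⟨h3, h4⟩
  exact .nil (by omega) ⟨r' + 1, hL₂.congr hag₃ (by simp [copyPass, copyEntry])
    (by simp [copyPass, copyEntry]), hC₂.congr hag₃ (by simp [copyPass, copyEntry])
    (by simp [copyPass, copyEntry]), h3, fun o' ho' => by rw [h4 o' ho', hcnt₂, hcnt₁], by omega,
    by omega⟩

/-! ### Dominating triangles -/

/-- `x`, `y`, `z` form a dominating triangle. -/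
structure DomTriple (n : ℕ) (N : ℕ → Finset ℕ) (x y z : ℕ) : Prop where
  xy : y ∈ N x
  xz : z ∈ N x
  yz : z ∈ N y
  dom : N x ∪ N y ∪ N z = Finset.range n

theorem DomTriple.swap {n m : ℕ} {N : ℕ → Finset ℕ} (hG : IsGraph n m N) {x y z : ℕ}
    (h : DomTriple n N x y z) : DomTriple n N y x z :=
  ⟨hG.symm _ _ h.xy, h.yz, h.xz, by rw [Finset.union_comm (N y)]; exact h.dom⟩

theorem DomTriple.rotate {n m : ℕ} {N : ℕ → Finset ℕ} (hG : IsGraph n m N) {x y z : ℕ}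
    (h : DomTriple n N x y z) : DomTriple n N z x y :=
  ⟨hG.symm _ _ h.xz, hG.symm _ _ h.yz, h.xy, by
    rw [← h.dom, Finset.union_assoc, Finset.union_comm]⟩

theorem DomTriple.lt {n m : ℕ} {N : ℕ → Finset ℕ} (hG : IsGraph n m N) {x y z : ℕ}
    (h : DomTriple n N x y z) : x < n ∧ y < n ∧ z < n :=
  ⟨hG.lt _ _ (hG.symm _ _ h.xy), hG.lt _ _ h.xy, hG.lt _ _ h.xz⟩

theorem IsGraph.common_range {n m : ℕ} {N : ℕ → Finset ℕ} (hG : IsGraph n m N) (y z : ℕ) :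
    common N (Finset.range n) y z = (N y ∩ N z).card := by
  unfold common
  rw [Finset.inter_eq_left.2]
  intro v hv
  exact Finset.mem_range.2 (hG.lt _ _ (Finset.mem_inter.1 hv).1)

theorem card_union₃ (A B C : Finset ℕ) : (A ∪ B ∪ C).card + ((A ∩ B).card + (A ∩ C).card +
    (B ∩ C).card) = A.card + B.card + C.card + (B ∩ C ∩ A).card := by
  have h1 := Finset.card_union_add_card_inter (A ∪ B) C
  have h2 := Finset.card_union_add_card_inter A B
  have h3 := Finset.card_union_add_card_inter (A ∩ C) (B ∩ C)
  have h4 : (A ∪ B) ∩ C = (A ∩ C) ∪ (B ∩ C) := Finset.union_inter_distrib_right A B C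
  have h5 : (A ∩ C) ∩ (B ∩ C) = B ∩ C ∩ A := by ext; simp; tauto
  rw [h4] at h1
  rw [h5] at h3
  omega

/-- The number of vertices that `x`, `y`, `z` fail to dominate, negated. -/
noncomputable def excess (n : ℕ) (N : ℕ → Finset ℕ) (x y z : ℕ) : ℤ :=
  (N x).card + (N y).card + (N z).card - common N (Finset.range n) x y -
    common N (Finset.range n) x z - common N (Finset.range n) y z + common N (N x) y z - n

/-- The union of the neighbourhoods lies in the vertex set, so it is the whole set as soon as its
size is n, and `card_union₃` expresses this size by the available counts. -/
theorem domTriple_iff {n m : ℕ} {N : ℕ → Finset ℕ} (hG : IsGraph n m N) (x y z : ℕ) :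
    DomTriple n N x y z ↔ (y ∈ N x ∧ z ∈ N x ∧ z ∈ N y) ∧ excess n N x y z = 0 := by
  have h1 : N x ∪ N y ∪ N z = Finset.range n ↔ (N x ∪ N y ∪ N z).card = n := by
    constructor
    · intro h; rw [h, Finset.card_range]
    · intro h
      refine Finset.eq_of_subset_of_card_le ?_ (by rw [Finset.card_range, h])
      intro v hv
      simp only [Finset.mem_union] at hv
      rw [Finset.mem_range]
      rcases hv with (hv | hv) | hv <;> exact hG.lt _ _ hv
  have h2 := card_union₃ (N x) (N y) (N z)
  have h3 : excess n N x y z = 0 ↔ (N x ∪ N y ∪ N z).card = n := by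
    unfold excess
    rw [hG.common_range, hG.common_range, hG.common_range, common]
    omega
  constructor
  · rintro ⟨a, b, c, d⟩
    exact ⟨⟨a, b, c⟩, h3.2 (h1.1 d)⟩
  · rintro ⟨⟨a, b, c⟩, d⟩
    exact ⟨a, b, c, h1.2 (h3.1 d)⟩

/-- Set `ans` if `x`, `y`, `z` form a dominating triangle; `t` is the number of their common
neighbours. -/
def check : GCmd := .ite (get2 .adj (vr .x) (vr .y) * (get2 .adj (vr .x) (vr .z) *
    get2 .adj (vr .y) (vr .z)))
  (.block [
    .set .g (get1 .deg (vr .x) + get1 .deg (vr .y) + get1 .deg (vr .z) -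
      get2 .cnt (vr .x) (vr .y) - get2 .cnt (vr .x) (vr .z) - get2 .cnt (vr .y) (vr .z) +
      vr .t - vr .n),
    .ite (lt 1 - vr .g * vr .g) (.set .ans (lt 1)) .skip])
  .skip

theorem Counted.congr {N : ℕ → Finset ℕ} {R : Finset ℕ} {o : ℕ} {σ σ' : GStore}
    (h : Counted N R o σ) (he : σ'.a .cnt o = σ.a .cnt o) : Counted N R o σ' := by
  intro y z hz; rw [he]; exact h y z hz

theorem check_run {E : Env} {n m : ℕ} {N : ℕ → Finset ℕ} {nb : ℕ → ℕ → ℕ} {R : Finset ℕ}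
    (hG : IsGraph n m N) {σ : GStore} (hL : Loaded n m N nb R σ)
    (hcnt : Counted N (Finset.range n) 0 σ) (hnV : 8 * n ≤ E.V) {x y z : ℕ} (hxn : x < n)
    (hyn : y < n) (hzn : z < n) (hx : σ.v .x = x) (hy : σ.v .y = y) (hz : σ.v .z = z)
    (ht : y ∈ N x → z ∈ N x → z ∈ N y → σ.v .t = (common N (N x) y z : ℕ)) {P : Prop}
    (hP : σ.v .ans = ind P) :
    Run E check σ 5 (fun σ' => σ'.v .ans = ind (P ∨ DomTriple n N x y z)) := by
  have ex : Evals E σ (vr .x) x := .var hx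
  have ey : Evals E σ (vr .y) y := .var hy
  have ez : Evals E σ (vr .z) z := .var hz
  have hiff := domTriple_iff hG x y z
  unfold check
  refine .ite (ind (y ∈ N x) * (ind (z ∈ N x) * ind (z ∈ N y)))
    ((hL.get_adj ex ey (by omega) (by omega)).mul ((hL.get_adj ex ez (by omega) (by omega)).mul
      (hL.get_adj ey ez (by omega) (by omega)))) (by omega) (fun h => ?_) (fun h => ?_)
  · rw [ind_mul, ind_mul] at h
    have htri : y ∈ N x ∧ z ∈ N x ∧ z ∈ N y := by
      by_contra hc; rw [ind_not hc] at h; omega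
    have ec : ∀ u v, v ∈ N u → ∀ e f : GExpr, Evals E σ e u → Evals E σ f v → u < n → v < n →
        Evals E σ (get2 .cnt e f) (common N (Finset.range n) u v : ℕ) := by
      intro u v huv e f he hf hu hv
      rw [← hcnt u v huv]
      exact Evals.get (i := 0) (.lit 0) he hf (by omega) (by omega) (by omega)
    have hb := fun u => hG.card_lt (by omega : 0 < n) u
    have hc := fun R u v => common_lt hG (by omega : 0 < n) R u v
    refine .cons 1 (by omega) (.set (excess n N x y z) ?_ ?_ le_rfl ?_)
    · exact (((((((hL.get_deg ex (by omega)).add (hL.get_deg ey (by omega))).add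
        (hL.get_deg ez (by omega))).sub (ec _ _ htri.1 _ _ ex ey hxn hyn)).sub
        (ec _ _ htri.2.1 _ _ ex ez hxn hzn)).sub (ec _ _ htri.2.2 _ _ ey ez hyn hzn)).add
        (.var (ht htri.1 htri.2.1 htri.2.2))).sub (.var hL.varN)
    · have := hb x; have := hb y; have := hb z
      have := hc (Finset.range n) x y; have := hc (Finset.range n) x z
      have := hc (Finset.range n) y z; have := hc (N x) y z
      unfold excess
      rw [abs_le]; constructor <;> omega
    -- The language can only test positivity; an integer g is 0 if and only if 1 - g² is positive.
    refine .cons 2 (by omega) (.ite (1 - excess n N x y z * excess n N x y z)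
      ((Evals.lit 1).sub ((Evals.var (by simp)).mul (.var (by simp)))) (by omega)
      (fun h => ?_) (fun h => ?_))
    · have h0 : excess n N x y z = 0 := by
        by_contra h0
        rcases lt_or_gt_of_ne h0 with h1 | h1 <;> nlinarith
      refine .setN 1 (.lit 1) (by omega) (by omega) (.nil (by omega) ?_)
      rw [ind_of (Or.inr (hiff.2 ⟨htri, h0⟩))]; simp
    · refine .skip (by omega) (.nil (by omega) ?_)
      have h0 : ¬ DomTriple n N x y z := by
        intro h'
        rw [(hiff.1 h').2] at h; simp at h
      simpa [h0] using hP
  · refine .skip (by omega) ?_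
    have h0 : ¬ DomTriple n N x y z := by
      intro h'
      rw [ind_of h'.xy, ind_of h'.xz, ind_of h'.yz] at h
      omega
    simpa [h0] using hP

def markAll : GCmd := .forUp .v .n (.put .mark (lt 0) (lt 0) (vr .v) (lt 1))

/-- Mark the neighbours of `x`. -/
def markNbrs : GCmd :=
  .forUp .v .n (.put .mark (lt 0) (lt 0) (vr .v) (get2 .adj (vr .x) (vr .v)))

theorem markAll_run {E : Env} {n m : ℕ} {N : ℕ → Finset ℕ} {nb : ℕ → ℕ → ℕ} {σ : GStore}
    (hT : Tables N nb σ) (hN : σ.v .n = n) (hM : σ.v .m = m) (hnV : n + 1 ≤ E.V) :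
    Run E markAll σ (3 * n + 2) (Loaded n m N nb (Finset.range n)) := by
  unfold markAll
  refine .forUp (N := n) (fun _ => 1) (fun s σ' => ∀ v < s, σ'.a .mark 0 0 v = 1) (by simp)
    (by simp) (by simp) hN (by omega) (by rw [sum_const_range]; omega) (by simp) ?_ ?_
  · intro v hv σ₁ hvv _ _ h
    refine .put 0 0 v 1 (.lit 0) (.lit 0) (.var hvv) (.lit 1) (by omega) (by omega) (by omega)
      (by simp; omega) le_rfl ?_
    intro v' hv'
    by_cases hvv' : v' = v
    · simp [hvv']
    · simp [hvv', h v' (by omega)]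
  · intro σ₁ _ hag h
    refine ⟨by rw [hag.v _ (by simp), hN], by rw [hag.v _ (by simp), hM],
      hT.congr hag (by simp), fun v hv => ?_⟩
    rw [h v hv, ind_of (Finset.mem_range.2 hv)]

theorem markNbrs_run {E : Env} {n m x : ℕ} {N : ℕ → Finset ℕ} {nb : ℕ → ℕ → ℕ} {R : Finset ℕ}
    {σ : GStore} (hL : Loaded n m N nb R σ) (hx : σ.v .x = x) (hxn : x < n) (hnV : n + 1 ≤ E.V) :
    Run E markNbrs σ (3 * n + 2) (Loaded n m N nb (N x)) := by
  unfold markNbrs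
  refine .forUp (N := n) (fun _ => 1) (fun s σ' => ∀ v < s, σ'.a .mark 0 0 v = ind (v ∈ N x))
    (by simp) (by simp) (by simp) hL.varN (by omega) (by rw [sum_const_range]; omega) (by simp) ?_ ?_
  · intro v hv σ₁ hvv _ hag h
    have hx₁ : σ₁.v .x = x := by rw [hag.v _ (by simp), hx]
    refine .put 0 0 v (ind (v ∈ N x)) (.lit 0) (.lit 0) (.var hvv) ?_ (by omega) (by omega)
      (by omega) ((abs_ind_le _).trans (by omega)) le_rfl ?_
    · rw [← hL.tables.adj x v]
      have := hag.a .adj (by simp)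
      rw [← this]
      exact Evals.get (i := 0) (.lit 0) (.var hx₁) (.var hvv) (by omega) (by omega) (by omega)
    intro v' hv'
    by_cases hvv' : v' = v
    · simp [hvv']
    · simp [hvv', h v' (by omega)]
  · intro σ₁ _ hag h
    exact ⟨by rw [hag.v _ (by simp), hL.varN], by rw [hag.v _ (by simp), hL.varM],
      hL.tables.congr hag (by simp), h⟩

/-- Check all triangles with the vertex `x`, using row `1` of `cnt`. -/
def checkEdges : GCmd := .forUp .y .n (.block [
  .set .d (get1 .deg (vr .y)),
  .forUp .i .d (.block [
    .set .z (get2 .nbr (vr .y) (vr .i)),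
    .set .t (.get .cnt (lt 1) (vr .y) (vr .z)),
    check])])

/-- All ordered adjacent pairs (y, z) are tried, in `O(m)` time. Row 0 of `cnt` supplies the pair
counts, and row 1, written with N(x) as the marked set, the triple counts. -/
theorem checkEdges_run {E : Env} {n m x : ℕ} {N : ℕ → Finset ℕ} {nb : ℕ → ℕ → ℕ} {R : Finset ℕ}
    (hG : IsGraph n m N) {σ : GStore} (hL : Loaded n m N nb R σ)
    (hcnt : Counted N (Finset.range n) 0 σ) (hcnt₁ : Counted N (N x) 1 σ) (hnV : 8 * n ≤ E.V)
    (hx : σ.v .x = x) (hxn : x < n) (hm : 0 < m) (hnm : n ≤ 2 * m) {P : Prop}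
    (hP : σ.v .ans = ind P) :
    Run E checkEdges σ (34 * m) (fun σ' =>
      σ'.v .ans = ind (P ∨ ∃ y z, DomTriple n N x y z)) := by
  unfold checkEdges
  refine .forUp (N := n) (fun y => 10 * (N y).card + 4)
    (fun s σ' => σ'.v .ans = ind (P ∨ ∃ y < s, ∃ z, DomTriple n N x y z))
    (by simp) (by simp [check]) (by simp [check]) hL.varN (by omega) ?_ ?_ ?_ ?_
  · rw [Finset.sum_add_distrib, Finset.sum_add_distrib, sum_const_range, sum_const_range,
      ← Finset.mul_sum, hG.handshake]
    omega
  · simpa using hP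
  · intro y hyn σ₁ hy _ hag₁ h1
    have hL₁ := hL.congr hag₁ (by simp [check]) (by simp [check])
    have hx₁ : σ₁.v .x = x := by rw [hag₁.v _ (by simp [check]), hx]
    have hc₁ : σ₁.a .cnt = σ.a .cnt := hag₁.a _ (by simp [check])
    have hdn := hG.card_lt (by omega) y
    refine .cons 1 (by omega) (.setN (N y).card (hL₁.get_deg (.var hy) (by omega)) (by omega)
      le_rfl ?_)
    have hL₂ := hL₁.setV .d (N y).card (by simp) (by simp)
    refine .cons (10 * (N y).card + 2) (by omega) (.forUp (N := (N y).card) (fun _ => 8)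
      (fun i σ' => σ'.v .ans = ind ((P ∨ ∃ y' < y, ∃ z, DomTriple n N x y' z) ∨
        ∃ a < i, DomTriple n N x y (nb y a))) (by simp) (by simp [check]) (by simp [check])
        (by simp) (by omega) ?_ ?_ ?_ ?_)
    · rw [sum_const_range]; omega
    · simpa using h1
    · intro i hi σ₂ hvi _ hag₂ h2
      have hL₃ := hL₂.congr hag₂ (by simp [check]) (by simp [check])
      have hx₂ : σ₂.v .x = x := by rw [hag₂.v _ (by simp [check])]; simpa using hx₁
      have hy₂ : σ₂.v .y = y := by rw [hag₂.v _ (by simp [check])]; simpa using hy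
      have hc₂ : σ₂.a .cnt = σ.a .cnt := by rw [hag₂.a _ (by simp [check])]; simpa using hc₁
      have hzN := hL.nb_mem hi
      have hzn := hG.lt _ _ hzN
      have hcl := common_lt hG (by omega) (N x) y (nb y i)
      refine .cons 1 (by omega) (.setN (nb y i) (hL₃.get_nbr (.var hy₂) (.var hvi) (by omega) hi
        (by omega)) (by omega) le_rfl ?_)
      have hL₄ := hL₃.setV .z (nb y i) (by simp) (by simp)
      refine .cons 1 (by omega) (.setN (common N (N x) y (nb y i)) ?_ (by omega) le_rfl ?_)
      · rw [← hcnt₁ y _ hzN, ← hc₂]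
        exact Evals.get (i := 1) (σ := Store.setV _ _ _) (.lit 1) (.var (by simpa using hy₂))
          (.var (by simp)) (by omega) (by omega) (by omega)
      have hL₅ := hL₄.setV .t (common N (N x) y (nb y i)) (by simp) (by simp)
      refine .cons 5 (by omega) ((check_run hG hL₅ (hcnt.congr (by simp [hc₂])) hnV hxn hyn hzn
        (by simpa using hx₂) (by simpa using hy₂) (by simp) (fun _ _ _ => by simp)
        (by simpa using h2)).mono le_rfl ?_)
      intro σ₃ _ h3
      refine .nil (by omega) ?_
      simp only [Store.setV_v, reduceCtorEq, if_false, h3]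
      refine ind_congr ?_
      rw [or_assoc]
      refine or_congr_right ⟨?_, ?_⟩
      · rintro (⟨a, ha, h⟩ | h)
        exacts [⟨a, by omega, h⟩, ⟨i, by omega, h⟩]
      · rintro ⟨a, ha, h⟩
        rcases Nat.lt_succ_iff_lt_or_eq.1 ha with ha | rfl
        exacts [Or.inl ⟨a, ha, h⟩, Or.inr h]
    · intro σ₂ _ _ h2
      refine .nil (by omega) ?_
      simp only [Store.setV_v, reduceCtorEq, if_false, h2]
      refine ind_congr ?_
      rw [or_assoc]
      refine or_congr_right ⟨?_, ?_⟩
      · rintro (⟨a, ha, h⟩ | ⟨a, ha, h⟩)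
        exacts [⟨a, by omega, h⟩, ⟨y, by omega, _, h⟩]
      · rintro ⟨a, ha, z, h⟩
        rcases Nat.lt_succ_iff_lt_or_eq.1 ha with ha | rfl
        · exact Or.inl ⟨a, ha, z, h⟩
        · obtain ⟨i, hi, rfl⟩ := ((hL.tables.lists a).mem z).1 h.yz
          exact Or.inr ⟨i, hi, h⟩
  · intro σ₁ _ _ h1
    rw [h1]
    refine ind_congr (or_congr_right ⟨?_, ?_⟩)
    · rintro ⟨y, -, h⟩; exact ⟨y, h⟩
    · rintro ⟨y, z, h⟩; exact ⟨y, (h.lt hG).2.1, z, h⟩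

/-- A dominated graph has no isolated vertex, so its degree sum is at least n. -/
theorem DomTriple.edges {n m : ℕ} {N : ℕ → Finset ℕ} (hG : IsGraph n m N) {x y z : ℕ}
    (h : DomTriple n N x y z) : 0 < m ∧ n ≤ 2 * m := by
  have h1 : ∀ v ∈ Finset.range n, 1 ≤ (N v).card := by
    intro v hv
    rw [← h.dom] at hv
    simp only [Finset.mem_union] at hv
    rw [Nat.one_le_iff_ne_zero, Finset.card_ne_zero]
    rcases hv with (hv | hv) | hv
    exacts [⟨_, hG.symm _ _ hv⟩, ⟨_, hG.symm _ _ hv⟩, ⟨_, hG.symm _ _ hv⟩]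
  have h2 := Finset.sum_le_sum h1
  rw [hG.handshake] at h2
  simp at h2
  have := (h.lt hG).1
  omega

/-- The memory at the start: `n` and `m`. -/
structure Initial (n m : ℕ) (σ : GStore) : Prop where
  varN : σ.v .n = n
  varM : σ.v .m = m
  var : ∀ x, x ≠ .n → x ≠ .m → σ.v x = 0
  arr : ∀ t i j k, σ.a t i j k = 0

/-- The input is the list of the edges of `e`. -/
structure IsInput (E : Env) (m : ℕ) (e : ℕ → ℕ × ℕ) : Prop where
  len : E.len = 2 * m
  inp : ∀ i < m, E.inp (2 * i) = (e i).1 ∧ E.inp (2 * i + 1) = (e i).2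

/-- Read the graph and count the common neighbours of all adjacent vertices. -/
def prepare (p : Program) : GCmd :=
  .block [readGraph, markAll, .set .out (lt 0), edgeCounts p]

structure PreparePost (p : Program) (n m : ℕ) (N : ℕ → Finset ℕ) (nb : ℕ → ℕ → ℕ) (r : ℕ)
    (σ : GStore) : Prop where
  loaded : Loaded n m N nb (Finset.range n) σ
  clean : Clean p r σ
  counted : Counted N (Finset.range n) 0 σ
  ans : σ.v .ans = 0
  run_le : r ≤ 2 * n + 32 * m + 1

theorem edgeCounts_wv {p : Program} {x : Var} (h : (edgeCounts p).wv x) :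
    x ≠ .x ∧ x ≠ .y ∧ x ≠ .z ∧ x ≠ .i ∧ x ≠ .t ∧ x ≠ .ans ∧ x ≠ .out ∧ x ≠ .n ∧ x ≠ .m := by
  simp only [edgeCounts, Cmd.wv_block_cons, Cmd.wv_block_nil, or_false] at h
  rcases h with h | h | h
  · have := findLimit_wv h
    refine ⟨?_, ?_, ?_, ?_, ?_, ?_, ?_, ?_, ?_⟩ <;> (rintro rfl; simp at this)
  · simp [lowPass, lowRow, lowEntry] at h
    refine ⟨?_, ?_, ?_, ?_, ?_, ?_, ?_, ?_, ?_⟩ <;> (rintro rfl; simp at h)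
  · simp [copyPass, copyEntry] at h
    refine ⟨?_, ?_, ?_, ?_, ?_, ?_, ?_, ?_, ?_⟩ <;> (rintro rfl; simp at h)

theorem prepare_run {E : Env} {n m c D : ℕ} {e : ℕ → ℕ × ℕ} {p : Program} {F : ℕ → ℕ}
    (hp : p.Deterministic) (hmul : Multiplies p c F) (hE : Roomy E n m c) (he : IsEdges n m e)
    (hI : IsInput E m e) {σ : GStore} (h0 : Initial n m σ) (hm : 0 < m) (hnm : n ≤ 2 * m)
    (hD : GoodLimit F m D) :
    Run E (prepare p) σ ((edgeCost p + 25) * (m * D)) (fun σ' => ∃ nb r,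
      PreparePost p n m (nbrsUpTo e m) nb r σ') := by
  have hlin := hE.linear
  have hsq := hE.square
  have hG := isGraph_nbrsUpTo he le_rfl
  have hD1 : 1 ≤ D := by
    rcases Nat.eq_zero_or_pos D with rfl | h
    · have := hD.cube; simp at this; omega
    · exact h
  have hmD : m ≤ m * D := Nat.le_mul_of_pos_right _ hD1
  have hcost : (edgeCost p + 25) * (m * D) = edgeCost p * (m * D) + 25 * (m * D) := by ring
  rw [hcost]
  unfold prepare
  refine .cons (13 * m + 2) (by omega) ((readGraph_run he h0.varM (by omega) (by omega) hI.len
    hI.inp (h0.arr _ _) (h0.arr _ _ _)).mono le_rfl ?_)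
  rintro σ₁ hag₁ ⟨nb, hT⟩
  refine .cons (3 * n + 2) (by omega) ((markAll_run (n := n) (m := m) hT
    (by rw [hag₁.v _ (by simp [readGraph, pushNbr]), h0.varN])
    (by rw [hag₁.v _ (by simp [readGraph, pushNbr]), h0.varM]) (by omega)).mono le_rfl ?_)
  intro σ₂ hag₂ hL
  have hv₂ : ∀ x, x = .run ∨ x = .ans ∨ (∃ k, x = .ext k) → σ₂.v x = 0 := by
    intro x hx
    rw [hag₂.v _ (by rintro h; simp [markAll] at h; simp [h] at hx),
      hag₁.v _ (by rintro h; simp [readGraph, pushNbr] at h; rcases h with h | h | h <;>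
        simp [h] at hx), h0.var _ (by rintro rfl; simp at hx) (by rintro rfl; simp at hx)]
  have ha₂ : ∀ t, t = .mm ∨ t = .acc → ∀ i j k, σ₂.a t i j k = 0 := by
    intro t ht i j k
    rw [hag₂.a _ (by rintro h; simp [markAll] at h; simp [h] at ht),
      hag₁.a _ (by rintro h; simp [readGraph, pushNbr] at h; rcases h with h | h | h <;>
        simp [h] at ht), h0.arr]
  have hC₂ : Clean p 0 σ₂ := ⟨by simpa using hv₂ .run (by simp),
    ⟨fun x _ _ => hv₂ _ (by simp), fun _ _ _ _ => ha₂ _ (by simp) _ _ _⟩,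
    fun _ _ _ _ => ha₂ _ (by simp) _ _ _⟩
  refine .cons 1 (by omega) (.setN 0 (.lit 0) (by omega) le_rfl ?_)
  refine .cons (edgeCost p * (m * D)) (by omega) ((edgeCounts_run hp hmul hE hG
    (hL.setV .out (0 : ℕ) (by simp) (by simp)) (hC₂.setV .out (0 : ℕ) (by simp) (by simp)) hm hnm
    (o := 0) (by simp) (by omega) (by omega) hD).mono le_rfl ?_)
  rintro σ₃ hag₃ ⟨r', h3⟩
  refine .nil (by omega) ⟨nb, r', h3.loaded, h3.clean, h3.counted, ?_, by have := h3.run_le; omega⟩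
  rw [hag₃.v _ (fun h => by simpa using edgeCounts_wv h)]
  simpa using hv₂ .ans (by simp)

/-! ### The algorithm through vertices of degree at least n / 3 -/

/-- Check all triangles with the vertex `x`. -/
def checkVertex (p : Program) : GCmd := .block [markNbrs, edgeCounts p, checkEdges]

/-- Check all triangles with a vertex of degree at least `n / 3`. -/
def checkHeavy (p : Program) : GCmd := .block [
  prepare p,
  .set .out (lt 1),
  .forUp .x .n (.ite (lt 3 * get1 .deg (vr .x) + lt 1 - vr .n) (checkVertex p) .skip)]

/-- The vertices of degree at least `n / 3`. -/
def heavy (N : ℕ → Finset ℕ) (n : ℕ) : Finset ℕ :=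
  (Finset.range n).filter fun v => n ≤ 3 * (N v).card

theorem heavy_card_mul_le {n m : ℕ} {N : ℕ → Finset ℕ} (hG : IsGraph n m N) :
    (heavy N n).card * n ≤ 6 * m := by
  have h1 := Finset.card_nsmul_le_sum (heavy N n) (fun v => 3 * (N v).card) n
    (fun v hv => (Finset.mem_filter.1 hv).2)
  have h2 : ∑ v ∈ heavy N n, 3 * (N v).card ≤ ∑ v ∈ Finset.range n, 3 * (N v).card :=
    Finset.sum_le_sum_of_subset (Finset.filter_subset _ _)
  rw [← Finset.mul_sum, ← Finset.mul_sum, hG.handshake, Finset.mul_sum] at h2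
  rw [smul_eq_mul] at h1
  omega

/-- The three degrees add up to at least n because the neighbourhoods cover everything, and the
roles of the three vertices are interchangeable. -/
theorem DomTriple.exists_heavy {n m : ℕ} {N : ℕ → Finset ℕ} (hG : IsGraph n m N) {x y z : ℕ}
    (h : DomTriple n N x y z) : ∃ x' ∈ heavy N n, ∃ y' z', DomTriple n N x' y' z' := by
  have h1 : n ≤ (N x).card + (N y).card + (N z).card := by
    have h2 := congrArg Finset.card h.dom
    rw [Finset.card_range] at h2
    have := Finset.card_union_le (N x ∪ N y) (N z)
    have := Finset.card_union_le (N x) (N y)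
    omega
  obtain ⟨hx, hy, hz⟩ := h.lt hG
  have : n ≤ 3 * (N x).card ∨ n ≤ 3 * (N y).card ∨ n ≤ 3 * (N z).card := by omega
  rcases this with h' | h' | h'
  · exact ⟨x, by simp [heavy, hx, h'], y, z, h⟩
  · exact ⟨y, by simp [heavy, hy, h'], x, z, h.swap hG⟩
  · exact ⟨z, by simp [heavy, hz, h'], x, y, h.rotate hG⟩

/-- The cost of `checkHeavy` per heavy vertex, up to the factor `m * D`. -/
def heavyCost (p : Program) : ℕ := edgeCost p + 45

/-- With N(x) marked, the common neighbours of y and z in the marked set are those of x, y and z, so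
one call of `edgeCounts` serves all triangles at x. The output row is 1, which preserves the pair
counts in row 0. -/
theorem checkVertex_run {E : Env} {n m c r x D : ℕ} {N : ℕ → Finset ℕ} {nb : ℕ → ℕ → ℕ}
    {R : Finset ℕ} {p : Program} {F : ℕ → ℕ} (hp : p.Deterministic) (hmul : Multiplies p c F)
    (hE : Roomy E n m c) (hG : IsGraph n m N) {σ : GStore} (hL : Loaded n m N nb R σ)
    (hC : Clean p r σ) (hcnt : Counted N (Finset.range n) 0 σ) (hm : 0 < m) (hnm : n ≤ 2 * m)
    (hx : σ.v .x = x) (hxn : x < n) (ho : σ.v .out = 1)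
    (hrV : r + 2 * n + 32 * m + 2 ≤ E.V) (hD : GoodLimit F m D) {P : Prop}
    (hP : σ.v .ans = ind P) :
    Run E (checkVertex p) σ (heavyCost p * (m * D)) (fun σ' =>
      σ'.v .ans = ind (P ∨ ∃ y z, DomTriple n N x y z) ∧ Loaded n m N nb (N x) σ' ∧
      Counted N (Finset.range n) 0 σ' ∧ ∃ r' ≤ r + (2 * n + 32 * m + 1), Clean p r' σ') := by
  have hlin := hE.linear
  have hD1 : 1 ≤ D := by
    rcases Nat.eq_zero_or_pos D with rfl | h
    · have := hD.cube; simp at this; omega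
    · exact h
  have hmD : m ≤ m * D := Nat.le_mul_of_pos_right _ hD1
  have hcost : heavyCost p * (m * D) = edgeCost p * (m * D) + 45 * (m * D) := by
    unfold heavyCost; ring
  rw [hcost]
  unfold checkVertex
  refine .cons (3 * n + 2) (by omega) ((markNbrs_run hL hx hxn (by omega)).mono le_rfl ?_)
  intro σ₁ hag₁ hL₁
  have hC₁ := hC.congr hag₁ (by simp [markNbrs]) (by simp [markNbrs])
  have ho₁ : σ₁.v .out = (1 : ℕ) := by rw [hag₁.v _ (by simp [markNbrs]), ho]; simp
  refine .cons (edgeCost p * (m * D)) (by omega) ((edgeCounts_run hp hmul hE hG hL₁ hC₁ hm hnm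
    ho₁ (by omega) hrV hD).mono le_rfl ?_)
  rintro σ₂ hag₂ ⟨r', h2⟩
  have hv₂ : ∀ x, x = .x ∨ x = .ans → σ₂.v x = σ.v x := by
    intro x hx
    rw [hag₂.v _ (fun h => by have := edgeCounts_wv h; rcases hx with rfl | rfl <;> simp at this),
      hag₁.v _ (fun h => by simp [markNbrs] at h; simp [h] at hx)]
  have hcnt₂ : Counted N (Finset.range n) 0 σ₂ := hcnt.congr (by
    rw [h2.rest 0 (by omega), hag₁.a _ (by simp [markNbrs])])
  refine .cons (34 * m) (by omega) ((checkEdges_run hG h2.loaded hcnt₂ h2.counted (by omega)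
    ((hv₂ _ (by simp)).trans hx) hxn hm hnm ((hv₂ _ (by simp)).trans hP)).mono le_rfl ?_)
  intro σ₃ hag₃ h3
  exact .nil (by omega) ⟨h3, h2.loaded.congr hag₃ (by simp [checkEdges, check])
    (by simp [checkEdges, check]), hcnt₂.congr (by rw [hag₃.a _ (by simp [checkEdges, check])]),
    r', h2.run_le, h2.clean.congr hag₃ (by simp [checkEdges, check])
    (by simp [checkEdges, check])⟩

/-- One unit in the factor (number of heavy vertices + 1) pays for the preparation and for passing
over the vertices that are not heavy; every heavy vertex pays for one call of `checkVertex`. -/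
theorem checkHeavy_run {E : Env} {n m c D : ℕ} {e : ℕ → ℕ × ℕ} {p : Program} {F : ℕ → ℕ}
    (hp : p.Deterministic) (hmul : Multiplies p c F) (hE : Roomy E n m c) (he : IsEdges n m e)
    (hI : IsInput E m e) {σ : GStore} (h0 : Initial n m σ) (hm : 0 < m) (hnm : n ≤ 2 * m)
    (hD : GoodLimit F m D) :
    Run E (checkHeavy p) σ (heavyCost p * (m * D) * ((heavy (nbrsUpTo e m) n).card + 1))
      (fun σ' => σ'.v .ans = ind (∃ x y z, DomTriple n (nbrsUpTo e m) x y z)) := by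
  set N := nbrsUpTo e m with hN
  have hG : IsGraph n m N := isGraph_nbrsUpTo he le_rfl
  have hlin := hE.linear
  have hsq := hE.square
  have hD1 : 1 ≤ D := by
    rcases Nat.eq_zero_or_pos D with rfl | h
    · have := hD.cube; simp at this; omega
    · exact h
  have hmD : m ≤ m * D := Nat.le_mul_of_pos_right _ hD1
  have hcost : heavyCost p * (m * D) * ((heavy N n).card + 1) =
      (heavy N n).card * (heavyCost p * (m * D)) + ((edgeCost p + 25) * (m * D) +
        20 * (m * D)) := by
    unfold heavyCost; ring
  rw [hcost]
  unfold checkHeavy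
  refine .cons _ (by omega) ((prepare_run hp hmul hE he hI h0 hm hnm hD).mono le_rfl ?_)
  rintro σ₁ - ⟨nb, r, h1⟩
  refine .cons 1 (by omega) (.setN 1 (.lit 1) (by omega) le_rfl ?_)
  have hrle := h1.run_le
  refine .cons ((heavy N n).card * (heavyCost p * (m * D)) + 18 * (m * D)) (by omega)
    (.forUp (N := n) (fun x => 2 + if n ≤ 3 * (N x).card then heavyCost p * (m * D) else 0)
    (fun s σ' => σ'.v .ans = ind (∃ x < s, x ∈ heavy N n ∧ ∃ y z, DomTriple n N x y z) ∧
      σ'.v .out = 1 ∧ (∃ R, Loaded n m N nb R σ') ∧ Counted N (Finset.range n) 0 σ' ∧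
      ∃ r' ≤ (s + 1) * (2 * n + 32 * m + 1), Clean p r' σ')
    (by simp) ?_ ?_ (by simpa using h1.loaded.varN) (by omega) ?_ ?_ ?_ ?_)
  · simp [checkVertex, markNbrs, checkEdges, check]
    exact fun h => by simpa using edgeCounts_wv h
  · simp [checkVertex, markNbrs, checkEdges, check]
    exact fun h => by simpa using edgeCounts_wv h
  · rw [Finset.sum_add_distrib, Finset.sum_add_distrib, sum_const_range,
      ← Finset.sum_filter, Finset.sum_const, smul_eq_mul]
    change 2 + (n * 2 + (heavy N n).card * _ + n * 2) ≤ _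
    omega
  · refine ⟨by simpa using h1.ans, by simp, ⟨_, (h1.loaded.setV _ _ (by simp) (by simp)).setV _ _
      (by simp) (by simp)⟩, h1.counted.congr rfl, r, by omega, (h1.clean.setV _ _ (by simp)
      (by simp)).setV _ _ (by simp) (by simp)⟩
  · rintro x hxn σ₂ hx - - ⟨ha, ho, ⟨R, hL⟩, hcnt, r', hr', hC⟩
    have step : ∀ P : Prop, (∃ x' < x + 1, x' ∈ heavy N n ∧ ∃ y z, DomTriple n N x' y z) ↔
        (∃ x' < x, x' ∈ heavy N n ∧ ∃ y z, DomTriple n N x' y z) ∨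
          (x ∈ heavy N n ∧ ∃ y z, DomTriple n N x y z) := by
      intro _
      constructor
      · rintro ⟨x', hx', h⟩
        rcases Nat.lt_succ_iff_lt_or_eq.1 hx' with hx' | rfl
        exacts [Or.inl ⟨x', hx', h⟩, Or.inr h]
      · rintro (⟨x', hx', h⟩ | h)
        exacts [⟨x', by omega, h⟩, ⟨x, by omega, h⟩]
    have hexp : (x + 1 + 1) * (2 * n + 32 * m + 1) =
      (x + 1) * (2 * n + 32 * m + 1) + (2 * n + 32 * m + 1) := by ring
    -- Rows of `mm` and `acc` are never reused. Each vertex takes at most 2n + 32m + 1 of them, so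
    -- the row numbers stay quadratic in the input size and fit into a word.
    have hrV : (x + 1) * (2 * n + 32 * m + 1) ≤ n * (2 * n + 32 * m + 1) :=
      Nat.mul_le_mul_right _ (by omega)
    refine .ite (3 * (N x).card + 1 - n) ((((Evals.lit 3).mul (hL.get_deg (.var hx)
      (by omega))).add (.lit 1)).sub (.var hL.varN)) (by omega) (fun h => ?_) (fun h => ?_)
    · have hxh : n ≤ 3 * (N x).card := by omega
      refine (checkVertex_run hp hmul hE hG hL hC hcnt hm hnm hx hxn ho ?_ hD ha).mono
        ?_ ?_
      · nlinarith
      · rw [if_pos hxh]; omega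
      · rintro σ₃ hag₃ ⟨g1, g2, g3, r₃, hr₃, g4⟩
        have ho₃ : σ₃.v .out = 1 := by
          rw [hag₃.v _ (by
            simp [checkVertex, markNbrs, checkEdges, check]
            exact fun h => by simpa using edgeCounts_wv h), ho]
        refine ⟨?_, by simpa using ho₃, ⟨_, g2.setV _ _ (by simp) (by simp)⟩, g3.congr rfl, r₃,
          by omega, g4.setV _ _ (by simp) (by simp)⟩
        simp only [Store.setV_v, reduceCtorEq, if_false, g1]
        refine ind_congr ?_
        rw [step True]
        refine or_congr_right ?_
        simp [heavy, hxn, hxh]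
    · have hxh : ¬ n ≤ 3 * (N x).card := by omega
      refine .skip (by omega) ⟨?_, by simpa using ho, ⟨_, hL.setV _ _ (by simp) (by simp)⟩,
        hcnt.congr rfl, r', by omega, hC.setV _ _ (by simp) (by simp)⟩
      simp only [Store.setV_v, reduceCtorEq, if_false, ha]
      refine ind_congr ?_
      rw [step True]
      simp [heavy, hxh]
  · rintro σ₂ - - ⟨h2, -⟩
    refine .nil (by omega) ?_
    rw [h2]
    refine ind_congr ⟨?_, ?_⟩
    · rintro ⟨x, -, -, h⟩; exact ⟨x, h⟩
    · rintro ⟨x, y, z, h⟩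
      obtain ⟨x', hx', h'⟩ := h.exists_heavy hG
      exact ⟨x', (h'.choose_spec.choose_spec.lt hG).1, hx', h'⟩

/-- Run `c` unless some vertex is isolated for lack of edges, and output `ans`. -/
def guarded (c : GCmd) : GCmd := .block [
  .ite (.band (vr .m) (lt 2 * vr .m + lt 1 - vr .n)) c .skip,
  .set .n (vr .ans)]

/-- If n is large compared to m, the time bounds may allow no more than a constant, too little for
reading the graph. In this case some vertex is isolated and the answer is no, so the time `T` is
charged only if the test succeeds. -/
theorem guarded_run {E : Env} {n m c T : ℕ} {e : ℕ → ℕ × ℕ} (he : IsEdges n m e) {C : GCmd}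
    {σ : GStore} (h0 : Initial n m σ) (hE : Roomy E n m c)
    (hC : 0 < m → n ≤ 2 * m → Run E C σ T (fun σ' =>
      σ'.v .ans = ind (∃ x y z, DomTriple n (nbrsUpTo e m) x y z))) :
    Run E (guarded C) σ ((if 0 < m ∧ n ≤ 2 * m then T else 0) + 4) (fun σ' =>
      σ'.v .n = ind (∃ x y z, DomTriple n (nbrsUpTo e m) x y z)) := by
  have hlin := hE.linear
  have hG := isGraph_nbrsUpTo he le_rfl
  unfold guarded
  obtain ⟨X, hX⟩ : ∃ X, X = if 0 < m ∧ n ≤ 2 * m then T else 0 := ⟨_, rfl⟩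
  rw [← hX]
  refine .cons (X + 2) (by omega) (Run.mono (T' := X + 2) (Q' := fun σ' =>
      σ'.v .ans = ind (∃ x y z, DomTriple n (nbrsUpTo e m) x y z)) (.ite _
      ((Evals.var h0.varM).band (fun _ => (((Evals.lit 2).mul (.var h0.varM)).add (.lit 1)).sub
        (.var h0.varN))) (by omega) (fun h => ?_) (fun h => ?_)) le_rfl ?_)
  · have h1 : 0 < m ∧ n ≤ 2 * m := by split_ifs at h <;> omega
    rw [if_pos h1] at hX
    exact (hC h1.1 h1.2).mono (by omega) (fun _ _ h => h)
  · have h1 : ¬ (0 < m ∧ n ≤ 2 * m) := by split_ifs at h <;> omega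
    refine .skip (by omega) ?_
    rw [h0.var _ (by simp) (by simp), ind_not]
    rintro ⟨x, y, z, h⟩
    exact h1 (h.edges hG)
  · intro σ₁ _ h1
    exact .cons 1 (by omega) (.set _ (.var h1) ((abs_ind_le _).trans (by omega)) le_rfl
      (.nil (by omega) (by simp)))

/-! ### The algorithm through all vertices and their partners -/

/-- The power of an expression. -/
def Expr.pow {ν α : Type} (e : Expr ν α) : ℕ → Expr ν α
  | 0 => .lit 1
  | k + 1 => e.pow k * e

theorem Evals.pow {ν α : Type} {E : Env} {σ : Store ν α} {e : Expr ν α} {a : ℤ}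
    (h : Evals E σ e a) (k : ℕ) : Evals E σ (e.pow k) (a ^ k) := by
  induction k with
  | zero => rw [pow_zero]; exact Evals.lit 1
  | succ k ih => rw [pow_succ]; exact ih.mul h

/-- Count the common neighbours of `x` and pairs of `rows`, for the next `kl` neighbours of `x`. -/
def countChunk (p : Program) (c₂ : ℕ) : GCmd := .block [
  .set .bud ((vr .n + vr .m + lt 2).pow c₂),
  countBlock p,
  .set .off (vr .off + vr .kl)]

/-- The middle vertices are consumed in chunks of `kl`, the number of rows, so that every product is
square; the last chunk is padded. All chunks add to the same row of `acc`. -/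
def countTriples (p : Program) (c₂ : ℕ) : GCmd := .block [
  .set .row (vr .run),
  .set .off (lt 0),
  .loop (vr .km - vr .off) (countChunk p c₂)]

def chunkCost (p : Program) : ℕ := 44 + 3 * p.size

structure TriplesPost (p : Program) (n m : ℕ) (N : ℕ → Finset ℕ) (nb : ℕ → ℕ → ℕ) (R S M : Finset ℕ)
    (r r' : ℕ) (σ : GStore) : Prop where
  loaded : Loaded n m N nb R σ
  clean : Clean p r' σ
  row : σ.v .row = r
  le : r' ≤ r + n
  count : ∀ y ∈ S, ∀ z ∈ S, σ.a .acc r y z = ((((N y ∩ N z) ∩ R) ∩ M).card : ℕ)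

theorem countBlock_wv {p : Program} {x : Var} (h : (countBlock p).wv x) :
    (∃ k, x = .ext k) ∨ x = .bud ∨ x = .p ∨ x = .q ∨ x = .g ∨ x = .h ∨ x = .run := by
  by_contra hx
  push Not at hx
  obtain ⟨h0, h⟩ := hx
  simp_all [countBlock, fillFactors, fillEntry, addProduct, addEntry]

theorem countBlock_wa {p : Program} {t : Arr} (h : (countBlock p).wa t) : t = .mm ∨ t = .acc := by
  by_contra hx
  push Not at hx
  simp_all [countBlock, fillFactors, fillEntry, addProduct, addEntry]

theorem sum_range_if_lt (o b : ℕ) (f : ℕ → ℤ) (h : b ≤ o) :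
    ∑ l ∈ Finset.range o, (if l < b then f l else 0) = ∑ l ∈ Finset.range b, f l := by
  rw [← Finset.sum_filter]
  congr 1
  ext l; simp; omega

/-- There are at most b/k + 1 chunks, each of cost `O(k * H)`, hence the total (b + k)H. The
hypothesis `hkb` excludes k = 0 with b > 0, where the offset would never advance. -/
theorem countTriples_run {E : Env} {n m c c₂ r k b H : ℕ} {N : ℕ → Finset ℕ} {nb : ℕ → ℕ → ℕ}
    {R S M : Finset ℕ} {lst md : ℕ → ℕ} {p : Program} {F : ℕ → ℕ} (hp : p.Deterministic)
    (hmul : Multiplies p c F) (hE : Roomy E n m c) (hbig : (n + m + 2) ^ c₂ ≤ E.V)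
    (hF : ∀ k, 0 < k → F k < (k + 2) ^ c₂) (hG : IsGraph n m N) {σ : GStore}
    (hL : Loaded n m N nb R σ) (hC : Clean p r σ) (hkl : σ.v .kl = k) (hkm : σ.v .km = b)
    (hrows : ∀ i < k, σ.a .rows 0 0 i = lst i ∧ lst i < n)
    (hmids : ∀ i < b, σ.a .mids 0 0 i = md i ∧ md i < n) (hS : Enumerates lst k S)
    (hM : Enumerates md b M) (hkn : k ≤ n) (hbn : b ≤ n) (hkb : k = 0 → b = 0)
    (hrV : r + n + 1 ≤ E.V) (hH : 0 < k → k ≤ H ∧ F k ≤ k * H) :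
    Run E (countTriples p c₂) σ ((b + k) * (chunkCost p * H) + 4) (fun σ' => ∃ r',
      TriplesPost p n m N nb R S M r r' σ') := by
  have hlin := hE.linear
  unfold countTriples
  refine .cons 1 (by omega) (.setN r (.var hC.run) (by omega) le_rfl ?_)
  refine .cons 1 (by omega) (.setN 0 (.lit 0) (by omega) le_rfl ?_)
  have hL₁ := (hL.setV .row r (by simp) (by simp)).setV .off (0 : ℕ) (by simp) (by simp)
  have hC₁ := (hC.setV .row r (by simp) (by simp)).setV .off (0 : ℕ) (by simp) (by simp)
  refine .cons ((b + k) * (chunkCost p * H) + 1) (by omega) (.loop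
    (fun σ' => ∃ o r₁ : ℕ, σ'.v .off = o ∧ o ≤ b + k ∧ Loaded n m N nb R σ' ∧ σ'.v .run = r₁ ∧
      r ≤ r₁ ∧ r₁ ≤ r + o ∧ r₁ ≤ r + n ∧ (0 < o → r < r₁) ∧ Fresh p r₁ σ' ∧
      (∀ r' y z, r₁ ≤ r' → r' ≠ r → σ'.a .acc r' y z = 0) ∧ (∀ y z, |σ'.a .acc r y z| ≤ o) ∧
      ∀ y ∈ S, ∀ z ∈ S, σ'.a .acc r y z = ∑ l ∈ Finset.range o,
        if l < b then ind (md l ∈ (N y ∩ N z) ∩ R) else 0)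
    -- A chunk advances the offset by k and is charged k units of the potential. The offset may
    -- overshoot b by less than k, hence b + k.
    (fun σ' => 1 + (b + k - (σ'.v .off).toNat) * (chunkCost p * H)) ?_ ?_ ?_)
  · refine ⟨0, r, by simp, by omega, hL₁, hC₁.run, le_rfl, by omega, by omega, by omega, hC₁.fresh,
      fun r' y z h _ => hC₁.acc r' y z h, fun y z => ?_, fun y _ z _ => ?_⟩
    · rw [hC₁.acc r y z le_rfl]; simp
    · rw [hC₁.acc r y z le_rfl]; simp
  · simp; omega
  rintro σ₁ hag₁ ⟨o, r₁, ho, hobk, hL₂, hrun, hr1, hr2, hr3, hr4, hfresh, hacc0, habs, hcount⟩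
  have hrow : σ₁.v .row = r := by
    rw [hag₁.v _ (by simp [countChunk]; exact fun h => by simpa using countBlock_wv h)]; simp
  have hkl₁ : σ₁.v .kl = k := by
    rw [hag₁.v _ (by simp [countChunk]; exact fun h => by simpa using countBlock_wv h)]
    simpa using hkl
  have hkm₁ : σ₁.v .km = b := by
    rw [hag₁.v _ (by simp [countChunk]; exact fun h => by simpa using countBlock_wv h)]
    simpa using hkm
  have hrows₁ : σ₁.a .rows = σ.a .rows := by
    rw [hag₁.a _ (by simp [countChunk]; exact fun h => by simpa using countBlock_wa h)]; simp
  have hmids₁ : σ₁.a .mids = σ.a .mids := by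
    rw [hag₁.a _ (by simp [countChunk]; exact fun h => by simpa using countBlock_wa h)]; simp
  refine ⟨b - o, (Evals.var hkm₁).sub (.var ho), fun hneg => ⟨by omega, ?_⟩, fun hpos => ?_⟩
  · refine .nil (by omega) ⟨r₁, hL₂, ⟨hrun, hfresh, ?_⟩, hrow, by omega, ?_⟩
    · intro r' y z hr'
      by_cases h : r' = r
      · subst h
        have h0 : o = 0 := by by_contra h0; have := hr4 (by omega); omega
        have := habs y z
        rw [h0] at this
        simpa using this
      · exact hacc0 r' y z hr' h
    · intro y hy z hz
      rw [hcount y hy z hz, sum_range_if_lt _ _ _ (by omega),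
        hM.sum_eq (fun v => ind (v ∈ (N y ∩ N z) ∩ R)), sum_ind_eq_card,
        Finset.filter_mem_eq_inter, Finset.inter_comm]
  · have hob : o < b := by omega
    have hk : 0 < k := by by_contra h; have := hkb (by omega); omega
    obtain ⟨hkH, hFk⟩ := hH hk
    have hkk : k * k ≤ k * H := Nat.mul_le_mul_left _ hkH
    have hk1 : 1 ≤ k * H := Nat.mul_pos hk (by omega)
    have hps : p.size * (min ((n + m + 2) ^ c₂) (F k) + 2) ≤ p.size * (3 * (k * H)) :=
      Nat.mul_le_mul_left _ (by omega)
    have hQ : k * (chunkCost p * H) = 44 * (k * H) + p.size * (3 * (k * H)) := by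
      unfold chunkCost; ring
    refine ⟨40 * (k * k) + p.size * (min ((n + m + 2) ^ c₂) (F k) + 2) + 3, ?_⟩
    unfold countChunk
    refine .cons 1 (by omega) (.setN ((n + m + 2) ^ c₂) ?_ hbig le_rfl ?_)
    · have := Evals.pow (((Evals.var hL₂.varN).add (.var hL₂.varM)).add (.lit (E := E) 2)) c₂
      exact this.congr (by push_cast; ring)
    have hL₃ := hL₂.setV .bud ((n + m + 2) ^ c₂ : ℕ) (by simp) (by simp)
    have hB : BlockBounds E n k b o r₁ r :=
      ⟨hk, hE.cube hkn, by omega, by omega, by omega, by omega⟩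
    have hSet : BlockSetup E N R n k b o r₁ r lst md (σ₁.setV .bud ((n + m + 2) ^ c₂ : ℕ)) :=
      ⟨by simpa using hkl₁, by simpa using hkm₁, by simpa using ho, by simpa using hrun,
        by simpa using hrow, by simpa [hrows₁] using hrows, by simpa [hmids₁] using hmids,
        fun u _ v _ => hL₃.tables.adj u v, hL₃.mark⟩
    refine .cons (40 * (k * k) + p.size * (min ((n + m + 2) ^ c₂) (F k) + 2)) (by omega)
      ((countBlock_run hp hmul hB hSet ⟨by simpa using hfresh.ext, hfresh.mm⟩ (hE.mul_le hkn)
      (hE.le_mul k) (by simp) hbig (fun y z => ?_)).mono le_rfl ?_)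
    · have := habs y z
      simp only [Store.setV_a]
      omega
    rintro σ₂ hag₂ ⟨β', hpost⟩
    -- The budget exceeds the running time of the product, so this call never runs out; here the
    -- limited execution serves only to embed the program.
    have hβ : 0 < β' := by
      have h1 := hpost.spent
      have h2 := hF k hk
      have h3 : (k + 2) ^ c₂ ≤ (n + m + 2) ^ c₂ := Nat.pow_le_pow_left (by omega) _
      omega
    have hadd := hpost.done hβ
    have ho₂ : σ₂.v .off = o := by
      rw [hag₂.v _ (fun h => by simpa using countBlock_wv h)]; simpa using ho
    have hkl₂ : σ₂.v .kl = k := by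
      rw [hag₂.v _ (fun h => by simpa using countBlock_wv h)]; simpa using hkl₁
    have hL₄ := hL₃.congr hag₂ (fun x hx h => by
      have := countBlock_wv h; rcases hx with rfl | rfl <;> simp at this) (fun x hx h => by
      have := countBlock_wa h; rcases hx with rfl | rfl | rfl | rfl <;> simp at this)
    have hps' : ∀ y z, |pairSum lst (blockEntry N R b o lst md k) k (k * k) y z| ≤ k :=
      pairSum_bound (abs_blockEntry_le N R b o lst md k) hS.inj
    refine .cons 1 (by omega) (.setN (o + k) ?_ (by omega) le_rfl (.nil (by omega)
      ⟨⟨o + k, r₁ + 1, by simp, by omega, hL₄.setV _ _ (by simp) (by simp), ?_, by omega, by omega,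
      ?_, by omega, ?_, ?_, ?_, ?_⟩, ?_⟩))
    · push_cast; exact (Evals.var ho₂).add (.var hkl₂)
    · simpa using hpost.run
    · omega
    · exact ⟨by simpa using hpost.fresh.ext, hpost.fresh.mm⟩
    · intro r' y z h h'
      rw [Store.setV_a, hadd.rest r' h', Store.setV_a]
      exact hacc0 r' y z (by omega) h'
    · intro y z
      rw [Store.setV_a, hadd.here, Store.setV_a]
      have := abs_add_le (σ₁.a .acc r y z) (pairSum lst (blockEntry N R b o lst md k) k (k * k) y z)
      have := habs y z
      have := hps' y z
      push_cast; linarith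
    · intro y hy z hz
      rw [Store.setV_a, hadd.here, Store.setV_a, hcount y hy z hz,
        pairSum_blockEntry hS hG.symm hy hz, Finset.sum_range_add]
    · obtain ⟨w, rfl⟩ := Nat.exists_eq_add_of_lt hob
      have e1 : o + w + 1 + k - o = w + 1 + k := by omega
      have e2 : o + w + 1 + k - (o + k) = w + 1 := by omega
      simp only [Store.setV_v, if_true, ho, Int.toNat_natCast, e1, e2]
      rw [add_mul (w + 1) k]
      omega

/-- Check all triangles of `x` and two vertices in `rows`. -/
def checkRows : GCmd := .forUp .i .kl (.block [
  .set .y (get1 .rows (vr .i)),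
  .forUp .a .kl (.block [
    .set .z (get1 .rows (vr .a)),
    .set .t (.get .acc (vr .row) (vr .y) (vr .z)),
    check])])

theorem exists_lt_succ {P : ℕ → Prop} {s : ℕ} : (∃ i < s + 1, P i) ↔ (∃ i < s, P i) ∨ P s := by
  constructor
  · rintro ⟨i, hi, h⟩
    rcases Nat.lt_succ_iff_lt_or_eq.1 hi with hi | rfl
    exacts [Or.inl ⟨i, hi, h⟩, Or.inr h]
  · rintro (⟨i, hi, h⟩ | h)
    exacts [⟨i, by omega, h⟩, ⟨s, by omega, h⟩]

theorem checkRows_run {E : Env} {n m x r k : ℕ} {N : ℕ → Finset ℕ} {nb : ℕ → ℕ → ℕ}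
    {R S : Finset ℕ} {lst : ℕ → ℕ} (hG : IsGraph n m N) {σ : GStore} (hL : Loaded n m N nb R σ)
    (hcnt : Counted N (Finset.range n) 0 σ) (hnV : 8 * n ≤ E.V) (hx : σ.v .x = x) (hxn : x < n)
    (hkl : σ.v .kl = k) (hkn : k ≤ n) (hrow : σ.v .row = r) (hrV : r ≤ E.V)
    (hrows : ∀ i < k, σ.a .rows 0 0 i = lst i ∧ lst i < n) (hS : Enumerates lst k S)
    (hacc : ∀ y ∈ S, ∀ z ∈ S, σ.a .acc r y z = (common N (N x) y z : ℕ)) {P : Prop}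
    (hP : σ.v .ans = ind P) :
    Run E checkRows σ (16 * (k * k) + 2) (fun σ' =>
      σ'.v .ans = ind (P ∨ ∃ y ∈ S, ∃ z ∈ S, DomTriple n N x y z)) := by
  unfold checkRows
  refine .forUp (N := k) (fun _ => 10 * k + 4)
    (fun s σ' => σ'.v .ans = ind (P ∨ ∃ i < s, ∃ a < k, DomTriple n N x (lst i) (lst a)))
    (by simp) (by simp [check]) (by simp [check]) hkl (by omega) ?_ (by simpa using hP) ?_ ?_
  · rw [sum_const_range]
    rcases Nat.eq_zero_or_pos k with rfl | hk
    · simp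
    · nlinarith
  · intro i hik σ₁ hi hkl₁ hag₁ h1
    obtain ⟨hyi, hyn⟩ := hrows i hik
    have hr₁ : σ₁.a .rows = σ.a .rows := hag₁.a _ (by simp [check])
    refine .cons 1 (by omega) (.setN (lst i) ?_ (by omega) le_rfl ?_)
    · rw [← hyi, ← hr₁]
      exact Evals.get (i := 0) (j := 0) (.lit 0) (.lit 0) (.var hi) (by omega) (by omega) (by omega)
    refine .cons (10 * k + 2) (by omega) (.forUp (N := k) (fun _ => 8)
      (fun s σ' => σ'.v .ans = ind ((P ∨ ∃ i' < i, ∃ a < k, DomTriple n N x (lst i') (lst a)) ∨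
        ∃ a < s, DomTriple n N x (lst i) (lst a))) (by simp) (by simp [check]) (by simp [check])
        (by simpa using hkl₁) (by omega) (by rw [sum_const_range]; omega) (by simpa using h1) ?_ ?_)
    · intro a hak σ₂ hva _ hag₂ h2
      obtain ⟨hza, hzn⟩ := hrows a hak
      have hL₂ := (hL.congr hag₁ (by simp [check]) (by simp [check])).setV .y (lst i) (by simp)
        (by simp)
      have hL₃ := hL₂.congr hag₂ (by simp [check]) (by simp [check])
      have hx₂ : σ₂.v .x = x := by
        rw [hag₂.v _ (by simp [check])]
        simp only [Store.setV_v, reduceCtorEq, if_false]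
        rw [hag₁.v _ (by simp [check]), hx]
      have hy₂ : σ₂.v .y = lst i := by rw [hag₂.v _ (by simp [check])]; simp
      have hrow₂ : σ₂.v .row = r := by
        rw [hag₂.v _ (by simp [check])]
        simp only [Store.setV_v, reduceCtorEq, if_false]
        rw [hag₁.v _ (by simp [check]), hrow]
      have ha₂ : σ₂.a = σ.a := by
        funext t
        rw [hag₂.a _ (by simp [check]), Store.setV_a, hag₁.a _ (by simp [check])]
      have hcl := common_lt hG (by omega) (N x) (lst i) (lst a)
      have hac := hacc _ (hS.apply_mem hik) _ (hS.apply_mem hak)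
      refine .cons 1 (by omega) (.setN (lst a) ?_ (by omega) le_rfl ?_)
      · rw [← hza, ← ha₂]
        exact Evals.get (i := 0) (j := 0) (.lit 0) (.lit 0) (.var hva) (by omega) (by omega)
          (by omega)
      have hL₄ := hL₃.setV .z (lst a) (by simp) (by simp)
      refine .cons 1 (by omega) (.setN (common N (N x) (lst i) (lst a)) ?_ (by omega) le_rfl ?_)
      · rw [← hac, ← ha₂]
        exact Evals.get (σ := Store.setV _ _ _) (.var (by simpa using hrow₂))
          (.var (by simpa using hy₂)) (.var (by simp)) (by omega) (by omega) (by omega)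
      have hL₅ := hL₄.setV .t (common N (N x) (lst i) (lst a)) (by simp) (by simp)
      refine .cons 5 (by omega) ((check_run hG hL₅ (hcnt.congr (by simp [ha₂])) hnV hxn hyn hzn
        (by simpa using hx₂) (by simpa using hy₂) (by simp) (fun _ _ _ => by simp)
        (by simpa using h2)).mono le_rfl ?_)
      intro σ₃ _ h3
      refine .nil (by omega) ?_
      simp only [Store.setV_v, reduceCtorEq, if_false, h3]
      exact ind_congr (by rw [exists_lt_succ (s := a), or_assoc])
    · intro σ₂ _ _ h2
      refine .nil (by omega) ?_
      simp only [Store.setV_v, reduceCtorEq, if_false, h2]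
      exact ind_congr (by rw [exists_lt_succ (s := i), or_assoc])
  · intro σ₁ _ _ h1
    rw [h1]
    refine ind_congr (or_congr_right ⟨?_, ?_⟩)
    · rintro ⟨i, hi, a, ha, h⟩
      exact ⟨_, hS.apply_mem hi, _, hS.apply_mem ha, h⟩
    · rintro ⟨y, hy, z, hz, h⟩
      obtain ⟨i, hi, rfl⟩ := (hS.mem y).1 hy
      obtain ⟨a, ha, rfl⟩ := (hS.mem z).1 hz
      exact ⟨i, hi, a, ha, h⟩

/-- List the possible partners of `x`: its neighbours if its degree is at most `lim`, and otherwise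
all vertices of degree more than `lim`. -/
def chooseRows : GCmd := .ite (vr .lim + lt 1 - get1 .deg (vr .x))
  (.block [
    .set .kl (get1 .deg (vr .x)),
    .forUp .i .kl (.put .rows (lt 0) (lt 0) (vr .i) (get2 .nbr (vr .x) (vr .i)))])
  collectHigh

def listNbrs : GCmd := .block [
  .set .km (get1 .deg (vr .x)),
  .forUp .i .km (.put .mids (lt 0) (lt 0) (vr .i) (get2 .nbr (vr .x) (vr .i)))]

def treatVertex (p : Program) (c₂ : ℕ) : GCmd :=
  .block [chooseRows, listNbrs, countTriples p c₂, checkRows]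

/-- Set `lim` to the square root of `m`, rounded down. -/
def sqrtLimit : GCmd := .block [
  .set .lim (lt 0),
  .loop (vr .m + lt 1 - (vr .lim + lt 1) * (vr .lim + lt 1)) (.set .lim (vr .lim + lt 1))]

def checkAll (p : Program) (c₂ : ℕ) : GCmd :=
  .block [prepare p, sqrtLimit, .forUp .x .n (treatVertex p c₂)]

/-- The possible partners of `x`. -/
def partners (N : ℕ → Finset ℕ) (n Δ x : ℕ) : Finset ℕ :=
  if (N x).card ≤ Δ then N x else high N n Δ

/-- The vertices of low degree contribute at most the degree sum 2m. The k vertices of high degree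
contribute k each, and k² ≤ 4m, since k ≤ 2(Δ + 1) and k(Δ + 1) ≤ 2m. -/
theorem sum_partners_le {n m Δ : ℕ} {N : ℕ → Finset ℕ} (hG : IsGraph n m N)
    (hΔ : m < (Δ + 1) * (Δ + 1)) :
    ∑ x ∈ Finset.range n, (partners N n Δ x).card ≤ 6 * m := by
  have h1 := hG.high_card_mul_le Δ
  set k := (high N n Δ).card with hk
  have hk2 : k ≤ 2 * (Δ + 1) := by
    by_contra h
    have h2 : (2 * (Δ + 1)) * (Δ + 1) ≤ k * (Δ + 1) := Nat.mul_le_mul_right _ (by omega)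
    nlinarith
  have h3 : k * k ≤ 4 * m := by
    calc k * k ≤ k * (2 * (Δ + 1)) := Nat.mul_le_mul_left _ hk2
      _ = 2 * (k * (Δ + 1)) := by ring
      _ ≤ 4 * m := by omega
  have h4 : ∀ x ∈ Finset.range n, (partners N n Δ x).card ≤
      (N x).card + if Δ < (N x).card then k else 0 := by
    intro x _
    unfold partners
    split_ifs <;> omega
  refine (Finset.sum_le_sum h4).trans ?_
  rw [Finset.sum_add_distrib, hG.handshake, ← Finset.sum_filter, Finset.sum_const, smul_eq_mul]
  change 2 * m + k * k ≤ _
  omega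

/-- In the case of high degree, k(Δ + 1) ≤ 2m < 2(Δ + 1)², so k is less than 2(Δ + 1). -/
theorem partners_card_le {n m Δ : ℕ} {N : ℕ → Finset ℕ} (hG : IsGraph n m N)
    (hΔ : m < (Δ + 1) * (Δ + 1)) (x : ℕ) : (partners N n Δ x).card ≤ 2 * Δ + 1 := by
  have h1 := hG.high_card_mul_le Δ
  unfold partners
  split_ifs with h
  · omega
  · by_contra h'
    have h2 : (2 * (Δ + 1)) * (Δ + 1) ≤ (high N n Δ).card * (Δ + 1) :=
      Nat.mul_le_mul_right _ (by omega)
    nlinarith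

theorem partners_lt {n m Δ : ℕ} {N : ℕ → Finset ℕ} (hG : IsGraph n m N) {x y : ℕ}
    (h : y ∈ partners N n Δ x) : y < n := by
  unfold partners at h
  split_ifs at h
  · exact hG.lt _ _ h
  · exact (mem_high.1 h).1

/-- If a dominating triangle has a vertex of low degree, this vertex is taken as x, and the other
two are among its neighbours. Otherwise all three have high degree, and any of them can be x. -/
theorem exists_domTriple_iff {n m : ℕ} {N : ℕ → Finset ℕ} (hG : IsGraph n m N) (Δ : ℕ) :
    (∃ x < n, ∃ y ∈ partners N n Δ x, ∃ z ∈ partners N n Δ x, DomTriple n N x y z) ↔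
      ∃ x y z, DomTriple n N x y z := by
  constructor
  · rintro ⟨x, -, y, -, z, -, h⟩; exact ⟨x, y, z, h⟩
  · have low : ∀ x y z, DomTriple n N x y z → (N x).card ≤ Δ →
        ∃ x < n, ∃ y ∈ partners N n Δ x, ∃ z ∈ partners N n Δ x, DomTriple n N x y z := by
      intro x y z h hx
      exact ⟨x, (h.lt hG).1, y, by simp [partners, hx, h.xy], z, by simp [partners, hx, h.xz], h⟩
    rintro ⟨x, y, z, h⟩
    by_cases hx : (N x).card ≤ Δ
    · exact low x y z h hx
    by_cases hy : (N y).card ≤ Δ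
    · exact low y x z (h.swap hG) hy
    by_cases hz : (N z).card ≤ Δ
    · exact low z x y (h.rotate hG) hz
    obtain ⟨h1, h2, h3⟩ := h.lt hG
    exact ⟨x, h1, y, by rw [partners, if_neg hx, mem_high]; exact ⟨h2, by omega⟩, z,
      by rw [partners, if_neg hx, mem_high]; exact ⟨h3, by omega⟩, h⟩

theorem sqrtLimit_run {E : Env} {m : ℕ} {σ : GStore} (hM : σ.v .m = m) (hmV : m ≤ E.V) :
    Run E sqrtLimit σ (2 * m + 3) (fun σ' => ∃ Δ : ℕ, σ'.v .lim = Δ ∧ Δ * Δ ≤ m ∧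
      m < (Δ + 1) * (Δ + 1)) := by
  unfold sqrtLimit
  refine .cons 1 (by omega) (.setN 0 (.lit 0) (by omega) le_rfl ?_)
  refine .cons (2 * m + 1) (by omega) (.loop (fun σ' => ∃ Δ : ℕ, σ'.v .lim = Δ ∧ Δ * Δ ≤ m)
    (fun σ' => 1 + 2 * (m - (σ'.v .lim).toNat)) ⟨0, by simp, by simp⟩ (by simp; omega) ?_)
  rintro σ₁ hag ⟨Δ, hΔ, hle⟩
  have hm₁ : σ₁.v .m = m := by rw [hag.v _ (by simp)]; simpa using hM
  refine ⟨m + 1 - (Δ + 1) * (Δ + 1), ((Evals.var hm₁).add (.lit 1)).sub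
    (((Evals.var hΔ).add (.lit 1)).mul ((Evals.var hΔ).add (.lit 1))), fun h => ⟨by omega, ?_⟩,
    fun h => ?_⟩
  · refine .nil (by omega) ⟨Δ, hΔ, hle, ?_⟩
    zify; linarith
  · have h1 : (Δ + 1) * (Δ + 1) ≤ m := by zify; linarith
    have h2 : Δ + 1 ≤ m := by nlinarith
    refine ⟨1, .setN (Δ + 1) ?_ (by omega) le_rfl ⟨⟨Δ + 1, by simp, h1⟩, ?_⟩⟩
    · push_cast; exact (Evals.var hΔ).add (.lit 1)
    · have : ((((Δ + 1 : ℕ) : ℤ)).toNat) = Δ + 1 := by omega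
      simp only [Store.setV_v, if_true, hΔ, Int.toNat_natCast, this]
      omega

theorem copyNbrs_run {E : Env} {n m x : ℕ} {N : ℕ → Finset ℕ} {nb : ℕ → ℕ → ℕ} {R : Finset ℕ}
    (hG : IsGraph n m N) {σ : GStore} (hL : Loaded n m N nb R σ) (hx : σ.v .x = x) (hxn : x < n)
    (hnV : n ≤ E.V) {w : Var} {t : Arr} (h1 : w ≠ .i) (h2 : w ≠ .x ∧ w ≠ .n ∧ w ≠ .m)
    (h3 : t = .rows ∨ t = .mids) :
    Run E (.block [.set w (get1 .deg (vr .x)),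
      .forUp .i w (.put t (lt 0) (lt 0) (vr .i) (get2 .nbr (vr .x) (vr .i)))]) σ
      (3 * (N x).card + 4) (fun σ' => σ'.v w = (N x).card ∧
        ∀ i < (N x).card, σ'.a t 0 0 i = nb x i) := by
  have hd := hG.card_lt (by omega) x
  refine .cons 1 (by omega) (.setN (N x).card (hL.get_deg (.var hx) (by omega)) (by omega)
    le_rfl ?_)
  have hL₁ := hL.setV w (N x).card h2.2.1 h2.2.2
  refine .cons (3 * (N x).card + 2) (by omega) (.forUp (N := (N x).card) (fun _ => 1)
    (fun s σ' => ∀ i < s, σ'.a t 0 0 i = nb x i) h1 (by simp) (by simp) (by simp) (by omega)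
    (by rw [sum_const_range]; omega) (by simp) ?_ ?_)
  · intro i hi σ₁ hvi _ hag h
    have hL₂ := hL₁.congr hag (by simp) (by rcases h3 with rfl | rfl <;> simp)
    have hx₁ : σ₁.v .x = x := by
      rw [hag.v _ (by simp)]; simpa [h2.1.symm] using hx
    have hwn := hG.lt _ _ (hL.nb_mem hi)
    refine .put 0 0 i (nb x i) (.lit 0) (.lit 0) (.var hvi) (hL₂.get_nbr (.var hx₁) (.var hvi)
      (by omega) hi (by omega)) (by omega) (by omega) (by omega) (by simp; omega) le_rfl ?_
    intro i' hi'
    by_cases hii : i' = i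
    · simp [hii]
    · simp [hii, h i' (by omega)]
  · intro σ₁ _ hag h
    refine .nil (by omega) ⟨?_, h⟩
    rw [hag.v _ (by simp [h1])]
    simp

theorem chooseRows_run {E : Env} {n m x Δ : ℕ} {N : ℕ → Finset ℕ} {nb : ℕ → ℕ → ℕ} {R : Finset ℕ}
    (hG : IsGraph n m N) {σ : GStore} (hL : Loaded n m N nb R σ) (hx : σ.v .x = x) (hxn : x < n)
    (hlim : σ.v .lim = Δ) (hnV : n ≤ E.V) :
    Run E chooseRows σ (3 * (N x).card + 5 + if Δ < (N x).card then 7 * n else 0) (fun σ' =>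
      ∃ lst, Enumerates lst (partners N n Δ x).card (partners N n Δ x) ∧
        σ'.v .kl = (partners N n Δ x).card ∧
        ∀ i < (partners N n Δ x).card, σ'.a .rows 0 0 i = lst i) := by
  unfold chooseRows
  refine .ite (Δ + 1 - (N x).card) (((Evals.var hlim).add (.lit 1)).sub
    (hL.get_deg (.var hx) (by omega))) (by omega) (fun h => ?_) (fun h => ?_)
  · have hd : (N x).card ≤ Δ := by omega
    have hp : partners N n Δ x = N x := by simp [partners, hd]
    rw [if_neg (by omega), hp]
    refine (copyNbrs_run hG hL hx hxn hnV (by simp) (by simp) (by simp)).mono (by omega) ?_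
    rintro σ₁ - ⟨h1, h2⟩
    exact ⟨nb x, hL.tables.lists x, h1, h2⟩
  · have hd : ¬ (N x).card ≤ Δ := by omega
    have hp : partners N n Δ x = high N n Δ := by simp [partners, hd]
    rw [if_pos (by omega), hp]
    refine (collectHigh_run hL hlim hnV).mono (by omega) ?_
    rintro σ₁ - ⟨lst, h1⟩
    exact ⟨lst, h1.enum, h1.kl, h1.rows⟩

/-- `H` bounds the cost per row of the multiplications of matrices with at most `2 * √m + 1` rows. -/
def GoodBound (F : ℕ → ℕ) (m H : ℕ) : Prop :=
  ∀ k, (k * k ≤ 4 * m) → k + 1 ≤ H ∧ F (k + 1) ≤ (k + 1) * H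

/-- With N(x) as list of middle vertices, the common neighbours of y and z that occur in it are the
common neighbours of x, y and z, although all vertices are marked. So the marks of the preparation
can stay. -/
theorem treatVertex_run {E : Env} {n m c c₂ r x Δ H : ℕ} {N : ℕ → Finset ℕ} {nb : ℕ → ℕ → ℕ}
    {p : Program} {F : ℕ → ℕ} (hp : p.Deterministic) (hmul : Multiplies p c F)
    (hE : Roomy E n m c) (hbig : (n + m + 2) ^ c₂ ≤ E.V)
    (hF : ∀ k, 0 < k → F k < (k + 2) ^ c₂) (hG : IsGraph n m N) {σ : GStore}
    (hL : Loaded n m N nb (Finset.range n) σ) (hC : Clean p r σ)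
    (hcnt : Counted N (Finset.range n) 0 σ) (hx : σ.v .x = x) (hxn : x < n) (hlim : σ.v .lim = Δ)
    (hΔ : Δ * Δ ≤ m) (hΔ' : m < (Δ + 1) * (Δ + 1)) (hH : GoodBound F m H)
    (hrV : r + n + 1 ≤ E.V) {P : Prop} (hP : σ.v .ans = ind P) :
    Run E (treatVertex p c₂) σ (((N x).card + (partners N n Δ x).card) * (chunkCost p * H) +
        16 * ((partners N n Δ x).card * H) + 6 * (N x).card + 16 +
        if Δ < (N x).card then 7 * n else 0)
      (fun σ' => σ'.v .ans = ind (P ∨ ∃ y ∈ partners N n Δ x, ∃ z ∈ partners N n Δ x,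
          DomTriple n N x y z) ∧
        Loaded n m N nb (Finset.range n) σ' ∧ Counted N (Finset.range n) 0 σ' ∧
        ∃ r' ≤ r + n, Clean p r' σ') := by
  have hlin := hE.linear
  have hdn := hG.card_lt (by omega) x
  have hb : ∀ k, 0 < k → k ≤ 2 * Δ + 1 → k ≤ H ∧ F k ≤ k * H := by
    intro k hk hk'
    obtain ⟨j, rfl⟩ : ∃ j, k = j + 1 := ⟨k - 1, by omega⟩
    refine hH j ?_
    have : j * j ≤ (2 * Δ) * (2 * Δ) := Nat.mul_le_mul (by omega) (by omega)
    nlinarith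
  have hSΔ := partners_card_le hG hΔ' x (n := n)
  have hSn : ∀ v ∈ partners N n Δ x, v < n := fun v => partners_lt hG
  -- A vertex of high degree is among its own partners, so the list is empty only for an isolated
  -- vertex.
  have hkb : (partners N n Δ x).card = 0 → (N x).card = 0 := by
    intro h
    by_contra h'
    unfold partners at h
    split_ifs at h with h1
    · exact h' h
    · rw [Finset.card_eq_zero] at h
      have : x ∈ high N n Δ := mem_high.2 ⟨hxn, by omega⟩
      rw [h] at this
      simp at this
  have hkn : (partners N n Δ x).card ≤ n := by
    have := Finset.card_le_card (fun v hv => Finset.mem_range.2 (hSn v hv))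
    simpa using this
  set S := partners N n Δ x with hSdef
  have hkk : S.card * S.card ≤ S.card * H := by
    rcases Nat.eq_zero_or_pos S.card with h | h
    · simp [h]
    · exact Nat.mul_le_mul_left _ (hb _ h hSΔ).1
  obtain ⟨X, hX⟩ : ∃ X, X = if Δ < (N x).card then 7 * n else 0 := ⟨_, rfl⟩
  rw [← hX]
  unfold treatVertex
  refine .cons (3 * (N x).card + 5 + X) (by omega)
    ((chooseRows_run hG hL hx hxn hlim (by omega)).mono (by omega) ?_)
  rintro σ₁ hag₁ ⟨lst, hS, hkl, hrows⟩
  have hL₁ := hL.congr hag₁ (by simp [chooseRows, collectHigh]) (by simp [chooseRows, collectHigh])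
  have hC₁ := hC.congr hag₁ (by simp [chooseRows, collectHigh]) (by simp [chooseRows, collectHigh])
  have hx₁ : σ₁.v .x = x := by rw [hag₁.v _ (by simp [chooseRows, collectHigh]), hx]
  have hP₁ : σ₁.v .ans = ind P := by rw [hag₁.v _ (by simp [chooseRows, collectHigh]), hP]
  have hcnt₁ : σ₁.a .cnt = σ.a .cnt := hag₁.a _ (by simp [chooseRows, collectHigh])
  refine .cons (3 * (N x).card + 4) (by omega) ((copyNbrs_run hG hL₁ hx₁ hxn (by omega)
    (w := .km) (t := .mids) (by simp) (by simp) (by simp)).mono (by omega) ?_)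
  rintro σ₂ hag₂ ⟨hkm, hmids⟩
  have hL₂ := hL₁.congr hag₂ (by simp) (by simp)
  have hC₂ := hC₁.congr hag₂ (by simp) (by simp)
  have hx₂ : σ₂.v .x = x := by rw [hag₂.v _ (by simp), hx₁]
  have hP₂ : σ₂.v .ans = ind P := by rw [hag₂.v _ (by simp), hP₁]
  have hcnt₂ : σ₂.a .cnt = σ.a .cnt := by rw [hag₂.a _ (by simp), hcnt₁]
  have hkl₂ : σ₂.v .kl = S.card := by rw [hag₂.v _ (by simp), hkl]
  have hrows₂ : σ₂.a .rows = σ₁.a .rows := hag₂.a _ (by simp)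
  refine .cons (((N x).card + S.card) * (chunkCost p * H) + 4) (by omega) ((countTriples_run hp
    hmul hE hbig hF hG hL₂ hC₂ hkl₂ hkm
    (fun i hi => ⟨by rw [hrows₂, hrows i hi], hSn _ (hS.apply_mem hi)⟩)
    (fun i hi => ⟨hmids i hi, hG.lt _ _ (hL.nb_mem hi)⟩) hS (hL.tables.lists x) hkn hdn.le hkb hrV
    (fun h => hb _ h hSΔ)).mono le_rfl ?_)
  rintro σ₃ hag₃ ⟨r', h3⟩
  have fv : ∀ y, y = .x ∨ y = .ans ∨ y = .kl → σ₃.v y = σ₂.v y := by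
    intro y hy
    refine hag₃.v _ (fun h => ?_)
    simp only [countTriples, countChunk, Cmd.wv_block_cons, Cmd.wv_block_nil, Cmd.wv_set,
      Cmd.wv_loop, or_false] at h
    rcases h with rfl | rfl | rfl | h | rfl
    · simp at hy
    · simp at hy
    · simp at hy
    · have := countBlock_wv h
      rcases hy with rfl | rfl | rfl <;> simp at this
    · simp at hy
  have fa : ∀ t, t = .rows ∨ t = .cnt → σ₃.a t = σ₂.a t := by
    intro t ht
    refine hag₃.a _ (fun h => ?_)
    simp [countTriples, countChunk] at h
    have := countBlock_wa h
    rcases ht with rfl | rfl <;> simp at this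
  have hcnt₃ : Counted N (Finset.range n) 0 σ₃ :=
    hcnt.congr (by rw [fa _ (by simp), hcnt₂])
  refine .cons (16 * (S.card * S.card) + 2) (by omega) ((checkRows_run hG h3.loaded hcnt₃
    (by omega) ((fv _ (by simp)).trans hx₂) hxn ((fv _ (by simp)).trans hkl₂) hkn h3.row (by omega)
    (fun i hi => ⟨by rw [fa _ (by simp), hrows₂, hrows i hi], hSn _ (hS.apply_mem hi)⟩) hS ?_
    ((fv _ (by simp)).trans hP₂)).mono le_rfl ?_)
  · intro y hy z hz
    rw [h3.count y hy z hz, common]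
    congr 3
    rw [Finset.inter_eq_left]
    intro v hv
    exact Finset.mem_range.2 (hG.lt _ _ (Finset.mem_inter.1 hv).1)
  · intro σ₄ hag₄ h4
    exact .nil (by omega) ⟨h4, h3.loaded.congr hag₄ (by simp [checkRows, check])
      (by simp [checkRows, check]), hcnt₃.congr (by rw [hag₄.a _ (by simp [checkRows, check])]),
      r', h3.le, h3.clean.congr hag₄ (by simp [checkRows, check]) (by simp [checkRows, check])⟩

/-- The cost of `checkAll`, up to the factor `m * D + m * H`. -/
def allCost (p : Program) : ℕ := edgeCost p + 8 * chunkCost p + 250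

/-- Summing the costs of the vertices with `sum_partners_le` gives `O(m * H)`; `m * D` is the cost
of the pair counts. -/
theorem checkAll_run {E : Env} {n m c c₂ D H : ℕ} {e : ℕ → ℕ × ℕ} {p : Program} {F : ℕ → ℕ}
    (hp : p.Deterministic) (hmul : Multiplies p c F) (hE : Roomy E n m c)
    (hbig : (n + m + 2) ^ c₂ ≤ E.V) (hF : ∀ k, 0 < k → F k < (k + 2) ^ c₂) (he : IsEdges n m e)
    (hI : IsInput E m e) {σ : GStore} (h0 : Initial n m σ) (hm : 0 < m) (hnm : n ≤ 2 * m)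
    (hD : GoodLimit F m D) (hH : GoodBound F m H) :
    Run E (checkAll p c₂) σ (allCost p * (m * D + m * H))
      (fun σ' => σ'.v .ans = ind (∃ x y z, DomTriple n (nbrsUpTo e m) x y z)) := by
  set N := nbrsUpTo e m with hN
  have hG : IsGraph n m N := isGraph_nbrsUpTo he le_rfl
  have hlin := hE.linear
  have hsq := hE.square
  have hH1 : 1 ≤ H := by have := (hH 0 (by omega)).1; omega
  have hmH : m ≤ m * H := Nat.le_mul_of_pos_right _ hH1
  have hcost : allCost p * (m * D + m * H) = (edgeCost p + 25) * (m * D) +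
      8 * m * (chunkCost p * H) + 250 * (m * H) +
      ((8 * chunkCost p + 225) * (m * D) + edgeCost p * (m * H)) := by
    unfold allCost; ring
  rw [hcost]
  unfold checkAll
  refine .cons _ (by omega) ((prepare_run hp hmul hE he hI h0 hm hnm hD).mono le_rfl ?_)
  rintro σ₁ - ⟨nb, r, h1⟩
  refine .cons (2 * m + 3) (by omega) ((sqrtLimit_run h1.loaded.varM (by omega)).mono le_rfl ?_)
  rintro σ₂ hag₂ ⟨Δ, hlim, hΔ, hΔ'⟩
  have hL₂ := h1.loaded.congr hag₂ (by simp [sqrtLimit]) (by simp [sqrtLimit])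
  have hC₂ := h1.clean.congr hag₂ (by simp [sqrtLimit]) (by simp [sqrtLimit])
  have hans₂ : σ₂.v .ans = 0 := by rw [hag₂.v _ (by simp [sqrtLimit]), h1.ans]
  have hcnt₂ : Counted N (Finset.range n) 0 σ₂ :=
    h1.counted.congr (by rw [hag₂.a _ (by simp [sqrtLimit])])
  have hrle := h1.run_le
  have hw : ∀ x, x = .x ∨ x = .n ∨ x = .lim → ¬ (treatVertex p c₂).wv x := by
    intro x hx h
    simp only [treatVertex, chooseRows, collectHigh, listNbrs, countTriples, countChunk, checkRows,
      check, Cmd.wv_block_cons, Cmd.wv_block_nil, Cmd.wv_set, Cmd.wv_loop, or_false, Cmd.wv_ite,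
      Cmd.wv_forUp, Cmd.wv_put, Cmd.wv_skip] at h
    have hb : (countBlock p).wv x → False := fun h => by
      have := countBlock_wv h
      rcases hx with rfl | rfl | rfl <;> simp at this
    rcases hx with rfl | rfl | rfl <;> (simp at h; exact hb h)
  -- For each vertex of high degree the list of all such vertices is made anew in time 7n. There are
  -- at most 2Δ + 1 ≤ H of them, and n ≤ 2m.
  have hhigh : (high N n Δ).card * (7 * n) ≤ 14 * (m * H) := by
    have h1 := hG.high_card_mul_le Δ
    have h2 : (high N n Δ).card ≤ H := by
      have h3 : (high N n Δ).card ≤ 2 * Δ + 1 := by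
        by_contra h'
        have h2 : (2 * (Δ + 1)) * (Δ + 1) ≤ (high N n Δ).card * (Δ + 1) :=
          Nat.mul_le_mul_right _ (by omega)
        nlinarith
      exact h3.trans (hH (2 * Δ) (by nlinarith)).1
    calc (high N n Δ).card * (7 * n) ≤ H * (7 * (2 * m)) := Nat.mul_le_mul h2 (by omega)
      _ = 14 * (m * H) := by ring
  refine .cons (8 * m * (chunkCost p * H) + 240 * (m * H)) (by omega) (.forUp (N := n)
    (fun x => ((N x).card + (partners N n Δ x).card) * (chunkCost p * H) +
        16 * ((partners N n Δ x).card * H) + 6 * (N x).card + 16 +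
        if Δ < (N x).card then 7 * n else 0)
    (fun s σ' => σ'.v .ans = ind (∃ x < s, ∃ y ∈ partners N n Δ x, ∃ z ∈ partners N n Δ x,
        DomTriple n N x y z) ∧ Loaded n m N nb (Finset.range n) σ' ∧
      Counted N (Finset.range n) 0 σ' ∧ ∃ r' ≤ 2 * n + 32 * m + 1 + s * n, Clean p r' σ')
    (by simp) (hw _ (by simp)) (hw _ (by simp)) hL₂.varN (by omega) ?_ ?_ ?_ ?_)
  · have hs := sum_partners_le hG hΔ' (n := n)
    simp only [Finset.sum_add_distrib, sum_const_range, ← Finset.sum_mul, ← Finset.mul_sum,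
      hG.handshake]
    rw [← Finset.sum_filter, Finset.sum_const, smul_eq_mul]
    change 2 + ((2 * m + _) * _ + _ + _ + _ + (high N n Δ).card * (7 * n) + _) ≤ _
    have e1 : (2 * m + ∑ x ∈ Finset.range n, (partners N n Δ x).card) * (chunkCost p * H) ≤
        8 * m * (chunkCost p * H) := Nat.mul_le_mul_right _ (by omega)
    have e2 : (∑ x ∈ Finset.range n, (partners N n Δ x).card) * H ≤ 6 * (m * H) := by
      rw [← mul_assoc]; exact Nat.mul_le_mul_right _ hs
    omega
  · exact ⟨by simpa using hans₂, hL₂.setV _ _ (by simp) (by simp), hcnt₂.congr rfl, r, by omega,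
      hC₂.setV _ _ (by simp) (by simp)⟩
  · rintro x hxn σ₃ hx - hag₃ ⟨ha, hL, hcnt, r', hr', hC⟩
    have hlim₃ : σ₃.v .lim = Δ := by
      rw [hag₃.v _ (by simpa using hw .lim (by simp)), hlim]
    have hxx : (x + 1) * n ≤ n * n := Nat.mul_le_mul_right _ (by omega)
    have hxe : (x + 1) * n = x * n + n := by ring
    refine (treatVertex_run hp hmul hE hbig hF hG hL hC hcnt hx hxn hlim₃ hΔ hΔ' hH
      (by nlinarith) ha).mono le_rfl ?_
    rintro σ₄ - ⟨g1, g2, g3, r₄, hr₄, g4⟩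
    refine ⟨?_, g2.setV _ _ (by simp) (by simp), g3.congr rfl, r₄, by omega,
      g4.setV _ _ (by simp) (by simp)⟩
    simp only [Store.setV_v, reduceCtorEq, if_false, g1]
    exact ind_congr (exists_lt_succ
      (P := fun x => ∃ y ∈ partners N n Δ x, ∃ z ∈ partners N n Δ x, DomTriple n N x y z)).symm
  · rintro σ₃ - - ⟨h3, -⟩
    refine .nil (by omega) ?_
    rw [h3]
    exact ind_congr (exists_domTriple_iff hG Δ)

/-! ### Programs for Dominating Triangle -/

theorem Exec.arith_eq {W : ℕ} {s : RamState} (o : ArithOp) (x y z : ℕ) {k : ℤ}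
    (hk : o.eval (s.reg y) (s.reg z) = k) (hW : |k| ≤ W) :
    Exec W (.arith o x y z) s [] 1 (s.setReg x k) := by
  subst hk; exact Exec.arith s o x y z hW

@[simp] theorem RamState.setReg_reg (s : RamState) (x : ℕ) (k : ℤ) (y : ℕ) :
    (s.setReg x k).reg y = if y = x then k else s.reg y := by
  simp [RamState.setReg, Function.update_apply]

@[simp] theorem RamState.setReg_mem (s : RamState) (x : ℕ) (k : ℤ) :
    (s.setReg x k).mem = s.mem := rfl

/-- Multiply register `1` with the `k`-th power of register `7`. -/
def powCode : ℕ → Program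
  | 0 => .skip
  | k + 1 => .seq (powCode k) (.arith .mul 1 1 7)

theorem powCode_exec {W b : ℕ} (hb : 0 < b) (k : ℕ) {s : RamState} (h7 : s.reg 7 = b)
    (h1 : s.reg 1 = 1) (hW : b ^ k ≤ W) :
    Exec W (powCode k) s [] (k + 1) (s.setReg 1 (b ^ k : ℕ)) := by
  induction k with
  | zero =>
    have : s.setReg 1 ((b ^ 0 : ℕ) : ℤ) = s := by
      ext y
      · simp only [RamState.setReg_reg]; split_ifs with h <;> simp [*]
      · rfl
    rw [this]; exact Exec.skip s
  | succ k ih =>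
    have hle : b ^ k ≤ b ^ (k + 1) := Nat.pow_le_pow_right hb (by omega)
    have h2 : Exec W (.arith .mul 1 1 7) (s.setReg 1 (b ^ k : ℕ)) [] 1
        ((s.setReg 1 (b ^ k : ℕ)).setReg 1 (b ^ (k + 1) : ℕ)) := by
      refine Exec.arith_eq .mul 1 1 7 ?_ (by simpa using (by exact_mod_cast hW))
      simp [ArithOp.eval, h7, pow_succ]
    have e : (s.setReg 1 (b ^ k : ℕ)).setReg 1 (b ^ (k + 1) : ℕ) = s.setReg 1 (b ^ (k + 1) : ℕ) := by
      ext y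
      · simp only [RamState.setReg_reg]; split_ifs <;> rfl
      · rfl
    rw [e] at h2
    exact (ih (hle.trans hW)).seqNil h2

theorem powCode_deterministic (k : ℕ) : (powCode k).Deterministic := by
  induction k with
  | zero => trivial
  | succ k ih => exact ⟨ih, trivial⟩

/-- Set up the registers for compiled code on graphs. -/
def graphSetup (c : ℕ) : Program :=
  .seq (.arith .add 2 1 5) <| .seq (.arith .add 3 1 1) <| .seq (.arith .add 1 0 1) <|
  .seq (.const 7 2) <| .seq (.arith .add 7 1 7) <| .seq (.const 1 1) <| .seq (powCode c) <|
  .seq (.const 9 1) (.arith .add 1 1 9)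

/-- Register 1 delivers m but has to hold the base `V + 1` for the compiled code; so m is first
copied to register 2, the place of the variable `m`, by adding register 5, which is still 0. -/
theorem graphSetup_exec {W n m c : ℕ} {s : RamState} (h0 : s.reg 0 = n) (h1 : s.reg 1 = m)
    (h2 : ∀ x, 2 ≤ x → s.reg x = 0) (hc : 1 ≤ c) (hW : 2 * (n + m + 2) ^ c ≤ W) :
    ∃ s', Exec W (graphSetup c) s [] (c + 9) s' ∧ s'.mem = s.mem ∧ s'.reg 0 = n ∧
      s'.reg 1 = ((n + m + 2) ^ c + 1 : ℕ) ∧ s'.reg 2 = m ∧ s'.reg 3 = (2 * m : ℕ) ∧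
      s'.reg 5 = 0 ∧ ∀ x, x % 2 = 0 → 4 ≤ x → s'.reg x = 0 := by
  have hle : n + m + 2 ≤ (n + m + 2) ^ c := Nat.le_self_pow (by omega) _
  have hpos : 1 ≤ (n + m + 2) ^ c := Nat.one_le_pow _ _ (by omega)
  have a5 : s.reg 5 = 0 := h2 5 (by omega)
  have s1 := Exec.arith_eq (W := W) (s := s) .add 2 1 5 (k := m)
    (by simp [ArithOp.eval, h1, a5]) (by simp; omega)
  have s2 := Exec.arith_eq (W := W) (s := s.setReg 2 m) .add 3 1 1 (k := (2 * m : ℕ))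
    (by simp [ArithOp.eval, h1]; ring) (by rw [Nat.abs_cast]; omega)
  have s3 := Exec.arith_eq (W := W) (s := (s.setReg 2 m).setReg 3 (2 * m : ℕ)) .add 1 0 1
    (k := (n + m : ℕ)) (by simp [ArithOp.eval, h1, h0]) (by rw [Nat.abs_cast]; omega)
  have s4 := Exec.const (W := W) (((s.setReg 2 m).setReg 3 (2 * m : ℕ)).setReg 1 (n + m : ℕ)) 7 2
    (by simp; omega)
  have s5 := Exec.arith_eq (W := W) (s := ((((s.setReg 2 m).setReg 3 (2 * m : ℕ)).setReg 1
    (n + m : ℕ)).setReg 7 2)) .add 7 1 7 (k := (n + m + 2 : ℕ))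
    (by simp [ArithOp.eval]) (by rw [Nat.abs_cast]; omega)
  have s6 := Exec.const (W := W) (((((s.setReg 2 m).setReg 3 (2 * m : ℕ)).setReg 1
    (n + m : ℕ)).setReg 7 2).setReg 7 (n + m + 2 : ℕ)) 1 1 (by simp; omega)
  have s7 := powCode_exec (W := W) (b := n + m + 2) (by omega) c (s := (((((s.setReg 2 m).setReg 3
    (2 * m : ℕ)).setReg 1 (n + m : ℕ)).setReg 7 2).setReg 7 (n + m + 2 : ℕ)).setReg 1 1)
    (by simp) (by simp) (by omega)
  have s8 := Exec.const (W := W) (((((((s.setReg 2 m).setReg 3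
    (2 * m : ℕ)).setReg 1 (n + m : ℕ)).setReg 7 2).setReg 7 (n + m + 2 : ℕ)).setReg 1 1).setReg 1
    ((n + m + 2) ^ c : ℕ)) 9 1 (by simp; omega)
  have s9 := Exec.arith_eq (W := W) (s := ((((((((s.setReg 2 m).setReg 3
    (2 * m : ℕ)).setReg 1 (n + m : ℕ)).setReg 7 2).setReg 7 (n + m + 2 : ℕ)).setReg 1 1).setReg 1
    ((n + m + 2) ^ c : ℕ)).setReg 9 1)) .add 1 1 9 (k := ((n + m + 2) ^ c + 1 : ℕ))
    (by simp [ArithOp.eval]) (by rw [Nat.abs_cast]; omega)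
  have e : c + 9 = 1 + (1 + (1 + (1 + (1 + (1 + (c + 1 + (1 + 1))))))) := by ring
  rw [e]
  refine ⟨_, s1.seqNil (s2.seqNil (s3.seqNil (s4.seqNil (s5.seqNil (s6.seqNil (s7.seqNil
    (s8.seqNil s9))))))), rfl, ?_, ?_, ?_, ?_, ?_, fun x hx hx' => ?_⟩
  · simp [h0]
  · simp
  · simp
  · simp
  · simp [a5]
  · simp [h2 x (by omega), show x ≠ 1 by omega, show x ≠ 2 by omega, show x ≠ 3 by omega,
      show x ≠ 7 by omega, show x ≠ 9 by omega]

/-! ### The input graph in terms of its neighbourhoods, and the interface to the word RAM -/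

theorem hasDominatingTriangle_iff {n m : ℕ} {N : ℕ → Finset ℕ} (hG : IsGraph n m N)
    (G : SimpleGraph (Fin n)) (hadj : ∀ u v : Fin n, (v : ℕ) ∈ N u ↔ G.Adj u v) :
    HasDominatingTriangle G ↔ ∃ x y z, DomTriple n N x y z := by
  constructor
  · rintro ⟨S, ⟨f⟩, hdom⟩
    have hA : ∀ i j : Fin 3, i ≠ j → G.Adj (f.symm i : Fin n) (f.symm j : Fin n) := by
      intro i j hij
      have : (G.induce S).Adj (f.symm i) (f.symm j) := f.symm.map_rel_iff.2 (by simpa using hij)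
      exact this
    refine ⟨(f.symm 0 : Fin n), (f.symm 1 : Fin n), (f.symm 2 : Fin n),
      (hadj _ _).2 (hA 0 1 (by decide)), (hadj _ _).2 (hA 0 2 (by decide)),
      (hadj _ _).2 (hA 1 2 (by decide)), ?_⟩
    -- A vertex of the triangle itself is adjacent to another one of its vertices, so open
    -- neighbourhoods are enough for the domination.
    have key : ∀ v : Fin n, ∃ i : Fin 3, G.Adj (f.symm i : Fin n) v := by
      intro v
      rcases hdom v with hv | ⟨s, hs, hv⟩
      · obtain ⟨j, hj⟩ : ∃ j : Fin 3, j ≠ f ⟨v, hv⟩ := exists_ne _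
        refine ⟨j, ?_⟩
        have := hA j (f ⟨v, hv⟩) hj
        simpa using this
      · exact ⟨f ⟨s, hs⟩, by simpa using hv⟩
    ext v
    simp only [Finset.mem_union, Finset.mem_range]
    constructor
    · rintro ((h | h) | h) <;> exact hG.lt _ _ h
    · intro hv
      obtain ⟨i, hi⟩ := key ⟨v, hv⟩
      have := (hadj _ _).2 hi
      fin_cases i
      exacts [Or.inl (Or.inl this), Or.inl (Or.inr this), Or.inr this]
  · rintro ⟨x, y, z, h⟩
    obtain ⟨hx, hy, hz⟩ := h.lt hG
    have hxy : G.Adj ⟨x, hx⟩ ⟨y, hy⟩ := (hadj _ _).1 h.xy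
    have hxz : G.Adj ⟨x, hx⟩ ⟨z, hz⟩ := (hadj _ _).1 h.xz
    have hyz : G.Adj ⟨y, hy⟩ ⟨z, hz⟩ := (hadj _ _).1 h.yz
    set g : Fin 3 → Fin n := ![⟨x, hx⟩, ⟨y, hy⟩, ⟨z, hz⟩] with hg
    have hgadj : ∀ i j, G.Adj (g i) (g j) ↔ i ≠ j := by
      intro i j
      fin_cases i <;> fin_cases j <;>
        simp [hg, hxy, hxz, hyz, hxy.symm, hxz.symm, hyz.symm]
    have hinj : Function.Injective g := by
      intro i j hij
      by_contra hne
      have := (hgadj i j).2 hne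
      rw [hij] at this
      exact G.irrefl this
    refine ⟨Set.range g, ⟨(RelIso.symm ⟨Equiv.ofInjective g hinj, ?_⟩)⟩, ?_⟩
    · intro i j
      simpa using hgadj i j
    · intro v
      have hv : (v : ℕ) ∈ N x ∪ N y ∪ N z := by rw [h.dom]; simp
      simp only [Finset.mem_union] at hv
      right
      rcases hv with (hv | hv) | hv
      · exact ⟨g 0, ⟨0, rfl⟩, (hadj ⟨x, hx⟩ v).1 hv⟩
      · exact ⟨g 1, ⟨1, rfl⟩, (hadj ⟨y, hy⟩ v).1 hv⟩
      · exact ⟨g 2, ⟨2, rfl⟩, (hadj ⟨z, hz⟩ v).1 hv⟩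

/-- The endpoints of the edges in a list. -/
def edgeAt {n : ℕ} (l : List (Fin n × Fin n)) (i : ℕ) : ℕ × ℕ :=
  if h : i < l.length then ((l[i].1 : ℕ), (l[i].2 : ℕ)) else (0, 0)

theorem edgeAt_of_lt {n : ℕ} (l : List (Fin n × Fin n)) {i : ℕ} (h : i < l.length) :
    edgeAt l i = ((l[i].1 : ℕ), (l[i].2 : ℕ)) := by simp [edgeAt, h]

theorem IsEdgeList.isEdges {n : ℕ} {G : SimpleGraph (Fin n)} {l : List (Fin n × Fin n)}
    (h : IsEdgeList G l) : IsEdges n l.length (edgeAt l) where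
  lt i hi := by rw [edgeAt_of_lt l hi]; exact ⟨l[i].1.2, l[i].2.2⟩
  ne i hi := by
    rw [edgeAt_of_lt l hi]
    have : s(l[i].1, l[i].2) ∈ G.edgeSet :=
      (h.2 _).2 (List.mem_map.2 ⟨l[i], List.getElem_mem hi, rfl⟩)
    exact fun h' => G.ne_of_adj this (Fin.ext h')
  nodup i hi j hj := by
    have key : s(l[j].1, l[j].2) ≠ s(l[i].1, l[i].2) := by
      intro h'
      have := (List.Nodup.getElem_inj_iff h.1 (i := j) (j := i) (hi := by simp; omega)
        (hj := by simpa using hi)).1 (by simpa using h')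
      omega
    rw [edgeAt_of_lt l hi, edgeAt_of_lt l (by omega)]
    constructor
    · intro h'
      rw [Prod.mk.injEq] at h'
      exact key (by rw [Fin.ext h'.1, Fin.ext h'.2])
    · intro h'
      rw [Prod.swap_prod_mk, Prod.mk.injEq] at h'
      exact key (by rw [Fin.ext h'.1, Fin.ext h'.2, Sym2.eq_swap])

theorem IsEdgeList.ncard_eq {n : ℕ} {G : SimpleGraph (Fin n)} {l : List (Fin n × Fin n)}
    (h : IsEdgeList G l) : G.edgeSet.ncard = l.length := by
  have : G.edgeSet = ((l.map fun e => s(e.1, e.2)).toFinset : Set (Sym2 (Fin n))) := by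
    ext e; simpa using h.2 e
  rw [this, Set.ncard_coe_finset, List.toFinset_card_of_nodup h.1, List.length_map]

theorem IsEdgeList.adj_iff {n : ℕ} {G : SimpleGraph (Fin n)} {l : List (Fin n × Fin n)}
    (h : IsEdgeList G l) (u v : Fin n) :
    (v : ℕ) ∈ nbrsUpTo (edgeAt l) l.length u ↔ G.Adj u v := by
  rw [mem_nbrsUpTo h.isEdges le_rfl, ← SimpleGraph.mem_edgeSet, h.2, List.mem_map]
  constructor
  · rintro ⟨i, hi, h'⟩
    rw [edgeAt_of_lt l hi, Prod.mk.injEq, Prod.mk.injEq] at h'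
    refine ⟨l[i], List.getElem_mem hi, ?_⟩
    rcases h' with h' | h'
    · rw [Fin.ext h'.1, Fin.ext h'.2, Sym2.eq_swap]
    · rw [Fin.ext h'.1, Fin.ext h'.2]
  · rintro ⟨e, he, h'⟩
    obtain ⟨i, hi, rfl⟩ := List.mem_iff_getElem.1 he
    refine ⟨i, hi, ?_⟩
    rw [edgeAt_of_lt l hi]
    rw [Sym2.eq_iff] at h'
    rcases h' with ⟨h1, h2⟩ | ⟨h1, h2⟩
    · right; rw [h1, h2]
    · left; rw [h1, h2]

/-- The link between the two levels: a time bound in the small language for word bound `V = (n + m +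
2) ^ c` becomes one for the word RAM, whose words may be a fixed power of `V`. The condition `4 ≤ c`
makes `V` at least 16, enough for ten arrays, and at least the length of the input. -/
theorem detTime_of_run (C : GCmd) (c : ℕ) (hc : 4 ≤ c) (f : ℕ → ℕ → ℝ)
    (h : ∀ (E : Env) (n m : ℕ) (e : ℕ → ℕ × ℕ) (σ : GStore), E.V = (n + m + 2) ^ c →
      IsEdges n m e → IsInput E m e → Initial n m σ → ∃ T : ℕ, (T : ℝ) ≤ f n m ∧
        Run E C σ T (fun σ' => σ'.v .n = ind (∃ x y z, DomTriple n (nbrsUpTo e m) x y z))) :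
    DominatingTriangleInDetTime fun n m => c + 9 + C.slow * f n m := by
  refine ⟨.seq (graphSetup c) (C.compile graphLayout), ⟨by
    simp [graphSetup, Program.Deterministic, powCode_deterministic],
    C.compile_deterministic _⟩, c * (C.width + 8), ?_⟩
  rintro n G l hl s ⟨h0, h1, h2, hmem, hrest⟩
  rw [hl.ncard_eq]
  obtain ⟨m, hm⟩ : ∃ m, m = l.length := ⟨_, rfl⟩
  have hpow : (n + m + 2) ^ 4 ≤ (n + m + 2) ^ c := Nat.pow_le_pow_right (by omega) hc
  have h4 : n + m + 2 ≤ (n + m + 2) ^ 4 := Nat.le_self_pow (by omega) _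
  have h4' : 16 ≤ (n + m + 2) ^ 4 := by
    calc 16 = 2 ^ 4 := by norm_num
      _ ≤ _ := Nat.pow_le_pow_left (by omega) 4
  have h4'' : 2 * (n + m + 2) ≤ (n + m + 2) ^ 4 := by
    calc 2 * (n + m + 2) ≤ (n + m + 2) ^ 3 * (n + m + 2) := Nat.mul_le_mul_right _ (by
          have : n + m + 2 ≤ (n + m + 2) ^ 3 := Nat.le_self_pow (by omega) _
          omega)
      _ = _ := by ring
  obtain ⟨V, hV⟩ : ∃ V, V = (n + m + 2) ^ c := ⟨_, rfl⟩
  have hW : V ^ (C.width + 8) ≤ (n + m + 2) ^ (c * (C.width + 8)) := by rw [hV, ← pow_mul]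
  have h2V : 2 * V ≤ (n + m + 2) ^ (c * (C.width + 8)) := by
    refine le_trans ?_ hW
    calc 2 * V ≤ V * V := Nat.mul_le_mul_right _ (by omega)
      _ = V ^ 2 := by ring
      _ ≤ _ := Nat.pow_le_pow_right (by omega) (by omega)
  rw [← hm]
  obtain ⟨s₁, e₁, m₁, r0, r1, r2, r3, r5, rr⟩ := graphSetup_exec (W := (n + m + 2) ^
    (c * (C.width + 8))) (n := n) (m := m) (c := c) h0 (by rw [h1, hm]) h2 (by omega)
    (by rw [← hV]; exact h2V)
  set σ : GStore := ⟨fun x => if x = .n then n else if x = .m then m else 0,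
    fun _ _ _ _ => 0⟩ with hσ
  have hvert : ∀ a < 2 * m, |s.mem a| ≤ V := by
    intro a ha
    obtain ⟨g1, g2⟩ := hmem ⟨a / 2, by omega⟩
    have hr : a = 2 * (a / 2) ∨ a = 2 * (a / 2) + 1 := by omega
    have b1 := (l.get ⟨a / 2, by omega⟩).1.2
    have b2 := (l.get ⟨a / 2, by omega⟩).2.2
    rcases hr with hr | hr
    · rw [hr, g1, Nat.abs_cast]; omega
    · rw [hr, g2, Nat.abs_cast]; omega
  have hrep : Represents graphLayout V (2 * m) s.mem σ s₁ := by
    refine ⟨fun x => ?_, by rw [r1, hV], r3, r5, fun a _ => by rw [m₁], ?_⟩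
    · by_cases hxn : x = .n
      · subst hxn; rw [show σ.v .n = n by simp [hσ]]; exact r0
      · by_cases hxm : x = .m
        · subst hxm; rw [show σ.v .m = m by simp [hσ]]; exact r2
        · have g0 : graphLayout.vreg x ≠ 0 := fun h => hxn (graphLayout.vreg_inj h)
          have g1 : graphLayout.vreg x ≠ 1 := fun h => hxm (graphLayout.vreg_inj h)
          rw [rr _ (by omega) (by omega)]
          simp [hσ, hxn, hxm]
    · intro t i j k _ _ _
      rw [m₁]
      exact hrest _ (by unfold Layout.addr; omega)
  obtain ⟨T, hT, t, ht, σ', hex, hans⟩ := h ⟨V, 2 * m, s.mem⟩ n m (edgeAt l) σ hV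
    (hm ▸ hl.isEdges) ⟨rfl, fun i hi => by
      obtain ⟨g1, g2⟩ := hmem ⟨i, by omega⟩
      rw [edgeAt_of_lt l (by omega)]
      exact ⟨g1, g2⟩⟩ ⟨by simp [hσ], by simp [hσ], fun x hx hx' => by simp [hσ, hx, hx'],
      fun _ _ _ _ => rfl⟩
  obtain ⟨-, t', ht', s₂, e₂, r₂⟩ := Cmd.compile_exec (by omega) (show graphLayout.J ≤ V by
    change 10 ≤ V; omega) (by omega) hvert hex
    ⟨fun x => by simp only [hσ]; split_ifs <;> simp <;> omega, fun _ _ _ _ => by simp [hσ]⟩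
    hW s₁ hrep
  refine ⟨c + 9 + t', s₂, e₁.seqNil e₂, ?_, ?_⟩
  · have hreg : s₂.reg 0 = σ'.v .n := r₂.var .n
    have hiff := hasDominatingTriangle_iff (m := m) (hm ▸ isGraph_nbrsUpTo hl.isEdges le_rfl) G
      (fun u v => hm ▸ hl.adj_iff u v)
    constructor
    · intro hd; rw [hreg, hans, ind_of (hiff.1 hd)]
    · intro hd; rw [hreg, hans, ind_not (fun h => hd (hiff.2 h))]
  · have : (t' : ℝ) ≤ C.slow * f n m := by
      calc (t' : ℝ) ≤ ((C.slow * t : ℕ) : ℝ) := by exact_mod_cast ht'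
        _ ≤ C.slow * f n m := by
          push_cast
          refine mul_le_mul_of_nonneg_left (le_trans ?_ hT) (by positivity)
          exact_mod_cast ht
    push_cast
    linarith

theorem DominatingTriangleInDetTime.mono {f g : ℕ → ℕ → ℝ} (h : DominatingTriangleInDetTime f)
    (hfg : ∀ n m, f n m ≤ g n m) : DominatingTriangleInDetTime g := by
  obtain ⟨p, hp, c, H⟩ := h
  refine ⟨p, hp, c, fun n G l hl s hs => ?_⟩
  obtain ⟨t, s', h1, h2, h3⟩ := H n G l hl s hs
  exact ⟨t, s', h1, h2, h3.trans (hfg _ _)⟩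

/-- A run without coin flips uses the empty prefix of the random bits, so its answer is right for
all outcomes and the probability of success is 1. -/
theorem DominatingTriangleInDetTime.inRandTime {f : ℕ → ℕ → ℝ}
    (h : DominatingTriangleInDetTime f) (d : ℕ) : DominatingTriangleInRandTime d f := by
  obtain ⟨p, -, c, H⟩ := h
  refine ⟨p, c, fun n G l hl s hs => ?_⟩
  obtain ⟨t, s', h1, h2, h3⟩ := H n G l hl s hs
  have hr : ∀ r : Fin t → Bool, HaltsWithin ((n + G.edgeSet.ncard + 2) ^ c) p s t r s' :=
    fun r => ⟨t, le_rfl, [], List.nil_prefix, h1⟩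
  refine ⟨t, h3, fun r => ⟨s', hr r⟩, ?_⟩
  have : {r : Fin t → Bool | ∃ s', HaltsWithin ((n + G.edgeSet.ncard + 2) ^ c) p s t r s' ∧
      CorrectAnswer G s'} = Set.univ := by
    ext r; simp only [Set.mem_ofPred_eq, Set.mem_univ, iff_true]; exact ⟨s', hr r, h2⟩
  rw [this, Set.ncard_univ, Nat.card_eq_fintype_card]
  simp only [Fintype.card_pi, Fintype.card_bool, Finset.prod_const, Finset.card_univ,
    Fintype.card_fin]
  push_cast
  have h0 : (0 : ℝ) ≤ 1 / ((n : ℝ) + 2) ^ d := by positivity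
  have h2 : (0 : ℝ) < 2 ^ t := by positivity
  nlinarith

/-! ### The exponent of matrix multiplication is at least two -/

/-- A step writes at most one memory cell. -/
theorem Exec.exists_changed {W : ℕ} {p : Program} {s s' : RamState} {bs : List Bool} {t : ℕ}
    (h : Exec W p s bs t s') : ∃ S : Finset ℕ, S.card ≤ t ∧ ∀ a ∉ S, s'.mem a = s.mem a := by
  induction h with
  | store s x y a ha hW =>
    refine ⟨{a}, by simp, fun b hb => ?_⟩
    simp only [Finset.mem_singleton] at hb
    simp [RamState.setMem, hb]
  | seq _ _ ih1 ih2 =>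
    obtain ⟨S, h1, h2⟩ := ih1
    obtain ⟨S', h3, h4⟩ := ih2
    refine ⟨S ∪ S', (Finset.card_union_le _ _).trans (by omega), fun a ha => ?_⟩
    rw [Finset.mem_union, not_or] at ha
    rw [h4 a ha.2, h2 a ha.1]
  | branchPos _ _ ih =>
    obtain ⟨S, h1, h2⟩ := ih
    exact ⟨S, by omega, h2⟩
  | branchNonpos _ _ ih =>
    obtain ⟨S, h1, h2⟩ := ih
    exact ⟨S, by omega, h2⟩
  | loopStep _ _ _ ih1 ih2 =>
    obtain ⟨S, h1, h2⟩ := ih1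
    obtain ⟨S', h3, h4⟩ := ih2
    refine ⟨S ∪ S', (Finset.card_union_le _ _).trans (by omega), fun a ha => ?_⟩
    rw [Finset.mem_union, not_or] at ha
    rw [h4 a ha.2, h2 a ha.1]
  | _ => exact ⟨∅, by simp, fun _ _ => rfl⟩

/-- For the all-ones matrices every entry of the product is n, while the output cells start with 0;
so n² cells have to be changed, one step for each. -/
theorem MatMulInTime.two_le {τ : ℝ} (h : MatMulInTime τ) : 2 ≤ τ := by
  obtain ⟨p, -, c, C, e, he, H⟩ := h 0
  have key : ∀ n : ℕ, 0 < n → ((n : ℝ) ^ (2 : ℝ)) ≤ C * (n : ℝ) ^ (τ + e n) := by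
    intro n hn
    set A : Matrix (Fin n) (Fin n) ℤ := Matrix.of fun _ _ => 1 with hA
    have hlt : ∀ i j : Fin n, (i : ℕ) * n + j < n ^ 2 := by
      intro i j; rw [sq]; exact index_lt i.2 j.2
    set s : RamState := ⟨fun x => if x = 0 then n else 0,
      fun a => if a < 2 * n ^ 2 then 1 else 0⟩ with hs
    have hin : MatMulInput A A s := by
      refine ⟨by simp [hs], fun x hx => by simp [hs, hx], fun i j => ?_, fun i j => ?_,
        fun a ha => by simp [hs, ha]⟩
      · have := hlt i j
        simp [hs, hA]; omega
      · have := hlt i j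
        simp [hs, hA]; omega
    obtain ⟨t, s', hex, hout, ht⟩ := H n hn A A (by simp [hA]) (by simp [hA]) s hin
    obtain ⟨S, hS, hS'⟩ := hex.exists_changed
    have hsub : (Finset.range (n ^ 2)).image (fun a => 2 * n ^ 2 + a) ⊆ S := by
      intro b hb
      obtain ⟨a, ha, rfl⟩ := Finset.mem_image.1 hb
      rw [Finset.mem_range] at ha
      by_contra hbS
      have h1 := hS' _ hbS
      have hdiv : a / n < n := Nat.div_lt_of_lt_mul (by rw [sq] at ha; exact ha)
      have h2 := hout ⟨a / n, hdiv⟩ ⟨a % n, Nat.mod_lt _ hn⟩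
      simp only [Nat.div_add_mod'] at h2
      rw [h1] at h2
      simp [hs, hA, Matrix.mul_apply] at h2
      omega
    have hcard := Finset.card_le_card hsub
    rw [Finset.card_image_of_injective _ (fun a b hab => by simpa using hab),
      Finset.card_range] at hcard
    refine le_trans ?_ ht
    rw [Real.rpow_two]
    exact_mod_cast hcard.trans hS
  -- If τ < 2, then τ + e n is eventually below the midpoint of τ and 2, and n² outgrows every
  -- constant multiple of n to that power.
  by_contra hlt
  push Not at hlt
  have hδ : 0 < (2 - τ) / 2 := by linarith
  have h1 : ∀ᶠ n : ℕ in atTop, e n < (2 - τ) / 2 := he.eventually_lt_const hδ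
  have h2 : Tendsto (fun n : ℕ => (n : ℝ) ^ ((2 - τ) / 2)) atTop atTop :=
    (tendsto_rpow_atTop hδ).comp tendsto_natCast_atTop_atTop
  obtain ⟨n, hn1, hn2, hn3⟩ := (h1.and ((h2.eventually_gt_atTop C).and
    (eventually_gt_atTop 0))).exists
  have hn : (1 : ℝ) ≤ n := by exact_mod_cast hn3
  have h3 := key n hn3
  have h4 : (n : ℝ) ^ (2 : ℝ) = (n : ℝ) ^ ((2 - τ) / 2) * (n : ℝ) ^ (τ + (2 - τ) / 2) := by
    rw [← Real.rpow_add (by linarith)]; congr 1; ring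
  have h5 : (n : ℝ) ^ (τ + e n) ≤ (n : ℝ) ^ (τ + (2 - τ) / 2) :=
    Real.rpow_le_rpow_of_exponent_le hn (by linarith)
  have h6 : 0 < (n : ℝ) ^ (τ + (2 - τ) / 2) := Real.rpow_pos_of_pos (by linarith) _
  have h7 : 0 < (n : ℝ) ^ (2 : ℝ) := Real.rpow_pos_of_pos (by linarith) _
  have h8 : 0 < (n : ℝ) ^ (τ + e n) := Real.rpow_pos_of_pos (by linarith) _
  have hC : 0 < C := by
    by_contra hC
    nlinarith
  have : C * (n : ℝ) ^ (τ + e n) ≤ C * (n : ℝ) ^ (τ + (2 - τ) / 2) :=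
    mul_le_mul_of_nonneg_left h5 hC.le
  nlinarith

/-! ### Cubic matrix multiplication -/

inductive MatVar
  | n | i | j | k | sum
  deriving DecidableEq

def matLayout : Layout MatVar Unit where
  vreg
    | .n => 0
    | .i => 1
    | .j => 2
    | .k => 3
    | .sum => 4
  vreg_inj a b h := by cases a <;> cases b <;> first | rfl | simp at h
  aidx _ := 0
  aidx_inj _ _ _ := rfl
  J := 1
  aidx_lt _ := one_pos

def cubicEntry : Cmd MatVar Unit := .block [
  .set .sum (.lit 0),
  .forUp .k .n (.set .sum (.var .sum + .inp (.var .i * .var .n + .var .k) *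
    .inp (.var .n * .var .n + (.var .k * .var .n + .var .j)))),
  .put () (.lit 0) (.lit 0) (.var .i * .var .n + .var .j) (.var .sum)]

def cubic : Cmd MatVar Unit := .forUp .i .n (.forUp .j .n cubicEntry)

/-- The input consists of the matrices `A` and `B` with entries of absolute value at most `M`. -/
structure MatEnv (E : Env) (n M : ℕ) (A B : ℕ → ℕ → ℤ) : Prop where
  len : E.len = 2 * (n * n)
  le : 2 * (n * n) + n * (M * M) + n ≤ E.V
  left : ∀ i < n, ∀ j < n, E.inp (i * n + j) = A i j
  right : ∀ i < n, ∀ j < n, E.inp (n * n + (i * n + j)) = B i j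
  absLeft : ∀ i j, |A i j| ≤ M
  absRight : ∀ i j, |B i j| ≤ M

theorem cubicEntry_run {E : Env} {n M : ℕ} {A B : ℕ → ℕ → ℤ} (h : MatEnv E n M A B) {i j : ℕ}
    (hi : i < n) (hj : j < n) {σ : Store MatVar Unit} (hn : σ.v .n = n) (hvi : σ.v .i = i)
    (hvj : σ.v .j = j) :
    Run E cubicEntry σ (3 * n + 5) (fun σ' => σ'.a = (σ.setA () 0 0 (i * n + j)
      (∑ k ∈ Finset.range n, A i k * B k j)).a) := by
  have hle := h.le
  have hsum : ∀ k ≤ n, |∑ k ∈ Finset.range k, A i k * B k j| ≤ E.V := by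
    intro k hk
    have h1 : |∑ k ∈ Finset.range k, A i k * B k j| ≤ ∑ _k ∈ Finset.range k, ((M * M : ℕ) : ℤ) := by
      refine (Finset.abs_sum_le_sum_abs _ _).trans (Finset.sum_le_sum fun l _ => ?_)
      rw [abs_mul]
      push_cast
      exact mul_le_mul (h.absLeft i l) (h.absRight l j) (abs_nonneg _) (by positivity)
    have h2 : ∑ _k ∈ Finset.range k, ((M * M : ℕ) : ℤ) = ((k * (M * M) : ℕ) : ℤ) := by simp
    have h3 : k * (M * M) ≤ n * (M * M) := Nat.mul_le_mul_right _ hk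
    omega
  unfold cubicEntry
  refine .cons 1 (by omega) (.setN 0 (.lit 0) (by omega) le_rfl ?_)
  refine .cons (3 * n + 2) (by omega) (.forUp (N := n) (fun _ => 1)
    (fun k σ' => σ'.v .sum = ∑ k ∈ Finset.range k, A i k * B k j) (by simp) (by simp) (by simp)
    (by simpa using hn) (by omega) ?_ (by simp) ?_ ?_)
  · rw [sum_const_range]; omega
  · intro k hk σ₁ hvk hvn hag hs
    have hi₁ : σ₁.v .i = i := by rw [hag.v _ (by simp)]; simpa using hvi
    have hj₁ : σ₁.v .j = j := by rw [hag.v _ (by simp)]; simpa using hvj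
    have i1 := index_lt hi hk
    have i2 := index_lt hk hj
    refine .set (∑ k ∈ Finset.range (k + 1), A i k * B k j) ?_ (hsum _ (by omega)) le_rfl
      (by simp)
    rw [Finset.sum_range_succ, ← hs, ← h.left i hi k hk, ← h.right k hk j hj]
    refine (Evals.var rfl).add ((Evals.inp ?_ (by rw [h.len]; omega)).mul
      (Evals.inp ?_ (by rw [h.len]; omega)))
    · push_cast; exact ((Evals.var hi₁).mul (.var hvn)).add (.var hvk)
    · push_cast
      exact ((Evals.var hvn).mul (.var hvn)).add (((Evals.var hvk).mul (.var hvn)).add (.var hj₁))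
  · intro σ₁ _ hag hs
    have hi₁ : σ₁.v .i = i := by rw [hag.v _ (by simp)]; simpa using hvi
    have hj₁ : σ₁.v .j = j := by rw [hag.v _ (by simp)]; simpa using hvj
    have hn₁ : σ₁.v .n = n := by rw [hag.v _ (by simp)]; simpa using hn
    have i1 := index_lt hi hj
    refine .cons 1 (by omega) (.put 0 0 (i * n + j) _ (.lit 0) (.lit 0) ?_ (.var hs) (by omega)
      (by omega) (by omega) (hsum n le_rfl) le_rfl (.nil (by omega) ?_))
    · push_cast; exact ((Evals.var hi₁).mul (.var hn₁)).add (.var hj₁)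
    · funext t a b l
      have : σ₁.a t = σ.a t := by rw [hag.a _ (by simp)]; simp
      simp [this]

theorem cubic_run {E : Env} {n M : ℕ} {A B : ℕ → ℕ → ℤ} (h : MatEnv E n M A B)
    {σ : Store MatVar Unit} (hn : σ.v .n = n) :
    Run E cubic σ (16 * n ^ 3 + 2) (fun σ' => ∀ i < n, ∀ j < n,
      σ'.a () 0 0 (i * n + j) = ∑ k ∈ Finset.range n, A i k * B k j) := by
  have hle := h.le
  unfold cubic
  refine .forUp (N := n) (fun _ => n * (3 * n + 7) + 2) (fun s σ' => ∀ i < s, ∀ j < n,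
    σ'.a () 0 0 (i * n + j) = ∑ k ∈ Finset.range n, A i k * B k j) (by simp)
    (by simp [cubicEntry]) (by simp [cubicEntry]) hn (by omega) ?_ (by simp) ?_ (fun _ _ _ h => h)
  · rw [sum_const_range]
    rcases Nat.eq_zero_or_pos n with rfl | hpos
    · simp
    · have : n ≤ n ^ 2 := Nat.le_self_pow (by omega) n
      have : n ^ 2 ≤ n ^ 3 := Nat.pow_le_pow_right hpos (by omega)
      nlinarith
  · intro i hi σ₁ hvi hvn hag h1
    refine .forUp (N := n) (fun _ => 3 * n + 5) (fun s σ' => (∀ i' < i, ∀ j < n,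
      σ'.a () 0 0 (i' * n + j) = ∑ k ∈ Finset.range n, A i' k * B k j) ∧ ∀ j < s,
      σ'.a () 0 0 (i * n + j) = ∑ k ∈ Finset.range n, A i k * B k j) (by simp)
      (by simp [cubicEntry]) (by simp [cubicEntry]) hvn (by omega)
      (by rw [sum_const_range]; exact le_of_eq (by ring)) ⟨by simpa using h1, by simp⟩ ?_ ?_
    · rintro j hj σ₂ hvj hvn₂ hag₂ ⟨g1, g2⟩
      have hi₂ : σ₂.v .i = i := by rw [hag₂.v _ (by simp [cubicEntry]), hvi]
      refine (cubicEntry_run h hi hj hvn₂ hi₂ hvj).mono le_rfl ?_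
      intro σ₃ _ h3
      refine ⟨fun i' hi' j' hj' => ?_, fun j' hj' => ?_⟩
      · have : i' * n + j' ≠ i * n + j := fun h' => by
          have := (index_inj hj' hj h').1; omega
        simp [h3, this, g1 i' hi' j' hj']
      · by_cases hjj : j' = j
        · simp [h3, hjj]
        · simp [h3, hjj, g2 j' (by omega)]
    · rintro σ₂ - - ⟨g1, g2⟩ i' hi' j hj
      simp only [Store.setV_a]
      rcases Nat.lt_succ_iff_lt_or_eq.1 hi' with hi' | rfl
      exacts [g1 i' hi' j hj, g2 j hj]

/-- Set up the registers for compiled code on matrices. -/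
def matSetup (c : ℕ) : Program :=
  .seq (.arith .mul 3 0 0) <| .seq (.arith .add 3 3 3) <| .seq (.const 7 2) <|
  .seq (.arith .add 7 0 7) <| .seq (.const 1 1) <| .seq (powCode c) <|
  .seq (.const 9 1) (.arith .add 1 1 9)

theorem matSetup_exec {W n c : ℕ} {s : RamState} (h0 : s.reg 0 = n)
    (h2 : ∀ x, x ≠ 0 → s.reg x = 0) (hc : 1 ≤ c) (hW : 2 * (n + 2) ^ c ≤ W)
    (hn : 2 * (n * n) ≤ W) :
    ∃ s', Exec W (matSetup c) s [] (c + 8) s' ∧ s'.mem = s.mem ∧ s'.reg 0 = n ∧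
      s'.reg 1 = ((n + 2) ^ c + 1 : ℕ) ∧ s'.reg 3 = (2 * (n * n) : ℕ) ∧
      ∀ x, x % 2 = 0 ∨ x = 5 → x ≠ 0 → s'.reg x = 0 := by
  have hle : n + 2 ≤ (n + 2) ^ c := Nat.le_self_pow (by omega) _
  have hpos : 1 ≤ (n + 2) ^ c := Nat.one_le_pow _ _ (by omega)
  have s1 := Exec.arith_eq (W := W) (s := s) .mul 3 0 0 (k := (n * n : ℕ))
    (by simp [ArithOp.eval, h0]) (by rw [Nat.abs_cast]; omega)
  have s2 := Exec.arith_eq (W := W) (s := s.setReg 3 (n * n : ℕ)) .add 3 3 3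
    (k := (2 * (n * n) : ℕ)) (by simp [ArithOp.eval]; ring) (by rw [Nat.abs_cast]; omega)
  have s3 := Exec.const (W := W) ((s.setReg 3 (n * n : ℕ)).setReg 3 (2 * (n * n) : ℕ)) 7 2
    (by simp; omega)
  have s4 := Exec.arith_eq (W := W) (s := ((s.setReg 3 (n * n : ℕ)).setReg 3
    (2 * (n * n) : ℕ)).setReg 7 2) .add 7 0 7 (k := (n + 2 : ℕ))
    (by simp [ArithOp.eval, h0]) (by rw [Nat.abs_cast]; omega)
  have s5 := Exec.const (W := W) ((((s.setReg 3 (n * n : ℕ)).setReg 3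
    (2 * (n * n) : ℕ)).setReg 7 2).setReg 7 (n + 2 : ℕ)) 1 1 (by simp; omega)
  have s6 := powCode_exec (W := W) (b := n + 2) (by omega) c (s := ((((s.setReg 3
    (n * n : ℕ)).setReg 3 (2 * (n * n) : ℕ)).setReg 7 2).setReg 7 (n + 2 : ℕ)).setReg 1 1)
    (by simp) (by simp) (by omega)
  have s7 := Exec.const (W := W) (((((s.setReg 3 (n * n : ℕ)).setReg 3
    (2 * (n * n) : ℕ)).setReg 7 2).setReg 7 (n + 2 : ℕ)).setReg 1 1 |>.setReg 1
    ((n + 2) ^ c : ℕ)) 9 1 (by simp; omega)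
  have s8 := Exec.arith_eq (W := W) (s := (((((s.setReg 3 (n * n : ℕ)).setReg 3
    (2 * (n * n) : ℕ)).setReg 7 2).setReg 7 (n + 2 : ℕ)).setReg 1 1 |>.setReg 1
    ((n + 2) ^ c : ℕ)).setReg 9 1) .add 1 1 9 (k := ((n + 2) ^ c + 1 : ℕ))
    (by simp [ArithOp.eval]) (by rw [Nat.abs_cast]; omega)
  have e : c + 8 = 1 + (1 + (1 + (1 + (1 + (c + 1 + (1 + 1)))))) := by ring
  rw [e]
  refine ⟨_, s1.seqNil (s2.seqNil (s3.seqNil (s4.seqNil (s5.seqNil (s6.seqNil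
    (s7.seqNil s8)))))), rfl, ?_, ?_, ?_, fun x hx hx' => ?_⟩
  · simp [h0]
  · simp
  · simp
  · simp [h2 x hx', show x ≠ 1 by omega, show x ≠ 3 by omega, show x ≠ 7 by omega,
      show x ≠ 9 by omega]

/-- This is needed for the definition of the exponent: the infimum of an empty set of reals would be
0 by convention. -/
theorem matMulInTime_three : MatMulInTime 3 := by
  intro a
  obtain ⟨c, hc⟩ : ∃ c, c = 2 * a + 5 := ⟨_, rfl⟩
  refine ⟨.seq (matSetup c) (cubic.compile matLayout), ⟨by
    simp [matSetup, Program.Deterministic, powCode_deterministic],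
    cubic.compile_deterministic _⟩, c * (cubic.width + 8), c + 8 + cubic.slow * 18, fun _ => 0,
    tendsto_const_nhds, ?_⟩
  rintro n hn A B hA hB s ⟨h0, h1, hmA, hmB, hrest⟩
  obtain ⟨V, hV⟩ : ∃ V, V = (n + 2) ^ c := ⟨_, rfl⟩
  have h4 : (n + 2) ^ 5 ≤ V := by rw [hV]; exact Nat.pow_le_pow_right (by omega) (by omega)
  have h5 : 4 * (n + 2) ^ 3 ≤ (n + 2) ^ 5 := by
    have : 4 ≤ (n + 2) ^ 2 := by nlinarith
    calc 4 * (n + 2) ^ 3 ≤ (n + 2) ^ 2 * (n + 2) ^ 3 := Nat.mul_le_mul_right _ this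
      _ = _ := by ring
  have h6 : 2 * (n * n) + 2 * n + 2 ≤ (n + 2) ^ 3 := by nlinarith [Nat.zero_le (n ^ 3)]
  have hW : V ^ (cubic.width + 8) ≤ (n + 2) ^ (c * (cubic.width + 8)) := by rw [hV, ← pow_mul]
  have h2V : 2 * V ≤ (n + 2) ^ (c * (cubic.width + 8)) := by
    refine le_trans ?_ hW
    calc 2 * V ≤ V * V := Nat.mul_le_mul_right _ (by omega)
      _ = V ^ 2 := by ring
      _ ≤ _ := Nat.pow_le_pow_right (by omega) (by omega)
  have hM : n * (n ^ a * n ^ a) * 4 ≤ V := by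
    calc n * (n ^ a * n ^ a) * 4 = n ^ (2 * a + 1) * 4 := by ring
      _ ≤ (n + 2) ^ (2 * a + 1) * (n + 2) ^ 4 := Nat.mul_le_mul
          (Nat.pow_le_pow_left (by omega) _) (by
            calc 4 ≤ 2 ^ 4 := by norm_num
              _ ≤ _ := Nat.pow_le_pow_left (by omega) 4)
      _ = V := by rw [← pow_add, hV, hc]
  obtain ⟨s₁, e₁, m₁, r0, r1, r3, rr⟩ := matSetup_exec (W := (n + 2) ^ (c * (cubic.width + 8)))
    (c := c) h0 h1 (by omega) (by rw [← hV]; exact h2V) (by omega)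
  set σ : Store MatVar Unit := ⟨fun x => if x = .n then n else 0, fun _ _ _ _ => 0⟩ with hσ
  have hV' : n ^ a ≤ V := by
    have : n ^ a ≤ n * (n ^ a * n ^ a) * 4 := by
      have : 1 ≤ n ^ a := Nat.one_le_pow _ _ hn
      nlinarith
    omega
  have hinp : ∀ b < 2 * (n * n), |s.mem b| ≤ V := by
    intro b hb
    have hna : ((n : ℤ) ^ a) ≤ V := by exact_mod_cast hV'
    rcases lt_or_ge b (n * n) with hlt | hge
    · have h1 := hmA ⟨b / n, Nat.div_lt_of_lt_mul hlt⟩ ⟨b % n, Nat.mod_lt _ hn⟩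
      simp only [Nat.div_add_mod'] at h1
      rw [h1]; exact (hA _ _).trans hna
    · have hlt : b - n * n < n * n := by omega
      have h1 := hmB ⟨(b - n * n) / n, Nat.div_lt_of_lt_mul hlt⟩
        ⟨(b - n * n) % n, Nat.mod_lt _ hn⟩
      simp only [Nat.div_add_mod', sq] at h1
      rw [show n * n + (b - n * n) = b by omega] at h1
      rw [h1]; exact (hB _ _).trans hna
  have hrep : Represents matLayout V (2 * (n * n)) s.mem σ s₁ := by
    refine ⟨fun x => ?_, by rw [r1, hV], r3, rr 5 (by simp) (by simp), fun a _ => by rw [m₁], ?_⟩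
    · cases x
      · rw [show σ.v .n = n by simp [hσ]]; exact r0
      all_goals exact rr _ (Or.inl rfl) (by decide)
    · intro t i j k _ _ _
      rw [m₁]
      exact hrest _ (by unfold Layout.addr; rw [sq]; omega)
  have hext : ∀ (M : Matrix (Fin n) (Fin n) ℤ), (∀ i j, |M i j| ≤ (n : ℤ) ^ a) → ∀ i j : ℕ,
      |if h : i < n ∧ j < n then M ⟨i, h.1⟩ ⟨j, h.2⟩ else 0| ≤ ((n ^ a : ℕ) : ℤ) := by
    intro M hM i j
    push_cast
    split_ifs
    · exact hM _ _
    · simp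
  have hEnv : MatEnv ⟨V, 2 * (n * n), s.mem⟩ n (n ^ a)
      (fun i j => if h : i < n ∧ j < n then A ⟨i, h.1⟩ ⟨j, h.2⟩ else 0)
      (fun i j => if h : i < n ∧ j < n then B ⟨i, h.1⟩ ⟨j, h.2⟩ else 0) := by
    refine ⟨rfl, by change _ ≤ V; omega, fun i hi j hj => ?_, fun i hi j hj => ?_, hext A hA, hext B hB⟩
    · simpa [hi, hj] using hmA ⟨i, hi⟩ ⟨j, hj⟩
    · simpa [hi, hj, sq] using hmB ⟨i, hi⟩ ⟨j, hj⟩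
  obtain ⟨t, ht, σ', hex, hres⟩ := cubic_run hEnv (σ := σ) (by simp [hσ])
  obtain ⟨-, t', ht', s₂, e₂, r₂⟩ := Cmd.compile_exec (by omega) (show matLayout.J ≤ V by
    change 1 ≤ V; omega) (by omega) hinp hex
    ⟨fun x => by simp only [hσ]; split_ifs <;> simp; omega, fun _ _ _ _ => by simp [hσ]⟩
    hW s₁ hrep
  refine ⟨c + 8 + t', s₂, e₁.seqNil e₂, fun i j => ?_, ?_⟩
  · have hij := index_lt i.2 j.2
    have := r₂.arr () 0 0 (i * n + j) (by omega) (by omega) (by omega)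
    rw [hres i i.2 j j.2] at this
    -- With a single array and indices (0, 0, l), the address is l plus the length 2n² of the input,
    -- which is just where the output is expected; nothing has to be copied.
    have haddr : matLayout.addr V (2 * (n * n)) () 0 0 (i * n + j) = 2 * n ^ 2 + (i * n + j) := by
      simp [Layout.addr, matLayout]; ring
    rw [← haddr, this, Matrix.mul_apply, Finset.sum_range]
    simp
  · have h3 : 1 ≤ n ^ 3 := Nat.one_le_pow _ _ hn
    have : c + 8 + t' ≤ (c + 8 + cubic.slow * 18) * n ^ 3 := by
      have h7 : cubic.slow * t ≤ cubic.slow * (18 * n ^ 3) := Nat.mul_le_mul_left _ (by omega)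
      nlinarith
    rw [add_zero, show (3 : ℝ) = ((3 : ℕ) : ℝ) by norm_num, Real.rpow_natCast]
    exact_mod_cast this

theorem two_le_matMulExponent : 2 ≤ matMulExponent :=
  le_csInf ⟨3, matMulInTime_three⟩ fun _ h => MatMulInTime.two_le h

/-- The lower bound 2 for all admissible τ makes the infimum a genuine one, so it is approached from
above by exponents that are attained. -/
theorem exists_matMulInTime_lt {δ : ℝ} (hδ : 0 < δ) :
    ∃ τ, MatMulInTime τ ∧ matMulExponent ≤ τ ∧ τ < matMulExponent + δ := by
  obtain ⟨τ, h1, h2⟩ := exists_lt_of_csInf_lt (s := {τ : ℝ | MatMulInTime τ})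
    ⟨3, matMulInTime_three⟩ (show sInf {τ : ℝ | MatMulInTime τ} < matMulExponent + δ by
      change matMulExponent < _; linarith)
  exact ⟨τ, h1, csInf_le ⟨2, fun _ h => MatMulInTime.two_le h⟩ h1, h2⟩

/-! ### From matrix multiplication to running times -/

theorem Exec.mono_word {W W' : ℕ} (hW : W ≤ W') {p : Program} {s s' : RamState} {bs : List Bool}
    {t : ℕ} (h : Exec W p s bs t s') : Exec W' p s bs t s' := by
  have hc : (W : ℤ) ≤ W' := by exact_mod_cast hW
  induction h with
  | skip s => exact .skip s
  | const s x k hk => exact .const s x k (hk.trans hc)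
  | arith s o x y z h => exact .arith s o x y z (h.trans hc)
  | load s x y a ha h => exact .load s x y a ha (h.trans hW)
  | store s x y a ha h => exact .store s x y a ha (h.trans hW)
  | flip s x b => exact .flip s x b
  | seq _ _ h1 h2 => exact .seq h1 h2
  | branchPos hx _ h => exact .branchPos hx h
  | branchNonpos hx _ h => exact .branchNonpos hx h
  | loopDone hx => exact .loopDone hx
  | loopStep hx _ _ h1 h2 => exact .loopStep hx h1 h2

theorem exists_forall_le_of_eventually_le {f : ℕ → ℝ} {b : ℝ} (h : ∀ᶠ n in atTop, f n ≤ b) :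
    ∃ B, 0 ≤ B ∧ ∀ n, f n ≤ B := by
  obtain ⟨N, hN⟩ := eventually_atTop.1 h
  have hs : 0 ≤ ∑ i ∈ Finset.range N, |f i| := Finset.sum_nonneg fun _ _ => abs_nonneg _
  refine ⟨|b| + ∑ i ∈ Finset.range N, |f i|, by positivity, fun n => ?_⟩
  rcases lt_or_ge n N with h' | h'
  · have := Finset.single_le_sum (f := fun i => |f i|) (fun _ _ => abs_nonneg _)
      (Finset.mem_range.2 h')
    have h2 := le_abs_self (f n)
    have h3 := abs_nonneg b
    linarith
  · have := hN n h'
    have h2 := le_abs_self b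
    linarith

/-- The running time is put into the form k · H(k) with a monotone H, an integer-valued version of
k^(τ-1+o(1)). H does not depend on δ; only the constants in the growth bounds do. Entries of
absolute value at most n^0 = 1 are enough. -/
theorem MatMulInTime.exists_multiplies {τ : ℝ} (h : MatMulInTime τ) :
    ∃ (p : Program) (c c₂ : ℕ) (H : ℕ → ℕ), p.Deterministic ∧ 1 ≤ c ∧ Monotone H ∧
      (∀ k, k ≤ H k) ∧ Multiplies p c (fun k => k * H k) ∧
      (∀ k, 0 < k → k * H k < (k + 2) ^ c₂) ∧
      ∀ δ : ℝ, 0 < δ → ∃ C : ℝ, 0 ≤ C ∧ ∀ k : ℕ, 0 < k → (H k : ℝ) ≤ C * (k : ℝ) ^ (τ - 1 + δ) := by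
  have hτ := h.two_le
  obtain ⟨p, hp, c, C, e, he, hrun⟩ := h 0
  set G : ℕ → ℕ := fun j => ⌈C * (j : ℝ) ^ (τ - 1 + e j)⌉₊ with hG
  -- The supremum makes H monotone, although the error exponent need not be; the summand k covers
  -- the quadratic cost of writing the factors and reading the product.
  set H : ℕ → ℕ := fun k => k + (Finset.range (k + 1)).sup G with hH
  have hGH : ∀ k, G k ≤ H k := fun k =>
    (Finset.le_sup (f := G) (Finset.self_mem_range_succ k)).trans (Nat.le_add_left _ _)
  have hgrow : ∀ δ : ℝ, 0 < δ →
      ∃ C : ℝ, 0 ≤ C ∧ ∀ k : ℕ, 0 < k → (H k : ℝ) ≤ C * (k : ℝ) ^ (τ - 1 + δ) := by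
    intro δ hδ
    -- For large n the error exponent is below δ; the finitely many other values go into the
    -- constant.
    have hev : ∀ᶠ n : ℕ in atTop, (n : ℝ) ^ (e n - δ) ≤ 1 := by
      filter_upwards [he.eventually (gt_mem_nhds hδ), eventually_ge_atTop 1] with n h1 h2
      exact Real.rpow_le_one_of_one_le_of_nonpos (by exact_mod_cast h2) (by linarith)
    obtain ⟨B, hB, hB'⟩ := exists_forall_le_of_eventually_le hev
    refine ⟨1 + (|C| * B + 1 + G 0), by positivity, fun k hk => ?_⟩
    have hk1 : (1 : ℝ) ≤ k := by exact_mod_cast hk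
    have hpow1 : (1 : ℝ) ≤ (k : ℝ) ^ (τ - 1 + δ) := Real.one_le_rpow hk1 (by linarith)
    have hpowk : (k : ℝ) ≤ (k : ℝ) ^ (τ - 1 + δ) := by
      simpa using Real.rpow_le_rpow_of_exponent_le hk1 (show (1 : ℝ) ≤ τ - 1 + δ by linarith)
    have hsup : (((Finset.range (k + 1)).sup G : ℕ) : ℝ) ≤
        (|C| * B + 1 + G 0) * (k : ℝ) ^ (τ - 1 + δ) := by
      obtain ⟨j, hj, hjG⟩ := Finset.exists_mem_eq_sup (Finset.range (k + 1)) ⟨0, by simp⟩ G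
      rw [hjG]
      rw [Finset.mem_range] at hj
      rcases Nat.eq_zero_or_pos j with rfl | hj0
      · have h0 : (0 : ℝ) ≤ |C| * B + 1 := by positivity
        have h1 : (0 : ℝ) ≤ G 0 := by positivity
        nlinarith
      · have hj1 : (0 : ℝ) < j := by exact_mod_cast hj0
        have hceil : (G j : ℝ) ≤ |C| * (j : ℝ) ^ (τ - 1 + e j) + 1 := by
          have hle : C * (j : ℝ) ^ (τ - 1 + e j) ≤ |C| * (j : ℝ) ^ (τ - 1 + e j) :=
            mul_le_mul_of_nonneg_right (le_abs_self C) (by positivity)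
          have h1 : (G j : ℝ) ≤ (⌈|C| * (j : ℝ) ^ (τ - 1 + e j)⌉₊ : ℕ) := by
            exact_mod_cast Nat.ceil_mono hle
          exact h1.trans (Nat.ceil_lt_add_one (by positivity)).le
        have hsplit : (j : ℝ) ^ (τ - 1 + e j) = (j : ℝ) ^ (e j - δ) * (j : ℝ) ^ (τ - 1 + δ) := by
          rw [← Real.rpow_add hj1]; congr 1; ring
        have hjk : (j : ℝ) ^ (τ - 1 + δ) ≤ (k : ℝ) ^ (τ - 1 + δ) :=
          Real.rpow_le_rpow hj1.le (by exact_mod_cast (by omega : j ≤ k)) (by linarith)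
        have h2 : (j : ℝ) ^ (τ - 1 + e j) ≤ B * (k : ℝ) ^ (τ - 1 + δ) := by
          rw [hsplit]
          exact mul_le_mul (hB' j) hjk (by positivity) hB
        have h3 := mul_le_mul_of_nonneg_left h2 (abs_nonneg C)
        have h4 : (0 : ℝ) ≤ G 0 * (k : ℝ) ^ (τ - 1 + δ) := by positivity
        nlinarith
    have : (H k : ℝ) = k + (((Finset.range (k + 1)).sup G : ℕ) : ℝ) := by
      simp only [hH]; push_cast; rfl
    rw [this]; linarith
  obtain ⟨C₁, hC₁, hC₁'⟩ := hgrow 1 one_pos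
  -- The constant C₁ is absorbed by (k + 2)^L ≥ 2^L > C₁, which gives the polynomial bound on the
  -- time that serves as a sufficient budget.
  obtain ⟨L, hL⟩ := pow_unbounded_of_one_lt C₁ (one_lt_two (α := ℝ))
  refine ⟨p, c + 1, ⌈τ + 1⌉₊ + L, H, hp, by omega, ?_, fun k => Nat.le_add_right _ _, ?_, ?_, hgrow⟩
  · intro a b hab
    exact Nat.add_le_add hab (Finset.sup_mono (Finset.range_mono (by omega)))
  · intro k hk A B hA hB s hs
    obtain ⟨t, s', h1, h2, h3⟩ := hrun k hk A B (by simpa using hA) (by simpa using hB) s hs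
    refine ⟨t, ?_, s', h1.mono_word (Nat.pow_le_pow_right (by omega) (by omega)), h2⟩
    have hk0 : (0 : ℝ) < k := by exact_mod_cast hk
    have h4 : C * (k : ℝ) ^ (τ + e k) = k * (C * (k : ℝ) ^ (τ - 1 + e k)) := by
      rw [show τ + e k = 1 + (τ - 1 + e k) by ring, Real.rpow_add hk0, Real.rpow_one]; ring
    have h5 : C * (k : ℝ) ^ (τ - 1 + e k) ≤ G k := Nat.le_ceil _
    have h6 : (t : ℝ) ≤ (k * G k : ℕ) := by
      push_cast
      exact h3.trans (h4.le.trans (mul_le_mul_of_nonneg_left h5 hk0.le))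
    exact (by exact_mod_cast h6 : t ≤ k * G k).trans (Nat.mul_le_mul_left _ (hGH k))
  · intro k hk
    have hk0 : (0 : ℝ) < k := by exact_mod_cast hk
    have h1 : (k : ℝ) ^ (τ + 1) ≤ ((k : ℝ) + 2) ^ ⌈τ + 1⌉₊ := by
      rw [← Real.rpow_natCast]
      exact (Real.rpow_le_rpow hk0.le (by linarith) (by linarith)).trans
        (Real.rpow_le_rpow_of_exponent_le (by linarith) (Nat.le_ceil _))
    have h2 : (2 : ℝ) ^ L ≤ ((k : ℝ) + 2) ^ L := pow_le_pow_left₀ (by norm_num) (by linarith) L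
    have h3 : (k : ℝ) * H k ≤ C₁ * (k : ℝ) ^ (τ + 1) := by
      have := mul_le_mul_of_nonneg_left (hC₁' k hk) hk0.le
      rw [show τ + 1 = 1 + (τ - 1 + 1) by ring, Real.rpow_add hk0 1, Real.rpow_one]
      linarith
    have h4 : C₁ * (k : ℝ) ^ (τ + 1) < ((k : ℝ) + 2) ^ L * ((k : ℝ) + 2) ^ ⌈τ + 1⌉₊ :=
      mul_lt_mul (hL.trans_le h2) h1 (by positivity) (by positivity)
    have h5 : (k : ℝ) * H k < ((k : ℝ) + 2) ^ (⌈τ + 1⌉₊ + L) := by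
      rw [pow_add, mul_comm (_ ^ ⌈τ + 1⌉₊)]; linarith
    exact_mod_cast h5

/-- The least degree above which matrix multiplication is fast enough. -/
noncomputable def limit (F : ℕ → ℕ) (m : ℕ) : ℕ := sInf {D | GoodLimit F m D}

/-- The balance between the two parts of the count: with k ≤ 2m/Δ, a time of C k^s is at most mΔ
once Δ^(s+1) ≥ C 2^s m^(s-1), that is, from about m^((s-1)/(s+1)) on. -/
theorem exists_goodLimit {H : ℕ → ℕ} {s C : ℝ} (hs : 2 ≤ s) (hC : 0 ≤ C)
    (h : ∀ k : ℕ, 0 < k → (H k : ℝ) ≤ C * (k : ℝ) ^ (s - 1)) {m : ℕ} (hm : 0 < m) :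
    ∃ D : ℕ, GoodLimit (fun k => k * H k) m D ∧
      (D : ℝ) ≤ (33 + C * 2 ^ s) * (m : ℝ) ^ ((s - 1) / (s + 1)) := by
  have hm1 : (1 : ℝ) ≤ m := by exact_mod_cast hm
  have hm0 : (0 : ℝ) < m := by linarith
  set β := (s - 1) / (s + 1) with hβ
  -- Here s ≥ 2 is used: it puts the limit above the cube root of m, where the search starts.
  have hβ3 : 1 / 3 ≤ β := by rw [hβ, div_le_div_iff₀ (by norm_num) (by linarith)]; linarith
  set K := 32 + C * (2 : ℝ) ^ s with hK
  have h2s : (0 : ℝ) ≤ C * (2 : ℝ) ^ s := by positivity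
  have hK32 : 32 ≤ K := by linarith
  have hmβ : (1 : ℝ) ≤ (m : ℝ) ^ β := Real.one_le_rpow hm1 (by linarith)
  have hle : K * (m : ℝ) ^ β ≤ (⌈K * (m : ℝ) ^ β⌉₊ : ℕ) := Nat.le_ceil _
  refine ⟨⌈K * (m : ℝ) ^ β⌉₊, ⟨?_, ?_⟩, ?_⟩
  · set D := ⌈K * (m : ℝ) ^ β⌉₊
    have h1 : (m : ℝ) ≤ (m : ℝ) ^ β * ((m : ℝ) ^ β * (m : ℝ) ^ β) := by
      rw [← Real.rpow_add hm0, ← Real.rpow_add hm0]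
      simpa using Real.rpow_le_rpow_of_exponent_le hm1 (show (1 : ℝ) ≤ β + (β + β) by linarith)
    have h2 : 32 ≤ K * (K * K) := by nlinarith
    have h3 : (32 : ℝ) * m ≤ D * (D * D) := by
      calc (32 : ℝ) * m ≤ (K * (K * K)) * ((m : ℝ) ^ β * ((m : ℝ) ^ β * (m : ℝ) ^ β)) :=
            mul_le_mul h2 h1 hm0.le (by positivity)
        _ = (K * (m : ℝ) ^ β) * ((K * (m : ℝ) ^ β) * (K * (m : ℝ) ^ β)) := by ring
        _ ≤ D * (D * D) := by gcongr
    exact_mod_cast h3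
  · intro Δ k hΔ hk hkΔ
    have hk0 : (0 : ℝ) < k := by exact_mod_cast hk
    have hΔ1 : K * (m : ℝ) ^ β ≤ Δ := hle.trans (by exact_mod_cast hΔ)
    have hΔ0 : (0 : ℝ) < Δ := lt_of_lt_of_le (by positivity) hΔ1
    have hkΔ' : (k : ℝ) * Δ ≤ 2 * m := by exact_mod_cast hkΔ
    have hF : (k : ℝ) * H k ≤ C * (k : ℝ) ^ s := by
      have := mul_le_mul_of_nonneg_left (h k hk) hk0.le
      rw [show s = 1 + (s - 1) by ring, Real.rpow_add hk0 1, Real.rpow_one]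
      linarith
    have h1 : (k : ℝ) ^ s * (Δ : ℝ) ^ s ≤ (2 : ℝ) ^ s * (m : ℝ) ^ s := by
      rw [← Real.mul_rpow hk0.le hΔ0.le, ← Real.mul_rpow (by norm_num) hm0.le]
      exact Real.rpow_le_rpow (by positivity) hkΔ' (by linarith)
    -- K ≥ 1 and K ≥ C 2^s, so K^(s+1) dominates the constant, and β(s+1) = s - 1 matches the powers
    -- of m.
    have h2 : C * (2 : ℝ) ^ s * (m : ℝ) ^ (s - 1) ≤ (Δ : ℝ) ^ (s + 1) := by
      calc C * (2 : ℝ) ^ s * (m : ℝ) ^ (s - 1) ≤ K ^ (s + 1) * (m : ℝ) ^ (s - 1) := by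
            refine mul_le_mul_of_nonneg_right ?_ (by positivity)
            refine le_trans (by linarith) (Real.self_le_rpow_of_one_le (by linarith) (by linarith))
        _ = (K * (m : ℝ) ^ β) ^ (s + 1) := by
            rw [Real.mul_rpow (by linarith) (by positivity), ← Real.rpow_mul hm0.le, hβ,
              div_mul_cancel₀ _ (by linarith)]
        _ ≤ (Δ : ℝ) ^ (s + 1) := Real.rpow_le_rpow (by positivity) hΔ1 (by linarith)
    have h3 : C * (k : ℝ) ^ s * (Δ : ℝ) ^ s ≤ m * Δ * (Δ : ℝ) ^ s := by
      calc C * (k : ℝ) ^ s * (Δ : ℝ) ^ s = C * ((k : ℝ) ^ s * (Δ : ℝ) ^ s) := by ring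
        _ ≤ C * ((2 : ℝ) ^ s * (m : ℝ) ^ s) := mul_le_mul_of_nonneg_left h1 hC
        _ = m * (C * (2 : ℝ) ^ s * (m : ℝ) ^ (s - 1)) := by
            have : (m : ℝ) ^ s = m * (m : ℝ) ^ (s - 1) := by
              rw [← Real.rpow_one_add' hm0.le (by linarith)]; congr 1; ring
            rw [this]; ring
        _ ≤ m * (Δ : ℝ) ^ (s + 1) := mul_le_mul_of_nonneg_left h2 hm0.le
        _ = m * Δ * (Δ : ℝ) ^ s := by rw [Real.rpow_add hΔ0, Real.rpow_one]; ring
    have h4 : (k : ℝ) * H k ≤ m * Δ :=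
      hF.trans (le_of_mul_le_mul_right h3 (by positivity))
    exact_mod_cast h4
  · have := (Nat.ceil_lt_add_one (show 0 ≤ K * (m : ℝ) ^ β by positivity)).le
    have h5 : (33 + C * (2 : ℝ) ^ s) = K + 1 := by rw [hK]; ring
    rw [h5]; linarith

/-- A bound for the cost per row of the multiplication of matrices of size at most `2√m + 1`. -/
def rate (H : ℕ → ℕ) (m : ℕ) : ℕ := H (Nat.sqrt (4 * m) + 1)

/-- The condition k² ≤ 4m says that k is at most the integer square root of 4m, and H is monotone.
-/
theorem goodBound_rate {H : ℕ → ℕ} (hH : Monotone H) (hk : ∀ k, k ≤ H k) (m : ℕ) :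
    GoodBound (fun k => k * H k) m (rate H m) := by
  intro k hkm
  have h1 : k + 1 ≤ Nat.sqrt (4 * m) + 1 := Nat.succ_le_succ (Nat.le_sqrt.2 hkm)
  exact ⟨(hk _).trans (hH h1), Nat.mul_le_mul_left _ (hH h1)⟩

theorem rate_le {H : ℕ → ℕ} {s C : ℝ} (hs : 2 ≤ s) (hC : 0 ≤ C)
    (h : ∀ k : ℕ, 0 < k → (H k : ℝ) ≤ C * (k : ℝ) ^ (s - 1)) {m : ℕ} (hm : 0 < m) :
    (rate H m : ℝ) ≤ C * 3 ^ (s - 1) * (m : ℝ) ^ ((s - 1) / 2) := by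
  have hm0 : (0 : ℝ) ≤ m := by positivity
  have h1 : ((Nat.sqrt (4 * m) + 1 : ℕ) : ℝ) ≤ 3 * Real.sqrt m := by
    have h2 : ((Nat.sqrt (4 * m) : ℕ) : ℝ) ≤ 2 * Real.sqrt m := by
      refine (Real.nat_sqrt_le_real_sqrt).trans ?_
      push_cast
      rw [Real.sqrt_mul (by norm_num), show (4 : ℝ) = 2 ^ 2 by norm_num,
        Real.sqrt_sq (by norm_num)]
    have h3 : 1 ≤ Real.sqrt m := Real.one_le_sqrt.2 (by exact_mod_cast hm)
    push_cast; linarith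
  refine (h _ (by omega)).trans ?_
  rw [mul_assoc]
  refine mul_le_mul_of_nonneg_left ?_ hC
  refine (Real.rpow_le_rpow (by positivity) h1 (by linarith)).trans ?_
  rw [Real.mul_rpow (by norm_num) (Real.sqrt_nonneg _), Real.sqrt_eq_rpow, ← Real.rpow_mul hm0]
  exact le_of_eq (by congr 2; ring)

/-! ### The running times of the two algorithms -/

theorem roomy_of_eq {E : Env} {n m c c₂ : ℕ} (hc : 1 ≤ c) (h : E.V = (n + m + 2) ^ (c + c₂ + 10)) :
    Roomy E n m c ∧ (n + m + 2) ^ c₂ ≤ E.V := by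
  have h1 : 64 ≤ (n + m + 2) ^ 6 := by
    calc 64 = 2 ^ 6 := by norm_num
      _ ≤ (n + m + 2) ^ 6 := Nat.pow_le_pow_left (by omega) 6
  refine ⟨⟨?_, ?_, hc⟩, ?_⟩
  · rw [h]
    calc 64 * (n + m + 2) ^ 4 ≤ (n + m + 2) ^ 6 * (n + m + 2) ^ 4 := Nat.mul_le_mul_right _ h1
      _ = (n + m + 2) ^ 10 := by rw [← pow_add]
      _ ≤ _ := Nat.pow_le_pow_right (by omega) (by omega)
  · rw [h]
    exact (Nat.pow_le_pow_left (by omega) c).trans (Nat.pow_le_pow_right (by omega) (by omega))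
  · rw [h]
    exact Nat.pow_le_pow_right (by omega) (by omega)

/-- The additional 1, for the preparation, is at most 2m/n because n ≤ 2m. -/
theorem heavy_card_succ_le {n m : ℕ} {N : ℕ → Finset ℕ} (hG : IsGraph n m N) (hn : 0 < n)
    (hnm : n ≤ 2 * m) : (((heavy N n).card + 1 : ℕ) : ℝ) ≤ 8 * (m / n) := by
  have h1 := heavy_card_mul_le hG
  have h2 : ((heavy N n).card + 1) * n ≤ 8 * m := by rw [add_mul]; omega
  have h3 : (0 : ℝ) < n := by exact_mod_cast hn
  rw [← mul_div_assoc, le_div_iff₀ h3]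
  exact_mod_cast h2

theorem IsEdges.pos {n m : ℕ} {e : ℕ → ℕ × ℕ} (he : IsEdges n m e) (hm : 0 < m) : 0 < n := by
  have := (he.lt 0 hm).1; omega

theorem add_mul_one_add_le {a x : ℝ} (ha : 0 ≤ a) (hx : 0 ≤ x) (s b : ℝ) :
    a + s * (b * (1 + x)) ≤ (a + s * b) * (1 + x) := by
  nlinarith [mul_nonneg ha hx]

/-- The time is written with the factor m/n already separated, and the case distinction is that of
`guarded`, so that sparse graphs cost O(1). -/
theorem detTime_heavy {p : Program} {c : ℕ} {F D : ℕ → ℕ} (hp : p.Deterministic) (hc : 1 ≤ c)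
    (hmul : Multiplies p c F) (hD : ∀ m, 0 < m → GoodLimit F m (D m)) :
    ∃ K : ℝ, 0 ≤ K ∧ DominatingTriangleInDetTime fun n m =>
      K * (1 + if 0 < m ∧ n ≤ 2 * m then (m * D m : ℕ) * ((m : ℝ) / n) else 0) := by
  have key := detTime_of_run (guarded (checkHeavy p)) (c + 0 + 10) (by omega)
    (fun n m => (8 * heavyCost p + 4 : ℕ) *
      (1 + if 0 < m ∧ n ≤ 2 * m then (m * D m : ℕ) * ((m : ℝ) / n) else 0)) ?_
  · refine ⟨(c + 0 + 10 : ℕ) + 9 + (guarded (checkHeavy p)).slow * (8 * heavyCost p + 4 : ℕ),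
      by positivity, key.mono fun n m => ?_⟩
    have h0 : (0 : ℝ) ≤ if 0 < m ∧ n ≤ 2 * m then (m * D m : ℕ) * ((m : ℝ) / n) else 0 := by
      split_ifs <;> positivity
    exact add_mul_one_add_le (by positivity) h0 _ _
  · intro E n m e σ hV he hI h0
    obtain ⟨hE, -⟩ := roomy_of_eq (c₂ := 0) hc hV
    refine ⟨_, ?_, guarded_run he h0 hE fun hm hnm =>
      checkHeavy_run hp hmul hE he hI h0 hm hnm (hD m hm)⟩
    split_ifs with hif
    · have h1 := heavy_card_succ_le (isGraph_nbrsUpTo he le_rfl) (he.pos hif.1) hif.2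
      have h2 : (0 : ℝ) ≤ ((heavyCost p * (m * D m) : ℕ) : ℝ) := by positivity
      have h3 := mul_le_mul_of_nonneg_left h1 h2
      have h4 : (0 : ℝ) ≤ (m * D m : ℕ) * ((m : ℝ) / n) := by positivity
      have h5 : (0 : ℝ) ≤ heavyCost p := by positivity
      have h6 : ((heavyCost p * (m * D m) : ℕ) : ℝ) * (8 * (m / n)) =
          8 * heavyCost p * ((m * D m : ℕ) * ((m : ℝ) / n)) := by push_cast; ring
      rw [h6, ← Nat.cast_mul] at h3
      rw [Nat.cast_add, Nat.cast_add]
      push_cast at h3 h4 ⊢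
      nlinarith
    · push_cast
      have h5 : (0 : ℝ) ≤ heavyCost p := by positivity
      linarith

theorem detTime_all {p : Program} {c c₂ : ℕ} {F D H : ℕ → ℕ} (hp : p.Deterministic) (hc : 1 ≤ c)
    (hmul : Multiplies p c F) (hF : ∀ k, 0 < k → F k < (k + 2) ^ c₂)
    (hD : ∀ m, 0 < m → GoodLimit F m (D m)) (hH : ∀ m, GoodBound F m (H m)) :
    ∃ K : ℝ, 0 ≤ K ∧ DominatingTriangleInDetTime fun _ m =>
      K * (1 + (m * D m + m * H m : ℕ)) := by
  have key := detTime_of_run (guarded (checkAll p c₂)) (c + c₂ + 10) (by omega)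
    (fun _ m => (allCost p + 4 : ℕ) * (1 + (m * D m + m * H m : ℕ))) ?_
  · refine ⟨(c + c₂ + 10 : ℕ) + 9 + (guarded (checkAll p c₂)).slow * (allCost p + 4 : ℕ),
      by positivity, key.mono fun n m => ?_⟩
    have h0 : (0 : ℝ) ≤ (m * D m + m * H m : ℕ) := by positivity
    exact add_mul_one_add_le (by positivity) h0 _ _
  · intro E n m e σ hV he hI h0
    obtain ⟨hE, hbig⟩ := roomy_of_eq hc hV
    refine ⟨_, ?_, guarded_run he h0 hE fun hm hnm =>
      checkAll_run hp hmul hE hbig hF he hI h0 hm hnm (hD m hm) (hH m)⟩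
    obtain ⟨X, hX⟩ : ∃ X, X = m * D m + m * H m := ⟨_, rfl⟩
    rw [← hX]
    have : (if 0 < m ∧ n ≤ 2 * m then allCost p * X else 0) + 4 ≤ (allCost p + 4) * (1 + X) := by
      split_ifs <;> nlinarith [Nat.zero_le X, Nat.zero_le (allCost p)]
    exact_mod_cast this

/-- `g m` is `m ^ (q + o(1))`, in terms of constants. -/
def GrowsLike (g : ℕ → ℕ) (q : ℝ) : Prop :=
  ∀ δ : ℝ, 0 < δ → ∃ C : ℝ, 0 ≤ C ∧ ∀ m : ℕ, 0 < m → (g m : ℝ) ≤ C * (m : ℝ) ^ (q + δ)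

/-- The exponent that g really needs beyond q, namely log(g(m)/m^q)/log m cut off at 0, tends to 0,
because for every δ it is at most δ/2 + log(C + 1)/log m, up to this cut-off. -/
theorem GrowsLike.exists_exponent {g : ℕ → ℕ} {q : ℝ} (h : GrowsLike g q) :
    ∃ (C : ℝ) (e : ℕ → ℝ), 0 ≤ C ∧ (∀ m, 0 ≤ e m) ∧ Tendsto e atTop (𝓝 0) ∧
      ∀ m : ℕ, 0 < m → (g m : ℝ) ≤ C * (m : ℝ) ^ (q + e m) := by
  -- At m = 1 all powers of m are 1, so the constant itself has to dominate g 1.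
  refine ⟨1 + g 1, fun m => max 0 (Real.log (g m / (m : ℝ) ^ q) / Real.log m), by positivity,
    fun m => le_max_left _ _, ?_, ?_⟩
  · rw [Metric.tendsto_atTop]
    intro δ hδ
    obtain ⟨C, hC, hg⟩ := h (δ / 2) (by linarith)
    have hlog : Tendsto (fun m : ℕ => Real.log m) atTop atTop :=
      Real.tendsto_log_atTop.comp tendsto_natCast_atTop_atTop
    have hev := hlog.eventually_gt_atTop (Real.log (C + 1) * (2 / δ))
    obtain ⟨N, hN⟩ := eventually_atTop.1 (hev.and (eventually_ge_atTop 2))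
    refine ⟨N, fun m hm => ?_⟩
    obtain ⟨h1, h2⟩ := hN m hm
    have hm1 : (1 : ℝ) < m := by exact_mod_cast h2
    have hm0 : (0 : ℝ) < m := by linarith
    have hl : 0 < Real.log m := Real.log_pos hm1
    rw [Real.dist_eq, sub_zero, abs_of_nonneg (le_max_left _ _), max_lt_iff]
    refine ⟨hδ, ?_⟩
    rw [div_lt_iff₀ hl]
    rcases Nat.eq_zero_or_pos (g m) with hz | hpos
    · simp only [hz, Nat.cast_zero, zero_div, Real.log_zero]; positivity
    have hgp : (0 : ℝ) < g m := by exact_mod_cast hpos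
    have hle : (g m : ℝ) / (m : ℝ) ^ q ≤ (C + 1) * (m : ℝ) ^ (δ / 2) := by
      rw [div_le_iff₀ (by positivity), mul_assoc, ← Real.rpow_add hm0, add_comm (δ / 2)]
      exact (hg m (by omega)).trans (mul_le_mul_of_nonneg_right (by linarith) (by positivity))
    have h3 := Real.log_le_log (by positivity) hle
    rw [Real.log_mul (by positivity) (by positivity), Real.log_rpow hm0] at h3
    have h4 : Real.log (C + 1) < δ / 2 * Real.log m := by
      have := mul_lt_mul_of_pos_left h1 (show 0 < δ / 2 by linarith)
      have h5 : δ / 2 * (Real.log (C + 1) * (2 / δ)) = Real.log (C + 1) := by field_simp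
      linarith
    linarith
  · intro m hm
    rcases Nat.eq_zero_or_pos (g m) with hz | hpos
    · rw [hz, Nat.cast_zero]; positivity
    have hgp : (0 : ℝ) < g m := by exact_mod_cast hpos
    rcases (show m = 1 ∨ 2 ≤ m by omega) with rfl | h2
    · simp
    have hm1 : (1 : ℝ) < m := by exact_mod_cast h2
    have hm0 : (0 : ℝ) < m := by linarith
    have hl : 0 < Real.log m := Real.log_pos hm1
    have h3 : (g m : ℝ) / (m : ℝ) ^ q ≤
        (m : ℝ) ^ max 0 (Real.log (g m / (m : ℝ) ^ q) / Real.log m) := by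
      rw [← Real.log_le_log_iff (by positivity) (by positivity), Real.log_rpow hm0,
        ← div_le_iff₀ hl]
      exact le_max_right _ _
    rw [div_le_iff₀ (by positivity), mul_comm, ← Real.rpow_add hm0] at h3
    refine h3.trans (le_mul_of_one_le_left (by positivity) ?_)
    have : (0 : ℝ) ≤ g 1 := by positivity
    linarith

/-- The left side is the function 2t/(t+1) at t = τ + δ, and its slope is at most 1. -/
theorem exponent_heavy_le {τ δ : ℝ} (hτ : 2 ≤ τ) (hδ : 0 < δ) :
    1 + (τ + δ - 1) / (τ + δ + 1) ≤ 2 * τ / (τ + 1) + δ := by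
  have h1 : 1 + (τ + δ - 1) / (τ + δ + 1) = 2 * (τ + δ) / (τ + δ + 1) := by
    rw [eq_div_iff (by linarith), add_mul, div_mul_cancel₀ _ (by linarith)]; ring
  have h2 : 2 * τ / (τ + 1) + δ = (2 * τ + δ * (τ + 1)) / (τ + 1) := by
    rw [add_div, mul_div_cancel_right₀ _ (by linarith)]
  rw [h1, h2, div_le_div_iff₀ (by linarith) (by linarith)]
  have h3 : 0 ≤ δ * τ := by nlinarith
  nlinarith [mul_nonneg h3 hδ.le, mul_nonneg h3 (by linarith : (0 : ℝ) ≤ τ)]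

/-- This is 4τ ≤ (τ+1)²: the pair counts do not dominate the time of the second algorithm. -/
theorem exponent_heavy_le_exponent_all {τ : ℝ} (hτ : 2 ≤ τ) :
    2 * τ / (τ + 1) ≤ (τ + 1) / 2 := by
  rw [div_le_div_iff₀ (by linarith) (by norm_num)]
  nlinarith [sq_nonneg (τ - 1)]

/-- The least good limit lies below the good limits obtained for each δ, and it depends on H alone.
So a single program has all these time bounds at once. -/
theorem growsLike_limit {H : ℕ → ℕ} {τ : ℝ} (hτ : 2 ≤ τ)
    (h : ∀ δ : ℝ, 0 < δ → ∃ C : ℝ, 0 ≤ C ∧ ∀ k : ℕ, 0 < k → (H k : ℝ) ≤ C * (k : ℝ) ^ (τ - 1 + δ)) :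
    (∀ m, 0 < m → GoodLimit (fun k => k * H k) m (limit (fun k => k * H k) m)) ∧
    GrowsLike (fun m => m * limit (fun k => k * H k) m) (2 * τ / (τ + 1)) := by
  constructor
  · intro m hm
    obtain ⟨C, hC, hC'⟩ := h 1 one_pos
    obtain ⟨D, hD, -⟩ := exists_goodLimit (s := τ + 1) (by linarith) hC
      (by simpa [add_sub_right_comm] using hC') hm
    exact Nat.sInf_mem (s := {D | GoodLimit (fun k => k * H k) m D}) ⟨D, hD⟩
  · intro δ hδ
    obtain ⟨C, hC, hC'⟩ := h δ hδ
    refine ⟨33 + C * 2 ^ (τ + δ), by positivity, fun m hm => ?_⟩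
    obtain ⟨D, hD, hle⟩ := exists_goodLimit (s := τ + δ) (by linarith) hC
      (by simpa [add_sub_right_comm] using hC') hm
    have h1 : limit (fun k => k * H k) m ≤ D := Nat.sInf_le hD
    have hm1 : (1 : ℝ) ≤ m := by exact_mod_cast hm
    have hm0 : (0 : ℝ) < m := by linarith
    calc ((m * limit (fun k => k * H k) m : ℕ) : ℝ) ≤ m * D := by
          exact_mod_cast Nat.mul_le_mul_left m h1
      _ ≤ m * ((33 + C * 2 ^ (τ + δ)) * (m : ℝ) ^ ((τ + δ - 1) / (τ + δ + 1))) :=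
          mul_le_mul_of_nonneg_left hle hm0.le
      _ = (33 + C * 2 ^ (τ + δ)) * (m : ℝ) ^ (1 + (τ + δ - 1) / (τ + δ + 1)) := by
          rw [Real.rpow_add hm0, Real.rpow_one]; ring
      _ ≤ _ := mul_le_mul_of_nonneg_left
          (Real.rpow_le_rpow_of_exponent_le hm1 (exponent_heavy_le hτ hδ)) (by positivity)

/-- Matrices of size O(√m) have cost per row about m^((τ-1)/2), and there are O(m) rows in total. -/
theorem growsLike_rate {H : ℕ → ℕ} {τ : ℝ} (hτ : 2 ≤ τ)
    (h : ∀ δ : ℝ, 0 < δ → ∃ C : ℝ, 0 ≤ C ∧ ∀ k : ℕ, 0 < k → (H k : ℝ) ≤ C * (k : ℝ) ^ (τ - 1 + δ)) :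
    GrowsLike (fun m => m * rate H m) ((τ + 1) / 2) := by
  intro δ hδ
  obtain ⟨C, hC, hC'⟩ := h δ hδ
  refine ⟨C * 3 ^ (τ + δ - 1), by positivity, fun m hm => ?_⟩
  have hle := rate_le (s := τ + δ) (by linarith) hC
    (by simpa [add_sub_right_comm] using hC') hm
  have hm1 : (1 : ℝ) ≤ m := by exact_mod_cast hm
  have hm0 : (0 : ℝ) < m := by linarith
  calc ((m * rate H m : ℕ) : ℝ) = m * (rate H m : ℝ) := by push_cast; rfl
    _ ≤ m * (C * 3 ^ (τ + δ - 1) * (m : ℝ) ^ ((τ + δ - 1) / 2)) :=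
        mul_le_mul_of_nonneg_left hle hm0.le
    _ = C * 3 ^ (τ + δ - 1) * (m : ℝ) ^ (1 + (τ + δ - 1) / 2) := by
        rw [Real.rpow_add hm0, Real.rpow_one]; ring
    _ ≤ _ := mul_le_mul_of_nonneg_left
        (Real.rpow_le_rpow_of_exponent_le hm1 (by linarith)) (by positivity)

theorem GrowsLike.add {g h : ℕ → ℕ} {q r : ℝ} (hg : GrowsLike g q) (hh : GrowsLike h r)
    (hqr : q ≤ r) : GrowsLike (fun m => g m + h m) r := by
  intro δ hδ
  obtain ⟨C, hC, hC'⟩ := hg δ hδ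
  obtain ⟨C₁, hC₁, hC₁'⟩ := hh δ hδ
  refine ⟨C + C₁, by positivity, fun m hm => ?_⟩
  have h1 := hC' m hm
  have h2 := hC₁' m hm
  have hm1 : (1 : ℝ) ≤ m := by exact_mod_cast hm
  have h3 := mul_le_mul_of_nonneg_left
    (Real.rpow_le_rpow_of_exponent_le hm1 (show q + δ ≤ r + δ by linarith)) hC
  push_cast
  linarith

theorem MatMulInTime.detTime {τ : ℝ} (h : MatMulInTime τ) :
    (∃ (g : ℕ → ℕ) (K : ℝ), 0 ≤ K ∧ GrowsLike g (2 * τ / (τ + 1)) ∧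
      DominatingTriangleInDetTime fun n m =>
        K * (1 + if 0 < m ∧ n ≤ 2 * m then g m * ((m : ℝ) / n) else 0)) ∧
    ∃ (g : ℕ → ℕ) (K : ℝ), 0 ≤ K ∧ g 0 = 0 ∧ GrowsLike g ((τ + 1) / 2) ∧
      DominatingTriangleInDetTime fun _ m => K * (1 + g m) := by
  have hτ := h.two_le
  obtain ⟨p, c, c₂, H, hp, hc, hmono, hk, hmul, hF, hgrow⟩ := h.exists_multiplies
  obtain ⟨hD, hDg⟩ := growsLike_limit hτ hgrow
  obtain ⟨K, hK, hK'⟩ := detTime_heavy hp hc hmul hD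
  obtain ⟨K₁, hK₁, hK₁'⟩ := detTime_all hp hc hmul hF hD (goodBound_rate hmono hk)
  exact ⟨⟨_, K, hK, hDg, hK'⟩, _, K₁, hK₁, by simp,
    hDg.add (growsLike_rate hτ hgrow) (exponent_heavy_le_exponent_all hτ), hK₁'⟩

/-! ### The theorem -/

/-- The o(1) has to be moved from the exponent of m to the exponent of the whole quotient X: the
time is at most C · X · m^e, and m ≤ 2X turns m^e into at most 2^B · X^e. -/
theorem DominatingTriangleInDetTime.quotient {g : ℕ → ℕ} {K C B q : ℝ} {e : ℕ → ℝ} (hK : 0 ≤ K)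
    (h : DominatingTriangleInDetTime fun n m =>
      K * (1 + if 0 < m ∧ n ≤ 2 * m then g m * ((m : ℝ) / n) else 0)) (hC : 0 ≤ C) (hq : 1 ≤ q)
    (he : ∀ m, 0 ≤ e m) (hB : ∀ m, e m ≤ B)
    (hg : ∀ m : ℕ, 0 < m → (g m : ℝ) ≤ C * (m : ℝ) ^ (q + e m)) :
    DominatingTriangleInDetTime fun n m =>
      K * (1 + C * 2 ^ B) * (1 + ((m : ℝ) ^ (1 + q) / n) ^ (1 + e m)) := by
  refine h.mono fun n m => ?_
  have hX0 : (0 : ℝ) ≤ ((m : ℝ) ^ (1 + q) / n) ^ (1 + e m) := by positivity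
  have hCB : 0 ≤ C * (2 : ℝ) ^ B := by positivity
  rw [mul_assoc]
  refine mul_le_mul_of_nonneg_left ?_ hK
  suffices hs : (if 0 < m ∧ n ≤ 2 * m then g m * ((m : ℝ) / n) else 0) ≤
      C * 2 ^ B * ((m : ℝ) ^ (1 + q) / n) ^ (1 + e m) by nlinarith
  split_ifs with hif
  swap
  · positivity
  obtain ⟨hm, hnm⟩ := hif
  rcases Nat.eq_zero_or_pos n with rfl | hn
  · rw [Nat.cast_zero, div_zero, mul_zero]; positivity
  have hm1 : (1 : ℝ) ≤ m := by exact_mod_cast hm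
  have hm0 : (0 : ℝ) < m := by linarith
  have hn0 : (0 : ℝ) < n := by exact_mod_cast hn
  have hnm' : (n : ℝ) ≤ 2 * m := by exact_mod_cast hnm
  set X := (m : ℝ) ^ (1 + q) / n with hX
  have hXp : 0 < X := by positivity
  -- This is where n ≤ 2m, ensured by the guard, and q ≥ 1 are needed.
  have h1 : (m : ℝ) ≤ 2 * X := by
    rw [hX, ← mul_div_assoc, le_div_iff₀ hn0]
    have h2 : (m : ℝ) * m ≤ (m : ℝ) ^ (1 + q) := by
      have := Real.rpow_le_rpow_of_exponent_le hm1 (show (1 : ℝ) + 1 ≤ 1 + q by linarith)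
      rwa [Real.rpow_add hm0, Real.rpow_one] at this
    have := mul_le_mul_of_nonneg_left hnm' hm0.le
    linarith
  have h3 : (m : ℝ) ^ e m ≤ 2 ^ B * X ^ e m := by
    refine (Real.rpow_le_rpow hm0.le h1 (he m)).trans ?_
    rw [Real.mul_rpow (by norm_num) hXp.le]
    exact mul_le_mul_of_nonneg_right
      (Real.rpow_le_rpow_of_exponent_le (by norm_num) (hB m)) (by positivity)
  calc (g m : ℝ) * (m / n) ≤ C * (m : ℝ) ^ (q + e m) * (m / n) :=
        mul_le_mul_of_nonneg_right (hg m hm) (by positivity)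
    _ = C * X * (m : ℝ) ^ e m := by
        rw [hX, Real.rpow_add hm0 q, Real.rpow_add hm0 1, Real.rpow_one]; ring
    _ ≤ C * X * (2 ^ B * X ^ e m) := mul_le_mul_of_nonneg_left h3 (by positivity)
    _ = C * 2 ^ B * X ^ (1 + e m) := by rw [Real.rpow_add hXp, Real.rpow_one]; ring

/-- The value at m = 0 is treated apart, since the growth bound says nothing there; `g 0 = 0` closes
the gap. -/
theorem DominatingTriangleInDetTime.power {g : ℕ → ℕ} {K C q : ℝ} {e : ℕ → ℝ} (hK : 0 ≤ K)
    (h : DominatingTriangleInDetTime fun _ m => K * (1 + g m)) (h0 : g 0 = 0) (hC : 0 ≤ C)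
    (hg : ∀ m : ℕ, 0 < m → (g m : ℝ) ≤ C * (m : ℝ) ^ (q + e m)) :
    DominatingTriangleInDetTime fun _ m => K * (1 + C) * (1 + (m : ℝ) ^ (q + e m)) := by
  refine h.mono fun n m => ?_
  rw [mul_assoc]
  refine mul_le_mul_of_nonneg_left ?_ hK
  have h1 : (0 : ℝ) ≤ (m : ℝ) ^ (q + e m) := by positivity
  have h2 : (g m : ℝ) ≤ C * (m : ℝ) ^ (q + e m) := by
    rcases Nat.eq_zero_or_pos m with rfl | hm
    · rw [h0, Nat.cast_zero]; positivity
    · exact hg m hm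
  nlinarith

theorem GrowsLike.mono {g : ℕ → ℕ} {q r : ℝ} (h : GrowsLike g q) {ε : ℝ} (hqr : q < r + ε) :
    ∃ C : ℝ, 0 ≤ C ∧ ∀ m : ℕ, 0 < m → (g m : ℝ) ≤ C * (m : ℝ) ^ (r + ε) := by
  obtain ⟨C, hC, hC'⟩ := h (r + ε - q) (by linarith)
  exact ⟨C, hC, by simpa using hC'⟩

theorem one_le_exponent_heavy {τ : ℝ} (hτ : 2 ≤ τ) : 1 ≤ 2 * τ / (τ + 1) := by
  rw [le_div_iff₀ (by linarith)]; linarith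

/-- As `exponent_heavy_le` with δ = τ - ω; the case τ = ω is separate because that lemma requires δ
> 0. -/
theorem exponent_heavy_lt {τ ω ε : ℝ} (hω : 2 ≤ ω) (h1 : ω ≤ τ) (h2 : τ < ω + ε) :
    2 * τ / (τ + 1) < 2 * ω / (ω + 1) + ε := by
  rcases h1.eq_or_lt with rfl | h
  · linarith
  · have := exponent_heavy_le hω (show 0 < τ - ω by linarith)
    have h3 : 1 + (ω + (τ - ω) - 1) / (ω + (τ - ω) + 1) = 2 * τ / (τ + 1) := by
      rw [add_sub_cancel, eq_div_iff (by linarith), add_mul, div_mul_cancel₀ _ (by linarith)]; ring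
    linarith

/-- The infimum need not be attained, so a τ in [ω, ω + ε) is used; the excess of its exponent over
that of ω is less than ε. -/
theorem detTime_quotient (ε : ℝ) (hε : 0 < ε) : ∃ C : ℝ, DominatingTriangleInDetTime fun n m =>
    C * (1 + ((m : ℝ) ^ (1 + 2 * matMulExponent / (matMulExponent + 1)) / n) ^ (1 + ε)) := by
  obtain ⟨τ, hτ, h1, h2⟩ := exists_matMulInTime_lt hε
  obtain ⟨⟨g, K, hK, hg, hdet⟩, -⟩ := hτ.detTime
  obtain ⟨C, hC, hC'⟩ := hg.mono (exponent_heavy_lt two_le_matMulExponent h1 h2)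
  exact ⟨_, hdet.quotient hK hC (one_le_exponent_heavy two_le_matMulExponent)
    (fun _ => hε.le) (fun _ => le_rfl) hC'⟩

theorem detTime_power (ε : ℝ) (hε : 0 < ε) : ∃ C : ℝ, DominatingTriangleInDetTime fun _ m =>
    C * (1 + (m : ℝ) ^ ((matMulExponent + 1) / 2 + ε)) := by
  obtain ⟨τ, hτ, h1, h2⟩ := exists_matMulInTime_lt hε
  obtain ⟨-, g, K, hK, h0, hg, hdet⟩ := hτ.detTime
  obtain ⟨C, hC, hC'⟩ := hg.mono (show (τ + 1) / 2 < (matMulExponent + 1) / 2 + ε by linarith)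
  exact ⟨_, hdet.power (e := fun _ => ε) hK h0 hC hC'⟩

/-- For a fixed τ that is attained the program is fixed too, so the o(1) can be a function of m. It
is bounded because it converges, and this bound gives the constant B that `quotient` needs. -/
theorem MatMulInTime.detTime_quotient {τ : ℝ} (h : MatMulInTime τ) :
    ∃ (C : ℝ) (e : ℕ → ℝ), Tendsto e atTop (𝓝 0) ∧ DominatingTriangleInDetTime fun n m =>
      C * (1 + ((m : ℝ) ^ (1 + 2 * τ / (τ + 1)) / n) ^ (1 + e m)) := by
  obtain ⟨⟨g, K, hK, hg, hdet⟩, -⟩ := h.detTime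
  obtain ⟨C, e, hC, he, hlim, hC'⟩ := hg.exists_exponent
  obtain ⟨B, -, hB⟩ := exists_forall_le_of_eventually_le
    ((hlim.eventually (gt_mem_nhds one_pos)).mono fun _ h => h.le)
  exact ⟨_, e, hlim, hdet.quotient hK hC (one_le_exponent_heavy h.two_le) he hB hC'⟩

theorem MatMulInTime.detTime_power {τ : ℝ} (h : MatMulInTime τ) :
    ∃ (C : ℝ) (e : ℕ → ℝ), Tendsto e atTop (𝓝 0) ∧ DominatingTriangleInDetTime fun _ m =>
      C * (1 + (m : ℝ) ^ ((τ + 1) / 2 + e m)) := by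
  obtain ⟨-, g, K, hK, h0, hg, hdet⟩ := h.detTime
  obtain ⟨C, e, hC, he, hlim, hC'⟩ := hg.exists_exponent
  exact ⟨_, e, hlim, hdet.power hK h0 hC hC'⟩

theorem mainTheorem3 :
    -- deterministic time `(m ^ (1 + 2ω/(ω+1)) / n) ^ (1 + ε)` for every `ε > 0`
    (∀ ε : ℝ, 0 < ε → ∃ C : ℝ, DominatingTriangleInDetTime fun n m =>
      C * (1 + ((m : ℝ) ^ (1 + 2 * matMulExponent / (matMulExponent + 1)) / n) ^ (1 + ε))) ∧
    -- the case `ω = 2`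
    (matMulExponent = 2 → ∀ ε : ℝ, 0 < ε → ∃ C : ℝ, DominatingTriangleInDetTime fun n m =>
      C * (1 + ((m : ℝ) ^ (7 / 3 : ℝ) / n) ^ (1 + ε))) ∧
    -- randomized time `m ^ ((ω+1)/2 + ε)` for every `ε > 0`
    (∀ ε : ℝ, 0 < ε → ∀ d : ℕ, ∃ C : ℝ, DominatingTriangleInRandTime d fun _ m =>
      C * (1 + (m : ℝ) ^ ((matMulExponent + 1) / 2 + ε))) ∧
    -- if `ω` is attained by one matrix multiplication algorithm, then one algorithm with an
    -- exponent `o(1)` does it, in all three cases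
    (MatMulInTime matMulExponent →
      (∃ (C : ℝ) (e : ℕ → ℝ), Tendsto e atTop (𝓝 0) ∧ DominatingTriangleInDetTime fun n m =>
        C * (1 + ((m : ℝ) ^ (1 + 2 * matMulExponent / (matMulExponent + 1)) / n) ^ (1 + e m))) ∧
      (matMulExponent = 2 → ∃ (C : ℝ) (e : ℕ → ℝ), Tendsto e atTop (𝓝 0) ∧
        DominatingTriangleInDetTime fun n m =>
          C * (1 + ((m : ℝ) ^ (7 / 3 : ℝ) / n) ^ (1 + e m))) ∧
      (∀ d : ℕ, ∃ (C : ℝ) (e : ℕ → ℝ), Tendsto e atTop (𝓝 0) ∧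
        DominatingTriangleInRandTime d fun _ m =>
          C * (1 + (m : ℝ) ^ ((matMulExponent + 1) / 2 + e m)))) := by
  have hex : matMulExponent = 2 →
      (1 : ℝ) + 2 * matMulExponent / (matMulExponent + 1) = 7 / 3 := fun h => by
    rw [h]; norm_num
  refine ⟨detTime_quotient, fun h ε hε => ?_, fun ε hε d => ?_, fun hatt => ⟨hatt.detTime_quotient,
    fun h => ?_, fun d => ?_⟩⟩
  · rw [← hex h]
    exact detTime_quotient ε hε
  · obtain ⟨C, hC⟩ := detTime_power ε hε
    exact ⟨C, hC.inRandTime d⟩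
  · rw [← hex h]
    exact hatt.detTime_quotient
  · obtain ⟨C, e, he, hC⟩ := hatt.detTime_power
    exact ⟨C, e, he, hC.inRandTime d⟩
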